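/- **Setting.** Let $k$ be a field of characteristic not $2$, let $K$ be a nonzero finite étale $k$-algebra, and let $\iota$ be a ring endomorphism of $K$ with $\iota^2=\mathrm{Id}$ whose fixed ring is exactly $k$ (so $K=k$ and $\iota=\mathrm{Id}$, or $K/k$ is quadratic étale). Put $U(K,\iota)=\{\varepsilon\in K^\times : \varepsilon\,\iota(\varepsilon)=1\}$ and $\Gamma_{\mathbb N}=\mathbb N\times U(K,\iota)$. An *Azumaya algebra with involution* $(A,\sigma)$ over $(K,\iota)$ is an Azumaya $K$-algebra $A$ with an additive, anti-multiplicative map $\sigma$ with $\sigma^2=\mathrm{Id}$ and $\sigma|_K=\iota$. For $\varepsilon\in U(K,\iota)$, an *$\varepsilon$-hermitian module* $(V,h)$ over $(A,\sigma)$ is a finitely generated right $A$-module $V$ with a nondegenerate $h:V\times V\to A$ such that $h(xa,yb)=\sigma(a)h(x,y)b$ and $\sigma(h(x,y))=\varepsilon h(y,x)$. Let $SW^\varepsilon(A,\sigma)$ be the monoid of isometry classes of $\varepsilon$-hermitian modules under orthogonal sum. Tensor powers are over $K$, with $(A^{\otimes 0},\sigma^{\otimes 0})=(K,\iota)$. The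 tensor product over $K$ of an $\varepsilon$-hermitian module over $A^{\otimes m}$ and an $\varepsilon'$-hermitian module over $A^{\otimes n}$ is an $\varepsilon\varepsilon'$-hermitian module over $A^{\otimes(m+n)}$, and $$\widehat{SW}^\bullet_{\mathbb N}(A,\sigma)=\bigoplus_{(n,\varepsilon)\in\Gamma_{\mathbb N}}SW^\varepsilon(A^{\otimes n},\sigma^{\otimes n}).$$ **Alternating powers.** Let $(V,h)$ be $\varepsilon$-hermitian over an Azumaya algebra with involution $(A,\sigma)$, and let $B=\mathrm{End}_A(V)$. The Goldman element of $B$ is the $\sum_i a_i\otimes b_i\in B\otimes_K B$ such that $\sum_i a_ixb_i=\mathrm{Trd}_B(x)$ for all $x\in B$. Sending the transposition $(i,i+1)$ to the Goldman element placed in the positions $i,i+1$ extends to a group morphism $\mathfrak S_d\to (B^{\otimes d})^\times$, so that $\mathfrak S_d$ acts on $V^{\otimes d}$. With $s_d=\sum_{\pi\in\mathfrak S_d}\mathrm{sgn}(\pi)\,\pi$, set $\mathrm{Alt}^d(V)=s_dV^{\otimes d}$, a right $A^{\otimes d}$-submodule of $V^{\otimes d}$, and $\mathrm{Alt}^d(h)(s_dx,s_dy)=h^{\otimes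 d}(x,s_dy)$. **Structured semirings.** Let $M$ be an additive commutative monoid. - An *$M$-graded pre-$\lambda$-semiring* is a commutative semiring $R=\bigoplus_{g\in M}R_g$ with $1\in R_0$, $R_gR_h\subseteq R_{g+h}$, and maps $\lambda^d:R\to R$ ($d\in\mathbb N$) with $\lambda^d(R_g)\subseteq R_{dg}$, $\lambda^0=1$, $\lambda^1=\mathrm{Id}$ and $\lambda^d(x+y)=\sum_{p+q=d}\lambda^p(x)\lambda^q(y)$. An example is $\mathbb Z[M]$, with $\lambda^d(n\cdot g)=\binom nd\cdot(dg)$ for $n\in\mathbb Z$, $g\in M$. - An *augmentation* of $R$ is a semiring morphism $\widetilde\delta:R\to\mathbb Z[M]$ that respects the degrees and commutes with the $\lambda^d$; $\delta:R\to\mathbb Z$ is its composition with $\mathbb Z[M]\to\mathbb Z$, $g\mapsto 1$. - The *$\lambda$-dimension* of $x$ is $\sup\{n:\lambda^n(x)\ne0\}$. A homogeneous $x\in R_g$ is *graded-invertible* if multiplication by $x$ is a bijection $R_h\to R_{h+g}$ for all $h\in M$. - An augmented $R$ is *rigid* if it is additively cancellative, every homogeneous $x$ with $\delta(x)=0$ is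 $0$, and every homogeneous $x$ of $\lambda$-dimension $1$ is graded-invertible. - An *$M$-structured semiring* is an augmented $M$-graded pre-$\lambda$-semiring $R$ with a *positive structure*: a rigid graded subsemiring $R_{\ge0}$ that is stable under the $\lambda^d$, such that the graded-invertible elements of $R_{\ge 0}$ are graded-invertible in $R$, and for every homogeneous $x\in R$ there are homogeneous $a,b\in R_{\ge0}$ with $x+a=b$. - A *lax morphism* $R\to S$ of $M$-structured semirings is a pair of a monoid morphism $\phi:M\to M$ and a semiring morphism $f:R\to S$ with $f(R_g)\subseteq S_{\phi(g)}$, which commutes with the $\lambda^d$, satisfies $\widetilde\delta_S\circ f=\mathbb Z[\phi]\circ\widetilde\delta_R$, and maps $R_{\ge0}$ to $S_{\ge0}$. **Hermitian Brauer 2-group.** The objects of $\mathbf{Br}_h(K,\iota)$ are the Azumaya algebras with involution over $(K,\iota)$. The morphisms $(B,\tau)\to(A,\sigma)$ are the isomorphism classes of hermitian Morita equivalences $(V,h)$: $B$-$A$-bimodules $V$ with a nondegenerate $\varepsilon$-hermitian form $h$ over $(A,\sigma)$, for some $\varepsilon=\varepsilon(h)\in U(K,\iota)$, such that the action of $B$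 is an isomorphism $B\simeq\mathrm{End}_A(V)$ and $h(bu,v)=h(u,\tau(b)v)$. The identity of $(A,\sigma)$ is $A$ with $(x,y)\mapsto\sigma(x)y$. The composition of $(U,g):(C,\theta)\to(B,\tau)$ and $(V,h):(B,\tau)\to(A,\sigma)$ is $U\otimes_BV$ with $(u\otimes v,u'\otimes v')\mapsto h(v,g(u,u')v')$. The composition of an $\varepsilon'$-hermitian module over $(B,\tau)$ with $(V,h)$ is given by the same formula and is $\varepsilon(h)\varepsilon'$-hermitian over $(A,\sigma)$. **Theorem.** For every Azumaya algebra with involution $(A,\sigma)$ over $(K,\iota)$, all $d,n\in\mathbb N$ and $\varepsilon\in U(K,\iota)$, the alternating power $(\mathrm{Alt}^d(V),\mathrm{Alt}^d(h))$ of an $\varepsilon$-hermitian module over $(A^{\otimes n},\sigma^{\otimes n})$ is an $\varepsilon^d$-hermitian module over $(A^{\otimes nd},\sigma^{\otimes nd})$, and the resulting operations $$\mathrm{Alt}^d:SW^\varepsilon(A^{\otimes n},\sigma^{\otimes n})\to SW^{\varepsilon^d}(A^{\otimes nd},\sigma^{\otimes nd}),$$ together with the tensor product as multiplication, turn $\widehat{SW}^\bullet_{\mathbb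 N}(A,\sigma)$ into a rigid $\Gamma_{\mathbb N}$-structured semiring, which is its own positive structure. The augmentation is the graded reduced dimension, which sends the class of $(V,h)$ in $SW^\varepsilon(A^{\otimes n},\sigma^{\otimes n})$ to $r\cdot(n,\varepsilon)$, where $r\in\mathbb N$ and $r\cdot\deg(A^{\otimes n})=\dim_K(V)$. Furthermore, $(A,\sigma)\mapsto\widehat{SW}^\bullet_{\mathbb N}(A,\sigma)$ is a functor from $\mathbf{Br}_h(K,\iota)$ to the category of $\Gamma_{\mathbb N}$-structured semirings with lax morphisms: compositions of hermitian Morita equivalences, and of hermitian modules over tensor powers with tensor powers of hermitian Morita equivalences, exist as stated; a morphism $(V,h):(B,\tau)\to(A,\sigma)$ of sign $\varepsilon$ induces a lax morphism $\widehat{SW}^\bullet_{\mathbb N}(B,\tau)\to\widehat{SW}^\bullet_{\mathbb N}(A,\sigma)$ along $(n,\varepsilon')\mapsto(n,\varepsilon^n\varepsilon')$, given on $SW^{\varepsilon'}(B^{\otimes n},\tau^{\otimes n})$ by composition with $(V^{\otimes n},h^{\otimes n})$; and identities and compositions are respected. -/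

import Mathlib

open scoped TensorProduct DirectSum

universe u v w

noncomputable section

/-! ## Graded pre-lambda-semirings and structured semirings -/

/-- A commutative semiring graded over a commutative monoid `M`, with operations `lam d` making it
a graded pre-`λ`-semiring. The sum formula is required for all elements of the semiring, so that
the operations are determined by their values on homogeneous elements. -/
structure GradedPreLambdaSemiring (M : Type v) [AddCommMonoid M] where
  carrier : Type w
  [semiring : CommSemiring carrier]
  /-- the homogeneous components -/
  grade : M → AddSubmonoid carrier
  [gradedMonoid : SetLike.GradedMonoid grade]
  isInternal : letI := Classical.decEq M; DirectSum.IsInternal grade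
  lam : ℕ → carrier → carrier
  lam_mem : ∀ (d : ℕ) (g : M) (x : carrier), x ∈ grade g → lam d x ∈ grade (d • g)
  lam_zero : ∀ x, lam 0 x = 1
  lam_one : ∀ x, lam 1 x = x
  lam_add : ∀ (d : ℕ) (x y : carrier),
    lam d (x + y) = ∑ p ∈ Finset.HasAntidiagonal.antidiagonal d, lam p.1 x * lam p.2 y

attribute [instance] GradedPreLambdaSemiring.semiring GradedPreLambdaSemiring.gradedMonoid

/-- The `λ`-operations of the monoid ring `ℤ[M]`: those with
`λ^d (n · h) = (n choose d) · (d h)`, extended to sums by `λ_t (x + y) = λ_t (x) λ_t (y)`. -/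
def monoidRingLam {M : Type v} [AddCommMonoid M] (d : ℕ) (f : AddMonoidAlgebra ℤ M) :
    AddMonoidAlgebra ℤ M :=
  PowerSeries.coeff d (∏ h ∈ f.coeff.support,
    PowerSeries.mk fun i => AddMonoidAlgebra.single (i • h) (Ring.choose (f.coeff h) i))

/-- A graded pre-`λ`-semiring with an augmentation, a graded `λ`-morphism to `ℤ[M]`. -/
structure AugmentedPreLambdaSemiring (M : Type v) [AddCommMonoid M] extends
    GradedPreLambdaSemiring.{v, w} M where
  aug : carrier →+* AddMonoidAlgebra ℤ M
  aug_grade : ∀ (g : M) (x : carrier), x ∈ grade g → ∃ n : ℤ, aug x = AddMonoidAlgebra.single g n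
  aug_lam : ∀ (d : ℕ) (x : carrier), aug (lam d x) = monoidRingLam d (aug x)

namespace AugmentedPreLambdaSemiring

variable {M : Type v} [AddCommMonoid M] (S : AugmentedPreLambdaSemiring.{v, w} M)

/-- The total augmentation, with values in `ℤ`. -/
def totalAug (x : S.carrier) : ℤ := (S.aug x).coeff.sum fun _ n => n

/-- The `λ`-dimension: the supremum of all `n` with `λ^n (x) ≠ 0`. -/
def lamDim (x : S.carrier) : ℕ∞ := ⨆ n ∈ {n : ℕ | S.lam n x ≠ 0}, (n : ℕ∞)

/-- `x` belongs to at least one homogeneous component. -/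
def IsHomogeneous (x : S.carrier) : Prop := ∃ g, x ∈ S.grade g

/-- A subsemiring which is a graded pre-`λ`-subsemiring. -/
structure IsSubstructure (P : Subsemiring S.carrier) : Prop where
  homogeneous : ∀ x ∈ P, x ∈ AddSubmonoid.closure {y | y ∈ P ∧ S.IsHomogeneous y}
  lam_mem : ∀ (d : ℕ), ∀ x ∈ P, S.lam d x ∈ P

/-- `x` is a graded-invertible element of the graded subsemiring `P`: it is homogeneous of some
degree `g₀`, and multiplication by `x` is a bijection `P_g → P_{g + g₀}` for all `g`. -/
def IsGradedInvertibleIn (P : Subsemiring S.carrier) (x : S.carrier) : Prop :=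
  x ∈ P ∧ ∃ g₀, x ∈ S.grade g₀ ∧ ∀ g, Set.BijOn (fun y => x * y)
    {y | y ∈ P ∧ y ∈ S.grade g} {y | y ∈ P ∧ y ∈ S.grade (g + g₀)}

/-- The graded pre-`λ`-subsemiring `P`, with the restricted augmentation, is rigid. -/
structure IsRigid (P : Subsemiring S.carrier) : Prop where
  cancel : ∀ x ∈ P, ∀ y ∈ P, ∀ z ∈ P, x + y = x + z → y = z
  eq_zero : ∀ x ∈ P, S.IsHomogeneous x → S.totalAug x = 0 → x = 0
  line : ∀ x ∈ P, S.IsHomogeneous x → S.lamDim x = 1 → S.IsGradedInvertibleIn P x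

end AugmentedPreLambdaSemiring

/-- An `M`-structured semiring: an augmented `M`-graded pre-`λ`-semiring with a positive
structure. -/
structure StructuredSemiring (M : Type v) [AddCommMonoid M] extends
    AugmentedPreLambdaSemiring.{v, w} M where
  pos : Subsemiring carrier
  pos_sub : toAugmentedPreLambdaSemiring.IsSubstructure pos
  pos_rigid : toAugmentedPreLambdaSemiring.IsRigid pos
  pos_inv : ∀ x, toAugmentedPreLambdaSemiring.IsGradedInvertibleIn pos x →
    toAugmentedPreLambdaSemiring.IsGradedInvertibleIn ⊤ x
  pos_gen : ∀ x, toAugmentedPreLambdaSemiring.IsHomogeneous x →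
    ∃ a ∈ pos, ∃ b ∈ pos, toAugmentedPreLambdaSemiring.IsHomogeneous a ∧
      toAugmentedPreLambdaSemiring.IsHomogeneous b ∧ x + a = b

namespace StructuredSemiring

/-- Lax morphisms of structured semirings. -/
@[ext]
structure LaxHom {M : Type v} [AddCommMonoid M] (S T : StructuredSemiring.{v, w} M) where
  /-- the morphism between the grading monoids -/
  deg : M →+ M
  hom : S.carrier →+* T.carrier
  map_grade : ∀ (g : M) (x : S.carrier), x ∈ S.grade g → hom x ∈ T.grade (deg g)
  map_lam : ∀ (d : ℕ) (x : S.carrier), hom (S.lam d x) = T.lam d (hom x)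
  map_aug : ∀ x : S.carrier, T.aug (hom x) = (S.aug x).mapDomain deg
  map_pos : ∀ x ∈ S.pos, hom x ∈ T.pos

variable {M : Type v} [AddCommMonoid M]

/-- The identity morphism. -/
def LaxHom.id (S : StructuredSemiring.{v, w} M) : LaxHom S S where
  deg := AddMonoidHom.id M
  hom := RingHom.id _
  map_grade _ _ hx := hx
  map_lam _ _ := rfl
  map_aug x := by
    ext m
    simp [Finsupp.mapDomain_id]
  map_pos _ hx := hx

/-- The composition `g ∘ f` of lax morphisms. -/
def LaxHom.comp {S T R : StructuredSemiring.{v, w} M} (g : LaxHom T R) (f : LaxHom S T) :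
    LaxHom S R where
  deg := g.deg.comp f.deg
  hom := g.hom.comp f.hom
  map_grade _ _ hx := g.map_grade _ _ (f.map_grade _ _ hx)
  map_lam d x := by simp [f.map_lam, g.map_lam]
  map_aug x := by
    rw [RingHom.comp_apply, g.map_aug, f.map_aug]
    ext m
    simp [Finsupp.mapDomain_comp]
  map_pos _ hx := g.map_pos _ (f.map_pos _ hx)

/-- Structured semirings over `M` with lax morphisms form a category. -/
instance : CategoryTheory.Category (StructuredSemiring.{v, w} M) where
  Hom S T := LaxHom S T
  id S := LaxHom.id S
  comp f g := g.comp f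

end StructuredSemiring

/-! ## Algebras with involution and hermitian spaces -/

section

variable {K : Type u} [CommRing K]

/-- The group `U(K, ι)` of all `ε ∈ Kˣ` with `ε ι(ε) = 1`. -/
def signGroup (ι : K →+* K) : Subgroup Kˣ where
  carrier := {ε | (ε : K) * ι ε = 1}
  one_mem' := by simp
  mul_mem' {a b} ha hb := by
    have ha' : (a : K) * ι a = 1 := ha
    have hb' : (b : K) * ι b = 1 := hb
    change ((a * b : Kˣ) : K) * ι ((a * b : Kˣ) : K) = 1
    rw [Units.val_mul, map_mul, mul_mul_mul_comm, ha', hb', one_mul]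
  inv_mem' {a} ha := by
    have ha' : (a : K) * ι a = 1 := ha
    have h1 : ι (a : K) * ι ((a⁻¹ : Kˣ) : K) = 1 := by rw [← map_mul]; simp
    have h2 : ((a⁻¹ : Kˣ) : K) * (a : K) = 1 := by simp
    change ((a⁻¹ : Kˣ) : K) * ι ((a⁻¹ : Kˣ) : K) = 1
    calc ((a⁻¹ : Kˣ) : K) * ι ((a⁻¹ : Kˣ) : K)
        = (((a⁻¹ : Kˣ) : K) * ι ((a⁻¹ : Kˣ) : K)) * ((a : K) * ι a) := by rw [ha', mul_one]
      _ = (((a⁻¹ : Kˣ) : K) * (a : K)) * (ι (a : K) * ι ((a⁻¹ : Kˣ) : K)) := by ring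
      _ = 1 := by rw [h1, h2, one_mul]

/-- The grading monoid `Γ_ℕ = ℕ × U(K, ι)`, written additively. -/
abbrev GammaN (ι : K →+* K) : Type u := ℕ × Additive (signGroup ι)

/-- An Azumaya algebra with involution over `(K, ι)`. -/
structure AzumayaInv (ι : K →+* K) where
  carrier : Type u
  [ring : Ring carrier]
  [algebra : Algebra K carrier]
  [azumaya : IsAzumaya K carrier]
  inv : carrier → carrier
  inv_add : ∀ a b, inv (a + b) = inv a + inv b
  inv_mul : ∀ a b, inv (a * b) = inv b * inv a
  inv_inv : ∀ a, inv (inv a) = a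
  inv_algebraMap : ∀ c : K, inv (algebraMap K carrier c) = algebraMap K carrier (ι c)

attribute [instance] AzumayaInv.ring AzumayaInv.algebra AzumayaInv.azumaya

/-- A module with scalars twisted along `ι`. -/
def Twist (_ι : K →+* K) (N : Type u) : Type u := N

instance (ι : K →+* K) (N : Type u) [AddCommGroup N] : AddCommGroup (Twist ι N) :=
  inferInstanceAs (AddCommGroup N)

instance (ι : K →+* K) (N : Type u) [AddCommGroup N] [Module K N] : Module K (Twist ι N) :=
  Module.compHom N ι

namespace AzumayaInv

variable {ι : K →+* K} (A : AzumayaInv ι)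

/-- The involution is `ι`-semilinear. -/
theorem inv_smul (c : K) (a : A.carrier) : A.inv (c • a) = ι c • A.inv a := by
  rw [Algebra.smul_def, A.inv_mul, A.inv_algebraMap, Algebra.smul_def, Algebra.commutes]

/-- The involution as a `K`-linear map to the twisted module. -/
def invTwist : A.carrier →ₗ[K] Twist ι A.carrier where
  toFun a := A.inv a
  map_add' := A.inv_add
  map_smul' := A.inv_smul

/-- The tensor power `A^{⊗ n}` over `K`. -/
abbrev pow (n : ℕ) : Type u := ⨂[K] (_ : Fin n), A.carrier

/-- The multilinear map `(a₁, …, aₙ) ↦ σ(a₁) ⊗ ⋯ ⊗ σ(aₙ)` to the twisted tensor power. -/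
def invPowMultilinear (n : ℕ) :
    MultilinearMap K (fun _ : Fin n => A.carrier) (Twist ι (A.pow n)) where
  toFun a := (PiTensorProduct.tprod K fun i => A.inv (a i) : A.pow n)
  map_update_add' {inst} a i x y := by
    have key : ∀ z, (fun j => A.inv (Function.update a i z j))
        = Function.update (fun j => A.inv (a j)) i (A.inv z) := by
      intro z
      funext j
      rcases eq_or_ne j i with rfl | h
      · simp
      · simp [h]
    have h := (PiTensorProduct.tprod K (s := fun _ : Fin n => A.carrier)).map_update_add
      (fun j => A.inv (a j)) i (A.inv x) (A.inv y)
    simp only [key, A.inv_add]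
    exact h
  map_update_smul' {inst} a i c x := by
    have key : ∀ z, (fun j => A.inv (Function.update a i z j))
        = Function.update (fun j => A.inv (a j)) i (A.inv z) := by
      intro z
      funext j
      rcases eq_or_ne j i with rfl | h
      · simp
      · simp [h]
    have h := (PiTensorProduct.tprod K (s := fun _ : Fin n => A.carrier)).map_update_smul
      (fun j => A.inv (a j)) i (ι c) (A.inv x)
    simp only [key, A.inv_smul]
    exact h

/-- The involution `σ^{⊗ n}` of `A^{⊗ n}`. -/
def invPow (n : ℕ) (a : A.pow n) : A.pow n :=
  PiTensorProduct.lift (A.invPowMultilinear n) a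

theorem invPow_tprod (n : ℕ) (a : Fin n → A.carrier) :
    A.invPow n (PiTensorProduct.tprod K a) = PiTensorProduct.tprod K fun i => A.inv (a i) :=
  PiTensorProduct.lift.tprod (φ := A.invPowMultilinear n) a

/-- The algebra map `A^{⊗ m} ⊗ A^{⊗ n} → A^{⊗ (m + n)}`, on pairs of elements. -/
def powMul {m n : ℕ} (a : A.pow m) (b : A.pow n) : A.pow (m + n) :=
  TensorPower.mulEquiv (a ⊗ₜ[K] b)

/-- The map `a ↦ 1 ⊗ ⋯ ⊗ a ⊗ ⋯ ⊗ 1` from `A` to the `i`-th factor of `A^{⊗ n}`. -/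
def single (n : ℕ) (i : Fin n) : A.carrier →ₗ[K] A.pow n :=
  (PiTensorProduct.singleAlgHom (R := K) (A := fun _ : Fin n => A.carrier) i).toLinearMap

/-- The map from `A^{⊗ n}` to the `j`-th block of `n` consecutive factors of `A^{⊗ (d * n)}`; the
`i`-th factor goes to position `finProdFinEquiv (j, i) = i + n * j`. -/
def block (d n : ℕ) (j : Fin d) : A.pow n →ₗ[K] A.pow (d * n) :=
  PiTensorProduct.lift ((MultilinearMap.mkPiAlgebraFin K n (A.pow (d * n))).compLinearMap
    (M₁ := fun _ => A.carrier) fun i => A.single (d * n) (finProdFinEquiv (j, i)))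

/-- The canonical map `(A^{⊗ n})^{⊗ d} → A^{⊗ (d * n)}`, concatenation of tensors. -/
def flatten (d n : ℕ) : (⨂[K] (_ : Fin d), A.pow n) →ₗ[K] A.pow (d * n) :=
  PiTensorProduct.lift ((MultilinearMap.mkPiAlgebraFin K d (A.pow (d * n))).compLinearMap
    (M₁ := fun _ => A.pow n) fun j => A.block d n j)

end AzumayaInv

/-- The degree of an Azumaya algebra of constant rank: the square root of its dimension. -/
def azumayaDegree (K R : Type u) [CommRing K] [Ring R] [Algebra K R] : ℕ :=
  Nat.sqrt (Module.finrank K R)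

/-- A (nondegenerate) `ε`-hermitian module over the `K`-algebra `R` with involution `s`. Right
`R`-modules are modules over `Rᵐᵒᵖ`, with `v · a = op a • v`. -/
structure HermSpace (ι : K →+* K) (R : Type u) [Ring R] [Algebra K R] (s : R → R)
    (ε : signGroup ι) where
  carrier : Type u
  [addCommGroup : AddCommGroup carrier]
  [module : Module K carrier]
  [rightModule : Module Rᵐᵒᵖ carrier]
  [isScalarTower : IsScalarTower K Rᵐᵒᵖ carrier]
  [finite : Module.Finite K carrier]
  form : carrier →ₛₗ[ι] carrier →ₗ[K] R
  form_right : ∀ x y (a : R), form x (MulOpposite.op a • y) = form x y * a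
  form_left : ∀ x y (a : R), form (MulOpposite.op a • x) y = s a * form x y
  form_symm : ∀ x y, s (form x y) = ((ε : Kˣ) : K) • form y x
  nondegenerate : ∀ x, (∀ y, form x y = 0) → x = 0

attribute [instance] HermSpace.addCommGroup HermSpace.module HermSpace.rightModule
  HermSpace.isScalarTower HermSpace.finite

namespace HermSpace

variable {ι : K →+* K} {R : Type u} [Ring R] [Algebra K R] {s : R → R} {ε : signGroup ι}

instance (X : HermSpace ι R s ε) : SMulCommClass K Rᵐᵒᵖ X.carrier where
  smul_comm c a x := by
    have h (c : K) (x : X.carrier) : c • x = (c • (1 : Rᵐᵒᵖ)) • x := by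
      rw [smul_assoc, one_smul]
    rw [h c (a • x), h c x, smul_smul, smul_smul, smul_mul_assoc, mul_smul_comm, one_mul, mul_one]

instance (X : HermSpace ι R s ε) : SMulCommClass Rᵐᵒᵖ K X.carrier := SMulCommClass.symm _ _ _

/-- Two hermitian spaces are isometric. -/
def Isometric (X Y : HermSpace ι R s ε) : Prop :=
  ∃ e : X.carrier ≃ₗ[K] Y.carrier,
    (∀ (a : R) x, e (MulOpposite.op a • x) = MulOpposite.op a • e x) ∧
    ∀ x y, Y.form (e x) (e y) = X.form x y

/-- Right multiplication by `a`. -/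
def rmul (X : HermSpace ι R s ε) (a : R) : X.carrier →ₗ[K] X.carrier :=
  Module.toModuleEnd K (S := Rᵐᵒᵖ) X.carrier (MulOpposite.op a)

/-- The algebra `End_R(V)`. -/
abbrev endAlg (X : HermSpace ι R s ε) : Type u := Module.End Rᵐᵒᵖ X.carrier

/-- `r` is the reduced dimension of the underlying module: `deg(R) · r = dim_K(V)`. -/
def HasRdim (X : HermSpace ι R s ε) (r : ℕ) : Prop :=
  azumayaDegree K R * r = Module.finrank K X.carrier

/-- The zero space. -/
def zero (ι : K →+* K) (R : Type u) [Ring R] [Algebra K R] (s : R → R) (hs : s 0 = 0)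
    (ε : signGroup ι) : HermSpace ι R s ε where
  carrier := PUnit.{u + 1}
  form := 0
  form_right _ _ _ := by simp
  form_left _ _ _ := by simp
  form_symm _ _ := by simp [hs]
  nondegenerate _ _ := rfl

/-- The orthogonal sum. -/
def sum (hs : ∀ a b, s (a + b) = s a + s b) (X Y : HermSpace ι R s ε) : HermSpace ι R s ε where
  carrier := X.carrier × Y.carrier
  form := LinearMap.mk₂'ₛₗ ι (RingHom.id K)
    (fun x y => X.form x.1 y.1 + Y.form x.2 y.2)
    (fun x y z => by simp only [Prod.fst_add, Prod.snd_add, map_add, LinearMap.add_apply]; abel)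
    (fun c x y => by simp)
    (fun x y z => by simp only [Prod.fst_add, Prod.snd_add, map_add]; abel)
    (fun c x y => by simp)
  form_right x y a := by simp [form_right, add_mul]
  form_left x y a := by simp [form_left, mul_add]
  form_symm x y := by simp [form_symm, hs]
  nondegenerate x hx := by
    refine Prod.ext (X.nondegenerate _ fun y => ?_) (Y.nondegenerate _ fun y => ?_)
    · simpa using hx (y, 0)
    · simpa using hx (0, y)

theorem Isometric.refl (X : HermSpace ι R s ε) : Isometric X X :=
  ⟨LinearEquiv.refl K _, fun _ _ => rfl, fun _ _ => rfl⟩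

theorem Isometric.symm {X Y : HermSpace ι R s ε} : Isometric X Y → Isometric Y X := by
  rintro ⟨e, h1, h2⟩
  refine ⟨e.symm, fun a x => ?_, fun x y => ?_⟩
  · apply e.injective
    simp [h1]
  · simpa using (h2 (e.symm x) (e.symm y)).symm

theorem Isometric.trans {X Y Z : HermSpace ι R s ε} :
    Isometric X Y → Isometric Y Z → Isometric X Z := by
  rintro ⟨e, h1, h2⟩ ⟨f, h3, h4⟩
  exact ⟨e.trans f, fun a x => by simp [h1, h3], fun x y => by simp [h2, h4]⟩

/-- Isometry as an equivalence relation. -/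
def setoid (ι : K →+* K) (R : Type u) [Ring R] [Algebra K R] (s : R → R) (ε : signGroup ι) :
    Setoid (HermSpace ι R s ε) where
  r := Isometric
  iseqv := ⟨Isometric.refl, Isometric.symm, Isometric.trans⟩

theorem isometric_sum (hs : ∀ a b, s (a + b) = s a + s b) {X X' Y Y' : HermSpace ι R s ε} :
    Isometric X X' → Isometric Y Y' → Isometric (sum hs X Y) (sum hs X' Y') := by
  rintro ⟨e, h1, h2⟩ ⟨f, h3, h4⟩
  refine ⟨LinearEquiv.prodCongr e f, fun a x => Prod.ext (h1 a x.1) (h3 a x.2), fun x y => ?_⟩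
  exact congrArg₂ (· + ·) (h2 x.1 y.1) (h4 x.2 y.2)

theorem sum_comm (hs : ∀ a b, s (a + b) = s a + s b) (X Y : HermSpace ι R s ε) :
    Isometric (sum hs X Y) (sum hs Y X) :=
  ⟨LinearEquiv.prodComm K _ _, fun _ _ => rfl, fun _ _ => add_comm _ _⟩

theorem sum_assoc (hs : ∀ a b, s (a + b) = s a + s b) (X Y Z : HermSpace ι R s ε) :
    Isometric (sum hs (sum hs X Y) Z) (sum hs X (sum hs Y Z)) :=
  ⟨LinearEquiv.prodAssoc K _ _ _, fun _ _ => rfl, fun _ _ => (add_assoc _ _ _).symm⟩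

theorem zero_sum (hs : ∀ a b, s (a + b) = s a + s b) (hs0 : s 0 = 0) (X : HermSpace ι R s ε) :
    Isometric (sum hs (zero ι R s hs0 ε) X) X :=
  ⟨LinearEquiv.uniqueProd (M₂ := PUnit.{u + 1}), fun _ _ => rfl, fun _ _ => (zero_add _).symm⟩

end HermSpace

/-! ## Hermitian spaces over tensor powers -/

namespace AzumayaInv

variable {ι : K →+* K} (A : AzumayaInv ι)

theorem invPow_add (n : ℕ) (a b : A.pow n) :
    A.invPow n (a + b) = A.invPow n a + A.invPow n b :=
  map_add (PiTensorProduct.lift (A.invPowMultilinear n)) a b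

theorem invPow_zero (n : ℕ) : A.invPow n 0 = 0 :=
  map_zero (PiTensorProduct.lift (A.invPowMultilinear n))

/-- The `ε`-hermitian spaces over `(A^{⊗ n}, σ^{⊗ n})`. -/
abbrev Herm (n : ℕ) (ε : signGroup ι) : Type (u + 1) :=
  HermSpace ι (A.pow n) (A.invPow n) ε

/-- `SW^ε(A^{⊗ n}, σ^{⊗ n})`, the isometry classes of `ε`-hermitian spaces. -/
def SW (n : ℕ) (ε : signGroup ι) : Type (u + 1) :=
  Quotient (HermSpace.setoid ι (A.pow n) (A.invPow n) ε)

variable {A} in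
/-- The isometry class of a hermitian space. -/
def cls {n : ℕ} {ε : signGroup ι} (X : A.Herm n ε) : A.SW n ε :=
  Quotient.mk (HermSpace.setoid ι (A.pow n) (A.invPow n) ε) X

instance (n : ℕ) (ε : signGroup ι) : Add (A.SW n ε) where
  add := Quotient.map₂ (HermSpace.sum (A.invPow_add n))
    fun _ _ h _ _ h' => HermSpace.isometric_sum (A.invPow_add n) h h'

instance (n : ℕ) (ε : signGroup ι) : Zero (A.SW n ε) where
  zero := cls (HermSpace.zero ι (A.pow n) (A.invPow n) (A.invPow_zero n) ε)

/-- The orthogonal sum makes `SW^ε(A^{⊗ n}, σ^{⊗ n})` a commutative monoid. -/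
instance (n : ℕ) (ε : signGroup ι) : AddCommMonoid (A.SW n ε) where
  add_assoc := by
    rintro ⟨X⟩ ⟨Y⟩ ⟨Z⟩
    exact Quotient.sound (HermSpace.sum_assoc (A.invPow_add n) X Y Z)
  add_comm := by
    rintro ⟨X⟩ ⟨Y⟩
    exact Quotient.sound (HermSpace.sum_comm (A.invPow_add n) X Y)
  zero_add := by
    rintro ⟨X⟩
    exact Quotient.sound (HermSpace.zero_sum (A.invPow_add n) (A.invPow_zero n) X)
  add_zero := by
    rintro ⟨X⟩
    exact Quotient.sound ((HermSpace.sum_comm (A.invPow_add n) X _).trans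
      (HermSpace.zero_sum (A.invPow_add n) (A.invPow_zero n) X))
  nsmul := nsmulRec

variable {A} in
/-- The hermitian space `Z` over `A^{⊗ (m + n)}` is (isometric to) the tensor product over `K` of
the spaces `X` over `A^{⊗ m}` and `Y` over `A^{⊗ n}`. -/
def IsTensor {m n : ℕ} {ε ε' : signGroup ι} (X : A.Herm m ε) (Y : A.Herm n ε')
    (Z : A.Herm (m + n) (ε * ε')) : Prop :=
  ∃ e : (X.carrier ⊗[K] Y.carrier) ≃ₗ[K] Z.carrier,
    (∀ (a : A.pow m) (b : A.pow n) x y,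
      e (X.rmul a x ⊗ₜ Y.rmul b y) = Z.rmul (A.powMul a b) (e (x ⊗ₜ y))) ∧
    ∀ x y x' y', Z.form (e (x ⊗ₜ y)) (e (x' ⊗ₜ y')) = A.powMul (X.form x x') (Y.form y y')

end AzumayaInv

/-! ## The Goldman element, its action, and alternating powers -/

section Goldman

variable (B : Type u) [Ring B] [Algebra K B]

variable {B} in
/-- `t` is the reduced trace of `B`: after a faithfully flat extension `L` of scalars, and for some
isomorphism of `L ⊗ B` with a matrix algebra, it becomes the trace of matrices. -/
def IsReducedTrace (t : B →ₗ[K] K) : Prop :=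
  ∃ (L : Type u) (_ : CommRing L) (_ : Algebra K L) (_ : Module.FaithfullyFlat K L) (n : ℕ)
    (φ : L ⊗[K] B ≃ₐ[L] Matrix (Fin n) (Fin n) L),
    ∀ b : B, Matrix.trace (φ (1 ⊗ₜ b)) = algebraMap K L (t b)

variable {B} in
/-- `g = ∑ aᵢ ⊗ bᵢ` is the Goldman element of `B`: the map `x ↦ ∑ aᵢ x bᵢ` is the reduced
trace. -/
def IsGoldmanElement (g : B ⊗[K] B) : Prop :=
  ∃ t : B →ₗ[K] K, IsReducedTrace t ∧ ∀ x : B,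
    AlgHom.mulLeftRight K B
      (TensorProduct.map LinearMap.id (MulOpposite.opLinearEquiv K).toLinearMap g) x =
        algebraMap K B (t x)

/-- The map `B ⊗ B → B^{⊗ d}` that puts `a ⊗ b` in positions `i` and `j`, and `1` elsewhere. -/
def placeAt (d : ℕ) (i j : Fin d) : B ⊗[K] B →ₗ[K] (⨂[K] (_ : Fin d), B) :=
  TensorProduct.lift ((LinearMap.mul K (⨂[K] (_ : Fin d), B)).compl₁₂
    (PiTensorProduct.singleAlgHom (R := K) (A := fun _ : Fin d => B) i).toLinearMap
    (PiTensorProduct.singleAlgHom (R := K) (A := fun _ : Fin d => B) j).toLinearMap)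

variable {B} in
/-- `γ` is the canonical group morphism from the symmetric group to the units of `B^{⊗ d}`: it sends
the transposition of `i` and `i + 1` to the Goldman element placed in positions `i`, `i + 1`. -/
def IsGoldmanHom {d : ℕ} (γ : Equiv.Perm (Fin d) →* (⨂[K] (_ : Fin d), B)) : Prop :=
  ∃ g : B ⊗[K] B, IsGoldmanElement g ∧
    ∀ i j : Fin d, (i : ℕ) + 1 = j → γ (Equiv.swap i j) = placeAt B d i j g

/-- The left action of `B^{⊗ d}` on `V^{⊗ d}`, for a left `B`-module `V`. -/
def powAct (V : Type u) [AddCommGroup V] [Module K V] [Module B V] [IsScalarTower K B V] (d : ℕ) :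
    (⨂[K] (_ : Fin d), B) →ₗ[K] Module.End K (⨂[K] (_ : Fin d), V) :=
  PiTensorProduct.piTensorHomMap ∘ₗ
    PiTensorProduct.map fun _ : Fin d => (Algebra.lsmul K K V : B →ₐ[K] Module.End K V).toLinearMap

end Goldman

namespace HermSpace

variable {ι : K →+* K} {R : Type u} [Ring R] [Algebra K R] {s : R → R} {ε : signGroup ι}

/-- The action on `V^{⊗ d}` of the anti-symmetrizer `∑ sgn(π) π`, where `π` acts through its image
`γ π` in `End_R(V)^{⊗ d}`. -/
def antisymmetrizer (X : HermSpace ι R s ε) {d : ℕ}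
    (γ : Equiv.Perm (Fin d) →* (⨂[K] (_ : Fin d), X.endAlg)) :
    Module.End K (⨂[K] (_ : Fin d), X.carrier) :=
  ∑ π : Equiv.Perm (Fin d), ((Equiv.Perm.sign π : ℤˣ) : ℤ) • powAct X.endAlg X.carrier d (γ π)

end HermSpace

namespace AzumayaInv

variable {ι : K →+* K} {A : AzumayaInv ι}

/-- For a hermitian space `X = (V, h)` over `A^{⊗ n}`, the hermitian space `Y` over
`A^{⊗ (d * n)}` is (isometric to) the alternating power `(Alt^d(V), Alt^d(h))`. Here
`Alt^d(V) = s_d V^{⊗ d}` for the Goldman action of the symmetric group, as a submodule of the right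
module `V^{⊗ d}`, and `Alt^d(h)(s_d x, s_d y) = h^{⊗ d}(x, s_d y)`. -/
def IsAlt (d : ℕ) {n : ℕ} {ε : signGroup ι} (X : A.Herm n ε) (Y : A.Herm (d * n) (ε ^ d)) :
    Prop :=
  ∃ γ : Equiv.Perm (Fin d) →* (⨂[K] (_ : Fin d), X.endAlg), IsGoldmanHom γ ∧
  ∃ j : Y.carrier →ₗ[K] (⨂[K] (_ : Fin d), X.carrier),
    Function.Injective j ∧
    LinearMap.range j = LinearMap.range (X.antisymmetrizer γ) ∧
    (∀ (a : Fin d → A.pow n) (y : Y.carrier),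
      j (Y.rmul (A.flatten d n (PiTensorProduct.tprod K a)) y) =
        PiTensorProduct.map (fun i => X.rmul (a i)) (j y)) ∧
    ∀ (x : Fin d → X.carrier) (y y' : Y.carrier),
      j y = X.antisymmetrizer γ (PiTensorProduct.tprod K x) →
      Y.form y y' = A.flatten d n (PiTensorProduct.map (fun i => X.form (x i)) (j y'))

end AzumayaInv

/-! ## Hermitian Morita equivalences -/

/-- A hermitian Morita equivalence from `(B, τ)` to `(A, σ)`: a `B`-`A`-bimodule `V` with a regular
`ε`-hermitian form over `(A, σ)`, such that `B ≅ End_A(V)` and `τ` is the adjoint involution. -/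
structure HermMorita {ι : K →+* K} (B A : AzumayaInv ι) where
  sign : signGroup ι
  space : HermSpace ι A.carrier A.inv sign
  [leftModule : Module B.carrier space.carrier]
  [leftScalarTower : IsScalarTower K B.carrier space.carrier]
  [smulCommClass : SMulCommClass B.carrier A.carrierᵐᵒᵖ space.carrier]
  faithful : ∀ b : B.carrier, (∀ v : space.carrier, b • v = 0) → b = 0
  full : ∀ f : space.endAlg, ∃ b : B.carrier, ∀ v : space.carrier, f v = b • v
  adjoint : ∀ (b : B.carrier) (u v : space.carrier),
    space.form (b • u) v = space.form u (B.inv b • v)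

attribute [instance] HermMorita.leftModule HermMorita.leftScalarTower HermMorita.smulCommClass

namespace HermMorita

variable {ι : K →+* K} {A B C : AzumayaInv ι}

/-- Isomorphism of hermitian Morita equivalences: an isometry of bimodules. -/
def Iso (U V : HermMorita B A) : Prop :=
  ∃ e : U.space.carrier ≃ₗ[K] V.space.carrier,
    (∀ (b : B.carrier) u, e (b • u) = b • e u) ∧
    (∀ (a : A.carrier) u, e (MulOpposite.op a • u) = MulOpposite.op a • e u) ∧
    ∀ u v, V.space.form (e u) (e v) = U.space.form u v

/-- Isomorphism as an equivalence relation. -/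
def setoid (B A : AzumayaInv ι) : Setoid (HermMorita B A) where
  r := Iso
  iseqv := by
    refine ⟨fun U => ⟨LinearEquiv.refl K _, fun _ _ => rfl, fun _ _ => rfl, fun _ _ => rfl⟩, ?_, ?_⟩
    · rintro U V ⟨e, h1, h2, h3⟩
      refine ⟨e.symm, fun b x => ?_, fun a x => ?_, fun x y => ?_⟩
      · apply e.injective
        simp [h1]
      · apply e.injective
        simp [h2]
      · simpa using (h3 (e.symm x) (e.symm y)).symm
    · rintro U V W ⟨e, h1, h2, h3⟩ ⟨f, h4, h5, h6⟩
      exact ⟨e.trans f, fun b x => by simp [h1, h4], fun a x => by simp [h2, h5],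
        fun x y => by simp [h3, h6]⟩

/-- The morphisms of the hermitian Brauer 2-group from `(B, τ)` to `(A, σ)`. -/
def Hom (B A : AzumayaInv ι) : Type (u + 1) := Quotient (setoid B A)

/-- The isomorphism class of a hermitian Morita equivalence. -/
def toHom (U : HermMorita B A) : Hom B A := Quotient.mk (setoid B A) U

/-- `W` is (isomorphic to) the composition of `U : (C, θ) → (B, τ)` and `V : (B, τ) → (A, σ)`:
the bimodule `U ⊗_B V` with `f(u ⊗ v, u' ⊗ v') = h(v, g(u, u') v')`. -/
def IsComp (U : HermMorita C B) (V : HermMorita B A) (W : HermMorita C A) : Prop :=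
  ∃ m : U.space.carrier ⊗[K] V.space.carrier →ₗ[K] W.space.carrier,
    Function.Surjective m ∧
    LinearMap.ker m = Submodule.span K
      {z | ∃ (u : U.space.carrier) (b : B.carrier) (v : V.space.carrier),
        z = U.space.rmul b u ⊗ₜ[K] v - u ⊗ₜ[K] (b • v)} ∧
    (∀ (c : C.carrier) u v, m ((c • u) ⊗ₜ v) = c • m (u ⊗ₜ v)) ∧
    (∀ (a : A.carrier) u v, m (u ⊗ₜ V.space.rmul a v) = W.space.rmul a (m (u ⊗ₜ v))) ∧
    ∀ u v u' v', W.space.form (m (u ⊗ₜ v)) (m (u' ⊗ₜ v')) =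
      V.space.form v (U.space.form u u' • v')

/-- For a hermitian Morita equivalence `U = (U, g) : (B, τ) → (A, σ)` and a hermitian space
`X = (V, h)` over `B^{⊗ n}`, the hermitian space `Y` over `A^{⊗ n}` is (isometric to) the composition
of `X` with `(U^{⊗ n}, g^{⊗ n})`: the module `V ⊗_{B^{⊗ n}} U^{⊗ n}` with
`f(x ⊗ u, x' ⊗ u') = g^{⊗ n}(u, h(x, x') u')`. -/
def IsPush (U : HermMorita B A) {n : ℕ} {ε : signGroup ι} (X : B.Herm n ε)
    (Y : A.Herm n (U.sign ^ n * ε)) : Prop :=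
  ∃ m : X.carrier ⊗[K] (⨂[K] (_ : Fin n), U.space.carrier) →ₗ[K] Y.carrier,
    Function.Surjective m ∧
    LinearMap.ker m = Submodule.span K
      {z | ∃ (x : X.carrier) (b : B.pow n) (w : ⨂[K] (_ : Fin n), U.space.carrier),
        z = X.rmul b x ⊗ₜ[K] w - x ⊗ₜ[K] powAct B.carrier U.space.carrier n b w} ∧
    (∀ (a : Fin n → A.carrier) x w,
      m (x ⊗ₜ PiTensorProduct.map (fun i => U.space.rmul (a i)) w) =
        Y.rmul (PiTensorProduct.tprod K a) (m (x ⊗ₜ w))) ∧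
    ∀ (x x' : X.carrier) (u : Fin n → U.space.carrier) w,
      Y.form (m (x ⊗ₜ PiTensorProduct.tprod K u)) (m (x' ⊗ₜ w)) =
        PiTensorProduct.map (fun i => U.space.form (u i))
          (powAct B.carrier U.space.carrier n (X.form x x') w)

/-- The hermitian space `(A, ⟨1⟩_σ)` over `(A, σ)`, with `⟨1⟩_σ (x, y) = σ(x) y`. -/
def unitSpace (A : AzumayaInv ι) : HermSpace ι A.carrier A.inv 1 where
  carrier := A.carrier
  form := LinearMap.mk₂'ₛₗ ι (RingHom.id K) (fun x y => A.inv x * y)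
    (fun x y z => by rw [A.inv_add, add_mul])
    (fun c x y => by rw [A.inv_smul, smul_mul_assoc])
    (fun x y z => mul_add _ _ _)
    (fun c x y => by rw [mul_smul_comm]; rfl)
  form_right x y a := (mul_assoc _ _ _).symm
  form_left x y a := by
    change A.inv (x * a) * y = A.inv a * (A.inv x * y)
    rw [A.inv_mul, mul_assoc]
  form_symm x y := by
    change A.inv (A.inv x * y) = (((1 : signGroup ι) : Kˣ) : K) • (A.inv y * x)
    rw [A.inv_mul, A.inv_inv]
    simp
  nondegenerate x hx := by
    have h : A.inv x * 1 = 0 := hx 1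
    have h0 : A.inv 0 = 0 := by
      have := A.inv_add 0 0
      rw [add_zero] at this
      exact left_eq_add.mp this
    rw [mul_one] at h
    rw [← A.inv_inv x, h, h0]

instance (A : AzumayaInv ι) : Module A.carrier (unitSpace A).carrier :=
  inferInstanceAs (Module A.carrier A.carrier)

/-- The identity `(A, ⟨1⟩_σ)` of `(A, σ)` in the hermitian Brauer 2-group. -/
def refl (A : AzumayaInv ι) : HermMorita A A where
  sign := 1
  space := unitSpace A
  leftScalarTower := inferInstanceAs (IsScalarTower K A.carrier A.carrier)
  smulCommClass := inferInstanceAs (SMulCommClass A.carrier A.carrierᵐᵒᵖ A.carrier)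
  faithful := fun b hb => by
    have h : b * 1 = 0 := hb (1 : A.carrier)
    rwa [mul_one] at h
  full f := by
    have key (v : A.carrier) : f v = (show A.carrier from f (1 : A.carrier)) * v := by
      have h := f.map_smul (MulOpposite.op v) (1 : A.carrier)
      have h1 : MulOpposite.op v • (1 : A.carrier) = v := by simp
      exact (congrArg f h1).symm.trans h
    exact ⟨f (1 : A.carrier), key⟩
  adjoint b u v := by
    have key (b u v : A.carrier) : A.inv (b * u) * v = A.inv u * (A.inv b * v) := by
      rw [A.inv_mul, mul_assoc]
    exact key b u v

end HermMorita

end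

end

/-!
Everything is reduced to matrices. Let `F` be an algebraically closed field over `K`. An Azumaya
algebra with involution `(A, σ)` is split over `Pt ι = F × F`, on which `K` acts by `(q, q ∘ ι)`:
there is a homomorphism from `A` to matrices over `F × F` whose image spans, under which `σ` becomes
the transpose composed with the exchange of the two factors, whatever the type of `σ`
(`AzumayaInv.exists_goldman`). Every functional on `A` is a sandwich `x ↦ ∑ a i * x * b i`.
This gives the Goldman element, once the reduced trace is known to take values in `K`: a rational
multiple `c * tr` of the trace exists, `c ^ 2` is rational because `c * tr` is a sandwich, and `c` is
rational because automorphisms of `F` preserve the trace (`IsAzumaya.exists_rational_trace`). The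
Goldman element acts on tensor powers by exchanging tensor factors (`GoldmanAlg.psiPow_gamma`), so
that the Goldman representation of the symmetric group exists and is unique. A hermitian space
`(V, h)` acquires coordinates in the same way (`HermSpace.nonempty_coord`): `V` becomes a space of
matrices, of which one dimension is the reduced dimension, and `h` becomes the matrix product.

A hermitian space is determined up to isometry by the Gram matrix of a generating family
(`HermSpace.isometric_of_gram`), and every finitely generated hermitian Gram matrix is realized
(`HermSpace.exists_of_gram`). Since the splitting of `A^{⊗ n}` is injective, Gram matrices may be
written in coordinates. There, tensor products are products of entries and, because the Goldman
representation permutes tensor factors, the alternating power `Alt^d` has the `d × d` minors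
(`IsAlt.generates`). The laws of a graded pre-`λ`-semiring become identities of matrices; in
particular `λ^d (x + y) = ∑ λ^p x λ^q y` holds as the minors of a block diagonal matrix are products
of minors (`IsAlt.elt_sum`). Commutativity uses the Goldman elements of `A^{⊗ n}` again: they permute
the tensor factors of `A` (`Presents.twist`), so that both products, which live over the same
algebra, are isometric. The Cauchy–Binet formula shows that the reduced dimension of `Alt^d V` is
`(dim V).choose d` (`rdim_alt`), so that the reduced dimension is an augmentation.

Rigidity has three parts. The monoids of isometry classes are cancellative by Witt's theorem
(`HermSpace.cancel`): hermitian spaces over the semisimple ring `A^{⊗ n}` are handled by induction on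
the length, removing nonisotropic simple submodules by a Cayley transform, and otherwise reducing
along isotropic ones. Spaces of reduced dimension zero vanish. Finally, a homogeneous element of
`λ`-dimension one is the class of a space `L` of reduced dimension one, whose endomorphisms are
the scalars (`op_form_smul_of_rdim`); then a tensor factor `Y` of `W = L ⊗ Y` is recovered
from `W` by contracting with the reduced trace, for every `W` (`exists_isTensor_of_rdim_eq_one`).

A hermitian Morita equivalence `U` from `B` to `A` has coordinates as a hermitian space over `A`, and
these give a splitting of `B ≅ End_A(U)`. In this splitting, composition with `U^{⊗ n}` multiplies
Gram matrices on both sides by the coordinates of vectors of `U`, which is compatible with products and minors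
(`IsPush.tensor`, `IsPush.alt`). It preserves the reduced dimension because that is the largest `d`
with `Alt^d ≠ 0`, and vanishing is preserved. The sign of `U` is determined by its form
(`HermMorita.sign_eq`), so isomorphic equivalences act in the same way, and identities and
compositions are compared on Gram matrices.
-/

noncomputable section

/-! ### Split algebras with a Goldman element -/

/-- A splitting of the `K`-algebra `R` over `L`: a homomorphism `ψ` to matrices over `L` whose
image spans, a `K`-valued trace `t` (the reduced trace) that becomes the trace of matrices, and
a finite family `(a k, b k)` that is a pair of dual bases for the trace form. The Goldman element
is `∑ a k ⊗ b k`. -/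
structure GoldmanAlg (K L R : Type u) [CommRing K] [CommRing L] [Algebra K L] [Ring R]
    [Algebra K R] where
  I : Type
  [fintypeI : Fintype I]
  [decEqI : DecidableEq I]
  ψ : R →ₐ[K] Matrix I I L
  span_ψ : Submodule.span L (Set.range ψ) = ⊤
  t : R →ₗ[K] K
  trace_ψ : ∀ x, (ψ x).trace = algebraMap K L (t x)
  κ : Type
  [fintypeκ : Fintype κ]
  a : κ → R
  b : κ → R
  frob : ∀ x, ∑ k, t (x * a k) • b k = x

attribute [instance] GoldmanAlg.fintypeI GoldmanAlg.decEqI GoldmanAlg.fintypeκ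

theorem Fintype.prod_sum_eq_sum_prod {T I L : Type*} [CommSemiring L] [Fintype T] [Fintype I]
    [DecidableEq T] (f : T → I → L) : ∏ t, ∑ i, f t i = ∑ g : T → I, ∏ t, f t (g t) := by
  rw [Finset.prod_univ_sum, Fintype.piFinset_univ]

/-- Products of matrix entries, as a multilinear map. -/
def psiPowMultilinear {K L R : Type u} [CommRing K] [CommRing L] [Algebra K L] [Ring R]
    [Algebra K R] {I : Type} [Fintype I] [DecidableEq I] (ψ : R →ₐ[K] Matrix I I L)
    (T : Type) [Fintype T] :
    MultilinearMap K (fun _ : T => R) (Matrix (T → I) (T → I) L) where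
  toFun x := Matrix.of fun f g => ∏ t, ψ (x t) (f t) (g t)
  map_update_add' x t y z := by
    ext f g
    exact ((MultilinearMap.mkPiAlgebra K T L).compLinearMap fun t =>
        Matrix.entryLinearMap K L (f t) (g t) ∘ₗ ψ.toLinearMap).map_update_add x t y z
  map_update_smul' x t c y := by
    ext f g
    exact ((MultilinearMap.mkPiAlgebra K T L).compLinearMap fun t =>
        Matrix.entryLinearMap K L (f t) (g t) ∘ₗ ψ.toLinearMap).map_update_smul x t c y

/-- The tensor power of a matrix-valued algebra homomorphism: entries are products of entries. -/
def psiPow {K L R : Type u} [CommRing K] [CommRing L] [Algebra K L] [Ring R] [Algebra K R]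
    {I : Type} [Fintype I] [DecidableEq I] (ψ : R →ₐ[K] Matrix I I L)
    (T : Type) [Fintype T] [DecidableEq T] :
    (⨂[K] (_ : T), R) →ₐ[K] Matrix (T → I) (T → I) L :=
  PiTensorProduct.liftAlgHom (psiPowMultilinear ψ T)
    (by
      ext f g
      change ∏ t, ψ 1 (f t) (g t) = _
      simp only [map_one, Matrix.one_apply, Finset.prod_ite_zero, Finset.prod_const_one]
      simp [funext_iff])
    (by
      intro x y
      ext f g
      rw [Matrix.mul_apply]
      change ∏ t, ψ (x t * y t) (f t) (g t) =
        ∑ h : T → I, (∏ t, ψ (x t) (f t) (h t)) * (∏ t, ψ (y t) (h t) (g t))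
      simp only [map_mul, Matrix.mul_apply, ← Finset.prod_mul_distrib]
      exact Fintype.prod_sum_eq_sum_prod fun t i => ψ (x t) (f t) i * ψ (y t) i (g t))

theorem psiPow_tprod {K L R : Type u} [CommRing K] [CommRing L] [Algebra K L] [Ring R]
    [Algebra K R] {I : Type} [Fintype I] [DecidableEq I] (ψ : R →ₐ[K] Matrix I I L)
    (T : Type) [Fintype T] [DecidableEq T] (x : T → R) (f g : T → I) :
    psiPow ψ T (PiTensorProduct.tprod K x) f g = ∏ t, ψ (x t) (f t) (g t) := by
  have h := PiTensorProduct.lift.tprod (φ := psiPowMultilinear ψ T) x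
  exact congrFun (congrFun h f) g

namespace GoldmanAlg

variable {K L R : Type u} [CommRing K] [CommRing L] [Algebra K L] [Ring R] [Algebra K R]
variable (G : GoldmanAlg K L R)

/-- The `L`-linear identity on matrices expressed by the dual bases. -/
theorem frob_matrix (Z : Matrix G.I G.I L) :
    ∑ k, (Z * G.ψ (G.a k)).trace • G.ψ (G.b k) = Z := by
  have h : Z ∈ Submodule.span L (Set.range G.ψ) := by rw [G.span_ψ]; trivial
  induction h using Submodule.span_induction with
  | mem x hx =>
    obtain ⟨x, rfl⟩ := hx
    conv_rhs => rw [← G.frob x]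
    simp only [map_sum, map_smul, ← map_mul, G.trace_ψ, algebraMap_smul]
  | zero => simp
  | add x y _ _ hx hy =>
    conv_rhs => rw [← hx, ← hy]
    simp only [add_mul, Matrix.trace_add, add_smul, Finset.sum_add_distrib]
  | smul c x _ hx =>
    conv_rhs => rw [← hx]
    simp only [Matrix.smul_mul, Matrix.trace_smul, smul_assoc, Finset.smul_sum]

/-- The Goldman element of a matrix algebra is the flip. -/
theorem entries (i j p q : G.I) :
    ∑ k, G.ψ (G.a k) i j * G.ψ (G.b k) p q = if j = p ∧ i = q then 1 else 0 := by
  have h := congrFun (congrFun (G.frob_matrix (Matrix.single j i 1)) p) q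
  rw [Matrix.sum_apply] at h
  simp only [Matrix.smul_apply, Matrix.trace_single_mul, smul_eq_mul, one_mul,
    Matrix.single_apply] at h
  exact h

theorem t_comm (hK : Function.Injective (algebraMap K L)) (x y : R) :
    G.t (x * y) = G.t (y * x) := by
  apply hK
  rw [← G.trace_ψ, ← G.trace_ψ, map_mul, map_mul, Matrix.trace_mul_comm]

theorem ψ_injective (hK : Function.Injective (algebraMap K L)) : Function.Injective G.ψ := by
  rw [injective_iff_map_eq_zero]
  intro x hx
  rw [← G.frob x]
  refine Finset.sum_eq_zero fun k _ => ?_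
  have : G.t (x * G.a k) = 0 := by
    apply hK
    rw [← G.trace_ψ, map_mul, hx, zero_mul, Matrix.trace_zero, map_zero]
  rw [this, zero_smul]

/-- Sandwiching with the Goldman element is the reduced trace. -/
theorem sandwich (hK : Function.Injective (algebraMap K L)) (x : R) :
    ∑ k, G.a k * x * G.b k = algebraMap K R (G.t x) := by
  apply G.ψ_injective hK
  ext p q
  rw [AlgHom.commutes, map_sum, Matrix.sum_apply]
  simp only [map_mul, Matrix.mul_apply]
  calc ∑ k, ∑ j, (∑ i, G.ψ (G.a k) p i * G.ψ x i j) * G.ψ (G.b k) j q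
      = ∑ j, ∑ i, G.ψ x i j * ∑ k, G.ψ (G.a k) p i * G.ψ (G.b k) j q := by
        rw [Finset.sum_comm]
        refine Finset.sum_congr rfl fun j _ => ?_
        simp only [Finset.sum_mul, Finset.mul_sum]
        rw [Finset.sum_comm]
        refine Finset.sum_congr rfl fun i _ => Finset.sum_congr rfl fun k _ => by ring
    _ = _ := by
        simp only [G.entries]
        rw [IsScalarTower.algebraMap_apply K L (Matrix G.I G.I L), Matrix.algebraMap_matrix_apply,
          Algebra.algebraMap_self_apply, ← G.trace_ψ, Matrix.trace]
        by_cases h : p = q <;> simp [h]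

/-- The Goldman element. -/
def g : R ⊗[K] R := ∑ k, G.a k ⊗ₜ G.b k

theorem g_symm (hK : Function.Injective (algebraMap K L)) (x : R) :
    ∑ k, (x * G.a k) ⊗ₜ[K] G.b k = ∑ k, G.b k ⊗ₜ[K] (G.a k * x) := by
  calc ∑ k, (x * G.a k) ⊗ₜ[K] G.b k
      = ∑ k, ∑ l, G.b l ⊗ₜ[K] (G.t (x * G.a k * G.a l) • G.b k) := by
        refine Finset.sum_congr rfl fun k _ => ?_
        conv_lhs => rw [← G.frob (x * G.a k)]
        rw [TensorProduct.sum_tmul]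
        simp only [TensorProduct.smul_tmul]
    _ = ∑ l, ∑ k, G.b l ⊗ₜ[K] (G.t (G.a l * x * G.a k) • G.b k) := by
        rw [Finset.sum_comm]
        refine Finset.sum_congr rfl fun l _ => Finset.sum_congr rfl fun k _ => ?_
        rw [G.t_comm hK, mul_assoc]
    _ = _ := by
        refine Finset.sum_congr rfl fun l _ => ?_
        rw [← TensorProduct.tmul_sum, G.frob]

theorem g_symm' (hK : Function.Injective (algebraMap K L)) :
    ∑ k, G.b k ⊗ₜ[K] G.a k = ∑ k, G.a k ⊗ₜ[K] G.b k := by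
  have := G.g_symm hK 1
  simpa using this.symm

theorem casimir (hK : Function.Injective (algebraMap K L)) (x : R) :
    ∑ k, (G.a k * x) ⊗ₜ[K] G.b k = ∑ k, G.a k ⊗ₜ[K] (x * G.b k) := by
  calc ∑ k, (G.a k * x) ⊗ₜ[K] G.b k
      = ∑ k, ∑ l, G.b l ⊗ₜ[K] (G.t (G.a k * x * G.a l) • G.b k) := by
        refine Finset.sum_congr rfl fun k _ => ?_
        conv_lhs => rw [← G.frob (G.a k * x)]
        rw [TensorProduct.sum_tmul]
        simp only [TensorProduct.smul_tmul]
    _ = ∑ l, ∑ k, G.b l ⊗ₜ[K] (G.t (x * G.a l * G.a k) • G.b k) := by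
        rw [Finset.sum_comm]
        refine Finset.sum_congr rfl fun l _ => Finset.sum_congr rfl fun k _ => ?_
        rw [mul_assoc, G.t_comm hK]
    _ = ∑ l, G.b l ⊗ₜ[K] (x * G.a l) := by
        refine Finset.sum_congr rfl fun l _ => ?_
        rw [← TensorProduct.tmul_sum, G.frob]
    _ = _ := by
        have := congrArg (TensorProduct.map LinearMap.id (LinearMap.mulLeft K x)) (G.g_symm' hK)
        simpa using this

/-- The tensor power of a split algebra. -/
abbrev pow (T : Type) [Fintype T] [DecidableEq T] : GoldmanAlg K L (⨂[K] (_ : T), R) where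
  I := T → G.I
  ψ := psiPow G.ψ T
  span_ψ := by
    rw [eq_top_iff]
    intro Z _
    -- products of elementary matrices span, and each is reached by multilinearity
    have key : ∀ Y : T → Matrix G.I G.I L,
        (Matrix.of fun f g : T → G.I => ∏ t, Y t (f t) (g t)) ∈
          Submodule.span L (Set.range (psiPow G.ψ T)) := by
      intro Y
      have hY : ∀ t, Y t = ∑ k, (Y t * G.ψ (G.a k)).trace • G.ψ (G.b k) := fun t =>
        (G.frob_matrix (Y t)).symm
      have : (Matrix.of fun f g : T → G.I => ∏ t, Y t (f t) (g t)) =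
          ∑ k : T → G.κ, (∏ t, (Y t * G.ψ (G.a (k t))).trace) •
            psiPow G.ψ T (PiTensorProduct.tprod K fun t => G.b (k t)) := by
        ext f g
        rw [Matrix.sum_apply]
        simp only [Matrix.of_apply, Matrix.smul_apply, psiPow_tprod, smul_eq_mul,
          ← Finset.prod_mul_distrib]
        rw [← Fintype.prod_sum_eq_sum_prod fun t k =>
          (Y t * G.ψ (G.a k)).trace * G.ψ (G.b k) (f t) (g t)]
        refine Finset.prod_congr rfl fun t _ => ?_
        conv_lhs => rw [hY t]
        rw [Matrix.sum_apply]
        rfl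
      rw [this]
      exact Submodule.sum_mem _ fun k _ => Submodule.smul_mem _ _
        (Submodule.subset_span ⟨_, rfl⟩)
    rw [Matrix.matrix_eq_sum_single Z]
    refine Submodule.sum_mem _ fun f _ => Submodule.sum_mem _ fun g _ => ?_
    have h := Submodule.smul_mem _ (Z f g) (key fun t => Matrix.single (f t) (g t) 1)
    convert h using 1
    ext f' g'
    simp only [Matrix.single_apply, Matrix.smul_apply, Matrix.of_apply, smul_eq_mul,
      Finset.prod_ite_zero, Finset.prod_const_one, forall_and, Finset.mem_univ, true_imp_iff]
    simp [funext_iff]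
  t := PiTensorProduct.lift ((MultilinearMap.mkPiAlgebra K T K).compLinearMap fun _ => G.t)
  trace_ψ := by
    intro x
    induction x using PiTensorProduct.induction_on with
    | smul_tprod r x =>
      rw [map_smul, Matrix.trace_smul, map_smul, smul_eq_mul, map_mul, Algebra.smul_def]
      congr 1
      rw [PiTensorProduct.lift.tprod, Matrix.trace]
      simp only [Matrix.diag_apply, psiPow_tprod, MultilinearMap.compLinearMap_apply,
        MultilinearMap.mkPiAlgebra_apply, map_prod, ← G.trace_ψ]
      exact (Fintype.prod_sum_eq_sum_prod fun t i => G.ψ (x t) i i).symm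
    | add x y hx hy => rw [map_add, Matrix.trace_add, hx, hy, map_add, map_add]
  κ := T → G.κ
  a k := PiTensorProduct.tprod K fun t => G.a (k t)
  b k := PiTensorProduct.tprod K fun t => G.b (k t)
  frob := by
    intro x
    induction x using PiTensorProduct.induction_on with
    | smul_tprod r x =>
      conv_rhs => rw [show x = fun t => ∑ k, G.t (x t * G.a k) • G.b k from
        funext fun t => (G.frob _).symm]
      rw [MultilinearMap.map_sum, Finset.smul_sum]
      refine Finset.sum_congr rfl fun k _ => ?_
      rw [smul_mul_assoc, map_smul, PiTensorProduct.tprod_mul_tprod, PiTensorProduct.lift.tprod,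
        smul_assoc, MultilinearMap.map_smul_univ]
      rfl
    | add x y hx hy =>
      conv_rhs => rw [← hx, ← hy]
      simp only [add_mul, map_add, add_smul, Finset.sum_add_distrib]

@[simp] theorem pow_ψ (T : Type) [Fintype T] [DecidableEq T] : (G.pow T).ψ = psiPow G.ψ T := rfl

end GoldmanAlg

/-! ### Faithfully flat descent of freeness, and uniqueness of the reduced trace -/

section Free

variable {K L : Type u} [CommRing K] [CommRing L] [Algebra K L]

/-- A maximal ideal of `K` is the kernel of a homomorphism to a residue field of a faithfully flat
extension. -/
theorem exists_residueField [Module.FaithfullyFlat K L] (P : Ideal K) (hP : P.IsMaximal) :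
    ∃ Q : Ideal L, Q.IsMaximal ∧ P ≤ Q.comap (algebraMap K L) := by
  have h := Module.FaithfullyFlat.submodule_ne_top (M := L) hP
  have h' : P.map (algebraMap K L) ≠ ⊤ := by
    intro h'
    apply h
    have h2 := Ideal.smul_top_eq_map (S := L) P
    rw [h'] at h2
    exact h2
  obtain ⟨Q, hQ, hPQ⟩ := Ideal.exists_le_maximal _ h'
  exact ⟨Q, hQ, Ideal.map_le_iff_le_comap.mp hPQ⟩

variable {M N : Type u} [AddCommGroup M] [Module K M] [AddCommGroup N] [Module K N] [Module L N]
  [IsScalarTower K L N]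
variable {κ : Type} [Fintype κ]

theorem liftBaseChange_bijective (χ : M →ₗ[K] N)
    (hspan : Submodule.span L (Set.range χ) = ⊤) (e : κ → M) (lam : κ → M →ₗ[K] K)
    (Lam : κ → N →ₗ[L] L) (h : ∀ k m, Lam k (χ m) = algebraMap K L (lam k m))
    (hm : ∀ m, ∑ k, lam k m • e k = m) : Function.Bijective (χ.liftBaseChange L) := by
  constructor
  · rw [injective_iff_map_eq_zero]
    have key : ∀ z : L ⊗[K] M, z = ∑ k, Lam k (χ.liftBaseChange L z) • ((1 : L) ⊗ₜ[K] e k) := by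
      intro z
      induction z using TensorProduct.induction_on with
      | zero => simp
      | tmul l m =>
        simp only [LinearMap.liftBaseChange_tmul, map_smul, h, smul_eq_mul]
        conv_lhs => rw [← hm m]
        rw [TensorProduct.tmul_sum]
        refine Finset.sum_congr rfl fun k _ => ?_
        rw [TensorProduct.smul_tmul', ← TensorProduct.smul_tmul, Algebra.smul_def, smul_eq_mul,
          mul_one, mul_comm]
      | add x y hx hy =>
        conv_lhs => rw [hx, hy]
        simp only [map_add, add_smul, Finset.sum_add_distrib]
    intro z hz
    rw [key z, hz]
    simp
  · rw [← LinearMap.range_eq_top, eq_top_iff, ← hspan, Submodule.span_le]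
    rintro _ ⟨m, rfl⟩
    exact ⟨1 ⊗ₜ m, by simp⟩

/-- Over an artinian ring, freeness of given rank descends along faithfully flat extensions, because
it can be checked on the ranks at the maximal ideals. -/
theorem free_of_baseChange [Nontrivial K] [IsArtinianRing K] [Module.FaithfullyFlat K L] [Module.Finite K M]
    [Module.Flat K M] {n : Type} [Fintype n] (f : L ⊗[K] M ≃ₗ[L] (n → L)) :
    Module.Free K M ∧ Module.finrank K M = Fintype.card n := by
  have : Nontrivial L := (FaithfulSMul.algebraMap_injective K L).nontrivial
  have hrk : ∀ P : MaximalSpectrum K,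
      Module.finrank (K ⧸ P.1) ((K ⧸ P.1) ⊗[K] M) = Fintype.card n := by
    intro P
    have := P.2
    obtain ⟨Q, hQ, hPQ⟩ := exists_residueField (L := L) P.1 P.2
    let : Field (K ⧸ P.1) := Ideal.Quotient.field _
    let : Field (L ⧸ Q) := Ideal.Quotient.field _
    let : Algebra (K ⧸ P.1) (L ⧸ Q) := (Ideal.quotientMap Q (algebraMap K L) hPQ).toAlgebra
    have : IsScalarTower K (K ⧸ P.1) (L ⧸ Q) := IsScalarTower.of_algebraMap_eq fun x => rfl
    rw [← Module.finrank_baseChange (R := L ⧸ Q)]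
    rw [(TensorProduct.AlgebraTensorModule.cancelBaseChange K (K ⧸ P.1) (L ⧸ Q) (L ⧸ Q)
      M).finrank_eq]
    rw [← (TensorProduct.AlgebraTensorModule.cancelBaseChange K L (L ⧸ Q) (L ⧸ Q)
      M).finrank_eq]
    rw [(TensorProduct.AlgebraTensorModule.congr (LinearEquiv.refl (L ⧸ Q) (L ⧸ Q))
      f).finrank_eq, Module.finrank_baseChange, Module.finrank_fintype_fun_eq_card]
  have hfree : Module.Free K M := Module.free_of_flat_of_finrank_eq K M (Fintype.card n) hrk
  refine ⟨hfree, ?_⟩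
  rw [← Module.finrank_baseChange (R := L), f.finrank_eq, Module.finrank_fintype_fun_eq_card]

theorem free_of_coordinates [Nontrivial K] [IsArtinianRing K] [Module.FaithfullyFlat K L]
    {n : Type} [Fintype n] (b : N ≃ₗ[L] (n → L)) (χ : M →ₗ[K] N)
    (hspan : Submodule.span L (Set.range χ) = ⊤) (e : κ → M) (lam : κ → M →ₗ[K] K)
    (Lam : κ → N →ₗ[L] L) (h : ∀ k m, Lam k (χ m) = algebraMap K L (lam k m))
    (hm : ∀ m, ∑ k, lam k m • e k = m) :
    Module.Free K M ∧ Module.finrank K M = Fintype.card n := by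
  have hsplit : (Fintype.linearCombination K e) ∘ₗ LinearMap.pi lam = LinearMap.id := by
    ext m
    simp [Fintype.linearCombination_apply, hm]
  have : Module.Projective K M := Module.Projective.of_split _ _ hsplit
  have : Module.Finite K M := Module.Finite.of_surjective (Fintype.linearCombination K e)
    fun m => ⟨LinearMap.pi lam m, LinearMap.congr_fun hsplit m⟩
  exact free_of_baseChange ((LinearEquiv.ofBijective _
    (liftBaseChange_bijective χ hspan e lam Lam h hm)).trans b)

end Free

namespace GoldmanAlg

variable {K L R : Type u} [CommRing K] [CommRing L] [Algebra K L] [Ring R] [Algebra K R]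
variable (G : GoldmanAlg K L R)

/-- The extension of scalars of a homomorphism to matrices. -/
def _root_.matrixLift {I : Type} [Fintype I] [DecidableEq I] (ψ : R →ₐ[K] Matrix I I L) :
    L ⊗[K] R →ₐ[L] Matrix I I L :=
  Algebra.TensorProduct.lift (Algebra.ofId L _) ψ fun x y => by
    rw [Algebra.ofId_apply]
    exact Algebra.commute_algebraMap_left x (ψ y)

theorem _root_.matrixLift_tmul {I : Type} [Fintype I] [DecidableEq I] (ψ : R →ₐ[K] Matrix I I L)
    (l : L) (x : R) : matrixLift ψ (l ⊗ₜ x) = l • ψ x := by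
  rw [matrixLift, Algebra.TensorProduct.lift_tmul, Algebra.ofId_apply, ← Algebra.smul_def]

theorem matrixLift_bijective : Function.Bijective (matrixLift G.ψ) := by
  have h := liftBaseChange_bijective (L := L) G.ψ.toLinearMap G.span_ψ G.b
    (fun k => G.t ∘ₗ LinearMap.mulRight K (G.a k))
    (fun k => Matrix.traceLinearMap G.I L L ∘ₗ LinearMap.mulRight L (G.ψ (G.a k)))
    (fun k m => by
      change (G.ψ m * G.ψ (G.a k)).trace = algebraMap K L (G.t (m * G.a k))
      rw [← G.trace_ψ, map_mul]) (fun m => G.frob m)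
  have h2 : ∀ z, matrixLift G.ψ z = G.ψ.toLinearMap.liftBaseChange L z := by
    intro z
    induction z using TensorProduct.induction_on with
    | zero => rw [map_zero, map_zero]
    | tmul l m => rw [matrixLift_tmul, LinearMap.liftBaseChange_tmul]; rfl
    | add x y hx hy => rw [map_add, map_add, hx, hy]
  rwa [← funext h2] at h

/-- The splitting, as an isomorphism of the base change with a matrix algebra. -/
def splitEquiv : L ⊗[K] R ≃ₐ[L] Matrix G.I G.I L :=
  AlgEquiv.ofBijective (matrixLift G.ψ) G.matrixLift_bijective

theorem splitEquiv_one_tmul (x : R) : G.splitEquiv (1 ⊗ₜ x) = G.ψ x := by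
  change matrixLift G.ψ (1 ⊗ₜ x) = _
  rw [matrixLift_tmul, one_smul]

theorem isReducedTrace [Module.FaithfullyFlat K L] : IsReducedTrace G.t := by
  refine ⟨L, inferInstance, inferInstance, inferInstance, Fintype.card G.I,
    G.splitEquiv.trans (Matrix.reindexAlgEquiv L L (Fintype.equivFin G.I)), fun x => ?_⟩
  rw [← G.trace_ψ, AlgEquiv.trans_apply, splitEquiv_one_tmul, Matrix.coe_reindexAlgEquiv]
  exact (Fintype.equivFin G.I).symm.sum_comp fun i => G.ψ x i i

theorem free_finrank [Nontrivial K] [IsArtinianRing K] [Module.FaithfullyFlat K L] :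
    Module.Free K R ∧ Module.finrank K R = Fintype.card G.I * Fintype.card G.I := by
  have h := free_of_coordinates (L := L) (M := R) (N := Matrix G.I G.I L) (n := G.I × G.I)
    (LinearEquiv.curry L L G.I G.I).symm
    G.ψ.toLinearMap G.span_ψ G.b
    (fun k => G.t ∘ₗ LinearMap.mulRight K (G.a k))
    (fun k => Matrix.traceLinearMap G.I L L ∘ₗ LinearMap.mulRight L (G.ψ (G.a k)))
    (fun k m => by
      change (G.ψ m * G.ψ (G.a k)).trace = algebraMap K L (G.t (m * G.a k))
      rw [← G.trace_ψ, map_mul]) (fun m => G.frob m)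
  rwa [Fintype.card_prod] at h

end GoldmanAlg

/-- The trace does not depend on an isomorphism of matrix algebras over a field. -/
theorem trace_algEquiv {E : Type*} [Field E] {I J : Type*} [Fintype I] [Fintype J]
    [DecidableEq I] [DecidableEq J] (f : Matrix I I E ≃ₐ[E] Matrix J J E) (x : Matrix I I E) :
    (f x).trace = x.trace := by
  obtain ⟨T, hT⟩ := AlgEquiv.eq_linearEquivConjAlgEquiv
    ((Matrix.toLinAlgEquiv' (R := E) (n := I)).symm.trans (f.trans Matrix.toLinAlgEquiv'))
  have h := congrArg (fun F : Module.End E (I → E) ≃ₐ[E] Module.End E (J → E) =>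
    LinearMap.trace E (J → E) (F (Matrix.toLinAlgEquiv' x))) hT
  simp only [AlgEquiv.trans_apply, AlgEquiv.symm_apply_apply] at h
  have h1 := Matrix.trace_toLin'_eq (f x)
  have h2 := Matrix.trace_toLin'_eq x
  rw [← h1, ← h2]
  refine h.trans ?_
  exact LinearMap.trace_conj' (Matrix.toLin' x) T

section Unique

variable {K R : Type u} [CommRing K] [Ring R] [Algebra K R]

/-- Base change of an `L`-isomorphism to matrices along `L → E`. -/
theorem exists_splitEquiv_baseChange {L E : Type u} [CommRing L] [Algebra K L] [Field E]
    [Algebra K E] [Algebra L E] [IsScalarTower K L E] {I : Type} [Fintype I] [DecidableEq I]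
    (φ : L ⊗[K] R ≃ₐ[L] Matrix I I L) :
    ∃ φ' : E ⊗[K] R ≃ₐ[E] Matrix I I E, ∀ x : R,
      (φ' (1 ⊗ₜ x)).trace = algebraMap L E (φ (1 ⊗ₜ x)).trace := by
  let θ : Matrix I I L →ₐ[K] Matrix I I E := (IsScalarTower.toAlgHom K L E).mapMatrix
  let ψ : R →ₐ[K] Matrix I I E :=
    θ.comp ((φ.toAlgHom.restrictScalars K).comp Algebra.TensorProduct.includeRight)
  have hψ : ∀ x, ψ x = (φ (1 ⊗ₜ x)).map (algebraMap L E) := fun x => rfl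
  have hsurj : Function.Surjective (matrixLift ψ) := by
    rw [← AlgHom.range_eq_top, eq_top_iff]
    have h1 : ∀ Z : Matrix I I L, Z.map (algebraMap L E) ∈ (matrixLift ψ).range := by
      intro Z
      obtain ⟨z, rfl⟩ := φ.surjective Z
      induction z using TensorProduct.induction_on with
      | zero => rw [map_zero, Matrix.map_zero _ (map_zero _)]; exact zero_mem _
      | tmul l x =>
        refine ⟨algebraMap L E l ⊗ₜ x, ?_⟩
        change matrixLift ψ _ = _
        have h : l ⊗ₜ[K] x = l • (1 : L) ⊗ₜ[K] x := by
          rw [TensorProduct.smul_tmul', smul_eq_mul, mul_one]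
        rw [matrixLift_tmul, hψ, h, map_smul]
        ext i j
        exact (map_mul (algebraMap L E) l _).symm
      | add x y hx hy =>
        rw [map_add, Matrix.map_add _ (map_add _)]
        exact add_mem hx hy
    intro Z _
    rw [Matrix.matrix_eq_sum_single Z]
    refine sum_mem fun i _ => sum_mem fun j _ => ?_
    have h2 := Subalgebra.smul_mem _ (h1 (Matrix.single i j 1)) (Z i j)
    rwa [Matrix.map_single, map_one, Matrix.smul_single, smul_eq_mul, mul_one] at h2
  have hfin : Module.Free L (L ⊗[K] R) := Module.Free.of_equiv φ.symm.toLinearEquiv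
  have : Nontrivial L := (algebraMap L E).domain_nontrivial
  have hrk : Module.finrank E (E ⊗[K] R) = Module.finrank E (Matrix I I E) := by
    rw [← (TensorProduct.AlgebraTensorModule.cancelBaseChange K L E E R).finrank_eq,
      Module.finrank_baseChange, φ.toLinearEquiv.finrank_eq, Module.finrank_matrix,
      Module.finrank_matrix, Module.finrank_self, Module.finrank_self]
  have e2 : E ⊗[L] (L ⊗[K] R) ≃ₗ[E] E ⊗[K] R :=
    TensorProduct.AlgebraTensorModule.cancelBaseChange K L E E R
  have : Module.Finite L (L ⊗[K] R) := Module.Finite.equiv φ.symm.toLinearEquiv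
  have : Module.Finite E (E ⊗[K] R) := Module.Finite.equiv e2
  -- a surjection between spaces of the same dimension over the field `E`
  have hinj : Function.Injective (matrixLift ψ) :=
    (LinearMap.injective_iff_surjective_of_finrank_eq_finrank
      (f := (matrixLift ψ).toLinearMap) hrk).mpr hsurj
  refine ⟨AlgEquiv.ofBijective (matrixLift ψ) ⟨hinj, hsurj⟩, fun x => ?_⟩
  change (matrixLift ψ (1 ⊗ₜ x)).trace = _
  rw [matrixLift_tmul, one_smul, hψ]
  exact (AddMonoidHom.map_trace (algebraMap L E).toAddMonoidHom _).symm

/-- Two splittings over a field have the same trace. -/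
theorem trace_eq_of_splitEquiv {E : Type u} [Field E] [Algebra K E] {I J : Type} [Fintype I]
    [DecidableEq I] [Fintype J] [DecidableEq J] (φ : E ⊗[K] R ≃ₐ[E] Matrix I I E)
    (φ' : E ⊗[K] R ≃ₐ[E] Matrix J J E) (z : E ⊗[K] R) : (φ z).trace = (φ' z).trace := by
  have h := trace_algEquiv (φ.symm.trans φ') (φ z)
  simpa using h.symm

/-- Two splittings over extensions of a common field quotient have traces that agree in a
composite of the extensions. -/
theorem reducedTrace_eq {L L' : Type u} [CommRing L] [Algebra K L] [CommRing L'] [Algebra K L']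
    {I J : Type} [Fintype I] [DecidableEq I] [Fintype J] [DecidableEq J]
    (φ : L ⊗[K] R ≃ₐ[L] Matrix I I L) (φ' : L' ⊗[K] R ≃ₐ[L'] Matrix J J L') {t t' : R → K}
    (Q : Ideal (L ⊗[K] L')) (hQ : Q.IsMaximal)
    (ht : ∀ x, (φ (1 ⊗ₜ x)).trace = algebraMap K L (t x))
    (ht' : ∀ x, (φ' (1 ⊗ₜ x)).trace = algebraMap K L' (t' x)) (x : R) :
    algebraMap K (L ⊗[K] L') (t x) - algebraMap K (L ⊗[K] L') (t' x) ∈ Q := by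
  let : Field ((L ⊗[K] L') ⧸ Q) := Ideal.Quotient.field _
  let : Algebra L' ((L ⊗[K] L') ⧸ Q) :=
    ((Ideal.Quotient.mkₐ K Q).comp Algebra.TensorProduct.includeRight).toRingHom.toAlgebra
  have : IsScalarTower K L' ((L ⊗[K] L') ⧸ Q) := IsScalarTower.of_algebraMap_eq fun x =>
    (((Ideal.Quotient.mkₐ K Q).comp (Algebra.TensorProduct.includeRight : L' →ₐ[K] L ⊗[K] L')).commutes
      x).symm
  obtain ⟨φ₁, h₁⟩ := exists_splitEquiv_baseChange (E := (L ⊗[K] L') ⧸ Q) φ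
  obtain ⟨φ₂, h₂⟩ := exists_splitEquiv_baseChange (E := (L ⊗[K] L') ⧸ Q) φ'
  have h := trace_eq_of_splitEquiv φ₁ φ₂ (1 ⊗ₜ x)
  rw [h₁, h₂, ht, ht', ← IsScalarTower.algebraMap_apply, ← IsScalarTower.algebraMap_apply] at h
  exact Ideal.Quotient.eq.mp h

/-- Reduced traces are unique, over a ring with trivial Jacobson radical. -/
theorem IsReducedTrace.unique (hJ : ∀ c : K, (∀ P : Ideal K, P.IsMaximal → c ∈ P) → c = 0)
    {t t' : R →ₗ[K] K} (h : IsReducedTrace t) (h' : IsReducedTrace t') : t = t' := by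
  obtain ⟨L, _, _, _, n, φ, hφ⟩ := h
  obtain ⟨L', _, _, _, n', φ', hφ'⟩ := h'
  have : Module.FaithfullyFlat K (L ⊗[K] L') := Module.FaithfullyFlat.trans K L (L ⊗[K] L')
  ext x
  rw [← sub_eq_zero]
  refine hJ _ fun P hP => ?_
  obtain ⟨Q, hQ, hPQ⟩ := exists_residueField (L := L ⊗[K] L') P hP
  have h := reducedTrace_eq φ φ' Q hQ hφ hφ' x
  rw [← map_sub] at h
  have : P = Q.comap (algebraMap K (L ⊗[K] L')) :=
    hP.eq_of_le (Ideal.comap_ne_top _ hQ.ne_top) hPQ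
  rw [this]
  exact h

end Unique

/-! ### The Goldman representation of the symmetric group -/

/-- A submonoid of the symmetric group containing all adjacent transpositions is everything. -/
theorem Equiv.Perm.mem_of_adjacent {d : ℕ} (S : Submonoid (Equiv.Perm (Fin d)))
    (h : ∀ i j : Fin d, (i : ℕ) + 1 = j → Equiv.swap i j ∈ S) (π : Equiv.Perm (Fin d)) : π ∈ S := by
  cases d with
  | zero => rw [Subsingleton.elim π 1]; exact S.one_mem
  | succ n =>
    have h1 : Submonoid.closure (Set.range fun i : Fin n ↦ Equiv.swap i.castSucc i.succ) ≤ S := by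
      rw [Submonoid.closure_le]
      rintro _ ⟨i, rfl⟩
      exact h _ _ (by simp)
    rw [Equiv.Perm.mclosure_swap_castSucc_succ] at h1
    exact h1 trivial

/-- Two monoid homomorphisms on the symmetric group that agree on adjacent transpositions agree. -/
theorem Equiv.Perm.monoidHom_ext_adjacent {d : ℕ} {N : Type*} [Monoid N]
    {f f' : Equiv.Perm (Fin d) →* N}
    (h : ∀ i j : Fin d, (i : ℕ) + 1 = j → f (Equiv.swap i j) = f' (Equiv.swap i j)) : f = f' :=
  MonoidHom.ext fun π => Equiv.Perm.mem_of_adjacent (f.eqLocusM f') h π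

/-- The permutation matrices on tensor powers of a free module. -/
def tensorPermMatrix (T I L : Type*) [CommRing L] [Fintype T] [Fintype I] [DecidableEq T]
    [DecidableEq I] : Equiv.Perm T →* Matrix (T → I) (T → I) L where
  toFun π := Matrix.of fun f h => if h = f ∘ π then 1 else 0
  map_one' := by
    ext f h
    simp [Matrix.one_apply, eq_comm]
  map_mul' π π' := by
    ext f h
    rw [Matrix.mul_apply, Finset.sum_eq_single (f ∘ π)]
    · simp only [Matrix.of_apply, if_true, one_mul, Function.comp_assoc, Equiv.Perm.coe_mul]
      congr
    · intro j _ hj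
      simp [hj]
    · intro hj
      exact absurd (Finset.mem_univ _) hj

theorem tensorPermMatrix_apply {T I L : Type*} [CommRing L] [Fintype T] [Fintype I] [DecidableEq T]
    [DecidableEq I] (π : Equiv.Perm T) (f h : T → I) :
    tensorPermMatrix T I L π f h = if h = f ∘ π then 1 else 0 := rfl

section placeAt

variable {K B : Type u} [CommRing K] [Ring B] [Algebra K B] {d : ℕ}

theorem placeAt_tmul (i j : Fin d) (h : i ≠ j) (a b : B) :
    placeAt B d i j (a ⊗ₜ[K] b) =
      PiTensorProduct.tprod K (Function.update (Function.update 1 j b) i a) := by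
  change PiTensorProduct.tprod K (Pi.mulSingle (M := fun _ : Fin d => B) i a) *
    PiTensorProduct.tprod K (Pi.mulSingle (M := fun _ : Fin d => B) j b) = _
  rw [PiTensorProduct.tprod_mul_tprod]
  congr 1
  ext k
  rcases eq_or_ne k i with rfl | hk
  · simp [h]
  · rcases eq_or_ne k j with rfl | hk'
    · simp [hk]
    · simp [hk, hk']

end placeAt

theorem Finset.prod_eq_mul_mul_prod_erase {T L : Type*} [CommMonoid L] [Fintype T] [DecidableEq T]
    {i j : T} (h : i ≠ j) (F : T → L) :
    ∏ t, F t = F i * (F j * ∏ t ∈ (Finset.univ.erase i).erase j, F t) := by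
  rw [Finset.mul_prod_erase _ _ (Finset.mem_erase.mpr ⟨h.symm, Finset.mem_univ j⟩),
    Finset.mul_prod_erase _ _ (Finset.mem_univ i)]

theorem ite_one_zero_mul_ite {L : Type*} [MulZeroOneClass L] (p q : Prop) [Decidable p]
    [Decidable q] :
    (if p then (1 : L) else 0) * (if q then 1 else 0) = if p ∧ q then 1 else 0 := by
  by_cases hp : p <;> simp [hp]

namespace GoldmanAlg

variable {K L R : Type u} [CommRing K] [CommRing L] [Algebra K L] [Ring R] [Algebra K R]
variable (G : GoldmanAlg K L R)

theorem psiPow_placeAt {d : ℕ} (i j : Fin d) (h : i ≠ j) :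
    psiPow G.ψ (Fin d) (placeAt R d i j G.g) =
      tensorPermMatrix (Fin d) G.I L (Equiv.swap i j) := by
  ext f f'
  rw [g, map_sum, map_sum, Matrix.sum_apply, tensorPermMatrix_apply]
  have h1 : ∀ k, psiPow G.ψ (Fin d) (placeAt R d i j (G.a k ⊗ₜ G.b k)) f f' =
      (G.ψ (G.a k) (f i) (f' i) * G.ψ (G.b k) (f j) (f' j)) *
        ∏ t ∈ (Finset.univ.erase i).erase j, if f t = f' t then 1 else 0 := by
    intro k
    rw [placeAt_tmul i j h, psiPow_tprod, Finset.prod_eq_mul_mul_prod_erase h, mul_assoc]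
    congr 1
    · simp
    · congr 1
      · simp [h.symm]
      · refine Finset.prod_congr rfl fun t ht => ?_
        simp only [Finset.mem_erase, Finset.mem_univ, and_true] at ht
        rw [Function.update_of_ne ht.2, Function.update_of_ne ht.1, Pi.one_apply, map_one,
          Matrix.one_apply]
  rw [Finset.sum_congr rfl fun k _ => h1 k, ← Finset.sum_mul, G.entries, Finset.prod_ite_zero,
    Finset.prod_const_one, ite_one_zero_mul_ite]
  have key : ((f' i = f j ∧ f i = f' j) ∧ ∀ t ∈ (Finset.univ.erase i).erase j, f t = f' t) ↔
      f' = f ∘ Equiv.swap i j := ?_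
  · by_cases hf : f' = f ∘ Equiv.swap i j
    · rw [if_pos hf, if_pos (key.mpr hf)]
    · rw [if_neg hf, if_neg fun h' => hf (key.mp h')]
  constructor
  · rintro ⟨⟨h2, h3⟩, h4⟩
    funext t
    rcases eq_or_ne t i with rfl | hi
    · simp [h2]
    · rcases eq_or_ne t j with rfl | hj
      · simp [h3]
      · rw [Function.comp_apply, Equiv.swap_apply_of_ne_of_ne hi hj]
        exact (h4 t (by simp [hi, hj])).symm
  · rintro rfl
    refine ⟨⟨by simp, by simp⟩, fun t ht => ?_⟩
    simp only [Finset.mem_erase, Finset.mem_univ, and_true] at ht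
    rw [Function.comp_apply, Equiv.swap_apply_of_ne_of_ne ht.2 ht.1]

theorem psiPow_injective (hK : Function.Injective (algebraMap K L)) (d : ℕ) :
    Function.Injective (psiPow G.ψ (Fin d)) :=
  (G.pow (Fin d)).ψ_injective hK

theorem exists_gamma (hK : Function.Injective (algebraMap K L)) (d : ℕ) :
    ∃ γ : Equiv.Perm (Fin d) →* (⨂[K] (_ : Fin d), R),
      ∀ π, psiPow G.ψ (Fin d) (γ π) = tensorPermMatrix (Fin d) G.I L π := by
  have hinj := G.psiPow_injective hK d
  have h : ∀ π, ∃ z, psiPow G.ψ (Fin d) z = tensorPermMatrix (Fin d) G.I L π := by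
    intro π
    refine Equiv.Perm.mem_of_adjacent
      ((MonoidHom.mrange (psiPow G.ψ (Fin d)).toMonoidHom).comap
        (tensorPermMatrix (Fin d) G.I L)) (fun i j hij => ?_) π
    exact ⟨_, G.psiPow_placeAt i j (by rintro rfl; omega)⟩
  choose γ hγ using h
  exact ⟨⟨⟨γ, hinj (by rw [hγ, map_one, map_one])⟩, fun π π' => hinj (by
    change psiPow G.ψ (Fin d) (γ _) = psiPow G.ψ (Fin d) (γ _ * γ _)
    rw [hγ, map_mul, map_mul, hγ, hγ])⟩, hγ⟩

/-- The Goldman representation `𝔖_d → (R^{⊗ d})ˣ`. -/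
def gamma (hK : Function.Injective (algebraMap K L)) (d : ℕ) :
    Equiv.Perm (Fin d) →* (⨂[K] (_ : Fin d), R) :=
  (G.exists_gamma hK d).choose

theorem psiPow_gamma (hK : Function.Injective (algebraMap K L)) (d : ℕ)
    (π : Equiv.Perm (Fin d)) :
    psiPow G.ψ (Fin d) (G.gamma hK d π) = tensorPermMatrix (Fin d) G.I L π :=
  (G.exists_gamma hK d).choose_spec π

theorem gamma_swap (hK : Function.Injective (algebraMap K L)) {d : ℕ} {i j : Fin d} (h : i ≠ j) :
    G.gamma hK d (Equiv.swap i j) = placeAt R d i j G.g :=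
  G.psiPow_injective hK d (by rw [psiPow_gamma, psiPow_placeAt _ _ _ h])

theorem psiPow_mulEquiv {p q : ℕ} (x : ⨂[K] (_ : Fin p), R) (y : ⨂[K] (_ : Fin q), R)
    (f h : Fin (p + q) → G.I) :
    psiPow G.ψ (Fin (p + q)) (TensorPower.mulEquiv (x ⊗ₜ[K] y)) f h =
      psiPow G.ψ (Fin p) x (f ∘ Fin.castAdd q) (h ∘ Fin.castAdd q) *
        psiPow G.ψ (Fin q) y (f ∘ Fin.natAdd p) (h ∘ Fin.natAdd p) := by
  induction x using PiTensorProduct.induction_on with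
  | smul_tprod r x =>
    induction y using PiTensorProduct.induction_on with
    | smul_tprod s y =>
      have h1 : TensorPower.mulEquiv (PiTensorProduct.tprod K x ⊗ₜ[K] PiTensorProduct.tprod K y) =
          PiTensorProduct.tprod K (Fin.append x y) := TensorPower.tprod_mul_tprod K x y
      have h2 : TensorPower.mulEquiv ((r • PiTensorProduct.tprod K x) ⊗ₜ[K]
          (s • PiTensorProduct.tprod K y)) = (r * s) • PiTensorProduct.tprod K (Fin.append x y) := by
        rw [TensorProduct.smul_tmul_smul, map_smul, h1]
      rw [h2, map_smul, map_smul, map_smul, mul_smul]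
      simp only [Matrix.smul_apply, psiPow_tprod, Fin.prod_univ_add, Fin.append_left,
        Fin.append_right, Function.comp_apply, smul_mul_assoc, mul_smul_comm]
      exact smul_comm _ _ _
    | add y y' hy hy' =>
      rw [TensorProduct.tmul_add]
      simp only [map_add, Matrix.add_apply, hy, hy', mul_add]
  | add x x' hx hx' =>
    rw [TensorProduct.add_tmul]
    simp only [map_add, Matrix.add_apply, hx, hx', add_mul]

/-- The Goldman element is determined by its sandwich action, hence by the reduced trace. -/
theorem goldman_unique (hK : Function.Injective (algebraMap K L)) {g' : R ⊗[K] R}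
    (h : ∀ x : R, AlgHom.mulLeftRight K R
      (TensorProduct.map LinearMap.id (MulOpposite.opLinearEquiv K).toLinearMap g') x =
        algebraMap K R (G.t x)) : g' = G.g := by
  -- applying the sandwich by `z` to the first factor of the Goldman element `g` gives `z * g`
  have key : ∀ z : R ⊗[K] R, ∑ k, (AlgHom.mulLeftRight K R
      (TensorProduct.map LinearMap.id (MulOpposite.opLinearEquiv K).toLinearMap z) (G.a k)) ⊗ₜ[K]
        G.b k = z * G.g := by
    intro z
    induction z using TensorProduct.induction_on with
    | zero => simp
    | tmul x y =>
      have h1 := congrArg (fun w => (x ⊗ₜ[K] (1 : R)) * w) (G.casimir hK y)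
      simp only [Finset.mul_sum, Algebra.TensorProduct.tmul_mul_tmul, one_mul, ← mul_assoc] at h1
      simp only [g, Finset.mul_sum, Algebra.TensorProduct.tmul_mul_tmul]
      refine Eq.trans (Finset.sum_congr rfl fun k _ => ?_) h1
      simp [AlgHom.mulLeftRight_apply]
    | add z w hz hw =>
      simp only [map_add, LinearMap.add_apply, TensorProduct.add_tmul, Finset.sum_add_distrib,
        hz, hw, add_mul]
  have h1 : ∑ k, (algebraMap K R (G.t (G.a k))) ⊗ₜ[K] G.b k = 1 := by
    have h2 := G.frob 1
    simp only [one_mul] at h2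
    simp only [Algebra.algebraMap_eq_smul_one, TensorProduct.smul_tmul]
    rw [← TensorProduct.tmul_sum, h2]
    rfl
  have hg' : g' * G.g = 1 := by rw [← key, ← h1]; simp only [h]
  have hg : G.g * G.g = 1 := by
    rw [← key, ← h1]
    refine Finset.sum_congr rfl fun k _ => ?_
    rw [← G.sandwich hK, g]
    simp [AlgHom.mulLeftRight_apply]
  calc g' = g' * (G.g * G.g) := by rw [hg, mul_one]
    _ = G.g := by rw [← mul_assoc, hg', one_mul]

end GoldmanAlg

/-! ### The reduced trace of an Azumaya algebra -/

section Azumaya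

theorem TensorProduct.exists_fin_sum_tmul {K M N : Type u} [CommRing K] [AddCommGroup M] [Module K M]
    [AddCommGroup N] [Module K N] (z : M ⊗[K] N) :
    ∃ (n : ℕ) (a : Fin n → M) (b : Fin n → N), z = ∑ i, a i ⊗ₜ[K] b i := by
  induction z using TensorProduct.induction_on with
  | zero => exact ⟨0, fun _ => 0, fun _ => 0, by simp⟩
  | tmul x y => exact ⟨1, fun _ => x, fun _ => y, by simp⟩
  | add z w hz hw =>
    obtain ⟨n, a, b, rfl⟩ := hz
    obtain ⟨m, c, e, rfl⟩ := hw
    exact ⟨n + m, Fin.append a c, Fin.append b e, by simp [Fin.sum_univ_add]⟩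

variable {K A : Type u} [CommRing K] [Ring A] [Algebra K A]

/-- In an Azumaya algebra, every functional is a finite sum of two-sided multiplications. -/
theorem IsAzumaya.exists_sandwich [IsAzumaya K A] (f : A →ₗ[K] K) :
    ∃ (n : ℕ) (a b : Fin n → A), ∀ x, ∑ i, a i * x * b i = algebraMap K A (f x) := by
  obtain ⟨z, hz⟩ := (IsAzumaya.bij (R := K) (A := A)).2 ((Algebra.linearMap K A) ∘ₗ f)
  obtain ⟨n, a, b, rfl⟩ := TensorProduct.exists_fin_sum_tmul z
  refine ⟨n, a, fun i => (b i).unop, fun x => ?_⟩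
  have h := LinearMap.congr_fun hz x
  rw [map_sum, LinearMap.sum_apply] at h
  simpa using h

/-- The base change of an Azumaya algebra to a field is simple. Since every linear functional on `A`
is a sandwich `x ↦ ∑ a i * x * b i`, a two-sided ideal contains the coordinates of its elements. -/
theorem IsAzumaya.isSimpleRing_baseChange [IsArtinianRing K] [IsReduced K] [IsAzumaya K A]
    (E : Type u) [Field E] [Algebra K E] : IsSimpleRing (E ⊗[K] A) := by
  have := IsArtinianRing.isSemisimpleRing_of_isReduced K
  have : Module.Projective K E := Module.projective_of_isSemisimpleRing _ _
  have hnt : Nontrivial (E ⊗[K] A) :=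
    (Algebra.TensorProduct.includeLeft_injective (R := K) (S := K) (A := E) (B := A)
      (FaithfulSMul.algebraMap_injective K A)).nontrivial
  refine ⟨{ exists_pair_ne := ⟨⊥, ⊤, bot_ne_top⟩, eq_bot_or_eq_top := fun I => ?_ }⟩
  obtain ⟨n, p, q, -, -, hpq⟩ := Module.Finite.exists_comp_eq_id_of_projective K A
  rw [or_iff_not_imp_left]
  intro hI
  -- the coordinate functionals of `A`
  let f : Fin n → A →ₗ[K] K := fun j => LinearMap.proj j ∘ₗ q
  let e : Fin n → A := fun j => p (Pi.single j 1)
  have hfe : ∀ x, ∑ j, f j x • e j = x := by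
    intro x
    have h := LinearMap.congr_fun hpq x
    rw [LinearMap.comp_apply, LinearMap.id_apply] at h
    conv_rhs => rw [← h, pi_eq_sum_univ' (q x), map_sum]
    refine Finset.sum_congr rfl fun j _ => ?_
    rw [map_smul]
    congr 1
  -- every element of the base change is a combination of `1 ⊗ e j` with its coordinates
  have hfe' : ∀ z : E ⊗[K] A, ∑ j, TensorProduct.rid K E ((f j).lTensor E z) • (1 : E) ⊗ₜ[K] e j = z := by
    intro z
    induction z using TensorProduct.induction_on with
    | zero => simp
    | tmul c x =>
      conv_rhs => rw [← hfe x, TensorProduct.tmul_sum]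
      refine Finset.sum_congr rfl fun j _ => ?_
      rw [LinearMap.lTensor_tmul, TensorProduct.rid_tmul, TensorProduct.smul_tmul', smul_eq_mul,
        mul_one, TensorProduct.smul_tmul]
    | add z w hz hw =>
      conv_rhs => rw [← hz, ← hw]
      simp only [map_add, add_smul, Finset.sum_add_distrib]
  -- the coordinates of an element of the ideal are obtained by sandwiching
  have hmem : ∀ z ∈ I, ∀ j, TensorProduct.rid K E ((f j).lTensor E z) • (1 : E ⊗[K] A) ∈ I := by
    intro z hz j
    obtain ⟨m, a, b, hab⟩ := IsAzumaya.exists_sandwich (f j)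
    have h : ∀ z : E ⊗[K] A, ∑ i, (1 : E) ⊗ₜ[K] a i * z * (1 : E) ⊗ₜ[K] b i =
        TensorProduct.rid K E ((f j).lTensor E z) • (1 : E ⊗[K] A) := by
      intro z
      induction z using TensorProduct.induction_on with
      | zero => simp
      | tmul c x =>
        simp only [Algebra.TensorProduct.tmul_mul_tmul, one_mul, mul_one]
        rw [← TensorProduct.tmul_sum, hab, LinearMap.lTensor_tmul, TensorProduct.rid_tmul,
          Algebra.algebraMap_eq_smul_one, Algebra.TensorProduct.one_def, TensorProduct.smul_tmul',
          smul_eq_mul, mul_one, TensorProduct.smul_tmul]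
      | add z w hz hw =>
        simp only [mul_add, add_mul, Finset.sum_add_distrib, hz, hw, map_add, add_smul]
    rw [← h]
    exact sum_mem fun i _ => I.mul_mem_right _ _ (I.mul_mem_left _ _ hz)
  have hne : ∃ z ∈ I, z ≠ 0 := by
    by_contra! h
    exact hI (le_bot_iff.mp fun z hz => by rw [h z hz]; exact zero_mem _)
  obtain ⟨z, hz, hz0⟩ := hne
  have : ∃ j, TensorProduct.rid K E ((f j).lTensor E z) ≠ 0 := by
    by_contra! h
    apply hz0
    rw [← hfe' z]
    simp [h]
  obtain ⟨j, hj⟩ := this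
  have h1 := I.mul_mem_left ((TensorProduct.rid K E ((f j).lTensor E z))⁻¹ • 1) _ (hmem z hz j)
  rw [smul_mul_smul_comm, inv_mul_cancel₀ hj, one_mul, one_smul] at h1
  exact I.one_mem_iff.mp h1

variable [IsArtinianRing K] [IsReduced K] [IsAzumaya K A]

theorem IsAzumaya.exists_split (E : Type u) [Field E] [Algebra K E] [IsAlgClosed E] :
    ∃ (n : ℕ) (_ : NeZero n), Nonempty (E ⊗[K] A ≃ₐ[E] Matrix (Fin n) (Fin n) E) := by
  have := IsAzumaya.isSimpleRing_baseChange (K := K) (A := A) E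
  exact IsSimpleRing.exists_algEquiv_matrix_of_isAlgClosed E _

/-- A homomorphism from an Azumaya algebra to matrices over a field whose image spans is a
splitting. -/
theorem IsAzumaya.matrixLift_bijective {E : Type u} [Field E] [Algebra K E] {I : Type} [Fintype I]
    [DecidableEq I] [Nonempty I] (ψ : A →ₐ[K] Matrix I I E)
    (h : Submodule.span E (Set.range ψ) = ⊤) : Function.Bijective (matrixLift ψ) := by
  have := IsAzumaya.isSimpleRing_baseChange (K := K) (A := A) E
  refine ⟨RingHom.injective (matrixLift ψ).toRingHom, ?_⟩
  change Function.Surjective (matrixLift ψ).toLinearMap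
  rw [← LinearMap.range_eq_top, eq_top_iff, ← h, Submodule.span_le]
  rintro _ ⟨a, rfl⟩
  exact ⟨1 ⊗ₜ a, by rw [AlgHom.toLinearMap_apply, matrixLift_tmul, one_smul]⟩

omit [IsArtinianRing K] [IsReduced K] [IsAzumaya K A] in
theorem span_splitting {E : Type u} [Field E] [Algebra K E] {I : Type} [Fintype I]
    [DecidableEq I] (φ : E ⊗[K] A ≃ₐ[E] Matrix I I E) :
    Submodule.span E (Set.range fun a : A => φ (1 ⊗ₜ a)) = ⊤ := by
  rw [eq_top_iff]
  intro Z _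
  obtain ⟨z, rfl⟩ := φ.surjective Z
  induction z using TensorProduct.induction_on with
  | zero => rw [map_zero]; exact zero_mem _
  | tmul c x =>
    have h : c ⊗ₜ[K] x = c • (1 : E) ⊗ₜ[K] x := by
      rw [TensorProduct.smul_tmul', smul_eq_mul, mul_one]
    rw [h, map_smul]
    exact Submodule.smul_mem _ _ (Submodule.subset_span ⟨x, rfl⟩)
  | add x y hx hy => rw [map_add]; exact add_mem (hx trivial) (hy trivial)

/-- Trace-like functionals on matrices are multiples of the trace. -/
theorem Matrix.exists_eq_smul_trace {E I : Type*} [Field E] [Fintype I] [DecidableEq I] [Nonempty I]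
    (Λ : Matrix I I E →ₗ[E] E) (h : ∀ X Y, Λ (X * Y) = Λ (Y * X)) : ∃ c, ∀ X, Λ X = c * X.trace := by
  obtain ⟨i₀⟩ := ‹Nonempty I›
  refine ⟨Λ (Matrix.single i₀ i₀ 1), fun X => ?_⟩
  have h1 : ∀ i j, Λ (Matrix.single i j 1) = if i = j then Λ (Matrix.single i₀ i₀ 1) else 0 := by
    intro i j
    split_ifs with hij
    · subst hij
      have := h (Matrix.single i i₀ 1) (Matrix.single i₀ i 1)
      simpa using this
    · have := h (Matrix.single i j 1) (Matrix.single j j 1)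
      rw [Matrix.single_mul_single_same, Matrix.single_mul_single_of_ne _ _ _ _ (Ne.symm hij)] at this
      simpa using this
  conv_lhs => rw [Matrix.matrix_eq_sum_single X]
  have h2 : ∀ i j, Λ (Matrix.single i j (X i j)) =
      X i j * if i = j then Λ (Matrix.single i₀ i₀ 1) else 0 := by
    intro i j
    rw [← h1, ← smul_eq_mul, ← map_smul, Matrix.smul_single, smul_eq_mul, mul_one]
  simp only [map_sum, h2, mul_ite, mul_zero, Finset.sum_ite_eq, Finset.mem_univ, if_true]
  rw [← Finset.sum_mul, mul_comm]
  rfl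

omit [IsArtinianRing K] [IsReduced K] [IsAzumaya K A] in
/-- Matrices whose sandwiches are multiples of the trace have the entries of the flip. -/
theorem Matrix.entries_of_sandwich {E I κ : Type*} [CommRing E] [Fintype I] [DecidableEq I]
    [Fintype κ] (c : E) (a b : κ → Matrix I I E)
    (h : ∀ X : Matrix I I E, ∑ k, a k * X * b k = (c * X.trace) • 1) (i j p q : I) :
    ∑ k, a k i j * b k p q = if j = p ∧ i = q then c else 0 := by
  have h1 := congrFun (congrFun (h (Matrix.single j p (1 : E))) i) q
  rw [Matrix.sum_apply] at h1
  have h3 : ∀ k, (a k * Matrix.single j p (1 : E) * b k : Matrix I I E) i q = a k i j * b k p q := by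
    intro k
    rw [Matrix.mul_apply, Finset.sum_eq_single p]
    · rw [Matrix.mul_single_apply_same, mul_one]
    · intro l _ hl
      rw [Matrix.mul_single_apply_of_ne _ _ _ _ _ hl, zero_mul]
    · intro h; exact absurd (Finset.mem_univ _) h
  rw [Finset.sum_congr rfl fun k _ => h3 k] at h1
  rw [h1, Matrix.smul_apply, Matrix.one_apply]
  by_cases hjp : j = p
  · subst hjp
    simp
  · rw [Matrix.trace_single_eq_of_ne _ _ _ hjp]
    simp [hjp]

/-- The trace of a splitting over the algebraic closure of a residue field is rational: up to a
scalar `c`, it is rational because trace forms on a matrix algebra are unique; the square of `c` is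
rational because the trace form is realized by two-sided multiplications, and `c` is rational
because the trace is invariant under automorphisms of the algebraic closure. -/
theorem IsAzumaya.exists_rational_trace {k' F : Type u} [Field k'] [Field F] [Algebra k' F]
    [IsAlgClosure k' F] [Algebra K k'] [Algebra K F] [IsScalarTower K k' F]
    (hsurj : Function.Surjective (algebraMap K k')) (h2 : (2 : k') ≠ 0) {n : ℕ} [NeZero n]
    (φ : F ⊗[K] A ≃ₐ[F] Matrix (Fin n) (Fin n) F) :
    ∃ t : A →ₗ[K] k', ∀ a, (φ (1 ⊗ₜ a)).trace = algebraMap k' F (t a) := by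
  have : Algebra.IsAlgebraic k' F := IsAlgClosure.isAlgebraic
  have : IsAlgClosed F := IsAlgClosure.isAlgClosed k'
  let ψ : A →ₐ[K] Matrix (Fin n) (Fin n) F :=
    (φ.toAlgHom.restrictScalars K).comp Algebra.TensorProduct.includeRight
  have hψ : ∀ a, φ (1 ⊗ₜ a) = ψ a := fun a => rfl
  have hspan : Submodule.span F (Set.range ψ) = ⊤ := span_splitting φ
  by_cases h0 : ∀ a, (ψ a).trace = 0
  · exact ⟨0, fun a => by simp [hψ, h0]⟩
  push Not at h0
  obtain ⟨a₀, ha₀⟩ := h0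
  obtain ⟨ℓ, hℓ⟩ : ∃ ℓ : F →ₗ[k'] k', ℓ (ψ a₀).trace = 1 := by
    have h := mt (Module.forall_dual_apply_eq_zero_iff k' (ψ a₀).trace).mp ha₀
    push Not at h
    obtain ⟨f, hf⟩ := h
    exact ⟨(f (ψ a₀).trace)⁻¹ • f, by rw [LinearMap.smul_apply, smul_eq_mul, inv_mul_cancel₀ hf]⟩
  -- the rational functional `ℓ (tr ψ)` is a multiple of the trace
  let t₁ : A →ₗ[K] k' := (ℓ.restrictScalars K) ∘ₗ
    ((Matrix.traceLinearMap (Fin n) F F).restrictScalars K) ∘ₗ ψ.toLinearMap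
  have ht₁ : ∀ a, t₁ a = ℓ (ψ a).trace := fun a => rfl
  obtain ⟨c, hc⟩ : ∃ c : F, ∀ a, algebraMap k' F (t₁ a) = c * (ψ a).trace := by
    let Λ : Matrix (Fin n) (Fin n) F →ₗ[F] F :=
      (((IsScalarTower.toAlgHom K k' F).toLinearMap ∘ₗ t₁).liftBaseChange F) ∘ₗ
        φ.symm.toLinearEquiv.toLinearMap
    have hΛ : ∀ a, Λ (ψ a) = algebraMap k' F (t₁ a) := by
      intro a
      change ((IsScalarTower.toAlgHom K k' F).toLinearMap ∘ₗ t₁).liftBaseChange F (φ.symm (φ (1 ⊗ₜ a))) = _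
      rw [AlgEquiv.symm_apply_apply, LinearMap.liftBaseChange_tmul, one_smul]
      rfl
    have hcomm : ∀ X Y, Λ (X * Y) = Λ (Y * X) := by
      intro X Y
      have hX : X ∈ Submodule.span F (Set.range ψ) := by rw [hspan]; trivial
      have hY : Y ∈ Submodule.span F (Set.range ψ) := by rw [hspan]; trivial
      induction hX using Submodule.span_induction with
      | zero => simp
      | add x y _ _ hx hy => rw [add_mul, mul_add, map_add, map_add, hx, hy]
      | smul r x _ hx => rw [smul_mul_assoc, mul_smul_comm, map_smul, map_smul, hx]
      | mem x hx =>
        obtain ⟨a, rfl⟩ := hx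
        induction hY using Submodule.span_induction with
        | zero => simp
        | add x y _ _ hx hy => rw [add_mul, mul_add, map_add, map_add, hx, hy]
        | smul r x _ hx => rw [smul_mul_assoc, mul_smul_comm, map_smul, map_smul, hx]
        | mem x hx =>
          obtain ⟨b, rfl⟩ := hx
          rw [← map_mul, ← map_mul, hΛ, hΛ, ht₁, ht₁, map_mul, map_mul, Matrix.trace_mul_comm]
    obtain ⟨c, hc⟩ := Matrix.exists_eq_smul_trace Λ hcomm
    exact ⟨c, fun a => by rw [← hc, hΛ]⟩
  have hc0 : c * (ψ a₀).trace = 1 := by rw [← hc, ht₁, hℓ, map_one]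
  -- the square of `c` is rational
  have hc2 : ∃ e : k', algebraMap k' F e = c ^ 2 := by
    obtain ⟨T, hT⟩ := Module.projective_lifting_property (Algebra.linearMap K k') t₁ hsurj
    have hT' : ∀ a, algebraMap K F (T a) = c * (ψ a).trace := by
      intro a
      rw [← hc, ← hT, IsScalarTower.algebraMap_apply K k' F]
      rfl
    obtain ⟨m, a, b, hab⟩ := IsAzumaya.exists_sandwich T
    have hsand : ∀ X, ∑ k, ψ (a k) * X * ψ (b k) = (c * X.trace) • 1 := by
      intro X
      have hX : X ∈ Submodule.span F (Set.range ψ) := by rw [hspan]; trivial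
      induction hX using Submodule.span_induction with
      | zero => simp
      | add x y _ _ hx hy =>
        simp only [mul_add, add_mul, Finset.sum_add_distrib, hx, hy, Matrix.trace_add, add_smul]
      | smul r x _ hx =>
        simp only [mul_smul_comm, smul_mul_assoc, ← Finset.smul_sum, hx, Matrix.trace_smul, smul_smul]
        congr 1
      | mem x hx =>
        obtain ⟨x, rfl⟩ := hx
        simp only [← map_mul, ← map_sum]
        rw [hab, AlgHom.commutes, ← hT', IsScalarTower.algebraMap_apply K F (Matrix _ _ F),
          Algebra.algebraMap_eq_smul_one]
    have hent := Matrix.entries_of_sandwich c (fun k => ψ (a k)) (fun k => ψ (b k)) hsand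
    -- contracting the entries of the flip `∑ a k ⊗ b k`, scaled by `c`, with the trace
    let z := ∑ k, T (a k) • b k
    have hz : ψ z = c ^ 2 • 1 := by
      ext p q
      rw [map_sum, Matrix.sum_apply]
      have h3 : ∀ k, ψ (T (a k) • b k) p q = ∑ i, c * (ψ (a k) i i * ψ (b k) p q) := by
        intro k
        rw [map_smul, Matrix.smul_apply, Algebra.smul_def, hT', Matrix.trace, Finset.mul_sum,
          Finset.sum_mul]
        exact Finset.sum_congr rfl fun i _ => mul_assoc _ _ _
      rw [Finset.sum_congr rfl fun k _ => h3 k, Finset.sum_comm]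
      simp only [← Finset.mul_sum, hent, Matrix.smul_apply, Matrix.one_apply]
      by_cases hpq : p = q
      · subst hpq
        simp [pow_two]
      · have : ∀ i, ¬ (i = p ∧ i = q) := fun i h => hpq (h.1.symm.trans h.2)
        simp [hpq, this]
    refine ⟨t₁ (z * a₀), ?_⟩
    rw [hc, map_mul, hz, smul_mul_assoc, one_mul, Matrix.trace_smul, smul_eq_mul, mul_left_comm,
      hc0, mul_one]
  obtain ⟨e, he⟩ := hc2
  have hcne : c ≠ 0 := left_ne_zero_of_mul_eq_one hc0
  have h2F : (2 : F) ≠ 0 := by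
    have := (map_ne_zero (algebraMap k' F)).mpr h2
    rwa [map_ofNat] at this
  -- `c` is rational
  have hcmem : c ∈ (⊥ : Subalgebra k' F) := by
    by_contra hcon
    have hint : IsIntegral k' c := Algebra.IsIntegral.isIntegral c
    -- `c` is a root of `X ^ 2 - e`, which is separable because `2` is invertible
    have hsep : IsSeparable k' c := by
      have hs : (Polynomial.X ^ 2 - Polynomial.C e).Separable := by
        refine Polynomial.separable_X_pow_sub_C e (by simpa using h2) ?_
        rintro rfl
        rw [map_zero] at he
        exact hcne (pow_eq_zero_iff two_ne_zero |>.mp he.symm)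
      refine hs.of_dvd (minpoly.dvd _ _ ?_)
      simp [he]
    obtain ⟨y, hy, hconj⟩ := (notMem_iff_exists_ne_and_isConjRoot hsep
      (IsAlgClosed.splits _)).mp hcon
    obtain ⟨σ, hσ⟩ := hconj.exists_algEquiv
    have hσc : σ c = -c := by
      have h3 : σ (y ^ 2) = σ (c ^ 2) := by
        rw [map_pow, hσ, ← he, σ.commutes]
      have h4 := σ.injective h3
      rcases sq_eq_sq_iff_eq_or_eq_neg.mp h4 with h5 | h5
      · exact absurd h5.symm hy
      · rw [h5, map_neg] at hσ
        exact neg_eq_iff_eq_neg.mp hσ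
    -- the conjugate splitting has the same trace, so that `σ` fixes both `c * tr` and `tr`
    let ψ' : A →ₐ[K] Matrix (Fin n) (Fin n) F := ((σ.toAlgHom.restrictScalars K).mapMatrix).comp ψ
    have hψ' : ∀ a, ψ' a = (ψ a).map σ := fun a => rfl
    have hspan' : Submodule.span F (Set.range ψ') = ⊤ := by
      have key : ∀ Z : Matrix (Fin n) (Fin n) F, Z.map σ ∈ Submodule.span F (Set.range ψ') := by
        intro Z
        have hZ : Z ∈ Submodule.span F (Set.range ψ) := by rw [hspan]; trivial
        induction hZ using Submodule.span_induction with
        | zero => rw [Matrix.map_zero _ (map_zero _)]; exact zero_mem _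
        | add x y _ _ hx hy => rw [Matrix.map_add _ (map_add _)]; exact add_mem hx hy
        | smul r x _ hx =>
          have : (r • x).map σ = σ r • x.map σ := by ext; simp
          rw [this]
          exact Submodule.smul_mem _ _ hx
        | mem x hx =>
          obtain ⟨a, rfl⟩ := hx
          exact Submodule.subset_span ⟨a, rfl⟩
      rw [eq_top_iff]
      intro Z _
      have := key (Z.map σ.symm)
      rwa [Matrix.map_map, show (σ : F → F) ∘ σ.symm = _root_.id from funext fun x => by simp,
        Matrix.map_id] at this
    have htr := trace_eq_of_splitEquiv
      (AlgEquiv.ofBijective (matrixLift ψ') (IsAzumaya.matrixLift_bijective ψ' hspan')) φ (1 ⊗ₜ a₀)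
    rw [AlgEquiv.ofBijective_apply, matrixLift_tmul, one_smul, hψ, hψ'] at htr
    have htr' : σ (ψ a₀).trace = (ψ a₀).trace :=
      (AddMonoidHom.map_trace (σ : F →+* F).toAddMonoidHom _).trans htr
    have h6 := congrArg σ hc0
    rw [map_mul, hσc, htr', map_one, neg_mul, hc0] at h6
    exact h2F (by linear_combination -h6)
  obtain ⟨c', hc'⟩ := Algebra.mem_bot.mp hcmem
  refine ⟨c'⁻¹ • t₁, fun a => ?_⟩
  rw [hψ, LinearMap.smul_apply, smul_eq_mul, map_mul, hc, map_inv₀, hc', inv_mul_cancel_left₀ hcne]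

end Azumaya

section AzumayaTrace

variable {K A : Type u} [CommRing K] [Ring A] [Algebra K A] [IsArtinianRing K] [IsReduced K]
  [IsAzumaya K A]

/-- The reduced trace of an Azumaya algebra, as a functional that becomes the trace of matrices in
every splitting over a field. -/
theorem IsAzumaya.exists_trace (h2 : IsUnit (2 : K)) : ∃ t : A →ₗ[K] K,
    ∀ (E : Type u) [Field E] [Algebra K E] (I : Type) [Fintype I] [DecidableEq I]
      (φ : E ⊗[K] A ≃ₐ[E] Matrix I I E) (a : A), (φ (1 ⊗ₜ a)).trace = algebraMap K E (t a) := by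
  have key : ∀ m : MaximalSpectrum K, ∃ t : A →ₗ[K] K ⧸ m.1,
      ∀ (E : Type u) [Field E] [Algebra K E] (hE : RingHom.ker (algebraMap K E) = m.1)
        (I : Type) [Fintype I] [DecidableEq I] (φ : E ⊗[K] A ≃ₐ[E] Matrix I I E) (a : A) (c : K),
          Ideal.Quotient.mk m.1 c = t a → (φ (1 ⊗ₜ a)).trace = algebraMap K E c := by
    intro m
    have := m.2
    let : Field (K ⧸ m.1) := Ideal.Quotient.field _
    obtain ⟨n, _, ⟨φ₀⟩⟩ := IsAzumaya.exists_split (K := K) (A := A) (AlgebraicClosure (K ⧸ m.1))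
    have h2' : (2 : K ⧸ m.1) ≠ 0 := by
      have := (h2.map (Ideal.Quotient.mk m.1)).ne_zero
      rwa [map_ofNat] at this
    obtain ⟨t, ht⟩ := IsAzumaya.exists_rational_trace (k' := K ⧸ m.1)
      (F := AlgebraicClosure (K ⧸ m.1)) Ideal.Quotient.mk_surjective h2' φ₀
    refine ⟨t, fun E _ _ hE I _ _ φ a c hc => ?_⟩
    -- compare both splittings over an algebraic closure of `E`
    let : Algebra (K ⧸ m.1) (AlgebraicClosure E) :=
      (Ideal.Quotient.lift m.1 (algebraMap K (AlgebraicClosure E)) fun x hx => by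
        rw [IsScalarTower.algebraMap_apply K E, show algebraMap K E x = 0 from by
          rw [← RingHom.mem_ker, hE]; exact hx, map_zero]).toAlgebra
    have : IsScalarTower K (K ⧸ m.1) (AlgebraicClosure E) :=
      IsScalarTower.of_algebraMap_eq fun x => rfl
    let : Algebra (AlgebraicClosure (K ⧸ m.1)) (AlgebraicClosure E) :=
      (IsAlgClosed.lift (R := K ⧸ m.1) (S := AlgebraicClosure (K ⧸ m.1))
        (M := AlgebraicClosure E)).toRingHom.toAlgebra
    have : IsScalarTower (K ⧸ m.1) (AlgebraicClosure (K ⧸ m.1)) (AlgebraicClosure E) :=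
      IsScalarTower.of_algebraMap_eq fun x =>
        ((IsAlgClosed.lift (R := K ⧸ m.1) (S := AlgebraicClosure (K ⧸ m.1))
          (M := AlgebraicClosure E)).commutes x).symm
    have : IsScalarTower K (AlgebraicClosure (K ⧸ m.1)) (AlgebraicClosure E) :=
      IsScalarTower.of_algebraMap_eq fun x => by
        rw [IsScalarTower.algebraMap_apply K (K ⧸ m.1) (AlgebraicClosure (K ⧸ m.1)),
          ← IsScalarTower.algebraMap_apply (K ⧸ m.1) (AlgebraicClosure (K ⧸ m.1)),
          ← IsScalarTower.algebraMap_apply]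
    obtain ⟨φ₁, h₁⟩ := exists_splitEquiv_baseChange (E := AlgebraicClosure E) φ₀
    obtain ⟨φ₂, h₂⟩ := exists_splitEquiv_baseChange (E := AlgebraicClosure E) φ
    have h := trace_eq_of_splitEquiv φ₁ φ₂ (1 ⊗ₜ a)
    rw [h₁, h₂, ht, ← IsScalarTower.algebraMap_apply, ← hc] at h
    apply (algebraMap E (AlgebraicClosure E)).injective
    rw [← h, ← IsScalarTower.algebraMap_apply]
    exact (IsScalarTower.algebraMap_apply K (K ⧸ m.1) (AlgebraicClosure E) c).symm
  -- the reduced ring `K` is the product of its residue fields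
  choose t ht using key
  refine ⟨(IsArtinianRing.equivPi K).symm.toLinearMap ∘ₗ LinearMap.pi t,
    fun E _ _ I _ _ φ a => ?_⟩
  have : (RingHom.ker (algebraMap K E)).IsPrime := RingHom.ker_isPrime _
  have hmax : (RingHom.ker (algebraMap K E)).IsMaximal :=
    IsArtinianRing.isMaximal_of_isPrime _
  refine ht ⟨_, hmax⟩ E rfl I φ a _ ?_
  have h := congrFun ((IsArtinianRing.equivPi K).apply_symm_apply (LinearMap.pi t a)) ⟨_, hmax⟩
  exact h

/-- An element of a projective module vanishes if it vanishes over all residue fields. -/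
theorem eq_zero_of_forall_residue {M : Type u} [AddCommGroup M] [Module K M] [Module.Projective K M]
    [Module.Finite K M] {x : M}
    (h : ∀ (E : Type u) [Field E] [Algebra K E] [IsAlgClosed E], (1 : E) ⊗ₜ[K] x = 0) : x = 0 := by
  obtain ⟨n, p, q, -, -, hpq⟩ := Module.Finite.exists_comp_eq_id_of_projective K M
  have hq : q x = 0 := by
    funext j
    apply (IsArtinianRing.equivPi K).injective
    funext m
    have := m.2
    let : Field (K ⧸ m.1) := Ideal.Quotient.field _
    have h1 := congrArg (TensorProduct.rid K _ ∘ (LinearMap.proj j ∘ₗ q).lTensor _)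
      (h (AlgebraicClosure (K ⧸ m.1)))
    simp only [Function.comp_apply, LinearMap.lTensor_tmul, TensorProduct.rid_tmul, map_zero] at h1
    rw [← Algebra.algebraMap_eq_smul_one, IsScalarTower.algebraMap_apply K (K ⧸ m.1)] at h1
    change _ = IsArtinianRing.equivPi K 0 m
    rw [map_zero]
    exact (map_eq_zero (algebraMap (K ⧸ m.1) (AlgebraicClosure (K ⧸ m.1)))).mp h1
  have h2 := LinearMap.congr_fun hpq x
  rw [LinearMap.comp_apply, hq, map_zero] at h2
  exact h2.symm

end AzumayaTrace

/-! ### The base ring with involution -/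

/-- The properties of the base `(K, ι)`: fixed elements vanish or are invertible, `2` is
invertible, and nondegenerate sesquilinear forms are perfect. -/
class InvBase {K : Type u} [CommRing K] (ι : K →+* K) : Prop where
  inv : ∀ x, ι (ι x) = x
  fix : ∀ x, ι x = x → x = 0 ∨ IsUnit x
  two : IsUnit (2 : K)
  perfect : ∀ (V : Type u) [AddCommGroup V] [Module K V] [Module.Finite K V]
    (b : V →ₛₗ[ι] V →ₗ[K] K), (∀ x, (∀ y, b x y = 0) → x = 0) → ∀ f : V →ₗ[K] K, ∃ x, b x = f

section Pt

variable {K : Type u} [CommRing K] [Nontrivial K]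

/-- A maximal ideal of `K`. -/
def maxIdeal (K : Type u) [CommRing K] [Nontrivial K] : Ideal K := (Ideal.exists_maximal K).choose

instance : (maxIdeal K).IsMaximal := (Ideal.exists_maximal K).choose_spec

instance : Field (K ⧸ maxIdeal K) := Ideal.Quotient.field _

/-- A geometric residue field of `K`. -/
def Geom (K : Type u) [CommRing K] [Nontrivial K] : Type u := AlgebraicClosure (K ⧸ maxIdeal K)

instance : Field (Geom K) := inferInstanceAs (Field (AlgebraicClosure (K ⧸ maxIdeal K)))

instance : Algebra K (Geom K) :=
  inferInstanceAs (Algebra K (AlgebraicClosure (K ⧸ maxIdeal K)))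

instance : IsAlgClosed (Geom K) :=
  inferInstanceAs (IsAlgClosed (AlgebraicClosure (K ⧸ maxIdeal K)))

/-- The split extension `F × F` of `K`, for a geometric residue field `q : K → F`, in which `K` is
embedded by `(q, q ∘ ι)`. -/
def Pt (_ι : K →+* K) : Type u := Geom K × Geom K

variable (ι : K →+* K)

instance : CommRing (Pt ι) := inferInstanceAs (CommRing (Geom K × Geom K))

instance : Algebra K (Pt ι) :=
  ((algebraMap K (Geom K)).prod ((algebraMap K (Geom K)).comp ι)).toAlgebra

theorem Pt.algebraMap_apply (c : K) :
    algebraMap K (Pt ι) c = (algebraMap K (Geom K) c, algebraMap K (Geom K) (ι c)) := rfl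

/-- The first projection. -/
def Pt.fst : Pt ι →+* Geom K := RingHom.fst (Geom K) (Geom K)

/-- The second projection. -/
def Pt.snd : Pt ι →+* Geom K := RingHom.snd (Geom K) (Geom K)

/-- The exchange of the factors. -/
def Pt.swap : Pt ι →+* Pt ι := (Pt.snd ι).prod (Pt.fst ι)

theorem Pt.swap_swap (x : Pt ι) : Pt.swap ι (Pt.swap ι x) = x := rfl

theorem maxIdeal_eq_ker : maxIdeal K = RingHom.ker (algebraMap K (Geom K)) := by
  refine Ideal.IsMaximal.eq_of_le inferInstance (RingHom.ker_ne_top _) fun x hx => ?_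
  rw [RingHom.mem_ker]
  change algebraMap K (AlgebraicClosure (K ⧸ maxIdeal K)) x = 0
  rw [IsScalarTower.algebraMap_apply K (K ⧸ maxIdeal K),
    Ideal.Quotient.algebraMap_eq, Ideal.Quotient.eq_zero_iff_mem.mpr hx, map_zero]

variable [IsReduced K] [InvBase ι]

theorem Pt.swap_algebraMap (c : K) :
    Pt.swap ι (algebraMap K (Pt ι) c) = algebraMap K (Pt ι) (ι c) := by
  rw [Pt.algebraMap_apply, Pt.algebraMap_apply, InvBase.inv]
  rfl

/-- The conjugates of a maximal ideal intersect trivially. -/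
theorem InvBase.eq_zero {P : Ideal K} (hP : P ≠ ⊤) {c : K} (h : c ∈ P) (h' : ι c ∈ P) : c = 0 := by
  have key : ∀ x ∈ P, ι x = x → x = 0 := fun x hx hx' =>
    (InvBase.fix x hx').resolve_right fun hu => hP (Ideal.eq_top_of_isUnit_mem P hx hu)
  have h1 : c + ι c = 0 := key _ (P.add_mem h h') (by rw [map_add, InvBase.inv, add_comm])
  have h2 : c * ι c = 0 := key _ (P.mul_mem_right _ h) (by rw [map_mul, InvBase.inv, mul_comm])
  have h3 : ι c = -c := by linear_combination h1
  rw [h3] at h2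
  have : c ^ 2 = 0 := by linear_combination -h2
  exact pow_eq_zero_iff two_ne_zero |>.mp this

theorem Pt.injective : Function.Injective (algebraMap K (Pt ι)) := by
  rw [injective_iff_map_eq_zero]
  intro c hc
  rw [Pt.algebraMap_apply] at hc
  refine InvBase.eq_zero ι (P := maxIdeal K) (Ideal.IsMaximal.ne_top inferInstance) ?_ ?_
  · rw [maxIdeal_eq_ker]; exact congrArg Prod.fst hc
  · rw [maxIdeal_eq_ker]; exact congrArg Prod.snd hc

theorem InvBase.jacobson {K : Type u} [CommRing K] [Nontrivial K] [IsReduced K] (ι : K →+* K)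
    [InvBase ι] (c : K) (h : ∀ P : Ideal K, P.IsMaximal → c ∈ P) : c = 0 := by
  refine InvBase.eq_zero ι (P := maxIdeal K) (Ideal.IsMaximal.ne_top inferInstance)
    (h _ inferInstance) ?_
  have : ((maxIdeal K).comap ι).IsMaximal := Ideal.comap_isMaximal_of_surjective ι
    fun x => ⟨ι x, InvBase.inv x⟩
  exact h _ this

instance Pt.faithfullyFlat [IsArtinianRing K] : Module.FaithfullyFlat K (Pt ι) := by
  have := IsArtinianRing.isSemisimpleRing_of_isReduced K
  have : Module.Projective K (Pt ι) := Module.projective_of_isSemisimpleRing _ _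
  refine { submodule_ne_top := fun m hm htop => ?_ }
  have h1 : m.map (algebraMap K (Pt ι)) = ⊤ := by
    have h2 := Ideal.smul_top_eq_map (S := Pt ι) m
    rw [htop] at h2
    exact (Submodule.restrictScalars_eq_top_iff K _ _).mp h2.symm
  have h3 : maxIdeal K ⊓ (maxIdeal K).comap ι ≤ m := by
    intro c hc
    rw [Submodule.mem_inf] at hc
    rw [InvBase.eq_zero ι (P := maxIdeal K) (Ideal.IsMaximal.ne_top inferInstance) hc.1 hc.2]
    exact zero_mem _
  have hmax : ((maxIdeal K).comap ι).IsMaximal := Ideal.comap_isMaximal_of_surjective ι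
    fun x => ⟨ι x, InvBase.inv x⟩
  have hle : ∀ (f : Pt ι →+* Geom K), m ≤ RingHom.ker (f.comp (algebraMap K (Pt ι))) → False := by
    intro f hf
    have h4 : m.map (algebraMap K (Pt ι)) ≤ RingHom.ker f := by
      rw [Ideal.map_le_iff_le_comap]
      intro x hx
      exact hf hx
    rw [h1] at h4
    exact RingHom.ker_ne_top f (top_le_iff.mp h4)
  rcases hm.isPrime.inf_le.mp h3 with h | h
  · exact hle (Pt.fst ι) ((Ideal.IsMaximal.eq_of_le inferInstance hm.ne_top h).ge.trans
      (maxIdeal_eq_ker (K := K)).le)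
  · refine hle (Pt.snd ι) ((Ideal.IsMaximal.eq_of_le hmax hm.ne_top h).ge.trans fun x hx => ?_)
    rw [Ideal.mem_comap, maxIdeal_eq_ker] at hx
    exact hx

end Pt

/-! ### Azumaya algebras with involution are split by `F × F` -/

/-- A split algebra whose involution corresponds to the transpose, composed with the exchange of
the two factors of the splitting ring. -/
structure GoldmanInv {K : Type u} [CommRing K] [Nontrivial K] (ι : K →+* K) (R : Type u) [Ring R]
    [Algebra K R] (s : R → R) extends GoldmanAlg K (Pt ι) R where
  ψ_inv : ∀ x i j, ψ (s x) i j = Pt.swap ι (ψ x j i)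

section

variable {K : Type u} [CommRing K] [Nontrivial K] (ι : K →+* K)

/-- The field `E` with the structure of a `K`-algebra twisted by `ι`. -/
def TwistAlg (_ι : K →+* K) (E : Type u) : Type u := E

instance (E : Type u) [Field E] : Field (TwistAlg ι E) := inferInstanceAs (Field E)

instance (E : Type u) [Field E] [Algebra K E] : Algebra K (TwistAlg ι E) :=
  ((algebraMap K E).comp ι).toAlgebra

namespace AzumayaInv

variable {ι} (A : AzumayaInv ι)

theorem inv_one : A.inv 1 = 1 := by
  have h := A.inv_algebraMap 1
  rwa [map_one, map_one, map_one] at h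

theorem inv_zero : A.inv 0 = 0 := by
  have h := A.inv_algebraMap 0
  rwa [map_zero, map_zero, map_zero] at h

/-- The transpose of a homomorphism to matrices, composed with the involution. -/
def transposeHom {E : Type u} [Field E] [Algebra K E] {I : Type} [Fintype I] [DecidableEq I]
    (ψ : A.carrier →ₐ[K] Matrix I I E) : A.carrier →ₐ[K] Matrix I I (TwistAlg ι E) where
  toFun x := Matrix.transpose (ψ (A.inv x))
  map_one' := by rw [inv_one, map_one]; exact Matrix.transpose_one
  map_zero' := by rw [inv_zero, map_zero]; exact Matrix.transpose_zero
  map_add' x y := by rw [A.inv_add, map_add]; exact Matrix.transpose_add _ _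
  map_mul' x y := by rw [A.inv_mul, map_mul]; exact Matrix.transpose_mul _ _
  commutes' c := by
    rw [A.inv_algebraMap, AlgHom.commutes]
    ext i j
    change algebraMap K (Matrix I I E) (ι c) j i = algebraMap K (Matrix I I (TwistAlg ι E)) c i j
    rw [Matrix.algebraMap_matrix_apply, Matrix.algebraMap_matrix_apply]
    simp only [eq_comm (a := j)]
    rfl

theorem transposeHom_apply {E : Type u} [Field E] [Algebra K E] {I : Type} [Fintype I] [DecidableEq I]
    (ψ : A.carrier →ₐ[K] Matrix I I E) (x : A.carrier) (i j : I) :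
    A.transposeHom ψ x i j = ψ (A.inv x) j i := rfl

theorem span_transposeHom {E : Type u} [Field E] [Algebra K E] {I : Type} [Fintype I] [DecidableEq I]
    (ψ : A.carrier →ₐ[K] Matrix I I E) (h : Submodule.span E (Set.range ψ) = ⊤) :
    Submodule.span (TwistAlg ι E) (Set.range (A.transposeHom ψ)) = ⊤ := by
  have key : ∀ Z : Matrix I I E, (Matrix.transpose Z : Matrix I I (TwistAlg ι E)) ∈
      Submodule.span (TwistAlg ι E) (Set.range (A.transposeHom ψ)) := by
    intro Z
    have hZ : Z ∈ Submodule.span E (Set.range ψ) := by rw [h]; trivial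
    induction hZ using Submodule.span_induction with
    | zero => exact zero_mem _
    | add x y _ _ hx hy => exact add_mem hx hy
    | smul r x _ hx => exact Submodule.smul_mem _ (show TwistAlg ι E from r) hx
    | mem x hx =>
      obtain ⟨a, rfl⟩ := hx
      exact Submodule.subset_span ⟨A.inv a, by ext i j; rw [transposeHom_apply, A.inv_inv]; rfl⟩
  rw [eq_top_iff]
  intro Z _
  exact key (Matrix.transpose Z)

/-- An Azumaya algebra with involution has a splitting over `F × F`: a splitting over `F` is taken on
the first factor, and its transpose, composed with the involution, on the second. The Goldman element
comes from writing the reduced trace as a sandwich. -/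
theorem exists_goldman [IsArtinianRing K] [IsReduced K] [InvBase ι] :
    Nonempty (GoldmanInv ι A.carrier A.inv) := by
  obtain ⟨t, ht⟩ := IsAzumaya.exists_trace (K := K) (A := A.carrier) (InvBase.two ι)
  obtain ⟨m, a, b, hab⟩ := IsAzumaya.exists_sandwich t
  obtain ⟨n, _, ⟨φ⟩⟩ := IsAzumaya.exists_split (K := K) (A := A.carrier) (Geom K)
  let ψ : A.carrier →ₐ[K] Matrix (Fin n) (Fin n) (Geom K) :=
    (φ.toAlgHom.restrictScalars K).comp Algebra.TensorProduct.includeRight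
  have hspan : Submodule.span (Geom K) (Set.range ψ) = ⊤ := span_splitting φ
  have htψ : ∀ x, (ψ x).trace = algebraMap K (Geom K) (t x) := fun x => ht _ _ φ x
  -- the transposed splitting has the same reduced trace
  have hts : ∀ x, algebraMap K (Geom K) (t (A.inv x)) = algebraMap K (Geom K) (ι (t x)) := by
    intro x
    have h := ht (TwistAlg ι (Geom K)) (Fin n) (AlgEquiv.ofBijective _
      (IsAzumaya.matrixLift_bijective (A.transposeHom ψ) (A.span_transposeHom ψ hspan))) x
    rw [AlgEquiv.ofBijective_apply, matrixLift_tmul, one_smul] at h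
    rw [← htψ]
    exact h
  -- the splitting on the first factor, and its composition with the involution and the transpose
  -- on the second
  let Ψ : A.carrier →ₐ[K] Matrix (Fin n) (Fin n) (Pt ι) :=
    { toFun x := Matrix.of fun i j => ((ψ x i j, ψ (A.inv x) j i) : Geom K × Geom K)
      map_one' := by
        rw [inv_one, map_one]
        ext i j
        change (((1 : Matrix (Fin n) (Fin n) (Geom K)) i j,
          (1 : Matrix (Fin n) (Fin n) (Geom K)) j i) : Geom K × Geom K) =
            (1 : Matrix (Fin n) (Fin n) (Pt ι)) i j
        rw [Matrix.one_apply, Matrix.one_apply, Matrix.one_apply]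
        by_cases h : i = j
        · simp only [h, if_true]; rfl
        · simp only [h, Ne.symm h, if_false]; rfl
      map_zero' := by rw [inv_zero, map_zero]; rfl
      map_add' x y := by rw [A.inv_add, map_add, map_add]; rfl
      map_mul' x y := by
        rw [A.inv_mul, map_mul, map_mul]
        ext i j
        rw [Matrix.mul_apply]
        refine Prod.ext ?_ ?_
        · change (ψ x * ψ y) i j = Pt.fst ι _
          rw [map_sum, Matrix.mul_apply]
          rfl
        · change (ψ (A.inv y) * ψ (A.inv x)) j i = Pt.snd ι _
          rw [map_sum, Matrix.mul_apply]
          exact Finset.sum_congr rfl fun k _ => mul_comm _ _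
      commutes' c := by
        rw [A.inv_algebraMap, AlgHom.commutes, AlgHom.commutes]
        ext i j
        change ((algebraMap K (Matrix (Fin n) (Fin n) (Geom K)) c i j,
          algebraMap K (Matrix (Fin n) (Fin n) (Geom K)) (ι c) j i) : Geom K × Geom K) =
            algebraMap K (Matrix (Fin n) (Fin n) (Pt ι)) c i j
        rw [Matrix.algebraMap_matrix_apply, Matrix.algebraMap_matrix_apply,
          Matrix.algebraMap_matrix_apply]
        by_cases h : i = j
        · simp only [h, if_true]; rfl
        · simp only [h, Ne.symm h, if_false]; rfl }
  have hΨ : ∀ x i j, Ψ x i j = ((ψ x i j, ψ (A.inv x) j i) : Geom K × Geom K) := fun _ _ _ => rfl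
  refine ⟨⟨⟨Fin n, Ψ, ?_, t, ?_, Fin m, a, b, ?_⟩, ?_⟩⟩
  -- the images of the algebra span the matrices over each factor separately
  · have key1 : ∀ Z : Matrix (Fin n) (Fin n) (Geom K),
        (Matrix.of fun i j => ((Z i j, 0) : Geom K × Geom K) : Matrix (Fin n) (Fin n) (Pt ι)) ∈
          Submodule.span (Pt ι) (Set.range Ψ) := by
      intro Z
      have hZ : Z ∈ Submodule.span (Geom K) (Set.range ψ) := by rw [hspan]; trivial
      induction hZ using Submodule.span_induction with
      | zero => exact zero_mem _
      | add x y _ _ hx hy =>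
        convert add_mem hx hy using 1
        ext i j
        exact Prod.ext rfl (add_zero 0).symm
      | smul r x _ hx =>
        convert Submodule.smul_mem _ (show Pt ι from ((r, 0) : Geom K × Geom K)) hx using 1
        ext i j
        exact Prod.ext rfl (mul_zero _).symm
      | mem x hx =>
        obtain ⟨a, rfl⟩ := hx
        convert Submodule.smul_mem _ (show Pt ι from ((1, 0) : Geom K × Geom K))
          (Submodule.subset_span (Set.mem_range_self (f := Ψ) a)) using 1
        ext i j
        exact Prod.ext (one_mul _).symm (zero_mul _).symm
    have key2 : ∀ Z : Matrix (Fin n) (Fin n) (Geom K),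
        (Matrix.of fun i j => ((0, Z j i) : Geom K × Geom K) : Matrix (Fin n) (Fin n) (Pt ι)) ∈
          Submodule.span (Pt ι) (Set.range Ψ) := by
      intro Z
      have hZ : Z ∈ Submodule.span (Geom K) (Set.range ψ) := by rw [hspan]; trivial
      induction hZ using Submodule.span_induction with
      | zero => exact zero_mem _
      | add x y _ _ hx hy =>
        convert add_mem hx hy using 1
        ext i j
        exact Prod.ext (add_zero 0).symm rfl
      | smul r x _ hx =>
        convert Submodule.smul_mem _ (show Pt ι from ((0, r) : Geom K × Geom K)) hx using 1
        ext i j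
        exact Prod.ext (mul_zero _).symm rfl
      | mem x hx =>
        obtain ⟨a, rfl⟩ := hx
        convert Submodule.smul_mem _ (show Pt ι from ((0, 1) : Geom K × Geom K))
          (Submodule.subset_span (Set.mem_range_self (f := Ψ) (A.inv a))) using 1
        ext i j
        refine Prod.ext (zero_mul _).symm ?_
        change ψ a j i = (1 : Geom K) * ψ (A.inv (A.inv a)) j i
        rw [A.inv_inv, one_mul]
    rw [eq_top_iff]
    intro Z _
    convert add_mem (key1 (Matrix.of fun i j => Pt.fst ι (Z i j)))
      (key2 (Matrix.of fun i j => Pt.snd ι (Z j i))) using 1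
    ext i j
    exact Prod.ext (add_zero _).symm (zero_add _).symm
  · intro x
    refine Prod.ext ?_ ?_
    · change Pt.fst ι _ = algebraMap K (Geom K) (t x)
      rw [← htψ, Matrix.trace, Matrix.trace, map_sum]
      rfl
    · change Pt.snd ι _ = algebraMap K (Geom K) (ι (t x))
      rw [← hts, ← htψ, Matrix.trace, Matrix.trace, map_sum]
      rfl
  · intro x
    -- the duality of the bases can be checked in splittings over fields, where the entries of
    -- `∑ a k ⊗ b k` are those of the flip
    rw [← sub_eq_zero]
    refine eq_zero_of_forall_residue (K := K) fun E _ _ _ => ?_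
    obtain ⟨n', _, ⟨φ'⟩⟩ := IsAzumaya.exists_split (K := K) (A := A.carrier) E
    let χ : A.carrier →ₐ[K] Matrix (Fin n') (Fin n') E :=
      (φ'.toAlgHom.restrictScalars K).comp Algebra.TensorProduct.includeRight
    have hχ : ∀ x, (χ x).trace = algebraMap K E (t x) := fun x => ht _ _ φ' x
    have hsp : Submodule.span E (Set.range χ) = ⊤ := span_splitting φ'
    apply φ'.injective
    rw [map_zero]
    change χ _ = 0
    have hent := Matrix.entries_of_sandwich 1 (fun k => χ (a k)) (fun k => χ (b k)) (by
      intro X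
      have hX : X ∈ Submodule.span E (Set.range χ) := by rw [hsp]; trivial
      induction hX using Submodule.span_induction with
      | zero => simp
      | add x y _ _ hx hy =>
        simp only [mul_add, add_mul, Finset.sum_add_distrib, hx, hy, Matrix.trace_add, add_smul]
      | smul r x _ hx =>
        simp only [mul_smul_comm, smul_mul_assoc, ← Finset.smul_sum, hx, Matrix.trace_smul, smul_smul]
        congr 1
      | mem x hx =>
        obtain ⟨x, rfl⟩ := hx
        simp only [← map_mul, ← map_sum]
        rw [hab, AlgHom.commutes, hχ, IsScalarTower.algebraMap_apply K E (Matrix _ _ E),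
          Algebra.algebraMap_eq_smul_one, one_mul])
    rw [map_sub, sub_eq_zero, map_sum]
    ext p q
    rw [Matrix.sum_apply]
    have h3 : ∀ k, χ (t (x * a k) • b k) p q =
        ∑ i, ∑ j, χ x i j * (χ (a k) j i * χ (b k) p q) := by
      intro k
      rw [map_smul, Matrix.smul_apply, Algebra.smul_def, ← hχ, map_mul, Matrix.trace,
        Finset.sum_mul]
      refine Finset.sum_congr rfl fun i _ => ?_
      rw [Matrix.diag_apply, Matrix.mul_apply, Finset.sum_mul]
      exact Finset.sum_congr rfl fun j _ => mul_assoc _ _ _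
    rw [Finset.sum_congr rfl fun k _ => h3 k, Finset.sum_comm]
    simp only [Finset.sum_comm (s := (Finset.univ : Finset (Fin m))), ← Finset.mul_sum, hent]
    rw [Finset.sum_eq_single p, Finset.sum_eq_single q]
    · simp
    · intro j _ hj; simp [hj]
    · intro h; exact absurd (Finset.mem_univ _) h
    · intro i _ hi; simp [hi]
    · intro h; exact absurd (Finset.mem_univ _) h
  · intro x i j
    change Ψ (A.inv x) i j = Pt.swap ι (Ψ x j i)
    rw [hΨ, hΨ, A.inv_inv]
    rfl

/-- A chosen splitting. -/
def goldman [IsArtinianRing K] [IsReduced K] [InvBase ι] : GoldmanInv ι A.carrier A.inv :=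
  A.exists_goldman.some

end AzumayaInv

namespace GoldmanInv

variable {ι} {R : Type u} [Ring R] [Algebra K R] {s : R → R} (G : GoldmanInv ι R s)
variable [IsReduced K] [InvBase ι]
include G

theorem inj : Function.Injective G.ψ := G.ψ_injective (Pt.injective ι)

theorem inv_mul (x y : R) : s (x * y) = s y * s x := by
  apply G.inj
  ext i j
  rw [G.ψ_inv, map_mul, map_mul, Matrix.mul_apply, Matrix.mul_apply, map_sum]
  refine Finset.sum_congr rfl fun k _ => ?_
  rw [map_mul, G.ψ_inv, G.ψ_inv, mul_comm]

theorem inv_add (x y : R) : s (x + y) = s x + s y := by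
  apply G.inj
  ext i j
  rw [G.ψ_inv, map_add, map_add, Matrix.add_apply, Matrix.add_apply, map_add, G.ψ_inv, G.ψ_inv]

theorem inv_inv (x : R) : s (s x) = x := by
  apply G.inj
  ext i j
  rw [G.ψ_inv, G.ψ_inv, Pt.swap_swap]

theorem inv_smul (c : K) (x : R) : s (c • x) = ι c • s x := by
  apply G.inj
  ext i j
  rw [G.ψ_inv, map_smul, map_smul, Matrix.smul_apply, Matrix.smul_apply, Algebra.smul_def,
    map_mul, Pt.swap_algebraMap, G.ψ_inv, Algebra.smul_def]

theorem inv_one : s 1 = 1 := by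
  apply G.inj
  ext i j
  rw [G.ψ_inv, map_one, Matrix.one_apply, Matrix.one_apply]
  by_cases h : i = j
  · simp [h]
  · simp [h, Ne.symm h]

theorem inv_zero : s 0 = 0 := by
  have := G.inv_add 0 0
  rw [add_zero] at this
  exact left_eq_add.mp this

/-- The involution as an additive homomorphism. -/
def invHom : R →+ R := ⟨⟨s, G.inv_zero⟩, G.inv_add⟩

theorem inv_sum {κ : Type*} (S : Finset κ) (f : κ → R) : s (∑ k ∈ S, f k) = ∑ k ∈ S, s (f k) :=
  map_sum G.invHom f S

theorem t_inv (x : R) : G.t (s x) = ι (G.t x) := by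
  apply Pt.injective ι
  rw [← G.trace_ψ, ← Pt.swap_algebraMap, ← G.trace_ψ, Matrix.trace, Matrix.trace, map_sum]
  exact Finset.sum_congr rfl fun i _ => G.ψ_inv x i i

end GoldmanInv

namespace AzumayaInv

variable {ι} (A : AzumayaInv ι) [IsReduced K] [InvBase ι] [IsArtinianRing K]

/-- The splitting of the tensor powers. -/
abbrev goldmanPow (n : ℕ) : GoldmanInv ι (A.pow n) (A.invPow n) where
  toGoldmanAlg := A.goldman.toGoldmanAlg.pow (Fin n)
  ψ_inv x f h := by
    induction x using PiTensorProduct.induction_on with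
    | smul_tprod r x =>
      have h1 : A.invPow n (r • PiTensorProduct.tprod K x) =
          ι r • A.invPow n (PiTensorProduct.tprod K x) :=
        map_smul (PiTensorProduct.lift (A.invPowMultilinear n)) r _
      have h2 : A.goldman.ψ = A.goldman.toGoldmanAlg.ψ := rfl
      rw [h1, A.invPow_tprod, map_smul, map_smul, Matrix.smul_apply, Matrix.smul_apply,
        GoldmanAlg.pow_ψ]
      change _ = Pt.swap ι (r • psiPow A.goldman.ψ (Fin n) (PiTensorProduct.tprod K x) h f)
      rw [Algebra.smul_def r, map_mul, Pt.swap_algebraMap, ← Algebra.smul_def]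
      congr 1
      refine (psiPow_tprod _ _ _ _ _).trans ?_
      refine Eq.trans ?_ (congrArg (Pt.swap ι) (psiPow_tprod A.goldman.ψ (Fin n) x h f).symm)
      rw [map_prod]
      exact Finset.prod_congr rfl fun t _ => A.goldman.ψ_inv _ _ _
    | add x y hx hy =>
      rw [A.invPow_add, map_add, map_add, Matrix.add_apply, hx, hy, Matrix.add_apply, map_add]

end AzumayaInv

end

/-! ### Hermitian spaces and Gram matrices -/

namespace HermSpace

variable {K : Type u} [CommRing K] {ι : K →+* K} {R : Type u} [Ring R]
  [Algebra K R] {s : R → R} {ε : signGroup ι}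

theorem rmul_apply (X : HermSpace ι R s ε) (a : R) (x : X.carrier) :
    X.rmul a x = MulOpposite.op a • x := rfl

/-- The family `c` generates `X` as a right `R`-module. -/
def Generates (X : HermSpace ι R s ε) {T : Type*} (c : T → X.carrier) : Prop :=
  Submodule.span Rᵐᵒᵖ (Set.range c) = ⊤

variable {X Y : HermSpace ι R s ε}

theorem Generates.induction {T : Type*} {c : T → X.carrier} (hc : X.Generates c)
    {p : X.carrier → Prop} (mem : ∀ i, p (c i)) (add : ∀ x y, p x → p y → p (x + y)) (zero : p 0)
    (smul : ∀ (a : R) x, p x → p (MulOpposite.op a • x)) (x : X.carrier) : p x := by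
  have hx : x ∈ Submodule.span Rᵐᵒᵖ (Set.range c) := by
    rw [show Submodule.span Rᵐᵒᵖ (Set.range c) = ⊤ from hc]; trivial
  induction hx using Submodule.span_induction with
  | mem x hx => obtain ⟨i, rfl⟩ := hx; exact mem i
  | zero => exact zero
  | add x y _ _ hx hy => exact add x y hx hy
  | smul a x _ hx => exact smul a.unop x hx

theorem generates_id (X : HermSpace ι R s ε) : X.Generates (id : X.carrier → X.carrier) := by
  rw [Generates, Set.range_id, Submodule.span_univ]

theorem Generates.of_forall {T : Type*} {c : T → X.carrier} {T' : Type*} {c' : T' → X.carrier}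
    (hc : X.Generates c) (h : ∀ i, c i ∈ Submodule.span Rᵐᵒᵖ (Set.range c')) : X.Generates c' := by
  rw [Generates, eq_top_iff, ← show Submodule.span Rᵐᵒᵖ (Set.range c) = ⊤ from hc,
    Submodule.span_le]
  rintro _ ⟨i, rfl⟩
  exact h i

/-- A vector orthogonal to generators vanishes. -/
theorem eq_zero_of_form_left (X : HermSpace ι R s ε) {x : X.carrier} {T : Type*} {c : T → X.carrier}
    (hc : X.Generates c) (h : ∀ i, X.form x (c i) = 0) : x = 0 := by
  refine X.nondegenerate x fun y => ?_
  induction y using hc.induction with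
  | mem i => exact h i
  | add x y hx hy => rw [map_add, hx, hy, add_zero]
  | zero => exact map_zero _
  | smul a x hx => rw [X.form_right, hx, zero_mul]

theorem form_eq_zero_comm (X : HermSpace ι R s ε) (hs : s 0 = 0) {x y : X.carrier}
    (h : X.form x y = 0) : X.form y x = 0 := by
  have h1 := X.form_symm x y
  rw [h, hs] at h1
  have : ((ε⁻¹ : signGroup ι) : Kˣ).1 • ((ε : Kˣ) : K) • X.form y x = 0 := by rw [← h1, smul_zero]
  rw [smul_smul, ← Units.val_mul, ← Subgroup.coe_mul, inv_mul_cancel] at this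
  simpa using this

theorem eq_zero_of_form_right (X : HermSpace ι R s ε) (hs : s 0 = 0) {x : X.carrier} {T : Type*}
    {c : T → X.carrier} (hc : X.Generates c) (h : ∀ i, X.form (c i) x = 0) : x = 0 :=
  X.eq_zero_of_form_left hc fun i => X.form_eq_zero_comm hs (h i)

theorem eq_of_form_right (X : HermSpace ι R s ε) (hs : s 0 = 0) {x y : X.carrier} {T : Type*}
    {c : T → X.carrier} (hc : X.Generates c) (h : ∀ i, X.form (c i) x = X.form (c i) y) : x = y := by
  rw [← sub_eq_zero]
  exact X.eq_zero_of_form_right hs hc fun i => by rw [map_sub, h, sub_self]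

/-- The form on linear combinations of generators. -/
theorem form_linearCombination (X : HermSpace ι R s ε) {T : Type*} (c : T → X.carrier)
    (x : X.carrier) (r : T →₀ Rᵐᵒᵖ) :
    X.form x (Finsupp.linearCombination Rᵐᵒᵖ c r) = r.sum fun j a => X.form x (c j) * a.unop := by
  rw [Finsupp.linearCombination_apply, Finsupp.sum, map_sum, Finsupp.sum]
  exact Finset.sum_congr rfl fun j _ => X.form_right _ _ _

/-- Two families with adjoint Gram matrices are intertwined by a linear map. -/
theorem exists_linear_of_adjoint (hs : s 0 = 0) {T T' : Type*} {a : T → X.carrier}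
    (ha : X.Generates a) (b : T → Y.carrier) (c : T' → Y.carrier) (hc : Y.Generates c)
    (c' : T' → X.carrier) (h : ∀ i j, Y.form (c i) (b j) = X.form (c' i) (a j)) :
    ∃ f : X.carrier →ₗ[Rᵐᵒᵖ] Y.carrier, ∀ j, f (a j) = b j := by
  have hsurj : Function.Surjective (Finsupp.linearCombination Rᵐᵒᵖ a) := by
    rw [← LinearMap.range_eq_top, Finsupp.range_linearCombination]
    exact ha
  have hker : LinearMap.ker (Finsupp.linearCombination Rᵐᵒᵖ a) ≤
      LinearMap.ker (Finsupp.linearCombination Rᵐᵒᵖ b) := by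
    intro r hr
    rw [LinearMap.mem_ker] at hr ⊢
    refine Y.eq_zero_of_form_right hs hc fun i => ?_
    rw [form_linearCombination]
    simp only [h]
    rw [← form_linearCombination, hr, map_zero]
  let e := (Finsupp.linearCombination Rᵐᵒᵖ a).quotKerEquivOfSurjective hsurj
  refine ⟨(LinearMap.ker (Finsupp.linearCombination Rᵐᵒᵖ a)).liftQ _ hker ∘ₗ e.symm.toLinearMap,
    fun j => ?_⟩
  have h1 : e.symm (a j) = Submodule.Quotient.mk (Finsupp.single j 1) := by
    rw [LinearEquiv.symm_apply_eq]
    simp [e, LinearMap.quotKerEquivOfSurjective]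
  rw [LinearMap.comp_apply]
  change Submodule.liftQ _ _ hker (e.symm (a j)) = _
  rw [h1, Submodule.liftQ_apply]
  simp

/-- Hermitian spaces generated by families with the same Gram matrix are isometric. -/
theorem isometric_of_gram (hs : s 0 = 0) {T : Type*} {a : T → X.carrier} {b : T → Y.carrier}
    (ha : X.Generates a) (hb : Y.Generates b)
    (h : ∀ i j, Y.form (b i) (b j) = X.form (a i) (a j)) : Isometric X Y := by
  obtain ⟨f, hf⟩ := exists_linear_of_adjoint hs ha b b hb a h
  obtain ⟨f', hf'⟩ := exists_linear_of_adjoint hs hb a a ha b fun i j => (h i j).symm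
  have h1 : ∀ x, f' (f x) = x := by
    intro x
    induction x using ha.induction with
    | mem i => rw [hf, hf']
    | add x y hx hy => rw [map_add, map_add, hx, hy]
    | zero => rw [map_zero, map_zero]
    | smul a x hx => rw [map_smul, map_smul, hx]
  have h2 : ∀ x, f (f' x) = x := by
    intro x
    induction x using hb.induction with
    | mem i => rw [hf', hf]
    | add x y hx hy => rw [map_add, map_add, hx, hy]
    | zero => rw [map_zero, map_zero]
    | smul a x hx => rw [map_smul, map_smul, hx]
  have hK : ∀ (Z : HermSpace ι R s ε) (c : K) (x : Z.carrier), c • x = (c • (1 : Rᵐᵒᵖ)) • x := by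
    intro Z c x
    rw [smul_assoc, one_smul]
  let e : X.carrier ≃ₗ[K] Y.carrier :=
    { toFun := f
      invFun := f'
      map_add' := map_add f
      left_inv := h1
      right_inv := h2
      map_smul' := fun c x => by rw [hK X, map_smul, ← hK Y]; rfl }
  refine ⟨e, fun a x => map_smul f _ _, fun x y => ?_⟩
  · change Y.form (f x) (f y) = X.form x y
    induction x using ha.induction with
    | mem i =>
      induction y using ha.induction with
      | mem j => rw [hf, hf, h]
      | add x y hx hy => rw [map_add, map_add, map_add, hx, hy]
      | zero => rw [map_zero, map_zero, map_zero]
      | smul a x hx => rw [map_smul, Y.form_right, X.form_right, hx]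
    | add x y hx hy => simp only [map_add, LinearMap.add_apply, hx, hy]
    | zero => simp only [map_zero, LinearMap.zero_apply]
    | smul a x hx => rw [map_smul, Y.form_left, X.form_left, hx]

end HermSpace

section

variable {K : Type u} [CommRing K] [Nontrivial K] [IsReduced K] {ι : K →+* K} [InvBase ι]
  {R : Type u} [Ring R] [Algebra K R] {s : R → R} {ε : signGroup ι}

namespace GoldmanAlg

variable (G : GoldmanAlg K (Pt ι) R) [IsArtinianRing K]
include G

theorem finite : Module.Finite K R := by
  refine Module.Finite.of_surjective (Fintype.linearCombination K G.b) fun x =>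
    ⟨fun k => G.t (x * G.a k), ?_⟩
  rw [Fintype.linearCombination_apply, G.frob]

theorem exists_t_eq_one [Nonempty G.I] : ∃ c, G.t c = 1 := by
  have h : (LinearMap.range G.t : Ideal K) = ⊤ := by
    by_contra hne
    obtain ⟨m, hm, hle⟩ := Ideal.exists_le_maximal _ hne
    obtain ⟨Q, hQ, hPQ⟩ := exists_residueField (L := Pt ι) m hm
    have h1 : ∀ Z : Matrix G.I G.I (Pt ι), Z.trace ∈ Q := by
      intro Z
      have hZ : Z ∈ Submodule.span (Pt ι) (Set.range G.ψ) := by rw [G.span_ψ]; trivial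
      induction hZ using Submodule.span_induction with
      | mem x hx =>
        obtain ⟨x, rfl⟩ := hx
        rw [G.trace_ψ]
        exact hPQ (hle ⟨x, rfl⟩)
      | zero => rw [Matrix.trace_zero]; exact Q.zero_mem
      | add x y _ _ hx hy => rw [Matrix.trace_add]; exact Q.add_mem hx hy
      | smul r x _ hx => rw [Matrix.trace_smul]; exact Q.mul_mem_left _ hx
    obtain ⟨i⟩ := ‹Nonempty G.I›
    have h2 := h1 (Matrix.single i i 1)
    rw [Matrix.trace_single_eq_same] at h2
    exact hQ.ne_top ((Ideal.eq_top_iff_one Q).mpr h2)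
  have : (1 : K) ∈ (LinearMap.range G.t : Ideal K) := by rw [h]; trivial
  exact this

theorem subsingleton [IsEmpty G.I] : Subsingleton R := by
  have := (G.ψ_injective (Pt.injective ι))
  exact this.subsingleton

end GoldmanAlg

namespace HermSpace

variable (X : HermSpace ι R s ε) (G : GoldmanInv ι R s)
include G

/-- Every functional on a hermitian space is represented by a vector, through the trace of the
form. -/
theorem exists_form_eq (f : X.carrier →ₗ[K] K) : ∃ y, ∀ v, G.t (X.form y v) = f v := by
  let b : X.carrier →ₛₗ[ι] X.carrier →ₗ[K] K := LinearMap.mk₂'ₛₗ ι (RingHom.id K)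
    (fun x y => G.t (X.form x y))
    (fun x y z => by simp only [map_add, LinearMap.add_apply])
    (fun c x y => by simp)
    (fun x y z => by simp only [map_add])
    (fun c x y => by simp)
  obtain ⟨y, hy⟩ := InvBase.perfect (ι := ι) X.carrier b (fun x hx => by
    refine X.nondegenerate x fun y => ?_
    rw [← G.frob (X.form x y)]
    refine Finset.sum_eq_zero fun k _ => ?_
    rw [← X.form_right]
    have h : G.t (X.form x (MulOpposite.op (G.a k) • y)) = 0 := hx _
    rw [h, zero_smul]) f
  exact ⟨y, fun v => LinearMap.congr_fun hy v⟩

variable [IsArtinianRing K]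

/-- Dual bases over `K` for the trace of the form. -/
theorem exists_trace_basis : ∃ (n : ℕ) (x y : Fin n → X.carrier),
    ∀ v, ∑ i, G.t (X.form (y i) v) • x i = v := by
  have := IsArtinianRing.isSemisimpleRing_of_isReduced K
  have : Module.Projective K X.carrier := Module.projective_of_isSemisimpleRing _ _
  obtain ⟨n, p, q, -, -, hpq⟩ := Module.Finite.exists_comp_eq_id_of_projective K X.carrier
  choose y hy using fun i => X.exists_form_eq G (LinearMap.proj i ∘ₗ q)
  refine ⟨n, fun i => p (Pi.single i 1), y, fun v => ?_⟩
  have h := LinearMap.congr_fun hpq v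
  rw [LinearMap.comp_apply, LinearMap.id_apply] at h
  conv_rhs => rw [← h, pi_eq_sum_univ' (q v), map_sum]
  refine Finset.sum_congr rfl fun i _ => ?_
  rw [hy, map_smul]
  congr 1

/-- Dual bases over `R` for the form. -/
theorem exists_dual_basis : ∃ (n : ℕ) (x y : Fin n → X.carrier),
    ∀ v, ∑ i, MulOpposite.op (X.form (y i) v) • x i = v := by
  rcases isEmpty_or_nonempty G.I with hI | hI
  · have := G.subsingleton
    refine ⟨0, fun _ => 0, fun _ => 0, fun v => ?_⟩
    have h : (MulOpposite.op (1 : R)) • v = v := one_smul _ v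
    rw [← h, Subsingleton.elim (1 : R) 0, MulOpposite.op_zero, zero_smul]
    simp
  · obtain ⟨c, hc⟩ := G.exists_t_eq_one
    obtain ⟨n, x, y, hxy⟩ := X.exists_trace_basis G
    refine ⟨n, fun i => MulOpposite.op c • x i, y, fun v => ?_⟩
    have h1 : ∀ i, MulOpposite.op (X.form (y i) v) • MulOpposite.op c • x i =
        ∑ k, MulOpposite.op (c * G.b k) • G.t (X.form (y i) (MulOpposite.op (G.a k) • v)) • x i := by
      intro i
      conv_lhs => rw [← G.frob (X.form (y i) v)]
      rw [Finset.op_sum, Finset.sum_smul]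
      refine Finset.sum_congr rfl fun k _ => ?_
      rw [X.form_right, MulOpposite.op_smul, smul_assoc, smul_smul, smul_comm (MulOpposite.op _)]
      rfl
    rw [Finset.sum_congr rfl fun i _ => h1 i, Finset.sum_comm]
    simp only [← Finset.smul_sum, hxy, smul_smul, ← MulOpposite.op_mul, ← mul_assoc]
    rw [← Finset.sum_smul, ← Finset.op_sum, G.sandwich (Pt.injective ι), hc, map_one]
    exact one_smul _ v

end HermSpace

/-- A hermitian space with generators that have a given Gram matrix. It is the span of the columns of
the Gram matrix; the hypothesis `hfin` makes it finitely generated, and forms of columns are read off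
from their entries, so that the form is nondegenerate. -/
theorem HermSpace.exists_of_gram [IsArtinianRing K] (G : GoldmanInv ι R s) (ε : signGroup ι)
    {T : Type u} (g : T → T → R) (hsymm : ∀ i j, s (g i j) = ((ε : Kˣ) : K) • g j i)
    {n : ℕ} (f : Fin n → T)
    (hfin : ∀ j, ∃ r : Fin n → R, ∀ i, g i j = ∑ k, g i (f k) * r k) :
    ∃ (Y : HermSpace ι R s ε) (c : T → Y.carrier), Y.Generates c ∧
      ∀ i j, Y.form (c i) (c j) = g i j := by
  have := G.finite
  let col : T → (T → R) := fun j i => g i j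
  let N : Submodule Rᵐᵒᵖ (T → R) := Submodule.span Rᵐᵒᵖ (Set.range col)
  have hεu : ∀ (x : R), ((ε : Kˣ) : K) • x = 0 → x = 0 := by
    intro x hx
    have : ((ε⁻¹ : signGroup ι) : Kˣ).1 • ((ε : Kˣ) : K) • x = 0 := by rw [hx, smul_zero]
    rw [smul_smul, ← Units.val_mul, ← Subgroup.coe_mul, inv_mul_cancel] at this
    simpa using this
  have hfin' : Module.Finite K N := by
    have h1 : N = Submodule.span Rᵐᵒᵖ (Set.range (col ∘ f)) := by
      refine le_antisymm (Submodule.span_le.mpr ?_)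
        (Submodule.span_mono (Set.range_comp_subset_range _ _))
      rintro _ ⟨j, rfl⟩
      obtain ⟨r, hr⟩ := hfin j
      have : col j = ∑ k, MulOpposite.op (r k) • (col ∘ f) k := by
        funext i
        rw [Finset.sum_apply]
        exact hr i
      rw [this]
      exact Submodule.sum_mem _ fun k _ => Submodule.smul_mem _ _ (Submodule.subset_span ⟨k, rfl⟩)
    have h2 : Module.Finite Rᵐᵒᵖ N := by
      rw [h1]
      exact Module.Finite.span_of_finite Rᵐᵒᵖ (Set.finite_range _)
    have h3 : Module.Finite K Rᵐᵒᵖ := Module.Finite.equiv (MulOpposite.opLinearEquiv K)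
    exact Module.Finite.trans Rᵐᵒᵖ N
  -- evaluation of a coefficient vector on a column vector
  let ev : (T →₀ Rᵐᵒᵖ) → (T → R) → R := fun r w => r.sum fun j a => s a.unop * w j
  have hlc : ∀ x : N, ∃ r : T →₀ Rᵐᵒᵖ, Finsupp.linearCombination Rᵐᵒᵖ col r = x := fun x =>
    (Finsupp.mem_span_range_iff_exists_finsupp.mp x.2)
  have hs0 : s 0 = 0 := G.inv_zero
  have ev_add : ∀ r r' w, ev (r + r') w = ev r w + ev r' w := by
    intro r r' w
    refine Finsupp.sum_add_index' (fun j => by simp [hs0]) fun j a b => ?_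
    rw [MulOpposite.unop_add, G.inv_add, add_mul]
  have ev_smul : ∀ (a : R) r w, ev (MulOpposite.op a • r) w = s a * ev r w := by
    intro a r w
    rw [show ev (MulOpposite.op a • r) w = _ from Finsupp.sum_smul_index' fun j => by simp [hs0],
      show ev r w = r.sum _ from rfl, Finsupp.mul_sum]
    refine Finsupp.sum_congr fun j _ => ?_
    rw [smul_eq_mul, MulOpposite.unop_mul, MulOpposite.unop_op, G.inv_mul, mul_assoc]
  have ev_addr : ∀ r w w', ev r (w + w') = ev r w + ev r w' := by
    intro r w w'
    rw [← Finsupp.sum_add]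
    exact Finsupp.sum_congr fun j _ => mul_add _ _ _
  have ev_smulr : ∀ (a : R) r w, ev r (MulOpposite.op a • w) = ev r w * a := by
    intro a r w
    rw [show ev r w = r.sum _ from rfl, Finsupp.sum_mul]
    exact Finsupp.sum_congr fun j _ => (mul_assoc _ _ _).symm
  -- by symmetry, the value on the column `j` is the entry `j` of the combination with
  -- coefficients `r`
  have ev_col : ∀ r j, ev r (col j) =
      s (((ε : Kˣ) : K) • (Finsupp.linearCombination Rᵐᵒᵖ col r) j) := by
    intro r j
    rw [Finsupp.linearCombination_apply, Finsupp.sum, Finset.sum_apply, Finset.smul_sum, G.inv_sum]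
    refine Finset.sum_congr rfl fun i _ => ?_
    change s (r i).unop * g i j = s (((ε : Kˣ) : K) • (g j i * (r i).unop))
    rw [← smul_mul_assoc, ← hsymm, G.inv_mul, G.inv_inv]
  have ev_zero : ∀ r, ev r 0 = 0 := fun r => by
    change r.sum (fun j a => s a.unop * (0 : R)) = 0
    simp
  -- hence the value only depends on the combination
  have ev_wd : ∀ r r' : T →₀ Rᵐᵒᵖ, Finsupp.linearCombination Rᵐᵒᵖ col r =
      Finsupp.linearCombination Rᵐᵒᵖ col r' → ∀ w : N, ev r w = ev r' w := by
    rintro r r' h ⟨w, hw⟩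
    induction hw using Submodule.span_induction with
    | mem x hx => obtain ⟨j, rfl⟩ := hx; rw [ev_col, ev_col, h]
    | zero =>
      change ev r 0 = ev r' 0
      rw [ev_zero, ev_zero]
    | add x y _ _ hx hy =>
      change ev r (x + y) = ev r' (x + y)
      rw [ev_addr, ev_addr]
      exact congrArg₂ _ hx hy
    | smul a x _ hx =>
      change ev r (MulOpposite.op a.unop • x) = ev r' (MulOpposite.op a.unop • x)
      rw [ev_smulr, ev_smulr]
      exact congrArg (· * _) hx
  choose ρ hρ using hlc
  have hb : ∀ (r : T →₀ Rᵐᵒᵖ) (x : N), Finsupp.linearCombination Rᵐᵒᵖ col r = x →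
      ∀ w : N, ev (ρ x) w = ev r w := fun r x h w => ev_wd _ _ ((hρ x).trans h.symm) w
  have hop : ∀ (c : K) (M : Type u) [AddCommGroup M] [Module K M] [Module Rᵐᵒᵖ M]
      [IsScalarTower K Rᵐᵒᵖ M] (x : M), c • x = MulOpposite.op (c • (1 : R)) • x := by
    intro c M _ _ _ _ x
    rw [MulOpposite.op_smul, smul_assoc, MulOpposite.op_one, one_smul]
  have ev_lc : ∀ r r', ev r (Finsupp.linearCombination Rᵐᵒᵖ col r') =
      r'.sum fun j a => ev r (col j) * a.unop := by
    intro r r'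
    rw [Finsupp.linearCombination_apply]
    let evh : (T → R) →+ R := ⟨⟨ev r, ev_zero r⟩, ev_addr r⟩
    refine (map_finsuppSum evh r' _).trans (Finsupp.sum_congr fun j _ => ?_)
    exact ev_smulr _ _ _
  let Y : HermSpace ι R s ε :=
    { carrier := N
      form := LinearMap.mk₂'ₛₗ ι (RingHom.id K) (fun x w => ev (ρ x) w)
        (fun x y w => by
          rw [hb (ρ x + ρ y) (x + y) (by rw [map_add, hρ, hρ]; rfl), ev_add])
        (fun c x w => by
          rw [hb (MulOpposite.op (c • (1 : R)) • ρ x) (c • x) (by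
            rw [map_smul, hρ, hop c N]; rfl), ev_smul, G.inv_smul, G.inv_one, smul_mul_assoc,
            one_mul])
        (fun x w w' => ev_addr _ _ _)
        (fun c x w => by
          rw [hop c N]
          refine (ev_smulr _ _ _).trans ?_
          rw [mul_smul_comm, mul_one]; rfl)
      form_right := fun x w a => ev_smulr _ _ _
      form_left := fun x w a => by
        change ev (ρ (MulOpposite.op a • x)) w = s a * ev (ρ x) w
        rw [hb (MulOpposite.op a • ρ x) (MulOpposite.op a • x) (by rw [map_smul, hρ]; rfl), ev_smul]
      form_symm := fun x y => by
        change s (ev (ρ x) y) = ((ε : Kˣ) : K) • ev (ρ y) x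
        have h1 : ev (ρ x) y = (ρ y).sum fun j a => s (((ε : Kˣ) : K) • (x : T → R) j) * a.unop := by
          conv_lhs => rw [← hρ y]
          rw [ev_lc]
          refine Finsupp.sum_congr fun j _ => ?_
          rw [ev_col, hρ]
        rw [h1, Finsupp.sum, G.inv_sum, show ev (ρ y) x = (ρ y).sum _ from rfl, Finsupp.sum,
          Finset.smul_sum]
        refine Finset.sum_congr rfl fun j _ => ?_
        rw [G.inv_mul, G.inv_inv, mul_smul_comm]
      nondegenerate := fun x hx => by
        refine Subtype.ext (funext fun j => hεu _ ?_)
        have h1 : ev (ρ x) (col j) = 0 := hx ⟨col j, Submodule.subset_span ⟨j, rfl⟩⟩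
        rw [ev_col, hρ] at h1
        rw [← G.inv_inv (_ • (x : T → R) j), h1, hs0] }
  refine ⟨Y, fun j => (⟨col j, Submodule.subset_span ⟨j, rfl⟩⟩ : N), ?_, fun i j => ?_⟩
  · rw [HermSpace.Generates, eq_top_iff]
    rintro ⟨w, hw⟩ -
    induction hw using Submodule.span_induction with
    | mem x hx => obtain ⟨j, rfl⟩ := hx; exact Submodule.subset_span ⟨j, rfl⟩
    | zero => exact zero_mem (Submodule.span Rᵐᵒᵖ (Set.range fun j => (⟨col j, _⟩ : N)))
    | add x y _ _ hx hy => exact add_mem hx hy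
    | smul a x _ hx => exact Submodule.smul_mem _ a hx
  · change ev (ρ _) (col j) = g i j
    rw [ev_col, hρ]
    change s (((ε : Kˣ) : K) • g j i) = g i j
    rw [← hsymm, G.inv_inv]

end

/-! ### Actions on tensor powers -/

section ActPow

variable {K R R' M : Type u} [CommRing K] [Ring R] [Algebra K R] [Ring R'] [Algebra K R']
  [AddCommGroup M] [Module K M]

/-- The action of `R^{⊗ d}` on `M^{⊗ d}` induced by a linear map from `R` to endomorphisms. -/
def actPow (f : R →ₗ[K] Module.End K M) (d : ℕ) :
    (⨂[K] (_ : Fin d), R) →ₗ[K] Module.End K (⨂[K] (_ : Fin d), M) :=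
  PiTensorProduct.piTensorHomMap ∘ₗ PiTensorProduct.map fun _ : Fin d => f

theorem actPow_tprod (f : R →ₗ[K] Module.End K M) (d : ℕ) (a : Fin d → R) :
    actPow f d (PiTensorProduct.tprod K a) = PiTensorProduct.map fun i => f (a i) := by
  rw [actPow, LinearMap.comp_apply, PiTensorProduct.map_tprod,
    PiTensorProduct.piTensorHomMap_tprod_eq_map]

theorem actPow_tprod_tprod (f : R →ₗ[K] Module.End K M) (d : ℕ) (a : Fin d → R) (x : Fin d → M) :
    actPow f d (PiTensorProduct.tprod K a) (PiTensorProduct.tprod K x) =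
      PiTensorProduct.tprod K fun i => f (a i) (x i) := by
  rw [actPow_tprod, PiTensorProduct.map_tprod]

/-- Linear maps out of a tensor power agree if they agree on pure tensors. -/
theorem PiTensorProduct.linearMap_congr {κ N : Type*} {s : κ → Type*} [∀ i, AddCommGroup (s i)]
    [∀ i, Module K (s i)] [AddCommGroup N] [Module K N] {φ φ' : (⨂[K] i, s i) →ₗ[K] N}
    (h : ∀ x, φ (PiTensorProduct.tprod K x) = φ' (PiTensorProduct.tprod K x)) (z : ⨂[K] i, s i) :
    φ z = φ' z := by
  have : φ = φ' := PiTensorProduct.ext (MultilinearMap.ext h)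
  rw [this]

theorem actPow_mul (f : R →ₗ[K] Module.End K M) (hf : ∀ a b, f (a * b) = f a * f b) (d : ℕ)
    (a b : ⨂[K] (_ : Fin d), R) : actPow f d (a * b) = actPow f d a * actPow f d b := by
  refine PiTensorProduct.linearMap_congr (φ := actPow f d ∘ₗ LinearMap.mulRight K b)
    (φ' := LinearMap.mulRight K (actPow f d b) ∘ₗ actPow f d) (fun x => ?_) a
  refine PiTensorProduct.linearMap_congr
    (φ := actPow f d ∘ₗ LinearMap.mulLeft K (PiTensorProduct.tprod K x))
    (φ' := LinearMap.mulLeft K (actPow f d (PiTensorProduct.tprod K x)) ∘ₗ actPow f d)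
    (fun y => ?_) b
  simp only [LinearMap.comp_apply, LinearMap.mulLeft_apply, PiTensorProduct.tprod_mul_tprod,
    actPow_tprod, Pi.mul_apply, hf]
  exact PiTensorProduct.map_mul _ _

theorem actPow_comm (f : R →ₗ[K] Module.End K M) (f' : R' →ₗ[K] Module.End K M)
    (h : ∀ a b, f a * f' b = f' b * f a) (d : ℕ) (a : ⨂[K] (_ : Fin d), R)
    (b : ⨂[K] (_ : Fin d), R') : actPow f d a * actPow f' d b = actPow f' d b * actPow f d a := by
  refine PiTensorProduct.linearMap_congr (φ := LinearMap.mulRight K (actPow f' d b) ∘ₗ actPow f d)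
    (φ' := LinearMap.mulLeft K (actPow f' d b) ∘ₗ actPow f d) (fun x => ?_) a
  refine PiTensorProduct.linearMap_congr
    (φ := LinearMap.mulLeft K (actPow f d (PiTensorProduct.tprod K x)) ∘ₗ actPow f' d)
    (φ' := LinearMap.mulRight K (actPow f d (PiTensorProduct.tprod K x)) ∘ₗ actPow f' d)
    (fun y => ?_) b
  simp only [LinearMap.comp_apply, LinearMap.mulLeft_apply, LinearMap.mulRight_apply, actPow_tprod]
  rw [← PiTensorProduct.map_mul, ← PiTensorProduct.map_mul]
  simp only [h]

end ActPow

/-! ### Tensor powers of hermitian spaces -/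

namespace HermSpace

variable {K : Type u} [CommRing K] {ι : K →+* K} {R : Type u} [Ring R]
  [Algebra K R] {s : R → R} {ε : signGroup ι} (X : HermSpace ι R s ε)

/-- The right multiplication, as a linear map. -/
def rmulHom : R →ₗ[K] Module.End K X.carrier where
  toFun := X.rmul
  map_add' a b := by ext x; exact add_smul (MulOpposite.op a) (MulOpposite.op b) x
  map_smul' c a := by ext x; exact smul_assoc c (MulOpposite.op a) x

/-- The form of `X^{⊗ d}` in its second variable, on a pure tensor in its first variable. -/
def formPow {d : ℕ} (u : Fin d → X.carrier) :
    (⨂[K] (_ : Fin d), X.carrier) →ₗ[K] ⨂[K] (_ : Fin d), R :=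
  PiTensorProduct.map fun i => X.form (u i)

theorem formPow_tprod {d : ℕ} (u v : Fin d → X.carrier) :
    X.formPow u (PiTensorProduct.tprod K v) = PiTensorProduct.tprod K fun i => X.form (u i) (v i) :=
  PiTensorProduct.map_tprod _ _

theorem formPow_actPow {d : ℕ} (u : Fin d → X.carrier) (a : ⨂[K] (_ : Fin d), R)
    (w : ⨂[K] (_ : Fin d), X.carrier) :
    X.formPow u (actPow X.rmulHom d a w) = X.formPow u w * a := by
  refine PiTensorProduct.linearMap_congr (φ := X.formPow u ∘ₗ (actPow X.rmulHom d).flip w)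
    (φ' := LinearMap.mulLeft K (X.formPow u w)) (fun a => ?_) a
  refine PiTensorProduct.linearMap_congr
    (φ := X.formPow u ∘ₗ actPow X.rmulHom d (PiTensorProduct.tprod K a))
    (φ' := LinearMap.mulRight K (PiTensorProduct.tprod K a) ∘ₗ X.formPow u) (fun w => ?_) w
  simp only [LinearMap.comp_apply, actPow_tprod_tprod, formPow_tprod, LinearMap.mulRight_apply,
    PiTensorProduct.tprod_mul_tprod]
  congr 1
  funext i
  exact X.form_right _ _ _

/-- A dual basis gives dual bases of the tensor powers. -/
theorem sum_actPow_formPow {n d : ℕ} (x y : Fin n → X.carrier)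
    (hxy : ∀ v, ∑ i, MulOpposite.op (X.form (y i) v) • x i = v) (w : ⨂[K] (_ : Fin d), X.carrier) :
    ∑ f : Fin d → Fin n, actPow X.rmulHom d (X.formPow (fun i => y (f i)) w)
      (PiTensorProduct.tprod K fun i => x (f i)) = w := by
  refine PiTensorProduct.linearMap_congr (φ := ∑ f : Fin d → Fin n,
    (actPow X.rmulHom d).flip (PiTensorProduct.tprod K fun i => x (f i)) ∘ₗ
      X.formPow (fun i => y (f i))) (φ' := LinearMap.id) (fun v => ?_) w |> Eq.trans (by
        rw [LinearMap.sum_apply]; rfl)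
  rw [LinearMap.sum_apply, LinearMap.id_apply]
  conv_rhs => rw [show v = fun i => ∑ k, MulOpposite.op (X.form (y k) (v i)) • x k from
    funext fun i => (hxy _).symm]
  rw [MultilinearMap.map_sum]
  refine Finset.sum_congr rfl fun f _ => ?_
  rw [LinearMap.comp_apply, LinearMap.flip_apply, formPow_tprod, actPow_tprod_tprod]
  rfl

end HermSpace

section Flatten

theorem List.prod_ofFn_eq_single {M : Type*} [Monoid M] {n : ℕ} (f : Fin n → M) (i : Fin n)
    (h : ∀ j, j ≠ i → f j = 1) : (List.ofFn f).prod = f i := by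
  induction n with
  | zero => exact i.elim0
  | succ n ih =>
    rw [List.ofFn_succ, List.prod_cons]
    cases i using Fin.cases with
    | zero =>
      rw [List.prod_eq_one, mul_one]
      intro x hx
      obtain ⟨j, rfl⟩ := List.mem_ofFn.mp hx
      exact h _ (Fin.succ_ne_zero j)
    | succ i =>
      rw [h 0 (Fin.succ_ne_zero i).symm, one_mul]
      exact ih (fun j => f j.succ) i fun j hj => h _ fun h' => hj (Fin.succ_injective _ h')

theorem List.prod_ofFn_eq_one {M : Type*} [Monoid M] {n : ℕ} (f : Fin n → M)
    (h : ∀ j, f j = 1) : (List.ofFn f).prod = 1 := by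
  apply List.prod_eq_one
  intro x hx
  obtain ⟨j, rfl⟩ := List.mem_ofFn.mp hx
  exact h j

namespace AzumayaInv

variable {K : Type u} [CommRing K] {ι : K →+* K} (A : AzumayaInv ι)

theorem block_tprod (d n : ℕ) (j : Fin d) (b : Fin n → A.carrier) :
    A.block d n j (PiTensorProduct.tprod K b) = PiTensorProduct.tprod K fun k =>
      if (finProdFinEquiv.symm k).1 = j then b (finProdFinEquiv.symm k).2 else 1 := by
  rw [block, PiTensorProduct.lift.tprod]
  change (List.ofFn fun i => PiTensorProduct.tprodMonoidHom K
    (Pi.mulSingle (M := fun _ => A.carrier) (finProdFinEquiv (j, i)) (b i))).prod = _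
  have h1 : (List.ofFn fun i => PiTensorProduct.tprodMonoidHom K
      (Pi.mulSingle (M := fun _ => A.carrier) (finProdFinEquiv (j, i)) (b i))) =
      (List.ofFn fun i => (Pi.mulSingle (M := fun _ => A.carrier) (finProdFinEquiv (j, i)) (b i))).map
        (PiTensorProduct.tprodMonoidHom K) := by
    rw [List.map_ofFn]; rfl
  rw [h1, ← map_list_prod]
  change PiTensorProduct.tprod K _ = _
  congr 1
  funext k
  obtain ⟨⟨j', i⟩, rfl⟩ := finProdFinEquiv.surjective k
  rw [Equiv.symm_apply_apply]
  have h2 : ∀ l : List (Fin (d * n) → A.carrier), ∀ k, l.prod k = (l.map fun f => f k).prod :=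
    fun l k => map_list_prod (Pi.evalMonoidHom (fun _ : Fin (d * n) => A.carrier) k) l
  rw [h2, List.map_ofFn]
  split_ifs with h
  · subst h
    rw [List.prod_ofFn_eq_single _ i]
    · exact Pi.mulSingle_eq_same _ _
    · intro i' hi'
      refine Pi.mulSingle_eq_of_ne (fun h' => hi' ?_) _
      exact (congrArg Prod.snd (finProdFinEquiv.injective h')).symm
  · refine List.prod_ofFn_eq_one _ fun i' => Pi.mulSingle_eq_of_ne (fun h' => h ?_) _
    exact congrArg Prod.fst (finProdFinEquiv.injective h')

theorem flatten_tprod_tprod (d n : ℕ) (b : Fin d → Fin n → A.carrier) :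
    A.flatten d n (PiTensorProduct.tprod K fun j => PiTensorProduct.tprod K (b j)) =
      PiTensorProduct.tprod K fun k =>
        b (finProdFinEquiv.symm k).1 (finProdFinEquiv.symm k).2 := by
  rw [flatten, PiTensorProduct.lift.tprod]
  change (List.ofFn fun j => A.block d n j (PiTensorProduct.tprod K (b j))).prod = _
  simp only [block_tprod]
  have h1 : ∀ c : Fin d → Fin (d * n) → A.carrier, (List.ofFn fun j => PiTensorProduct.tprod K (c j)).prod =
      PiTensorProduct.tprod K (List.ofFn c).prod := by
    intro c
    have : (List.ofFn fun j => PiTensorProduct.tprod K (c j)) =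
        (List.ofFn c).map (PiTensorProduct.tprodMonoidHom K) := by rw [List.map_ofFn]; rfl
    rw [this, ← map_list_prod]; rfl
  rw [h1]
  congr 1
  funext k
  have h2 : ∀ l : List (Fin (d * n) → A.carrier), ∀ k, l.prod k = (l.map fun f => f k).prod :=
    fun l k => map_list_prod (Pi.evalMonoidHom (fun _ : Fin (d * n) => A.carrier) k) l
  rw [h2, List.map_ofFn, List.prod_ofFn_eq_single _ (finProdFinEquiv.symm k).1]
  · simp
  · intro j hj
    simp only [Function.comp_apply]
    rw [if_neg (Ne.symm hj)]

/-- Linear maps on `(A^{⊗ n})^{⊗ d}` agree if they agree on tensors of tensors. -/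
theorem nested_ext {N : Type*} [AddCommGroup N] [Module K N] {d n : ℕ}
    {φ φ' : (⨂[K] (_ : Fin d), A.pow n) →ₗ[K] N}
    (h : ∀ b : Fin d → Fin n → A.carrier,
      φ (PiTensorProduct.tprod K fun j => PiTensorProduct.tprod K (b j)) =
        φ' (PiTensorProduct.tprod K fun j => PiTensorProduct.tprod K (b j)))
    (z : ⨂[K] (_ : Fin d), A.pow n) : φ z = φ' z := by
  have : φ = φ' := PiTensorProduct.ext_of_span_eq_top
    (g := fun _ (b : Fin n → A.carrier) => PiTensorProduct.tprod K b)
    (fun _ => PiTensorProduct.span_tprod_eq_top) h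
  rw [this]

theorem _root_.PiTensorProduct.isScalarTower_self (K R : Type u) [CommRing K] [Ring R] [Algebra K R]
    (d : ℕ) : IsScalarTower K (⨂[K] (_ : Fin d), R) (⨂[K] (_ : Fin d), R) := inferInstance

theorem _root_.PiTensorProduct.smulCommClass_self (K R : Type u) [CommRing K] [Ring R] [Algebra K R]
    (d : ℕ) : SMulCommClass K (⨂[K] (_ : Fin d), R) (⨂[K] (_ : Fin d), R) := inferInstance

instance (d n : ℕ) : IsScalarTower K (⨂[K] (_ : Fin d), A.pow n) (⨂[K] (_ : Fin d), A.pow n) :=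
  PiTensorProduct.isScalarTower_self K (A.pow n) d

instance (d n : ℕ) : SMulCommClass K (⨂[K] (_ : Fin d), A.pow n) (⨂[K] (_ : Fin d), A.pow n) :=
  PiTensorProduct.smulCommClass_self K (A.pow n) d

theorem flatten_mul (d n : ℕ) (x y : ⨂[K] (_ : Fin d), A.pow n) :
    A.flatten d n (x * y) = A.flatten d n x * A.flatten d n y := by
  refine A.nested_ext (φ := A.flatten d n ∘ₗ LinearMap.mulRight K y)
    (φ' := LinearMap.mulRight K (A.flatten d n y) ∘ₗ A.flatten d n) (fun b => ?_) x
  refine A.nested_ext (φ := A.flatten d n ∘ₗ LinearMap.mulLeft K _)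
    (φ' := LinearMap.mulLeft K (A.flatten d n _) ∘ₗ A.flatten d n) (fun c => ?_) y
  simp only [LinearMap.comp_apply, LinearMap.mulLeft_apply, PiTensorProduct.tprod_mul_tprod,
    flatten_tprod_tprod]
  rw [show ((fun j => PiTensorProduct.tprod K (b j)) * fun j => PiTensorProduct.tprod K (c j)) =
    fun j => PiTensorProduct.tprod K (b j * c j) from
      funext fun j => PiTensorProduct.tprod_mul_tprod _ _, flatten_tprod_tprod]
  rfl

theorem flatten_surjective (d n : ℕ) : Function.Surjective (A.flatten d n) := by
  rw [← LinearMap.range_eq_top, eq_top_iff, ← PiTensorProduct.span_tprod_eq_top, Submodule.span_le]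
  rintro _ ⟨a, rfl⟩
  refine ⟨_, (A.flatten_tprod_tprod d n fun j i => a (finProdFinEquiv (j, i))).trans ?_⟩
  simp only [Prod.mk.eta, Equiv.apply_symm_apply]

theorem psiPow_flatten {L : Type u} [CommRing L] [Algebra K L] {I : Type} [Fintype I] [DecidableEq I]
    (ψ : A.carrier →ₐ[K] Matrix I I L) (d n : ℕ) (z : ⨂[K] (_ : Fin d), A.pow n)
    (f h : Fin (d * n) → I) :
    psiPow ψ (Fin (d * n)) (A.flatten d n z) f h =
      psiPow (psiPow ψ (Fin n)) (Fin d) z (fun j i => f (finProdFinEquiv (j, i)))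
        (fun j i => h (finProdFinEquiv (j, i))) := by
  have h0 (b : Fin d → Fin n → A.carrier) :
      psiPow ψ (Fin (d * n))
        (A.flatten d n (PiTensorProduct.tprod K fun j => PiTensorProduct.tprod K (b j))) f h =
      psiPow (psiPow ψ (Fin n)) (Fin d)
        (PiTensorProduct.tprod K fun j => PiTensorProduct.tprod K (b j))
        (fun j i => f (finProdFinEquiv (j, i))) (fun j i => h (finProdFinEquiv (j, i))) := by
    rw [flatten_tprod_tprod, psiPow_tprod, psiPow_tprod]
    simp only [psiPow_tprod]
    rw [← finProdFinEquiv.prod_comp, Fintype.prod_prod_type]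
    simp
  let φ : (⨂[K] (_ : Fin d), A.pow n) →ₗ[K] L :=
    { toFun := fun z => psiPow ψ (Fin (d * n)) (A.flatten d n z) f h
      map_add' := fun x y => by rw [map_add, map_add]; rfl
      map_smul' := fun c x => by rw [map_smul, map_smul]; rfl }
  let φ' : (⨂[K] (_ : Fin d), A.pow n) →ₗ[K] L :=
    { toFun := fun z => psiPow (psiPow ψ (Fin n)) (Fin d) z (fun j i => f (finProdFinEquiv (j, i)))
        (fun j i => h (finProdFinEquiv (j, i)))
      map_add' := fun x y => by rw [map_add]; rfl
      map_smul' := fun c x => by rw [map_smul]; rfl }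
  exact A.nested_ext (φ := φ) (φ' := φ') h0 z

variable [Nontrivial K] [IsReduced K] [IsArtinianRing K] [InvBase ι]

theorem flatten_injective (d n : ℕ) : Function.Injective (A.flatten d n) := by
  rw [injective_iff_map_eq_zero]
  intro z hz
  apply (A.goldmanPow n).toGoldmanAlg.psiPow_injective (Pt.injective ι) d
  rw [map_zero]
  ext f h
  have h1 := A.psiPow_flatten A.goldman.ψ d n z
    (fun k => f (finProdFinEquiv.symm k).1 (finProdFinEquiv.symm k).2)
    (fun k => h (finProdFinEquiv.symm k).1 (finProdFinEquiv.symm k).2)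
  rw [hz, map_zero] at h1
  simp only [Equiv.symm_apply_apply] at h1
  exact h1.symm

end AzumayaInv

end Flatten

/-! ### Coordinates on hermitian spaces -/

section

variable {K : Type u} [CommRing K] [Nontrivial K]

theorem Matrix.eq_zero_of_span_mul {E I J N : Type*} [CommRing E] [Fintype J] [DecidableEq J]
    [Finite I] [Nonempty I] {S : Set (Matrix I J E)} (hS : Submodule.span E S = ⊤)
    {Z : Matrix J N E} (h : ∀ Y ∈ S, Y * Z = 0) : Z = 0 := by
  classical
  cases nonempty_fintype I
  have key : ∀ Y : Matrix I J E, Y * Z = 0 := by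
    intro Y
    have hY : Y ∈ Submodule.span E S := by rw [hS]; trivial
    induction hY using Submodule.span_induction with
    | mem x hx => exact h x hx
    | zero => exact Matrix.zero_mul _
    | add x y _ _ hx hy => rw [Matrix.add_mul, hx, hy, add_zero]
    | smul r x _ hx => rw [Matrix.smul_mul, hx, smul_zero]
  obtain ⟨i⟩ := ‹Nonempty I›
  ext j n
  have h1 := congrFun (congrFun (key (Matrix.single i j 1)) i) n
  rw [Matrix.single_mul_apply_same, one_mul] at h1
  exact h1

namespace Pt

variable (ι : K →+* K)

/-- A family of matrices over `F × F` spans if both projections span, provided multiples of the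
family by the idempotents are formed. -/
theorem span_eq_top {κ M N : Type*} (Y : κ → Matrix M N (Pt ι))
    (h1 : Submodule.span (Geom K) (Set.range fun k => (Y k).map (Pt.fst ι)) = ⊤)
    (h2 : Submodule.span (Geom K) (Set.range fun k => (Y k).map (Pt.snd ι)) = ⊤) :
    Submodule.span (Pt ι) (Set.range Y) = ⊤ := by
  have key1 : ∀ Z : Matrix M N (Geom K),
      (Matrix.of fun i j => ((Z i j, 0) : Geom K × Geom K) : Matrix M N (Pt ι)) ∈
        Submodule.span (Pt ι) (Set.range Y) := by
    intro Z
    have hZ : Z ∈ Submodule.span (Geom K) (Set.range fun k => (Y k).map (Pt.fst ι)) := by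
      rw [h1]; trivial
    induction hZ using Submodule.span_induction with
    | zero => exact zero_mem _
    | add x y _ _ hx hy =>
      convert add_mem hx hy using 1
      ext i j
      exact Prod.ext rfl (add_zero 0).symm
    | smul r x _ hx =>
      convert Submodule.smul_mem _ (show Pt ι from ((r, 0) : Geom K × Geom K)) hx using 1
      ext i j
      exact Prod.ext rfl (mul_zero _).symm
    | mem x hx =>
      obtain ⟨a, rfl⟩ := hx
      convert Submodule.smul_mem _ (show Pt ι from ((1, 0) : Geom K × Geom K))
        (Submodule.subset_span (Set.mem_range_self (f := Y) a)) using 1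
      ext i j
      exact Prod.ext (one_mul _).symm (zero_mul _).symm
  have key2 : ∀ Z : Matrix M N (Geom K),
      (Matrix.of fun i j => ((0, Z i j) : Geom K × Geom K) : Matrix M N (Pt ι)) ∈
        Submodule.span (Pt ι) (Set.range Y) := by
    intro Z
    have hZ : Z ∈ Submodule.span (Geom K) (Set.range fun k => (Y k).map (Pt.snd ι)) := by
      rw [h2]; trivial
    induction hZ using Submodule.span_induction with
    | zero => exact zero_mem _
    | add x y _ _ hx hy =>
      convert add_mem hx hy using 1
      ext i j
      exact Prod.ext (add_zero 0).symm rfl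
    | smul r x _ hx =>
      convert Submodule.smul_mem _ (show Pt ι from ((0, r) : Geom K × Geom K)) hx using 1
      ext i j
      exact Prod.ext (mul_zero _).symm rfl
    | mem x hx =>
      obtain ⟨a, rfl⟩ := hx
      convert Submodule.smul_mem _ (show Pt ι from ((0, 1) : Geom K × Geom K))
        (Submodule.subset_span (Set.mem_range_self (f := Y) a)) using 1
      ext i j
      exact Prod.ext (zero_mul _).symm (one_mul _).symm
  rw [eq_top_iff]
  intro Z _
  convert add_mem (key1 (Matrix.of fun i j => Pt.fst ι (Z i j)))
    (key2 (Matrix.of fun i j => Pt.snd ι (Z i j))) using 1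
  ext i j
  exact Prod.ext (add_zero _).symm (zero_add _).symm

theorem span_map_fst {κ M N : Type*} {Y : κ → Matrix M N (Pt ι)}
    (h : Submodule.span (Pt ι) (Set.range Y) = ⊤) :
    Submodule.span (Geom K) (Set.range fun k => (Y k).map (Pt.fst ι)) = ⊤ := by
  have key : ∀ Z : Matrix M N (Pt ι), Z.map (Pt.fst ι) ∈
      Submodule.span (Geom K) (Set.range fun k => (Y k).map (Pt.fst ι)) := by
    intro Z
    have hZ : Z ∈ Submodule.span (Pt ι) (Set.range Y) := by rw [h]; trivial
    induction hZ using Submodule.span_induction with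
    | zero => rw [Matrix.map_zero _ (map_zero _)]; exact zero_mem _
    | add x y _ _ hx hy =>
      convert add_mem hx hy using 1; exact Matrix.map_add _ (map_add _) _ _
    | smul r x _ hx =>
      convert Submodule.smul_mem _ (Pt.fst ι r) hx using 1
      ext i j
      exact map_mul (Pt.fst ι) _ _
    | mem x hx =>
      obtain ⟨a, rfl⟩ := hx
      exact Submodule.subset_span ⟨a, rfl⟩
  rw [eq_top_iff]
  intro Z _
  exact key (Matrix.of fun i j => ((Z i j, 0) : Geom K × Geom K))

end Pt

theorem Matrix.span_transpose {E κ M N : Type*} [CommRing E] {Y : κ → Matrix M N E}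
    (h : Submodule.span E (Set.range Y) = ⊤) :
    Submodule.span E (Set.range fun k => (Y k).transpose) = ⊤ := by
  have h1 := congrArg (Submodule.map (Matrix.transposeLinearEquiv M N E E).toLinearMap) h
  rw [Submodule.map_span, Submodule.map_top, LinearEquiv.range] at h1
  rw [← h1, ← Set.range_comp]
  rfl

variable [IsReduced K] {ι : K →+* K} [InvBase ι]
  {R : Type u} [Ring R] [Algebra K R] {s : R → R} {ε : signGroup ι}

namespace HermSpace

/-- Coordinates on a hermitian space over a split algebra: after scalar extension, the right module
becomes the module of `J × I` matrices over the `I × I` matrices, and the form becomes the product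
of matrices. -/
structure Coord (X : HermSpace ι R s ε) (G : GoldmanInv ι R s) where
  J : Type
  [fintypeJ : Fintype J]
  [decEqJ : DecidableEq J]
  χ : X.carrier →ₗ[K] Matrix J G.I (Pt ι)
  χ_smul : ∀ v (a : R), χ (MulOpposite.op a • v) = χ v * G.ψ a
  span_χ : Submodule.span (Pt ι) (Set.range χ) = ⊤
  exists_η : ∀ x, ∃ E : Matrix G.I J (Pt ι), ∀ y, G.ψ (X.form x y) = E * χ y

attribute [instance] Coord.fintypeJ Coord.decEqJ

variable {X : HermSpace ι R s ε} {G : GoldmanInv ι R s}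

/-- Coordinates from a factorization of a Gram matrix of a generating family. -/
theorem exists_coord [Nonempty G.I] {T : Type*} {c : T → X.carrier} (hc : X.Generates c) {J : Type}
    [Fintype J] [DecidableEq J] (P : T → Matrix G.I J (Pt ι)) (Q : T → Matrix J G.I (Pt ι))
    (hg : ∀ i j, G.ψ (X.form (c i) (c j)) = P i * Q j)
    (hP : Submodule.span (Pt ι) (Set.range fun p : R × T => G.ψ p.1 * P p.2) = ⊤)
    (hQ : Submodule.span (Pt ι) (Set.range fun p : R × T => Q p.2 * G.ψ p.1) = ⊤) :
    ∃ C : X.Coord G, C.J = J := by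
  -- the coordinates of `v` are the matrix `Z` for which the products with the generators are
  -- `P i * Z`; it is unique because the `P i` span
  have ex : ∀ v, ∃ Z : Matrix J G.I (Pt ι), ∀ i, G.ψ (X.form (c i) v) = P i * Z := by
    intro v
    induction v using hc.induction with
    | mem j => exact ⟨Q j, fun i => hg i j⟩
    | add x y hx hy =>
      obtain ⟨Z, hZ⟩ := hx
      obtain ⟨Z', hZ'⟩ := hy
      exact ⟨Z + Z', fun i => by rw [map_add, map_add, hZ, hZ', Matrix.mul_add]⟩
    | zero => exact ⟨0, fun i => by rw [map_zero, map_zero, Matrix.mul_zero]⟩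
    | smul a x hx =>
      obtain ⟨Z, hZ⟩ := hx
      exact ⟨Z * G.ψ a, fun i => by rw [X.form_right, map_mul, hZ, Matrix.mul_assoc]⟩
  have uniq : ∀ Z Z' : Matrix J G.I (Pt ι), (∀ i, P i * Z = P i * Z') → Z = Z' := by
    intro Z Z' h
    rw [← sub_eq_zero]
    refine Matrix.eq_zero_of_span_mul hP ?_
    rintro _ ⟨⟨a, i⟩, rfl⟩
    simp only
    rw [Matrix.mul_assoc, Matrix.mul_sub, h, sub_self, Matrix.mul_zero]
  choose χ hχ using ex
  have hχc : ∀ j, χ (c j) = Q j := fun j => uniq _ _ fun i => by rw [← hχ, hg]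
  have hsm : ∀ v (a : R), χ (MulOpposite.op a • v) = χ v * G.ψ a := fun v a => uniq _ _ fun i => by
    rw [← hχ, X.form_right, map_mul, hχ, Matrix.mul_assoc]
  refine ⟨{ J := J
            χ := { toFun := χ
                   map_add' := fun x y => uniq _ _ fun i => by
                     rw [← hχ, map_add, map_add, hχ, hχ, Matrix.mul_add]
                   map_smul' := fun r x => uniq _ _ fun i => by
                     rw [← hχ, map_smul, map_smul, hχ, RingHom.id_apply, Matrix.mul_smul] }
            χ_smul := hsm
            span_χ := ?_
            exists_η := fun x => ?_ }, rfl⟩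
  · rw [eq_top_iff, ← hQ, Submodule.span_le]
    rintro _ ⟨⟨a, j⟩, rfl⟩
    refine Submodule.subset_span ⟨MulOpposite.op a • c j, ?_⟩
    change χ _ = _
    rw [hsm, hχc]
  · change ∃ E : Matrix G.I J (Pt ι), ∀ y, G.ψ (X.form x y) = E * χ y
    induction x using hc.induction with
    | mem i => exact ⟨P i, fun y => hχ y i⟩
    | add x y hx hy =>
      obtain ⟨E, hE⟩ := hx
      obtain ⟨E', hE'⟩ := hy
      exact ⟨E + E', fun y => by rw [map_add, LinearMap.add_apply, map_add, hE, hE', Matrix.add_mul]⟩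
    | zero => exact ⟨0, fun y => by
        rw [map_zero, LinearMap.zero_apply, map_zero, Matrix.zero_mul]⟩
    | smul a x hx =>
      obtain ⟨E, hE⟩ := hx
      exact ⟨G.ψ (s a) * E, fun y => by rw [X.form_left, map_mul, hE, Matrix.mul_assoc]⟩

namespace Coord

variable (C : X.Coord G)

/-- The coordinates of a vector as the first argument of the form. -/
def η (x : X.carrier) : Matrix G.I C.J (Pt ι) := (C.exists_η x).choose

theorem form_eq (x y : X.carrier) : G.ψ (X.form x y) = C.η x * C.χ y :=
  (C.exists_η x).choose_spec y

theorem mul_η_ext [Nonempty G.I] {M : Type*} {E E' : Matrix M C.J (Pt ι)}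
    (h : ∀ v, E * C.χ v = E' * C.χ v) : E = E' := by
  rw [← sub_eq_zero, ← Matrix.transpose_eq_zero]
  refine Matrix.eq_zero_of_span_mul (I := G.I) (Matrix.span_transpose C.span_χ) ?_
  rintro _ ⟨v, rfl⟩
  rw [← Matrix.transpose_mul, Matrix.sub_mul, h, sub_self, Matrix.transpose_zero]

theorem η_eq [Nonempty G.I] {x : X.carrier} {E : Matrix G.I C.J (Pt ι)}
    (h : ∀ y, G.ψ (X.form x y) = E * C.χ y) : C.η x = E :=
  C.mul_η_ext fun v => by rw [← C.form_eq, h]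

variable [Nonempty G.I]

theorem η_op_smul (a : R) (x : X.carrier) : C.η (MulOpposite.op a • x) = G.ψ (s a) * C.η x :=
  C.η_eq fun z => by rw [X.form_left, map_mul, C.form_eq, Matrix.mul_assoc]

theorem sum_χ_mul_η {n : ℕ} {x y : Fin n → X.carrier}
    (hxy : ∀ v, ∑ i, MulOpposite.op (X.form (y i) v) • x i = v) :
    ∑ i, C.χ (x i) * C.η (y i) = 1 :=
  C.mul_η_ext fun v => by
    conv_rhs => rw [Matrix.one_mul, ← hxy v, map_sum]
    rw [Matrix.sum_mul]
    refine Finset.sum_congr rfl fun i _ => ?_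
    rw [C.χ_smul, C.form_eq, Matrix.mul_assoc]

theorem span_η [IsArtinianRing K] : Submodule.span (Pt ι) (Set.range C.η) = ⊤ := by
  obtain ⟨n, x, y, hxy⟩ := X.exists_dual_basis G
  rw [eq_top_iff]
  intro E _
  rw [show E = ∑ i, (E * C.χ (x i)) * C.η (y i) by
    simp only [Matrix.mul_assoc]
    rw [← Matrix.mul_sum, C.sum_χ_mul_η hxy, Matrix.mul_one]]
  refine Submodule.sum_mem _ fun i _ => ?_
  generalize E * C.χ (x i) = Z
  have hZ : Z ∈ Submodule.span (Pt ι) (Set.range G.ψ) := by rw [G.span_ψ]; trivial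
  induction hZ using Submodule.span_induction with
  | mem x hx =>
    obtain ⟨a, rfl⟩ := hx
    rw [← G.inv_inv a, ← C.η_op_smul]
    exact Submodule.subset_span ⟨_, rfl⟩
  | zero => rw [Matrix.zero_mul]; exact zero_mem _
  | add x y _ _ hx hy => rw [Matrix.add_mul]; exact add_mem hx hy
  | smul r x _ hx => rw [Matrix.smul_mul]; exact Submodule.smul_mem _ r hx

theorem χ_injective : Function.Injective C.χ := by
  rw [injective_iff_map_eq_zero]
  intro v hv
  refine X.eq_zero_of_form_right G.inv_zero X.generates_id fun x => G.inj ?_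
  rw [C.form_eq, hv, Matrix.mul_zero, map_zero]

/-- The rank of a hermitian space. -/
theorem free_finrank [IsArtinianRing K] :
    Module.Free K X.carrier ∧
      Module.finrank K X.carrier = Fintype.card C.J * Fintype.card G.I := by
  obtain ⟨n, x, y, hxy⟩ := X.exists_trace_basis G
  rw [← Fintype.card_prod]
  exact free_of_coordinates (L := Pt ι) (N := Matrix C.J G.I (Pt ι)) (n := C.J × G.I)
    (LinearEquiv.curry (Pt ι) (Pt ι) C.J G.I).symm C.χ C.span_χ x
    (fun i => G.t ∘ₗ X.form (y i))
    (fun i => Matrix.traceLinearMap G.I (Pt ι) (Pt ι) ∘ₗ mulLeftLinearMap G.I (Pt ι) (C.η (y i)))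
    (fun i m => by
      change (C.η (y i) * C.χ m).trace = algebraMap K (Pt ι) (G.t (X.form (y i) m))
      rw [← G.trace_ψ, C.form_eq])
    hxy

end Coord

/-- An idempotent matrix over a field splits: it is the composition of a projection to coordinates of
its image and the inclusion of the image. -/
theorem _root_.Matrix.exists_mul_eq_of_isIdempotentElem {F N : Type*} [Field F] [Fintype N]
    [DecidableEq N] (e : Matrix N N F) (he : e * e = e) :
    ∃ (r : ℕ) (P : Matrix N (Fin r) F) (Q : Matrix (Fin r) N F), P * Q = e ∧ Q * P = 1 := by
  let W := LinearMap.range e.mulVecLin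
  let b := Module.finBasis F W
  have hv : ∀ w : W, e.mulVec w = w := by
    rintro ⟨_, v, rfl⟩
    change e.mulVec (e.mulVec v) = e.mulVec v
    rw [Matrix.mulVec_mulVec, he]
  refine ⟨_, Matrix.of fun a j => (b j : N → F) a,
    Matrix.of fun j a => b.repr ⟨e.mulVec (Pi.single a 1), Pi.single a 1, rfl⟩ j, ?_, ?_⟩
  · ext a a'
    have h := congrArg (fun w : W => (w : N → F) a)
      (b.sum_repr ⟨e.mulVec (Pi.single a' 1), Pi.single a' 1, rfl⟩)
    simp only [Submodule.coe_sum, Finset.sum_apply, Submodule.coe_smul, Pi.smul_apply,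
      smul_eq_mul, Matrix.mulVec_single_one] at h
    rw [Matrix.mul_apply]
    simp only [Matrix.of_apply, Matrix.mulVec_single_one]
    rw [Matrix.col_apply] at h
    rw [← h]
    exact Finset.sum_congr rfl fun j _ => mul_comm _ _
  · ext i j
    rw [Matrix.mul_apply]
    have h : ∑ a, (b j : N → F) a • (⟨e.mulVec (Pi.single a 1), Pi.single a 1, rfl⟩ : W) = b j := by
      apply Subtype.ext
      rw [Submodule.coe_sum]
      conv_rhs => rw [← hv (b j)]
      funext k
      simp only [Submodule.coe_smul, Finset.sum_apply, Pi.smul_apply, Matrix.mulVec_single_one,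
        smul_eq_mul, Matrix.col_apply]
      exact Finset.sum_congr rfl fun a _ => mul_comm _ _
    have h2 := congrArg (fun w => b.repr w i) h
    simp only [map_sum, map_smul, Finsupp.coe_finsetSum, Finset.sum_apply, Finsupp.smul_apply,
      smul_eq_mul, Module.Basis.repr_self] at h2
    simp only [Matrix.of_apply]
    rw [Finsupp.single_apply] at h2
    rw [Matrix.one_apply]
    simp only [eq_comm (a := i)]
    refine Eq.trans ?_ h2
    exact Finset.sum_congr rfl fun a _ => mul_comm _ _

/-- Every hermitian space has coordinates. Over the first factor, a dual basis exhibits the base change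
of the space as the image of the idempotent matrix of products of the dual basis; over the second
factor, the form with exchanged arguments gives the transposed coordinates. -/
theorem nonempty_coord (X : HermSpace ι R s ε) (G : GoldmanInv ι R s) [Nonempty G.I]
    [IsArtinianRing K] : Nonempty (X.Coord G) := by
  obtain ⟨n, x, y, hxy⟩ := X.exists_dual_basis G
  let ψ₁ : R →+* Matrix G.I G.I (Geom K) := (Pt.fst ι).mapMatrix.comp G.ψ.toRingHom
  have hspan : ∀ Z, Z ∈ Submodule.span (Geom K) (Set.range ψ₁) := fun Z => by
    have := Pt.span_map_fst ι G.span_ψ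
    change Submodule.span (Geom K) (Set.range ψ₁) = ⊤ at this
    rw [this]; trivial
  let col : X.carrier → Matrix (Fin n × G.I) G.I (Geom K) :=
    fun v => Matrix.of fun k q => ψ₁ (X.form (y k.1) v) k.2 q
  let row : X.carrier → Matrix G.I (Fin n × G.I) (Geom K) :=
    fun v => Matrix.of fun p k => ψ₁ (X.form v (x k.1)) p k.2
  let e : Matrix (Fin n × G.I) (Fin n × G.I) (Geom K) :=
    Matrix.of fun k l => ψ₁ (X.form (y k.1) (x l.1)) k.2 l.2
  have hsum : ∀ v w, X.form v w = ∑ i, X.form v (x i) * X.form (y i) w := by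
    intro v w
    conv_lhs => rw [← hxy w, map_sum]
    exact Finset.sum_congr rfl fun i _ => X.form_right _ _ _
  have hent : ∀ v w p q, ψ₁ (X.form v w) p q =
      ∑ k : Fin n × G.I, ψ₁ (X.form v (x k.1)) p k.2 * ψ₁ (X.form (y k.1) w) k.2 q := by
    intro v w p q
    rw [hsum, map_sum, Matrix.sum_apply, Fintype.sum_prod_type]
    exact Finset.sum_congr rfl fun i _ => by rw [map_mul, Matrix.mul_apply]
  have hrc : ∀ v w, row v * col w = ψ₁ (X.form v w) := fun v w => by
    ext p q; rw [hent]; rfl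
  have hec : ∀ w, e * col w = col w := fun w => by
    ext k q
    change _ = ψ₁ (X.form (y k.1) w) k.2 q
    rw [hent]; rfl
  have hee : e * e = e := by
    ext k l
    change _ = ψ₁ (X.form (y k.1) (x l.1)) k.2 l.2
    rw [hent]; rfl
  -- `Q * col v` and `row v * P` are the coordinates of `v` in the two arguments of the form
  obtain ⟨r, P, Q, hPQ, hQP⟩ := Matrix.exists_mul_eq_of_isIdempotentElem e hee
  have hQe : Q * e = Q := by rw [← hPQ, ← Matrix.mul_assoc, hQP, Matrix.one_mul]
  have heP : e * P = P := by rw [← hPQ, Matrix.mul_assoc, hQP, Matrix.mul_one]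
  have hcol : ∀ v a, col (MulOpposite.op a • v) = col v * ψ₁ a := fun v a => by
    ext k q
    change ψ₁ (X.form (y k.1) (MulOpposite.op a • v)) k.2 q = _
    rw [X.form_right, map_mul]; rfl
  have hrow : ∀ v a, row (MulOpposite.op (s a) • v) = ψ₁ a * row v := fun v a => by
    ext p k
    change ψ₁ (X.form (MulOpposite.op (s a) • v) (x k.1)) p k.2 = _
    rw [X.form_left, G.inv_inv, map_mul]; rfl
  -- the two families of coordinates over the first factor span
  have h1 : Submodule.span (Geom K) (Set.range fun v => Q * col v) = ⊤ := by
    rw [eq_top_iff]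
    intro Z _
    have hZ : Z = ∑ j, Q * (col (x j) * Matrix.of fun q p => (P * Z) (j, q) p) := by
      conv_lhs => rw [← Matrix.one_mul Z, ← hQP, Matrix.mul_assoc, ← hQe, Matrix.mul_assoc]
      rw [← Matrix.mul_sum]
      congr 1
      ext k p
      rw [Matrix.sum_apply, Matrix.mul_apply, Fintype.sum_prod_type]
      rfl
    rw [hZ]
    refine Submodule.sum_mem _ fun j _ => ?_
    generalize (Matrix.of fun q p => (P * Z) (j, q) p) = M
    induction hspan M using Submodule.span_induction with
    | mem m hm =>
      obtain ⟨a, rfl⟩ := hm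
      rw [← hcol]
      exact Submodule.subset_span ⟨_, rfl⟩
    | zero => rw [Matrix.mul_zero, Matrix.mul_zero]; exact zero_mem _
    | add m m' _ _ hm hm' => rw [Matrix.mul_add, Matrix.mul_add]; exact add_mem hm hm'
    | smul c m _ hm => rw [Matrix.mul_smul, Matrix.mul_smul]; exact Submodule.smul_mem _ c hm
  have h2 : Submodule.span (Geom K) (Set.range fun v => row v * P) = ⊤ := by
    rw [eq_top_iff]
    intro Z _
    have hZ : Z = ∑ j, ((Matrix.of fun p q => (Z * Q) p (j, q)) * row (y j)) * P := by
      conv_lhs => rw [← Matrix.mul_one Z, ← hQP, ← Matrix.mul_assoc, ← heP, ← Matrix.mul_assoc]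
      rw [← Matrix.sum_mul]
      congr 1
      ext p k
      rw [Matrix.sum_apply, Matrix.mul_apply, Fintype.sum_prod_type]
      rfl
    rw [hZ]
    refine Submodule.sum_mem _ fun j _ => ?_
    generalize (Matrix.of fun p q => (Z * Q) p (j, q)) = M
    induction hspan M using Submodule.span_induction with
    | mem m hm =>
      obtain ⟨a, rfl⟩ := hm
      rw [← hrow]
      exact Submodule.subset_span ⟨_, rfl⟩
    | zero => rw [Matrix.zero_mul, Matrix.zero_mul]; exact zero_mem _
    | add m m' _ _ hm hm' => rw [Matrix.add_mul, Matrix.add_mul]; exact add_mem hm hm'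
    | smul c m _ hm => rw [Matrix.smul_mul, Matrix.smul_mul]; exact Submodule.smul_mem _ c hm
  let z : Geom K := algebraMap K (Geom K) ((ε : Kˣ) : K)
  have hz : z⁻¹ * z = 1 := inv_mul_cancel₀ (((ε : Kˣ).isUnit.map (algebraMap K (Geom K))).ne_zero)
  -- over the second factor, the form is the transpose of the form with exchanged arguments
  obtain ⟨C, -⟩ := exists_coord (G := G) X.generates_id (J := Fin r)
    (fun v => Matrix.of fun p j => (((row v * P) p j, (Q * col v) j p) : Geom K × Geom K))
    (fun v => Matrix.of fun j p => (((Q * col v) j p, z * (row v * P) p j) : Geom K × Geom K))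
    (fun v w => by
      ext p q
      have hr : ∀ v w, (row v * P) * (Q * col w) = ψ₁ (X.form v w) := fun v w => by
        rw [Matrix.mul_assoc, ← Matrix.mul_assoc P, hPQ, hec, hrc]
      rw [Matrix.mul_apply]
      refine Prod.ext ?_ ?_
      · change ψ₁ (X.form v w) p q = Pt.fst ι _
        rw [map_sum, ← hr]; rfl
      · change Pt.snd ι (G.ψ (X.form v w) p q) = Pt.snd ι _
        have h3 : Pt.snd ι (G.ψ (X.form v w) p q) = ψ₁ (s (X.form v w)) q p := by
          change _ = Pt.fst ι (G.ψ (s (X.form v w)) q p)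
          rw [G.ψ_inv]; rfl
        have h4 : ψ₁ (((ε : Kˣ) : K) • X.form w v) q p = z * ψ₁ (X.form w v) q p := by
          change Pt.fst ι (G.ψ (((ε : Kˣ) : K) • X.form w v) q p) = _
          rw [map_smul, Matrix.smul_apply, Algebra.smul_def, map_mul]; rfl
        rw [h3, X.form_symm, h4, ← hr, Matrix.mul_apply, Finset.mul_sum, map_sum]
        refine Finset.sum_congr rfl fun j _ => ?_
        change z * ((row w * P) q j * (Q * col v) j p) = (Q * col v) j p * (z * (row w * P) q j)
        ring)
    (by
      rw [eq_top_iff, ← Pt.span_eq_top ι (fun v => Matrix.of fun p j =>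
        (((row v * P) p j, (Q * col v) j p) : Geom K × Geom K)) h2 (Matrix.span_transpose h1)]
      refine Submodule.span_mono ?_
      rintro _ ⟨v, rfl⟩
      exact ⟨(1, v), by simp only [map_one, Matrix.one_mul]⟩)
    (by
      rw [eq_top_iff, ← Pt.span_eq_top ι (fun v => Matrix.of fun j p =>
        (((Q * col v) j p, z * (row v * P) p j) : Geom K × Geom K)) h1 (by
          rw [eq_top_iff, ← Matrix.span_transpose h2, Submodule.span_le]
          rintro _ ⟨v, rfl⟩
          have : (row v * P).transpose = z⁻¹ • (z • (row v * P).transpose) := by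
            rw [smul_smul, hz, one_smul]
          simp only
          rw [this]
          exact Submodule.smul_mem _ _ (Submodule.subset_span ⟨v, rfl⟩))]
      refine Submodule.span_mono ?_
      rintro _ ⟨v, rfl⟩
      exact ⟨(1, v), by simp only [map_one, Matrix.mul_one]⟩)
  exact ⟨C⟩

namespace Coord

variable {X : HermSpace ι R s ε} {G : GoldmanInv ι R s} (C : X.Coord G) [Nonempty G.I]

/-- The action of endomorphisms in coordinates. -/
theorem exists_endHom [IsArtinianRing K] :
    ∃ ρ : X.endAlg →ₐ[K] Matrix C.J C.J (Pt ι), ∀ f v, C.χ (f v) = ρ f * C.χ v := by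
  obtain ⟨n, x, y, hxy⟩ := X.exists_dual_basis G
  have key : ∀ (f : X.endAlg) v, C.χ (f v) = (∑ i, C.χ (f (x i)) * C.η (y i)) * C.χ v := by
    intro f v
    conv_lhs => rw [← hxy v, map_sum, map_sum]
    rw [Matrix.sum_mul]
    refine Finset.sum_congr rfl fun i _ => ?_
    rw [map_smul, C.χ_smul, C.form_eq, Matrix.mul_assoc]
  have uniq : ∀ {f : X.endAlg} {Z}, (∀ v, C.χ (f v) = Z * C.χ v) →
      ∑ i, C.χ (f (x i)) * C.η (y i) = Z := fun h => C.mul_η_ext fun v => by rw [← key, h]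
  refine ⟨AlgHom.ofLinearMap
    { toFun := fun f => ∑ i, C.χ (f (x i)) * C.η (y i)
      map_add' := fun f g => uniq fun v => by
        rw [LinearMap.add_apply, map_add, Matrix.add_mul, ← key, ← key]
      map_smul' := fun c f => uniq fun v => by
        rw [LinearMap.smul_apply, map_smul, RingHom.id_apply, Matrix.smul_mul, ← key] }
    (uniq fun v => by rw [Matrix.one_mul]; rfl)
    (fun f g => uniq fun v => by
      change C.χ (f (g v)) = _
      rw [key, key g, ← Matrix.mul_assoc]; rfl), key⟩

/-- The action of endomorphisms in coordinates. -/
def endHom [IsArtinianRing K] : X.endAlg →ₐ[K] Matrix C.J C.J (Pt ι) := C.exists_endHom.choose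

theorem χ_apply [IsArtinianRing K] (f : X.endAlg) (v : X.carrier) :
    C.χ (f v) = C.endHom f * C.χ v := C.exists_endHom.choose_spec f v

/-- The rank one endomorphism `v ↦ x h(y, v)`. -/
def _root_.HermSpace.rankOne (X : HermSpace ι R s ε) (x y : X.carrier) : X.endAlg where
  toFun v := MulOpposite.op (X.form y v) • x
  map_add' v w := by rw [map_add, MulOpposite.op_add, add_smul]
  map_smul' a v := by
    have := X.form_right y v a.unop
    rw [MulOpposite.op_unop] at this
    rw [this, MulOpposite.op_mul, mul_smul]; rfl

theorem _root_.HermSpace.rankOne_apply (X : HermSpace ι R s ε) (x y v : X.carrier) :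
    X.rankOne x y v = MulOpposite.op (X.form y v) • x := rfl

theorem endHom_rankOne [IsArtinianRing K] (x y : X.carrier) :
    C.endHom (X.rankOne x y) = C.χ x * C.η y :=
  C.mul_η_ext fun v => by
    rw [← C.χ_apply, rankOne_apply, C.χ_smul, C.form_eq, Matrix.mul_assoc]

theorem span_endHom [IsArtinianRing K] :
    Submodule.span (Pt ι) (Set.range C.endHom) = ⊤ := by
  have h1 : ∀ (x : X.carrier) (Z : Matrix G.I C.J (Pt ι)),
      C.χ x * Z ∈ Submodule.span (Pt ι) (Set.range C.endHom) := by
    intro x Z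
    have hZ : Z ∈ Submodule.span (Pt ι) (Set.range C.η) := by rw [C.span_η]; trivial
    induction hZ using Submodule.span_induction with
    | mem m hm =>
      obtain ⟨y, rfl⟩ := hm
      rw [← C.endHom_rankOne]
      exact Submodule.subset_span ⟨_, rfl⟩
    | zero => rw [Matrix.mul_zero]; exact zero_mem _
    | add m m' _ _ hm hm' => rw [Matrix.mul_add]; exact add_mem hm hm'
    | smul c m _ hm => rw [Matrix.mul_smul]; exact Submodule.smul_mem _ c hm
  obtain ⟨n, x, y, hxy⟩ := X.exists_dual_basis G
  rw [eq_top_iff]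
  intro E _
  rw [← Matrix.one_mul E, ← C.sum_χ_mul_η hxy, Matrix.sum_mul]
  refine Submodule.sum_mem _ fun i _ => ?_
  rw [Matrix.mul_assoc]
  exact h1 _ _

/-- The reduced trace of the endomorphism algebra, with dual bases of rank one endomorphisms. -/
theorem exists_endTrace [IsArtinianRing K] :
    ∃ (t : X.endAlg →ₗ[K] K) (κ : Type) (_ : Fintype κ) (a b : κ → X.endAlg),
      (∀ f, (C.endHom f).trace = algebraMap K (Pt ι) (t f)) ∧ ∀ f, ∑ k, t (f * a k) • b k = f := by
  obtain ⟨n, x, y, hxy⟩ := X.exists_dual_basis G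
  let t : X.endAlg →ₗ[K] K :=
    { toFun := fun f => ∑ j, G.t (X.form (y j) (f (x j)))
      map_add' := fun f g => by
        simp only [LinearMap.add_apply, map_add, Finset.sum_add_distrib]
      map_smul' := fun c f => by
        simp only [LinearMap.smul_apply, map_smul, Finset.smul_sum, RingHom.id_apply] }
  have ht : ∀ f, (C.endHom f).trace = algebraMap K (Pt ι) (t f) := by
    intro f
    conv_lhs => rw [← Matrix.mul_one (C.endHom f), ← C.sum_χ_mul_η hxy, Matrix.mul_sum]
    rw [Matrix.trace_sum]
    change _ = algebraMap K (Pt ι) (∑ j, G.t (X.form (y j) (f (x j))))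
    rw [map_sum]
    refine Finset.sum_congr rfl fun j _ => ?_
    rw [← Matrix.mul_assoc, ← C.χ_apply, Matrix.trace_mul_comm, ← C.form_eq, G.trace_ψ]
  have ht' : ∀ (f : X.endAlg) u w, t (f * X.rankOne u w) = G.t (X.form w (f u)) := by
    intro f u w
    apply Pt.injective ι
    rw [← ht, map_mul, C.endHom_rankOne, ← Matrix.mul_assoc, ← C.χ_apply, Matrix.trace_mul_comm,
      ← C.form_eq, G.trace_ψ]
  refine ⟨t, (Fin n × Fin n) × G.κ, inferInstance,
    fun k => X.rankOne (MulOpposite.op (G.a k.2) • x k.1.1) (y k.1.2),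
    fun k => X.rankOne (MulOpposite.op (G.b k.2) • x k.1.2) (y k.1.1), ht, fun f => ?_⟩
  ext v
  rw [Fintype.sum_prod_type, Fintype.sum_prod_type]
  conv_rhs => rw [← hxy v, map_sum]
  rw [LinearMap.sum_apply]
  refine Finset.sum_congr rfl fun i _ => ?_
  conv_rhs => rw [map_smul, ← hxy (f (x i)), Finset.smul_sum]
  rw [LinearMap.sum_apply]
  refine Finset.sum_congr rfl fun j _ => ?_
  rw [LinearMap.sum_apply]
  simp only [LinearMap.smul_apply, rankOne_apply, ht', map_smul, X.form_right]
  conv_rhs => rw [← G.frob (X.form (y j) (f (x i))), Finset.op_sum, Finset.sum_smul, Finset.smul_sum]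
  refine Finset.sum_congr rfl fun k _ => ?_
  rw [MulOpposite.op_smul, smul_assoc]
  exact smul_comm _ _ _

/-- The endomorphism algebra of a hermitian space is split over `F × F`. -/
abbrev endGoldman [IsArtinianRing K] : GoldmanAlg K (Pt ι) X.endAlg where
  I := C.J
  ψ := C.endHom
  span_ψ := C.span_endHom
  t := C.exists_endTrace.choose
  trace_ψ := C.exists_endTrace.choose_spec.choose_spec.choose_spec.choose_spec.choose_spec.1
  κ := C.exists_endTrace.choose_spec.choose
  fintypeκ := C.exists_endTrace.choose_spec.choose_spec.choose
  a := C.exists_endTrace.choose_spec.choose_spec.choose_spec.choose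
  b := C.exists_endTrace.choose_spec.choose_spec.choose_spec.choose_spec.choose
  frob := C.exists_endTrace.choose_spec.choose_spec.choose_spec.choose_spec.choose_spec.2

end Coord

end HermSpace

end

/-! ### Tensor products of hermitian spaces -/

section

variable {K : Type u} [CommRing K] [Nontrivial K] [IsReduced K] {ι : K →+* K} [InvBase ι]
  {R : Type u} [Ring R] [Algebra K R] {s : R → R}

/-- Existence of the hermitian space that is spanned by the images of pure tensors with prescribed
inner products. -/
theorem HermSpace.exists_of_pairing [IsArtinianRing K] (G : GoldmanInv ι R s) (ε : signGroup ι)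
    {T : Type u} {M : Type u} [AddCommGroup M] [Module K M] (κ : T → M)
    (hκ : Submodule.span K (Set.range κ) = ⊤) (Φ : T → M →ₗ[K] R)
    (hsymm : ∀ i j, s (Φ i (κ j)) = ((ε : Kˣ) : K) • Φ j (κ i))
    {F : Type*} [Fintype F] (f : F → T)
    (hfin : ∀ j, ∃ r : F → R, ∀ i, Φ i (κ j) = ∑ k, Φ i (κ (f k)) * r k)
    (hact : ∀ j (a : R), ∃ m, ∀ i, Φ i m = Φ i (κ j) * a) :
    ∃ (Y : HermSpace ι R s ε) (σ : M →ₗ[K] Y.carrier), Function.Surjective σ ∧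
      Y.Generates (fun i => σ (κ i)) ∧ ∀ i m, Y.form (σ (κ i)) (σ m) = Φ i m := by
  obtain ⟨Y, c, hc, hg⟩ := HermSpace.exists_of_gram G ε (fun i j => Φ i (κ j)) hsymm
    (f ∘ (Fintype.equivFin F).symm) (fun j => by
      obtain ⟨r, hr⟩ := hfin j
      refine ⟨r ∘ (Fintype.equivFin F).symm, fun i => ?_⟩
      rw [hr]
      exact ((Fintype.equivFin F).symm.sum_comp fun k => Φ i (κ (f k)) * r k).symm)
  -- `σ m` is the vector with the inner products `Φ i m` with the generators
  have ex : ∀ m, ∃ y, ∀ i, Y.form (c i) y = Φ i m := by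
    intro m
    have hm : m ∈ Submodule.span K (Set.range κ) := by rw [hκ]; trivial
    induction hm using Submodule.span_induction with
    | mem x hx => obtain ⟨j, rfl⟩ := hx; exact ⟨c j, fun i => hg i j⟩
    | zero => exact ⟨0, fun i => by rw [map_zero, map_zero]⟩
    | add x y _ _ hx hy =>
      obtain ⟨x', hx'⟩ := hx
      obtain ⟨y', hy'⟩ := hy
      exact ⟨x' + y', fun i => by rw [map_add, map_add, hx', hy']⟩
    | smul r x _ hx =>
      obtain ⟨x', hx'⟩ := hx
      exact ⟨r • x', fun i => by rw [map_smul, map_smul, hx']⟩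
  have uniq : ∀ y y', (∀ i, Y.form (c i) y = Y.form (c i) y') → y = y' :=
    fun y y' h => Y.eq_of_form_right G.inv_zero hc h
  choose σ hσ using ex
  have hσc : ∀ j, σ (κ j) = c j := fun j => uniq _ _ fun i => by rw [hσ, hg]
  refine ⟨Y, ⟨⟨σ, fun x y => uniq _ _ fun i => by rw [hσ, map_add, map_add, hσ, hσ]⟩,
    fun r x => uniq _ _ fun i => by rw [hσ, map_smul, map_smul, hσ]; rfl⟩, ?_, ?_, ?_⟩
  · intro y
    change ∃ m, σ m = y
    induction y using hc.induction with
    | mem j => exact ⟨κ j, hσc j⟩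
    | add x y hx hy =>
      obtain ⟨m, rfl⟩ := hx
      obtain ⟨m', rfl⟩ := hy
      exact ⟨m + m', uniq _ _ fun i => by rw [hσ, map_add, map_add, hσ, hσ]⟩
    | zero => exact ⟨0, uniq _ _ fun i => by rw [hσ, map_zero, map_zero]⟩
    | smul a x hx =>
      obtain ⟨m, rfl⟩ := hx
      have key : ∃ m', ∀ i, Φ i m' = Φ i m * a := by
        have hm : m ∈ Submodule.span K (Set.range κ) := by rw [hκ]; trivial
        induction hm using Submodule.span_induction with
        | mem x hx => obtain ⟨j, rfl⟩ := hx; exact hact j a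
        | zero => exact ⟨0, fun i => by rw [map_zero, zero_mul]⟩
        | add x y _ _ hx hy =>
          obtain ⟨x', hx'⟩ := hx
          obtain ⟨y', hy'⟩ := hy
          exact ⟨x' + y', fun i => by rw [map_add, map_add, hx', hy', add_mul]⟩
        | smul r x _ hx =>
          obtain ⟨x', hx'⟩ := hx
          exact ⟨r • x', fun i => by rw [map_smul, map_smul, hx', smul_mul_assoc]⟩
      obtain ⟨m', hm'⟩ := key
      exact ⟨m', uniq _ _ fun i => by rw [hσ, hm', Y.form_right, hσ]⟩
  · change Y.Generates fun i => σ (κ i)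
    simp only [hσc]
    exact hc
  · intro i m
    change Y.form (σ (κ i)) (σ m) = _
    rw [hσc, hσ]

theorem HermSpace.Generates.of_span {X : HermSpace ι R s ε} {T : Type*} {c : T → X.carrier}
    (h : Submodule.span K (Set.range c) = ⊤) : X.Generates c := by
  rw [HermSpace.Generates, eq_top_iff]
  intro x _
  have hx : x ∈ Submodule.span K (Set.range c) := by rw [h]; trivial
  exact Submodule.span_le_restrictScalars K Rᵐᵒᵖ (Set.range c) hx

theorem HermSpace.Generates.span_op_smul {X : HermSpace ι R s ε} {T : Type*} {c : T → X.carrier}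
    (h : X.Generates c) :
    Submodule.span K (Set.range fun p : R × T => MulOpposite.op p.1 • c p.2) = ⊤ := by
  rw [eq_top_iff]
  rintro x -
  induction x using h.induction with
  | mem i => exact Submodule.subset_span ⟨(1, i), by simp⟩
  | add x y hx hy => exact add_mem hx hy
  | zero => exact zero_mem _
  | smul a x hx =>
    refine Submodule.span_induction (p := fun x _ => MulOpposite.op a • x ∈ Submodule.span K
      (Set.range fun p : R × T => MulOpposite.op p.1 • c p.2)) ?_ ?_ ?_ ?_ hx
    · rintro _ ⟨p, rfl⟩
      exact Submodule.subset_span ⟨(p.1 * a, p.2), by simp [mul_smul]⟩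
    · rw [smul_zero]
      exact zero_mem _
    · intro x y _ _ hx hy
      rw [smul_add]
      exact add_mem hx hy
    · intro r x _ hx
      rw [smul_comm]
      exact Submodule.smul_mem _ _ hx

end

theorem TensorProduct.span_tmul_eq_top_of_span {K M N : Type*} [CommRing K] [AddCommGroup M]
    [Module K M] [AddCommGroup N] [Module K N] {S T : Type*} {a : S → M} {b : T → N}
    (ha : Submodule.span K (Set.range a) = ⊤) (hb : Submodule.span K (Set.range b) = ⊤) :
    Submodule.span K (Set.range fun p : S × T => a p.1 ⊗ₜ[K] b p.2) = ⊤ := by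
  have h := Submodule.map₂_span_span K (TensorProduct.mk K M N) (Set.range a) (Set.range b)
  rw [ha, hb, TensorProduct.map₂_mk_top_top_eq_top, Set.image2_range] at h
  exact h.symm

namespace AzumayaInv

variable {K : Type u} [CommRing K] {ι : K →+* K} (A : AzumayaInv ι)

theorem powMul_smul {m n : ℕ} (c c' : K) (a : A.pow m) (b : A.pow n) :
    A.powMul (c • a) (c' • b) = (c * c') • A.powMul a b := by
  rw [powMul, TensorProduct.smul_tmul_smul, map_smul]; rfl

variable [Nontrivial K]

instance : Nontrivial A.carrier := by
  refine ⟨0, 1, fun h => zero_ne_one (α := K) ?_⟩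
  apply FaithfulSMul.algebraMap_injective K A.carrier
  rw [map_zero, map_one, h]

variable [IsReduced K] [IsArtinianRing K] [InvBase ι]

instance : Nonempty A.goldman.I := by
  by_contra h
  rw [not_nonempty_iff] at h
  exact not_subsingleton A.carrier A.goldman.toGoldmanAlg.subsingleton

instance (n : ℕ) : Nonempty (A.goldmanPow n).I := inferInstanceAs (Nonempty (Fin n → A.goldman.I))

theorem ψ_powMul {m n : ℕ} (a : A.pow m) (b : A.pow n) (f h : Fin (m + n) → A.goldman.I) :
    (A.goldmanPow (m + n)).ψ (A.powMul a b) f h =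
      (A.goldmanPow m).ψ a (f ∘ Fin.castAdd n) (h ∘ Fin.castAdd n) *
        (A.goldmanPow n).ψ b (f ∘ Fin.natAdd m) (h ∘ Fin.natAdd m) :=
  A.goldman.toGoldmanAlg.psiPow_mulEquiv a b f h

theorem invPow_powMul {m n : ℕ} (a : A.pow m) (b : A.pow n) :
    A.invPow (m + n) (A.powMul a b) = A.powMul (A.invPow m a) (A.invPow n b) := by
  apply (A.goldmanPow (m + n)).inj
  ext f h
  rw [GoldmanInv.ψ_inv]
  refine (congrArg (Pt.swap ι) (A.ψ_powMul a b h f)).trans ?_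
  refine Eq.trans ?_ (A.ψ_powMul _ _ f h).symm
  rw [map_mul, GoldmanInv.ψ_inv, GoldmanInv.ψ_inv]

theorem _root_.Fin.sum_castAdd_mul_natAdd {E I : Type*} [CommSemiring E] [Fintype I] {m n : ℕ}
    (F : (Fin m → I) → E) (H : (Fin n → I) → E) :
    ∑ k : Fin (m + n) → I, F (k ∘ Fin.castAdd n) * H (k ∘ Fin.natAdd m) =
      (∑ k, F k) * ∑ k, H k := by
  rw [Finset.sum_mul_sum, ← Fintype.sum_prod_type']
  refine Fintype.sum_equiv ((Equiv.arrowCongr finSumFinEquiv.symm (Equiv.refl I)).trans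
    (Equiv.sumArrowEquivProdArrow _ _ _)) _ _ fun k => ?_
  rfl

theorem powMul_mul {m n : ℕ} (a a' : A.pow m) (b b' : A.pow n) :
    A.powMul (a * a') (b * b') = A.powMul a b * A.powMul a' b' := by
  apply (A.goldmanPow (m + n)).inj
  ext f h
  refine (A.ψ_powMul _ _ f h).trans ?_
  rw [map_mul, map_mul, map_mul, Matrix.mul_apply, Matrix.mul_apply, Matrix.mul_apply]
  refine (Fin.sum_castAdd_mul_natAdd _ _).symm.trans ?_
  refine Finset.sum_congr rfl fun k _ => ?_
  rw [A.ψ_powMul a b f k, A.ψ_powMul a' b' k h]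
  exact mul_mul_mul_comm _ _ _ _

variable {A} {m n : ℕ} {ε ε' : signGroup ι} (X : A.Herm m ε) (Y : A.Herm n ε')

theorem IsTensor.generates {X : A.Herm m ε} {Y : A.Herm n ε'} {Z : A.Herm (m + n) (ε * ε')}
    (h : IsTensor X Y Z) {S T : Type*} {a : S → X.carrier} {b : T → Y.carrier}
    (ha : X.Generates a) (hb : Y.Generates b) :
    ∃ c : S × T → Z.carrier, Z.Generates c ∧
      ∀ i j, Z.form (c i) (c j) = A.powMul (X.form (a i.1) (a j.1)) (Y.form (b i.2) (b j.2)) := by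
  obtain ⟨e, h1, h2⟩ := h
  refine ⟨fun p => e (a p.1 ⊗ₜ b p.2), ?_, fun i j => h2 _ _ _ _⟩
  have h3 : Submodule.span K (Set.range fun p : (A.pow m × S) × (A.pow n × T) =>
      e ((MulOpposite.op p.1.1 • a p.1.2) ⊗ₜ[K] (MulOpposite.op p.2.1 • b p.2.2))) = ⊤ := by
    rw [← LinearEquiv.range e, ← Submodule.map_top]
    refine Eq.trans ?_ (congrArg _ (TensorProduct.span_tmul_eq_top_of_span ha.span_op_smul
      hb.span_op_smul))
    rw [Submodule.map_span, ← Set.range_comp]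
    rfl
  refine (HermSpace.Generates.of_span h3).of_forall fun p => ?_
  rw [show e ((MulOpposite.op p.1.1 • a p.1.2) ⊗ₜ[K] (MulOpposite.op p.2.1 • b p.2.2)) =
    MulOpposite.op (A.powMul p.1.1 p.2.1) • e (a p.1.2 ⊗ₜ b p.2.2) from h1 _ _ _ _]
  exact Submodule.smul_mem _ _ (Submodule.subset_span ⟨(p.1.2, p.2.2), rfl⟩)

/-- The tensor product of two hermitian spaces: the form is defined by the pairings with pure tensors,
and nondegenerate because tensors are recovered from their products with a pair of dual bases. -/
theorem exists_isTensor : ∃ Z, IsTensor X Y Z := by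
  obtain ⟨p, x, x', hx⟩ := X.exists_dual_basis (A.goldmanPow m)
  obtain ⟨q, y, y', hy⟩ := Y.exists_dual_basis (A.goldmanPow n)
  let Φ : X.carrier × Y.carrier → X.carrier ⊗[K] Y.carrier →ₗ[K] A.pow (m + n) := fun i =>
    TensorPower.mulEquiv.toLinearMap ∘ₗ TensorProduct.map (X.form i.1) (Y.form i.2)
  have hΦ : ∀ i v w, Φ i (v ⊗ₜ w) = A.powMul (X.form i.1 v) (Y.form i.2 w) := fun i v w => rfl
  have hΦa : ∀ i v w (a : A.pow m) (b : A.pow n),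
      Φ i ((MulOpposite.op a • v) ⊗ₜ (MulOpposite.op b • w)) = Φ i (v ⊗ₜ w) * A.powMul a b := by
    intro i v w a b
    rw [hΦ, hΦ, X.form_right, Y.form_right, A.powMul_mul]
  obtain ⟨Z, σ, hσ, hgen, hform⟩ := HermSpace.exists_of_pairing (A.goldmanPow (m + n)) (ε * ε')
    (fun p : X.carrier × Y.carrier => p.1 ⊗ₜ[K] p.2) (by
      rw [← TensorProduct.span_tmul_eq_top]
      congr 1
      ext z
      simp [eq_comm]) Φ
    (fun i j => by
      rw [hΦ, hΦ, A.invPow_powMul, X.form_symm, Y.form_symm, A.powMul_smul]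
      rfl)
    (F := Fin p × Fin q) (fun k => (x k.1, y k.2))
    (fun j => ⟨fun k => A.powMul (X.form (x' k.1) j.1) (Y.form (y' k.2) j.2), fun i => by
      conv_lhs => rw [← hx j.1, ← hy j.2, TensorProduct.sum_tmul]
      simp only [TensorProduct.tmul_sum, map_sum, hΦa]
      rw [Fintype.sum_prod_type]⟩)
    (fun j a => by
      obtain ⟨z, rfl⟩ := TensorPower.mulEquiv.surjective a
      induction z using TensorProduct.induction_on with
      | zero => exact ⟨0, fun i => by rw [map_zero, map_zero, mul_zero]⟩
      | tmul a b => exact ⟨_, fun i => hΦa i j.1 j.2 a b⟩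
      | add z z' hz hz' =>
        obtain ⟨w, hw⟩ := hz
        obtain ⟨w', hw'⟩ := hz'
        exact ⟨w + w', fun i => by rw [map_add, map_add, hw, hw', mul_add]⟩)
  have hinj : Function.Injective σ := by
    rw [injective_iff_map_eq_zero]
    intro z hz
    have h0 : ∀ i : X.carrier × Y.carrier, TensorProduct.map (X.form i.1) (Y.form i.2) z = 0 := by
      intro i
      apply TensorPower.mulEquiv.injective
      rw [map_zero]
      change Φ i z = 0
      rw [← hform, hz, map_zero]
    -- every tensor is recovered from its inner products with the dual bases
    have h1 : ∀ z : X.carrier ⊗[K] Y.carrier, ∑ k, ∑ l,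
        TensorProduct.map (X.rmulHom.flip (x k)) (Y.rmulHom.flip (y l))
          (TensorProduct.map (X.form (x' k)) (Y.form (y' l)) z) = z := by
      intro z
      induction z using TensorProduct.induction_on with
      | zero => simp
      | tmul v w =>
        simp only [TensorProduct.map_tmul]
        rw [← Finset.sum_product']
        conv_rhs => rw [← hx v, ← hy w, TensorProduct.sum_tmul]
        simp only [TensorProduct.tmul_sum]
        rw [← Finset.sum_product']
        rfl
      | add z z' hz hz' => simp only [map_add, Finset.sum_add_distrib, hz, hz']
    rw [← h1 z]
    simp only [h0 (_, _), map_zero, Finset.sum_const_zero]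
  refine ⟨Z, LinearEquiv.ofBijective σ ⟨hinj, hσ⟩, fun a b v w => ?_, fun v w v' w' => ?_⟩
  · refine Z.eq_of_form_right (A.goldmanPow (m + n)).inv_zero hgen fun i => ?_
    refine (hform i _).trans ((hΦa i v w a b).trans ?_)
    rw [← hform]
    exact (Z.form_right _ _ _).symm
  · exact hform (v, w) (v' ⊗ₜ w')

end AzumayaInv

/-! ### Alternating powers in coordinates -/

/-- The determinant is multilinear in the rows. -/
theorem Matrix.det_sum_rows {E J : Type*} [CommRing E] [Fintype J] [DecidableEq J] {d : ℕ}
    (a : Fin d → J → E) (M : Fin d → J → Fin d → E) :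
    (Matrix.of fun i j => ∑ p, a i p * M i p j).det =
      ∑ P : Fin d → J, (∏ i, a i (P i)) * (Matrix.of fun i j => M i (P i) j).det := by
  have h : (Matrix.of fun i j => ∑ p, a i p * M i p j) = fun i => ∑ p, a i p • M i p := by
    ext i j
    simp
  rw [Matrix.det, h]
  change Matrix.detRowAlternating.toMultilinearMap _ = _
  rw [MultilinearMap.map_sum]
  refine Finset.sum_congr rfl fun P _ => ?_
  rw [MultilinearMap.map_smul_univ, smul_eq_mul]
  rfl

/-- Products of matrix entries, as a multilinear map on a module with matrix coordinates. -/
def tensorCoord {K L V : Type*} [CommRing K] [CommRing L] [Algebra K L] [AddCommGroup V] [Module K V]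
    {I J : Type*} (χ : V →ₗ[K] Matrix J I L) (d : ℕ) :
    (⨂[K] (_ : Fin d), V) →ₗ[K] Matrix (Fin d → J) (Fin d → I) L :=
  PiTensorProduct.lift (MultilinearMap.pi fun P => MultilinearMap.pi fun F =>
    (MultilinearMap.mkPiAlgebra K (Fin d) L).compLinearMap fun i =>
      Matrix.entryLinearMap K L (P i) (F i) ∘ₗ χ)

theorem tensorCoord_tprod {K L V : Type*} [CommRing K] [CommRing L] [Algebra K L] [AddCommGroup V]
    [Module K V] {I J : Type*} (χ : V →ₗ[K] Matrix J I L) {d : ℕ} (x : Fin d → V) (P : Fin d → J)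
    (F : Fin d → I) :
    tensorCoord χ d (PiTensorProduct.tprod K x) P F = ∏ i, χ (x i) (P i) (F i) := by
  have h := PiTensorProduct.lift.tprod (φ := MultilinearMap.pi fun P : Fin d → J =>
    MultilinearMap.pi fun F : Fin d → I =>
    (MultilinearMap.mkPiAlgebra K (Fin d) L).compLinearMap fun i =>
      Matrix.entryLinearMap K L (P i) (F i) ∘ₗ χ) x
  exact congrFun (congrFun h P) F

namespace GoldmanAlg

variable {K L B : Type u} [CommRing K] [CommRing L] [Algebra K L] [Ring B] [Algebra K B]
  (G : GoldmanAlg K L B) (hK : Function.Injective (algebraMap K L))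

include hK in
theorem mulLeftRight_g (x : B) : AlgHom.mulLeftRight K B
    (TensorProduct.map LinearMap.id (MulOpposite.opLinearEquiv K).toLinearMap G.g) x =
      algebraMap K B (G.t x) := by
  rw [← G.sandwich hK, g, map_sum, map_sum, LinearMap.sum_apply]
  refine Finset.sum_congr rfl fun k _ => ?_
  rw [TensorProduct.map_tmul]
  exact AlgHom.mulLeftRight_apply K B _ _ _

theorem isGoldmanHom_gamma [Module.FaithfullyFlat K L] (d : ℕ) : IsGoldmanHom (G.gamma hK d) :=
  ⟨G.g, ⟨G.t, G.isReducedTrace, G.mulLeftRight_g hK⟩, fun i j hij =>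
    G.gamma_swap hK (by rintro rfl; omega)⟩

theorem eq_gamma [Module.FaithfullyFlat K L] [Nontrivial K] [IsArtinianRing K]
    (hJ : ∀ c : K, (∀ P : Ideal K, P.IsMaximal → c ∈ P) → c = 0) {d : ℕ}
    {γ : Equiv.Perm (Fin d) →* (⨂[K] (_ : Fin d), B)} (h : IsGoldmanHom γ) : γ = G.gamma hK d := by
  obtain ⟨g', ⟨t, ht, hg⟩, hγ⟩ := h
  obtain rfl := IsReducedTrace.unique hJ ht G.isReducedTrace
  refine Equiv.Perm.monoidHom_ext_adjacent fun i j hij => ?_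
  rw [hγ i j hij, G.gamma_swap hK (by rintro rfl; omega), G.goldman_unique hK hg]

/-- Antisymmetrized products of matrix entries are minors. -/
theorem psiPow_sum_sign {d : ℕ} (m : Fin d → Fin d → B) (F F' : Fin d → G.I) :
    psiPow G.ψ (Fin d) (∑ π : Equiv.Perm (Fin d), ((Equiv.Perm.sign π : ℤˣ) : ℤ) •
      (PiTensorProduct.tprod K (fun i => m i (π.symm i)) * G.gamma hK d π)) F F' =
        (Matrix.of fun i j => G.ψ (m i j) (F i) (F' j)).det := by
  rw [map_sum, Matrix.sum_apply, ← Matrix.det_transpose, Matrix.det_apply]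
  refine Fintype.sum_equiv (Equiv.inv _) _ _ fun π => ?_
  rw [map_zsmul, map_mul, psiPow_gamma, Matrix.smul_apply, Matrix.mul_apply,
    Finset.sum_eq_single (F' ∘ π.symm)]
  · rw [tensorPermMatrix_apply, if_pos (by ext i; simp), mul_one, psiPow_tprod, Equiv.inv_apply,
      Equiv.Perm.sign_inv]
    rfl
  · intro H _ hH
    rw [tensorPermMatrix_apply, if_neg, mul_zero]
    rintro rfl
    exact hH (by ext i; simp)
  · intro h
    exact absurd (Finset.mem_univ _) h

end GoldmanAlg

section

variable {K : Type u} [CommRing K] [Nontrivial K] [IsReduced K] {ι : K →+* K} [InvBase ι]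
  {R : Type u} [Ring R] [Algebra K R] {s : R → R} {ε : signGroup ι} [IsArtinianRing K]

omit [Nontrivial K] [IsReduced K] [InvBase ι] [IsArtinianRing K] in
theorem HermSpace.antisymmetrizer_apply (X : HermSpace ι R s ε) {d : ℕ}
    (γ : Equiv.Perm (Fin d) →* (⨂[K] (_ : Fin d), X.endAlg)) (z : ⨂[K] (_ : Fin d), X.carrier) :
    X.antisymmetrizer γ z =
      ∑ π, ((Equiv.Perm.sign π : ℤˣ) : ℤ) • powAct X.endAlg X.carrier d (γ π) z := by
  rw [antisymmetrizer, LinearMap.sum_apply]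
  exact Finset.sum_congr rfl fun π _ => rfl

omit [Nontrivial K] [IsReduced K] [InvBase ι] [IsArtinianRing K] in
theorem HermSpace.antisymmetrizer_actPow (X : HermSpace ι R s ε) {d : ℕ}
    (γ : Equiv.Perm (Fin d) →* (⨂[K] (_ : Fin d), X.endAlg)) (a : ⨂[K] (_ : Fin d), R)
    (z : ⨂[K] (_ : Fin d), X.carrier) :
    X.antisymmetrizer γ (actPow X.rmulHom d a z) =
      actPow X.rmulHom d a (X.antisymmetrizer γ z) := by
  simp only [antisymmetrizer_apply, map_sum, map_zsmul]
  refine Finset.sum_congr rfl fun π _ => ?_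
  congr 1
  refine LinearMap.congr_fun (actPow_comm (Algebra.lsmul K K X.carrier : X.endAlg →ₐ[K] _).toLinearMap
    X.rmulHom (fun f r => ?_) d (γ π) a) z
  ext v
  exact map_smul f (MulOpposite.op r) v

namespace HermSpace.Coord

variable {X : HermSpace ι R s ε} {G : GoldmanInv ι R s} (C : X.Coord G) [Nonempty G.I]

theorem psiPow_formPow {d : ℕ} (x : Fin d → X.carrier) (z : ⨂[K] (_ : Fin d), X.carrier)
    (F H : Fin d → G.I) :
    psiPow G.ψ (Fin d) (X.formPow x z) F H =
      ∑ P : Fin d → C.J, (∏ i, C.η (x i) (F i) (P i)) * tensorCoord C.χ d z P H := by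
  let φ : (⨂[K] (_ : Fin d), X.carrier) →ₗ[K] Pt ι :=
    { toFun := fun z => psiPow G.ψ (Fin d) (X.formPow x z) F H
      map_add' := fun y z => by rw [map_add, map_add]; rfl
      map_smul' := fun c z => by rw [map_smul, map_smul]; rfl }
  let φ' : (⨂[K] (_ : Fin d), X.carrier) →ₗ[K] Pt ι :=
    { toFun := fun z => ∑ P : Fin d → C.J,
        (∏ i, C.η (x i) (F i) (P i)) * tensorCoord C.χ d z P H
      map_add' := fun y z => by
        simp only [map_add, Matrix.add_apply, mul_add, Finset.sum_add_distrib]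
      map_smul' := fun c z => by
        simp only [map_smul, Matrix.smul_apply, mul_smul_comm, Finset.smul_sum, RingHom.id_apply] }
  refine PiTensorProduct.linearMap_congr (φ := φ) (φ' := φ') (fun v => ?_) z
  change psiPow G.ψ (Fin d) (X.formPow x (PiTensorProduct.tprod K v)) F H = ∑ P : Fin d → C.J,
    (∏ i, C.η (x i) (F i) (P i)) * tensorCoord C.χ d (PiTensorProduct.tprod K v) P H
  rw [X.formPow_tprod, psiPow_tprod]
  simp only [tensorCoord_tprod, ← Finset.prod_mul_distrib]
  refine Eq.trans ?_ (Fintype.prod_sum_eq_sum_prod (T := Fin d) (I := C.J) fun i p =>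
    C.η (x i) (F i) p * C.χ (v i) p (H i))
  refine Finset.prod_congr rfl fun i _ => ?_
  rw [C.form_eq, Matrix.mul_apply]

theorem tensorCoord_powAct {d : ℕ} (b : ⨂[K] (_ : Fin d), X.endAlg)
    (z : ⨂[K] (_ : Fin d), X.carrier) :
    tensorCoord C.χ d (powAct X.endAlg X.carrier d b z) =
      psiPow C.endGoldman.ψ (Fin d) b * tensorCoord C.χ d z := by
  refine PiTensorProduct.linearMap_congr
    (φ := tensorCoord C.χ d ∘ₗ powAct X.endAlg X.carrier d b)
    (φ' := mulLeftLinearMap (Fin d → G.I) K (psiPow C.endGoldman.ψ (Fin d) b) ∘ₗ tensorCoord C.χ d)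
    (fun v => ?_) z
  refine PiTensorProduct.linearMap_congr
    (φ := tensorCoord C.χ d ∘ₗ (powAct X.endAlg X.carrier d).flip (PiTensorProduct.tprod K v))
    (φ' := mulRightLinearMap (Fin d → C.J) K (tensorCoord C.χ d (PiTensorProduct.tprod K v)) ∘ₗ
      (psiPow C.endGoldman.ψ (Fin d)).toLinearMap) (fun f => ?_) b
  change tensorCoord C.χ d (actPow (Algebra.lsmul K K X.carrier : X.endAlg →ₐ[K] _).toLinearMap d
    (PiTensorProduct.tprod K f) (PiTensorProduct.tprod K v)) =
      psiPow C.endGoldman.ψ (Fin d) (PiTensorProduct.tprod K f) *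
        tensorCoord C.χ d (PiTensorProduct.tprod K v)
  rw [actPow_tprod_tprod]
  ext P F
  rw [tensorCoord_tprod, Matrix.mul_apply]
  simp only [psiPow_tprod, tensorCoord_tprod, ← Finset.prod_mul_distrib]
  refine Eq.trans ?_ (Fintype.prod_sum_eq_sum_prod (T := Fin d) (I := C.J) fun i p =>
    C.endGoldman.ψ (f i) (P i) p * C.χ (v i) p (F i))
  refine Finset.prod_congr rfl fun i _ => ?_
  change C.χ (f i (v i)) (P i) (F i) = _
  rw [C.χ_apply, Matrix.mul_apply]

/-- The antisymmetrization of a pure tensor has minors as its coordinates. -/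
theorem tensorCoord_antisymmetrizer {d : ℕ} (x : Fin d → X.carrier) (P : Fin d → C.J)
    (F : Fin d → G.I) :
    tensorCoord C.χ d (X.antisymmetrizer (C.endGoldman.gamma (Pt.injective ι) d)
      (PiTensorProduct.tprod K x)) P F = (Matrix.of fun i j => C.χ (x j) (P i) (F j)).det := by
  rw [antisymmetrizer_apply, map_sum, Matrix.sum_apply, Matrix.det_apply]
  refine Finset.sum_congr rfl fun π _ => ?_
  rw [map_zsmul, tensorCoord_powAct, GoldmanAlg.psiPow_gamma]
  change ((Equiv.Perm.sign π : ℤˣ) : ℤ) • (tensorPermMatrix (Fin d) C.J (Pt ι) π *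
    tensorCoord C.χ d (PiTensorProduct.tprod K x) : Matrix _ _ _) P F = _
  rw [Matrix.mul_apply, Finset.sum_eq_single (P ∘ π)]
  · rw [tensorPermMatrix_apply, if_pos rfl, one_mul, tensorCoord_tprod]
    rfl
  · intro Q _ hQ
    rw [tensorPermMatrix_apply, if_neg hQ, zero_mul]
  · intro h
    exact absurd (Finset.mem_univ _) h

/-- The inner product of a pure tensor with an antisymmetrized one. The right hand side does not
depend on coordinates, so it can be computed in any splitting. -/
theorem formPow_antisymmetrizer {d : ℕ} (x x' : Fin d → X.carrier) :
    X.formPow x (X.antisymmetrizer (C.endGoldman.gamma (Pt.injective ι) d)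
      (PiTensorProduct.tprod K x')) = ∑ π : Equiv.Perm (Fin d), ((Equiv.Perm.sign π : ℤˣ) : ℤ) •
        (PiTensorProduct.tprod K (fun i => X.form (x i) (x' (π.symm i))) *
          G.gamma (Pt.injective ι) d π) := by
  apply G.psiPow_injective (Pt.injective ι) d
  ext F H
  rw [C.psiPow_formPow]
  refine Eq.trans ?_ (G.psiPow_sum_sign (Pt.injective ι) (fun i j => X.form (x i) (x' j)) F H).symm
  simp only [tensorCoord_antisymmetrizer]
  refine (Matrix.det_sum_rows (fun i p => C.η (x i) (F i) p)
    (fun _ p j => C.χ (x' j) p (H j))).symm.trans ?_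
  congr 1
  ext i j
  rw [Matrix.of_apply, Matrix.of_apply, C.form_eq, Matrix.mul_apply]

theorem psiPow_formPow_antisymmetrizer (G' : GoldmanAlg K (Pt ι) R) {d : ℕ}
    (x x' : Fin d → X.carrier) (F H : Fin d → G'.I) :
    psiPow G'.ψ (Fin d) (X.formPow x (X.antisymmetrizer (C.endGoldman.gamma (Pt.injective ι) d)
      (PiTensorProduct.tprod K x'))) F H =
        (Matrix.of fun i j => G'.ψ (X.form (x i) (x' j)) (F i) (H j)).det := by
  rw [formPow_antisymmetrizer, ← G'.psiPow_sum_sign (Pt.injective ι),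
    G'.eq_gamma (Pt.injective ι) (InvBase.jacobson ι) (G.isGoldmanHom_gamma (Pt.injective ι) d)]

end HermSpace.Coord

end

namespace AzumayaInv

variable {K : Type u} [CommRing K] {ι : K →+* K} {A : AzumayaInv ι} [Nontrivial K] [IsReduced K]
  [IsArtinianRing K] [InvBase ι] {n : ℕ} {ε : signGroup ι}

/-- Alternating powers are generated by a family whose inner products are, in coordinates, the
minors of the matrices of inner products. -/
theorem IsAlt.generates {d : ℕ} {X : A.Herm n ε} {Y : A.Herm (d * n) (ε ^ d)} (h : IsAlt d X Y)
    {T : Type*} {a : T → X.carrier} (ha : X.Generates a) :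
    ∃ c : (Fin d → T) → Y.carrier, Y.Generates c ∧
      ∀ (G : GoldmanAlg K (Pt ι) A.carrier) x x' (f h : Fin (d * n) → G.I),
        psiPow G.ψ (Fin (d * n)) (Y.form (c x) (c x')) f h =
        (Matrix.of fun i j => psiPow G.ψ (Fin n) (X.form (a (x i)) (a (x' j)))
          (fun k => f (finProdFinEquiv (i, k))) (fun k => h (finProdFinEquiv (j, k)))).det := by
  obtain ⟨γ, hγ, j, hinj, hrange, hact, hform⟩ := h
  obtain ⟨C⟩ := X.nonempty_coord (A.goldmanPow n)
  obtain rfl := C.endGoldman.eq_gamma (Pt.injective ι) (InvBase.jacobson ι) hγ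
  set D := X.antisymmetrizer (C.endGoldman.gamma (Pt.injective ι) d) with hD
  have ex : ∀ x : Fin d → T, ∃ y, j y = D (PiTensorProduct.tprod K fun i => a (x i)) := fun x => by
    have : D (PiTensorProduct.tprod K fun i => a (x i)) ∈ LinearMap.range j := by
      rw [hrange]; exact ⟨_, rfl⟩
    exact this
  choose c hc using ex
  refine ⟨c, ?_, fun G x x' f h => ?_⟩
  · have h3 : Submodule.span K (Set.range fun p : Fin d → A.pow n × T =>
        Y.rmul (A.flatten d n (PiTensorProduct.tprod K fun i => (p i).1)) (c fun i => (p i).2)) = ⊤ := by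
      apply Submodule.map_injective_of_injective hinj
      rw [Submodule.map_span, Submodule.map_top, hrange, LinearMap.range_eq_map,
        ← PiTensorProduct.submodule_span_eq_top fun _ : Fin d => ha.span_op_smul,
        Submodule.map_span, ← Set.range_comp, ← Set.range_comp]
      congr 2
      funext p
      change j (Y.rmul _ _) = D _
      rw [hact, hc]
      have h1 := X.antisymmetrizer_actPow (C.endGoldman.gamma (Pt.injective ι) d)
        (PiTensorProduct.tprod K fun i => (p i).1) (PiTensorProduct.tprod K fun i => a (p i).2)
      rw [actPow_tprod_tprod, actPow_tprod] at h1
      exact h1.symm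
    refine (HermSpace.Generates.of_span h3).of_forall fun p => ?_
    exact Submodule.smul_mem _ _ (Submodule.subset_span ⟨_, rfl⟩)
  · rw [hform (fun i => a (x i)) (c x) (c x') (hc x), hc]
    refine (A.psiPow_flatten G.ψ d n _ f h).trans ?_
    exact C.psiPow_formPow_antisymmetrizer (G.pow (Fin n)) (fun i => a (x i)) (fun i => a (x' i)) _ _

/-- Alternating powers exist. The Gram matrix of the `s_d x`, for pure tensors `x`, has minors as its
coordinates, so that it is `ε ^ d`-hermitian; the space it presents is the image of `s_d`, since a
tensor is in the kernel of `s_d` if and only if it is orthogonal to all pure tensors. -/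
theorem exists_isAlt (d : ℕ) (X : A.Herm n ε) : ∃ Y, IsAlt d X Y := by
  obtain ⟨C⟩ := X.nonempty_coord (A.goldmanPow n)
  obtain ⟨p, x, x', hx⟩ := X.exists_dual_basis (A.goldmanPow n)
  let γ := C.endGoldman.gamma (Pt.injective ι) d
  let D := X.antisymmetrizer γ
  let Φ : (Fin d → X.carrier) → (⨂[K] (_ : Fin d), X.carrier) →ₗ[K] A.pow (d * n) := fun i =>
    A.flatten d n ∘ₗ X.formPow i ∘ₗ D
  have hΦ : ∀ i j (f h : Fin (d * n) → A.goldman.I),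
      (A.goldmanPow (d * n)).ψ (Φ i (PiTensorProduct.tprod K j)) f h =
        (Matrix.of fun k l => (A.goldmanPow n).ψ (X.form (i k) (j l))
          (fun q => f (finProdFinEquiv (k, q))) (fun q => h (finProdFinEquiv (l, q)))).det :=
    fun i j f h => (A.psiPow_flatten A.goldman.ψ d n _ f h).trans
      (C.psiPow_formPow_antisymmetrizer (A.goldmanPow n).toGoldmanAlg i j _ _)
  have hD : ∀ a z, D (actPow X.rmulHom d a z) = actPow X.rmulHom d a (D z) :=
    X.antisymmetrizer_actPow γ
  have hΦa : ∀ i a z, Φ i (actPow X.rmulHom d a z) = Φ i z * A.flatten d n a := by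
    intro i a z
    change A.flatten d n (X.formPow i (D _)) = A.flatten d n (X.formPow i (D z)) * _
    rw [hD, X.formPow_actPow, A.flatten_mul]
  obtain ⟨Y, σ, hσ, hgen, hform⟩ := HermSpace.exists_of_pairing (A.goldmanPow (d * n)) (ε ^ d)
    (fun i : Fin d → X.carrier => PiTensorProduct.tprod K i) PiTensorProduct.span_tprod_eq_top Φ
    -- the transpose of a determinant of `ε`-hermitian entries
    (fun i j => by
      apply (A.goldmanPow (d * n)).inj
      ext f h
      rw [GoldmanInv.ψ_inv, map_smul, Matrix.smul_apply]
      refine (congrArg (Pt.swap ι) (hΦ i j h f)).trans ?_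
      refine Eq.trans ?_ (congrArg (fun r => (((ε ^ d : signGroup ι) : Kˣ) : K) • r) (hΦ j i f h).symm)
      rw [← Matrix.det_transpose, RingHom.map_det, Algebra.smul_def,
        show (((ε ^ d : signGroup ι) : Kˣ) : K) = ((ε : Kˣ) : K) ^ d by simp, map_pow]
      refine Eq.trans ?_ ((Matrix.det_smul _ (algebraMap K (Pt ι) ((ε : Kˣ) : K))).trans (by
        rw [Fintype.card_fin]))
      congr 1
      ext k l
      have h1 := congrArg (fun r => (A.goldmanPow n).ψ r (fun q => f (finProdFinEquiv (k, q)))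
        (fun q => h (finProdFinEquiv (l, q)))) (X.form_symm (i l) (j k))
      simp only [map_smul, Matrix.smul_apply] at h1
      rw [Algebra.smul_def] at h1
      refine Eq.trans ?_ h1
      exact ((A.goldmanPow n).ψ_inv _ _ _).symm)
    (F := Fin d → Fin p) (fun k l => x (k l))
    (fun j => ⟨fun k => A.flatten d n (X.formPow (fun l => x' (k l)) (PiTensorProduct.tprod K j)),
      fun i => by
        conv_lhs => rw [← X.sum_actPow_formPow x x' hx (PiTensorProduct.tprod K j), map_sum]
        exact Finset.sum_congr rfl fun k _ => hΦa _ _ _⟩)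
    (fun j a => by
      obtain ⟨a, rfl⟩ := A.flatten_surjective d n a
      exact ⟨_, fun i => hΦa i a _⟩)
  -- tensors are recovered from their products with pure tensors of a dual basis
  have hker : ∀ z, σ z = 0 ↔ D z = 0 := by
    intro z
    constructor
    · intro hz
      have h0 : ∀ i, X.formPow i (D z) = 0 := fun i => by
        apply A.flatten_injective d n
        rw [map_zero]
        change Φ i z = 0
        rw [← hform, hz, map_zero]
      rw [← X.sum_actPow_formPow x x' hx (D z)]
      simp only [h0, map_zero, LinearMap.zero_apply, Finset.sum_const_zero]
    · intro hz
      refine Y.eq_zero_of_form_right (A.goldmanPow (d * n)).inv_zero hgen fun i => ?_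
      rw [hform]
      change A.flatten d n (X.formPow i (D z)) = 0
      rw [hz, map_zero, map_zero]
  have hle : LinearMap.ker σ ≤ LinearMap.ker D := fun z hz => (hker z).mp hz
  -- the embedding of the alternating power in the tensor power
  let j : Y.carrier →ₗ[K] ⨂[K] (_ : Fin d), X.carrier :=
    (LinearMap.ker σ).liftQ D hle ∘ₗ (σ.quotKerEquivOfSurjective hσ).symm.toLinearMap
  have hj : ∀ z, j (σ z) = D z := by
    intro z
    have : (σ.quotKerEquivOfSurjective hσ).symm (σ z) = (LinearMap.ker σ).mkQ z := by
      rw [LinearEquiv.symm_apply_eq]; rfl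
    change (LinearMap.ker σ).liftQ D hle ((σ.quotKerEquivOfSurjective hσ).symm (σ z)) = D z
    rw [this]
    exact Submodule.liftQ_apply _ _ _
  have hjinj : Function.Injective j := by
    rw [injective_iff_map_eq_zero]
    intro y hy
    obtain ⟨z, rfl⟩ := hσ y
    rw [hj] at hy
    exact (hker z).mpr hy
  refine ⟨Y, γ, C.endGoldman.isGoldmanHom_gamma (Pt.injective ι) d, j, hjinj, ?_, ?_, ?_⟩
  · ext z
    constructor
    · rintro ⟨y, rfl⟩
      obtain ⟨z, rfl⟩ := hσ y
      exact ⟨z, (hj z).symm⟩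
    · rintro ⟨z, rfl⟩
      exact ⟨σ z, hj z⟩
  · intro a y
    obtain ⟨z, rfl⟩ := hσ y
    have h1 : Y.rmul (A.flatten d n (PiTensorProduct.tprod K a)) (σ z) =
        σ (actPow X.rmulHom d (PiTensorProduct.tprod K a) z) := by
      refine Y.eq_of_form_right (A.goldmanPow (d * n)).inv_zero hgen fun i => ?_
      rw [hform, hΦa, ← hform]
      exact Y.form_right _ _ _
    rw [h1, hj, hj, hD, actPow_tprod]
    rfl
  · intro i y y' hy
    obtain ⟨z', rfl⟩ := hσ y'
    have h1 : y = σ (PiTensorProduct.tprod K i) := hjinj (by rw [hy, hj])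
    rw [h1, hform, hj]
    rfl

end AzumayaInv

/-! ### Compositions with bimodules -/

section

variable {K : Type u} [CommRing K]

theorem TensorProduct.span_tmul_range {M N S : Type u} [AddCommGroup M] [Module K M]
    [AddCommGroup N] [Module K N] {v : S → N} (hv : Submodule.span K (Set.range v) = ⊤) :
    Submodule.span K (Set.range fun p : M × S => p.1 ⊗ₜ[K] v p.2) = ⊤ := by
  rw [eq_top_iff]
  rintro z -
  induction z using TensorProduct.induction_on with
  | zero => exact zero_mem _
  | add z z' hz hz' => exact add_mem hz hz'
  | tmul x w =>
    have hw : w ∈ Submodule.span K (Set.range v) := by rw [hv]; trivial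
    induction hw using Submodule.span_induction with
    | mem w hw =>
      obtain ⟨i, rfl⟩ := hw
      exact Submodule.subset_span ⟨(x, i), rfl⟩
    | zero => rw [TensorProduct.tmul_zero]; exact zero_mem _
    | add w w' _ _ hw hw' => rw [TensorProduct.tmul_add]; exact add_mem hw hw'
    | smul c w _ hw => rw [TensorProduct.tmul_smul]; exact Submodule.smul_mem _ c hw

theorem TensorProduct.induction_of_surjective {M N P : Type*} [AddCommGroup M] [Module K M]
    [AddCommGroup N] [Module K N] [AddCommGroup P] [Module K P] {m : M ⊗[K] N →ₗ[K] P}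
    (hm : Function.Surjective m) {p : P → Prop} (tmul : ∀ u v, p (m (u ⊗ₜ v)))
    (add : ∀ x y, p x → p y → p (x + y)) (zero : p 0) (w : P) : p w := by
  obtain ⟨z, rfl⟩ := hm w
  induction z using TensorProduct.induction_on with
  | zero => rw [map_zero]; exact zero
  | tmul u v => exact tmul u v
  | add z z' hz hz' => rw [map_add]; exact add _ _ hz hz'

variable [Nontrivial K] [IsReduced K] [IsArtinianRing K] {ι : K →+* K} [InvBase ι]

/-- The tensor product of a hermitian space over `R` with an `R`-`Q`-bimodule `N` that carries a
hermitian form with adjoint action of `R`. The form of `N` is only given for first arguments in a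
generating family `v`. -/
theorem HermSpace.exists_comp {R : Type u} [Ring R] [Algebra K R] {s : R → R} {ε : signGroup ι}
    (G : GoldmanInv ι R s) (X : HermSpace ι R s ε) {Q : Type u} [Ring Q] [Algebra K Q] {s' : Q → Q}
    (G' : GoldmanInv ι Q s') (ε' : signGroup ι) {N : Type u} [AddCommGroup N] [Module K N]
    (l : R →ₗ[K] Module.End K N) (hl : ∀ a b, l (a * b) = l a * l b)
    {S : Type u} (v : S → N) (hv : Submodule.span K (Set.range v) = ⊤) (ψ : S → N →ₗ[K] Q)
    (r : Q →ₗ[K] Module.End K N) (hlr : ∀ a b w, l a (r b w) = r b (l a w))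
    (hψ : ∀ i a w, ψ i (r a w) = ψ i w * a) {F : Type} [Fintype F] (p q : F → S)
    (hpq : ∀ w, ∑ k, r (ψ (q k) w) (v (p k)) = w)
    (hsymm : ∀ b i j, s' (ψ i (l b (v j))) = ((ε' : Kˣ) : K) • ψ j (l (s b) (v i))) :
    ∃ (Y : HermSpace ι Q s' (ε' * ε)) (m : X.carrier ⊗[K] N →ₗ[K] Y.carrier),
      Function.Surjective m ∧
      LinearMap.ker m = Submodule.span K {z | ∃ (x : X.carrier) (b : R) (w : N),
        z = X.rmul b x ⊗ₜ[K] w - x ⊗ₜ[K] l b w} ∧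
      (∀ a x w, m (x ⊗ₜ r a w) = Y.rmul a (m (x ⊗ₜ w))) ∧
      ∀ x i x' w, Y.form (m (x ⊗ₜ v i)) (m (x' ⊗ₜ w)) = ψ i (l (X.form x x') w) := by
  obtain ⟨n, x, y, hxy⟩ := X.exists_dual_basis G
  let Φ : X.carrier × S → X.carrier ⊗[K] N →ₗ[K] Q := fun i =>
    TensorProduct.lift ((l ∘ₗ X.form i.1).compr₂ (ψ i.2))
  have hΦ : ∀ i x w, Φ i (x ⊗ₜ w) = ψ i.2 (l (X.form i.1 x) w) := fun i x w => rfl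
  have hΦl : ∀ i b x w, Φ i (X.rmul b x ⊗ₜ w) = Φ i (x ⊗ₜ l b w) := by
    intro i b x w
    rw [hΦ, hΦ, HermSpace.rmul_apply, X.form_right, hl]
    rfl
  have hΦr : ∀ i a x w, Φ i (x ⊗ₜ r a w) = Φ i (x ⊗ₜ w) * a := by
    intro i a x w
    rw [hΦ, hΦ, hlr, hψ]
  have hsum : ∀ z, ∑ i, X.rmul (X.form (y i) z) (x i) = z := hxy
  obtain ⟨Y, σ, hσ, hgen, hform⟩ := HermSpace.exists_of_pairing G' (ε' * ε)
    (fun i : X.carrier × S => i.1 ⊗ₜ[K] v i.2) (TensorProduct.span_tmul_range hv) Φ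
    (fun i j => by
      rw [hΦ, hΦ, hsymm, X.form_symm, map_smul, LinearMap.smul_apply, map_smul, smul_smul]
      rfl)
    (F := Fin n × F) (fun k => (x k.1, p k.2))
    (fun j => ⟨fun k => ψ (q k.2) (l (X.form (y k.1) j.1) (v j.2)), fun i => by
      conv_lhs => rw [← hsum j.1, TensorProduct.sum_tmul, map_sum]
      rw [Fintype.sum_prod_type]
      refine Finset.sum_congr rfl fun k _ => ?_
      conv_lhs => rw [hΦl, ← hpq (l (X.form (y k) j.1) (v j.2)), TensorProduct.tmul_sum, map_sum]
      exact Finset.sum_congr rfl fun k' _ => hΦr _ _ _ _⟩)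
    (fun j a => ⟨j.1 ⊗ₜ r a (v j.2), fun i => hΦr i a _ _⟩)
  have h0 : ∀ z, σ z = 0 ↔ ∀ i, Φ i z = 0 := by
    intro z
    constructor
    · intro hz i
      rw [← hform, hz, map_zero]
    · intro hz
      refine Y.eq_zero_of_form_right G'.inv_zero hgen fun i => ?_
      rw [hform, hz]
  refine ⟨Y, σ, hσ, le_antisymm (fun z hz => ?_) (Submodule.span_le.mpr ?_), fun a x w => ?_,
    fun x i x' w => hform (x, i) _⟩
  · -- modulo the relations, `z` is a combination of the dual basis with coefficients `Λ i z`
    let Λ : Fin n → X.carrier ⊗[K] N →ₗ[K] N := fun i => TensorProduct.lift (l ∘ₗ X.form (y i))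
    have hz' := (h0 z).mp hz
    have hΛ : ∀ i, Λ i z = 0 := by
      intro i
      rw [← hpq (Λ i z)]
      refine Finset.sum_eq_zero fun k _ => ?_
      have h1 : ∀ z, Φ (y i, q k) z = ψ (q k) (Λ i z) := by
        intro z
        induction z using TensorProduct.induction_on with
        | zero => simp
        | tmul x w => rfl
        | add z z' hz hz' => rw [map_add, map_add, map_add, hz, hz']
      rw [← h1, hz', map_zero, LinearMap.zero_apply]
    have h2 : ∀ z, z - ∑ i, x i ⊗ₜ[K] Λ i z ∈ Submodule.span K
        {z | ∃ (x : X.carrier) (b : R) (w : N), z = X.rmul b x ⊗ₜ[K] w - x ⊗ₜ[K] l b w} := by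
      intro z
      induction z using TensorProduct.induction_on with
      | zero => simp
      | tmul u w =>
        have h4 : u ⊗ₜ[K] w - ∑ i, x i ⊗ₜ[K] Λ i (u ⊗ₜ w) =
            ∑ i, (X.rmul (X.form (y i) u) (x i) ⊗ₜ w - x i ⊗ₜ l (X.form (y i) u) w) := by
          rw [Finset.sum_sub_distrib, ← TensorProduct.sum_tmul, hsum]
          rfl
        rw [h4]
        exact Submodule.sum_mem _ fun i _ => Submodule.subset_span ⟨_, _, _, rfl⟩
      | add z z' hz hz' =>
        convert add_mem hz hz' using 1
        simp only [map_add, TensorProduct.tmul_add, Finset.sum_add_distrib]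
        abel
    have h3 := h2 z
    simp only [hΛ, TensorProduct.tmul_zero, Finset.sum_const_zero, sub_zero] at h3
    exact h3
  · rintro _ ⟨x, b, w, rfl⟩
    refine (h0 _).mpr fun i => ?_
    rw [map_sub, hΦl, sub_self]
  · refine Y.eq_of_form_right G'.inv_zero hgen fun i => ?_
    rw [hform, hΦr, ← hform]
    exact (Y.form_right _ _ _).symm

end

namespace HermMorita

variable {K : Type u} [CommRing K] {ι : K →+* K} {A B C : AzumayaInv ι}

/-- The left action, as a linear map. -/
def lsmul (U : HermMorita B A) : B.carrier →ₗ[K] Module.End K U.space.carrier :=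
  (Algebra.lsmul K K U.space.carrier : B.carrier →ₐ[K] Module.End K U.space.carrier).toLinearMap

theorem lsmul_apply (U : HermMorita B A) (b : B.carrier) (u : U.space.carrier) :
    U.lsmul b u = b • u := rfl

theorem powAct_mul (U : HermMorita B A) (n : ℕ) (b b' : B.pow n) :
    powAct B.carrier U.space.carrier n (b * b') =
      powAct B.carrier U.space.carrier n b * powAct B.carrier U.space.carrier n b' :=
  actPow_mul U.lsmul (fun a b => map_mul (Algebra.lsmul K K U.space.carrier) a b) n b b'

theorem powAct_tprod (U : HermMorita B A) {n : ℕ} (b : Fin n → B.carrier)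
    (u : Fin n → U.space.carrier) :
    powAct B.carrier U.space.carrier n (PiTensorProduct.tprod K b) (PiTensorProduct.tprod K u) =
      PiTensorProduct.tprod K fun i => b i • u i :=
  actPow_tprod_tprod U.lsmul n b u

theorem powAct_actPow (U : HermMorita B A) {n : ℕ} (b : B.pow n) (a : A.pow n)
    (w : ⨂[K] (_ : Fin n), U.space.carrier) :
    powAct B.carrier U.space.carrier n b (actPow U.space.rmulHom n a w) =
      actPow U.space.rmulHom n a (powAct B.carrier U.space.carrier n b w) :=
  LinearMap.congr_fun (actPow_comm U.lsmul U.space.rmulHom (fun b a => by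
    ext u
    exact smul_comm b (MulOpposite.op a) u) n b a) w

theorem invPow_formPow (U : HermMorita B A) {n : ℕ} (b : B.pow n) (u u' : Fin n → U.space.carrier) :
    A.invPow n (U.space.formPow u (powAct B.carrier U.space.carrier n b (PiTensorProduct.tprod K u'))) =
      (((U.sign ^ n : signGroup ι) : Kˣ) : K) • U.space.formPow u'
        (powAct B.carrier U.space.carrier n (B.invPow n b) (PiTensorProduct.tprod K u)) := by
  have hsm : ∀ (c : K) (a : A.pow n), A.invPow n (c • a) = ι c • A.invPow n a := fun c a =>
    map_smul (PiTensorProduct.lift (A.invPowMultilinear n)) c _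
  have hsm' : ∀ (c : K) (a : B.pow n), B.invPow n (c • a) = ι c • B.invPow n a := fun c a =>
    map_smul (PiTensorProduct.lift (B.invPowMultilinear n)) c _
  induction b using PiTensorProduct.induction_on with
  | smul_tprod c b =>
    rw [map_smul, LinearMap.smul_apply, map_smul, hsm, hsm', map_smul, LinearMap.smul_apply, map_smul,
      smul_comm]
    congr 1
    rw [powAct_tprod, HermSpace.formPow_tprod, A.invPow_tprod, B.invPow_tprod, powAct_tprod,
      HermSpace.formPow_tprod]
    have h1 : ∀ i, A.inv (U.space.form (u i) (b i • u' i)) =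
        ((U.sign : Kˣ) : K) • U.space.form (u' i) (B.inv (b i) • u i) := fun i => by
      rw [U.space.form_symm, U.adjoint]
    simp only [h1]
    rw [MultilinearMap.map_smul_univ]
    simp
  | add b b' hb hb' =>
    rw [map_add, LinearMap.add_apply, map_add, A.invPow_add, B.invPow_add, hb, hb', map_add,
      LinearMap.add_apply, map_add, smul_add]

variable [Nontrivial K] [IsReduced K] [IsArtinianRing K] [InvBase ι]

theorem exists_isPush (U : HermMorita B A) {n : ℕ} {ε : signGroup ι} (X : B.Herm n ε) :
    ∃ Y, IsPush U X Y := by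
  obtain ⟨q, x, y, hxy⟩ := U.space.exists_dual_basis A.goldman
  obtain ⟨Y, m, h1, h2, h3, h4⟩ := HermSpace.exists_comp (B.goldmanPow n) X (A.goldmanPow n)
    (U.sign ^ n) (powAct B.carrier U.space.carrier n) (U.powAct_mul n)
    (fun u : Fin n → U.space.carrier => PiTensorProduct.tprod K u)
    PiTensorProduct.span_tprod_eq_top (fun u => U.space.formPow u) (actPow U.space.rmulHom n)
    (fun b a w => U.powAct_actPow b a w) (fun u a w => U.space.formPow_actPow u a w)
    (F := Fin n → Fin q) (fun k i => x (k i)) (fun k i => y (k i))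
    (fun w => U.space.sum_actPow_formPow x y hxy w) (fun b u u' => U.invPow_formPow b u u')
  refine ⟨Y, m, h1, h2, fun a x w => ?_, fun x x' u w => h4 x u x' w⟩
  rw [← h3, actPow_tprod]
  rfl

theorem IsPush.generates {U : HermMorita B A} {n : ℕ} {ε : signGroup ι} {X : B.Herm n ε}
    {Y : A.Herm n (U.sign ^ n * ε)} (h : IsPush U X Y) {T S : Type*} {a : T → X.carrier}
    {u : S → U.space.carrier} (ha : X.Generates a) (hu : Submodule.span K (Set.range u) = ⊤) :
    ∃ c : T × (Fin n → S) → Y.carrier, Y.Generates c ∧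
      ∀ i j, Y.form (c i) (c j) = U.space.formPow (fun k => u (i.2 k))
        (powAct B.carrier U.space.carrier n (X.form (a i.1) (a j.1))
          (PiTensorProduct.tprod K fun k => u (j.2 k))) := by
  obtain ⟨m, hm, hker, -, hform⟩ := h
  refine ⟨fun i => m (a i.1 ⊗ₜ PiTensorProduct.tprod K fun k => u (i.2 k)),
    HermSpace.Generates.of_span ?_, fun i j => hform _ _ _ _⟩
  have hspan := PiTensorProduct.submodule_span_eq_top (R := K) fun _ : Fin n => hu
  have h1 := congrArg (Submodule.map m) (TensorProduct.span_tmul_eq_top_of_span ha.span_op_smul hspan)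
  rw [Submodule.map_span, Submodule.map_top, LinearMap.range_eq_top.mpr hm, ← Set.range_comp] at h1
  rw [eq_top_iff, ← h1, Submodule.span_le]
  rintro _ ⟨⟨⟨b, t⟩, s⟩, rfl⟩
  have h2 : m ((MulOpposite.op b • a t) ⊗ₜ PiTensorProduct.tprod K fun k => u (s k)) =
      m (a t ⊗ₜ powAct B.carrier U.space.carrier n b (PiTensorProduct.tprod K fun k => u (s k))) := by
    rw [← sub_eq_zero, ← map_sub]
    change _ ∈ LinearMap.ker m
    rw [hker]
    exact Submodule.subset_span ⟨_, _, _, rfl⟩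
  change m ((MulOpposite.op b • a t) ⊗ₜ PiTensorProduct.tprod K fun k => u (s k)) ∈ _
  rw [h2]
  generalize powAct B.carrier U.space.carrier n b (PiTensorProduct.tprod K fun k => u (s k)) = w
  have hw : w ∈ Submodule.span K (Set.range fun j : Fin n → S =>
      PiTensorProduct.tprod K fun i => u (j i)) := by rw [hspan]; trivial
  have h4 := Submodule.mem_map_of_mem (f := m ∘ₗ TensorProduct.mk K X.carrier _ (a t)) hw
  rw [Submodule.map_span, ← Set.range_comp] at h4
  refine Submodule.span_mono ?_ h4
  rintro _ ⟨s', rfl⟩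
  exact ⟨(t, s'), rfl⟩

/-- Compositions of hermitian Morita equivalences exist. The left action on the tensor product is
determined by its adjoint, and it exhausts the endomorphisms because these are sums of endomorphisms
of rank one, which come from those of the two factors. -/
theorem exists_isComp (U : HermMorita C B) (V : HermMorita B A) : ∃ W, IsComp U V W := by
  obtain ⟨q, x, y, hxy⟩ := V.space.exists_dual_basis A.goldman
  obtain ⟨Y, m, hm, hker, hr, hform⟩ := HermSpace.exists_comp B.goldman U.space A.goldman
    V.sign V.lsmul (fun a b => map_mul (Algebra.lsmul K K V.space.carrier) a b)
    (fun v : V.space.carrier => v) (by simp) (fun v => V.space.form v) V.space.rmulHom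
    (fun b a v => smul_comm b (MulOpposite.op a) v) (fun v a w => V.space.form_right v w a)
    x y hxy (fun b v v' => by
      rw [lsmul_apply, lsmul_apply, V.space.form_symm, V.adjoint])
  have hgen : Y.Generates fun i : U.space.carrier × V.space.carrier => m (i.1 ⊗ₜ i.2) := by
    refine HermSpace.Generates.of_span ?_
    have h1 := congrArg (Submodule.map m) (TensorProduct.span_tmul_range (K := K)
      (M := U.space.carrier) (v := fun v : V.space.carrier => v) (by simp))
    rw [Submodule.map_span, Submodule.map_top, LinearMap.range_eq_top.mpr hm, ← Set.range_comp] at h1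
    exact h1
  -- the action of `c` is characterized by its adjoint
  have ex : ∀ (c : C.carrier) (w : Y.carrier), ∃ w', ∀ u v,
      Y.form (m (u ⊗ₜ v)) w' = Y.form (m ((C.inv c • u) ⊗ₜ v)) w := by
    intro c w
    induction w using TensorProduct.induction_of_surjective hm with
    | tmul u' v' =>
      exact ⟨m ((c • u') ⊗ₜ v'), fun u v => by
        rw [hform, hform, U.adjoint, C.inv_inv]⟩
    | add x y hx hy =>
      obtain ⟨x', hx'⟩ := hx
      obtain ⟨y', hy'⟩ := hy
      exact ⟨x' + y', fun u v => by rw [map_add, map_add, hx', hy']⟩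
    | zero => exact ⟨0, fun u v => by rw [map_zero, map_zero]⟩
  have uniq : ∀ {w w' : Y.carrier}, (∀ u v, Y.form (m (u ⊗ₜ v)) w = Y.form (m (u ⊗ₜ v)) w') →
      w = w' := fun {w w'} h => Y.eq_of_form_right A.goldman.inv_zero hgen fun i => h i.1 i.2
  choose act hact using ex
  have hact_m : ∀ c u v, act c (m (u ⊗ₜ v)) = m ((c • u) ⊗ₜ v) := fun c u v => uniq fun u' v' => by
    rw [hact, hform, hform, U.adjoint, C.inv_inv]
  let modC : Module C.carrier Y.carrier :=
    { smul := act
      one_smul := fun w => uniq fun u v => by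
        change Y.form _ (act 1 w) = _
        rw [hact, C.inv_one, one_smul]
      mul_smul := fun c c' w => uniq fun u v => by
        change Y.form _ (act (c * c') w) = Y.form _ (act c (act c' w))
        rw [hact, hact, hact, C.inv_mul, mul_smul]
      smul_zero := fun c => uniq fun u v => by
        change Y.form _ (act c 0) = _
        rw [hact, map_zero, map_zero]
      smul_add := fun c w w' => uniq fun u v => by
        change Y.form _ (act c (w + w')) = Y.form _ (act c w + act c w')
        rw [hact, map_add, map_add, hact, hact]
      add_smul := fun c c' w => uniq fun u v => by
        change Y.form _ (act (c + c') w) = Y.form _ (act c w + act c' w)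
        rw [hact, C.inv_add, add_smul, TensorProduct.add_tmul, map_add, map_add,
          LinearMap.add_apply, map_add, hact, hact]
      zero_smul := fun w => uniq fun u v => by
        change Y.form _ (act 0 w) = _
        rw [hact, C.inv_zero, zero_smul, TensorProduct.zero_tmul, map_zero, map_zero, map_zero,
          LinearMap.zero_apply] }
  have towC : IsScalarTower K C.carrier Y.carrier := ⟨fun k c w => uniq fun u v => by
    change Y.form _ (act (k • c) w) = Y.form _ (k • act c w)
    rw [hact, C.inv_smul, smul_assoc, ← TensorProduct.smul_tmul', map_smul, map_smulₛₗ,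
      InvBase.inv, LinearMap.smul_apply, map_smul, hact]⟩
  have comC : SMulCommClass C.carrier A.carrierᵐᵒᵖ Y.carrier := ⟨fun c a w => uniq fun u v => by
    have h1 := fun w₁ w₂ => Y.form_right w₁ w₂ a.unop
    simp only [MulOpposite.op_unop] at h1
    change Y.form _ (act c (a • w)) = Y.form _ (a • act c w)
    rw [hact, h1, h1, hact]⟩
  -- rank one endomorphisms come from `C`
  have hone : ∀ u v u' v', ∃ c, ∀ w, Y.rankOne (m (u ⊗ₜ v)) (m (u' ⊗ₜ v')) w = act c w := by
    intro u v u' v'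
    obtain ⟨b, hb⟩ := V.full (V.space.rankOne v v')
    obtain ⟨c, hc⟩ := U.full (U.space.rankOne (U.space.rmul b u) u')
    refine ⟨c, fun w => ?_⟩
    have hrel : ∀ u v b, m (U.space.rmul b u ⊗ₜ v) = m (u ⊗ₜ (b • v)) := by
      intro u v b
      rw [← sub_eq_zero, ← map_sub]
      change _ ∈ LinearMap.ker m
      rw [hker]
      exact Submodule.subset_span ⟨_, _, _, rfl⟩
    induction w using TensorProduct.induction_of_surjective hm with
    | tmul u'' v'' =>
      rw [hact_m, ← hc, HermSpace.rankOne_apply, HermSpace.rankOne_apply, hform]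
      change Y.rmul _ _ = m (U.space.rmul _ (U.space.rmul b u) ⊗ₜ _)
      rw [hrel, hrel, ← hr, ← hb]
      rfl
    | add x y hx hy =>
      rw [map_add, hx, hy]
      exact (smul_add (M := C.carrier) c x y).symm
    | zero =>
      rw [map_zero]
      exact (smul_zero (M := C.carrier) c).symm
  have hrank : ∀ w w', ∃ c : C.carrier, ∀ x, Y.rankOne w w' x = act c x := by
    intro w w'
    induction w using TensorProduct.induction_of_surjective hm with
    | tmul u v =>
      induction w' using TensorProduct.induction_of_surjective hm with
      | tmul u' v' => exact hone u v u' v'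
      | add x y hx hy =>
        obtain ⟨c, hc⟩ := hx
        obtain ⟨c', hc'⟩ := hy
        refine ⟨c + c', fun z => ?_⟩
        refine Eq.trans ?_ (add_smul (R := C.carrier) c c' z).symm
        change _ = act c z + act c' z
        rw [← hc, ← hc', HermSpace.rankOne_apply, map_add, LinearMap.add_apply, MulOpposite.op_add,
          add_smul]
        rfl
      | zero =>
        refine ⟨0, fun z => ?_⟩
        refine Eq.trans (?_ : _ = (0 : Y.carrier)) (zero_smul C.carrier z).symm
        rw [HermSpace.rankOne_apply, map_zero, LinearMap.zero_apply, MulOpposite.op_zero, zero_smul]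
    | add x y hx hy =>
      obtain ⟨c, hc⟩ := hx
      obtain ⟨c', hc'⟩ := hy
      refine ⟨c + c', fun z => ?_⟩
      refine Eq.trans ?_ (add_smul (R := C.carrier) c c' z).symm
      change _ = act c z + act c' z
      rw [← hc, ← hc', HermSpace.rankOne_apply, smul_add]
      rfl
    | zero =>
      refine ⟨0, fun z => ?_⟩
      refine Eq.trans (?_ : _ = (0 : Y.carrier)) (zero_smul C.carrier z).symm
      rw [HermSpace.rankOne_apply, smul_zero]
  refine ⟨{ sign := V.sign * U.sign
            space := Y
            leftModule := modC
            leftScalarTower := towC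
            smulCommClass := comC
            faithful := fun c hc => ?_
            full := fun f => ?_
            adjoint := fun c w w' => ?_ }, m, hm, hker, fun c u v => (hact_m c u v).symm,
    fun a u v => hr a u v, fun u v u' v' => hform u v u' v'⟩
  -- an element that acts as zero is tested against the forms of both factors
  · refine U.faithful c fun u' => ?_
    refine U.space.eq_zero_of_form_right B.goldman.inv_zero U.space.generates_id fun u => ?_
    refine V.faithful _ fun v' => ?_
    refine V.space.eq_zero_of_form_right A.goldman.inv_zero V.space.generates_id fun v => ?_
    have h1 : act c (m (u' ⊗ₜ v')) = 0 := hc _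
    rw [hact_m] at h1
    have h2 := hform u v (c • u') v'
    rw [h1, map_zero] at h2
    exact h2.symm
  -- an endomorphism is a sum of rank one endomorphisms along a dual basis
  · obtain ⟨n, x, y, hxy⟩ := Y.exists_dual_basis A.goldman
    have hc : ∀ i, ∃ c : C.carrier, ∀ z, Y.rankOne (f (x i)) (y i) z = act c z :=
      fun i => hrank _ _
    choose c hc using hc
    refine ⟨∑ i, c i, fun w => ?_⟩
    conv_lhs => rw [← hxy w, map_sum]
    rw [Finset.sum_smul]
    refine Finset.sum_congr rfl fun i _ => ?_
    rw [map_smul]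
    exact hc i w
  · change Y.form (act c w) w' = Y.form w (act (C.inv c) w')
    induction w using TensorProduct.induction_of_surjective hm with
    | tmul u v => rw [hact, C.inv_inv, hact_m]
    | add x y hx hy =>
      have h1 : act c (x + y) = act c x + act c y := smul_add (M := C.carrier) c x y
      rw [h1, map_add, map_add, LinearMap.add_apply, LinearMap.add_apply, hx, hy]
    | zero =>
      have h1 : act c 0 = 0 := smul_zero (M := C.carrier) c
      rw [h1, map_zero, LinearMap.zero_apply, LinearMap.zero_apply]

end HermMorita

/-! ### Presentations of hermitian spaces by Gram matrices -/

section

variable {K : Type u} [CommRing K]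

/-- Transport of a splitting along an isomorphism. -/
abbrev GoldmanAlg.congr {L R R' : Type u} [CommRing L] [Algebra K L] [Ring R] [Algebra K R] [Ring R']
    [Algebra K R'] (G : GoldmanAlg K L R') (e : R ≃ₐ[K] R') : GoldmanAlg K L R where
  I := G.I
  ψ := G.ψ.comp e.toAlgHom
  span_ψ := by
    rw [← G.span_ψ]
    congr 1
    exact e.surjective.range_comp G.ψ
  t := G.t ∘ₗ e.toLinearMap
  trace_ψ x := G.trace_ψ (e x)
  κ := G.κ
  a k := e.symm (G.a k)
  b k := e.symm (G.b k)
  frob x := by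
    apply e.injective
    rw [map_sum, ← G.frob (e x)]
    refine Finset.sum_congr rfl fun k _ => ?_
    rw [map_smul, e.apply_symm_apply]
    change G.t (e (x * e.symm (G.a k))) • _ = _
    rw [map_mul, e.apply_symm_apply]

variable {ι : K →+* K}

/-- The Gram matrix of an orthogonal sum. -/
def sumGram {S T N : Type*} [Zero N] (g : S → S → N) (g' : T → T → N) : S ⊕ T → S ⊕ T → N
  | .inl i, .inl j => g i j
  | .inr i, .inr j => g' i j
  | _, _ => 0

theorem HermSpace.Generates.sum {R : Type u} [Ring R] [Algebra K R] {s : R → R} {ε : signGroup ι}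
    (hs : ∀ a b, s (a + b) = s a + s b) {X Y : HermSpace ι R s ε} {S T : Type*} {a : S → X.carrier}
    {b : T → Y.carrier} (ha : X.Generates a) (hb : Y.Generates b) :
    (HermSpace.sum hs X Y).Generates
      (Sum.elim (fun i => (a i, 0)) (fun i => (0, b i)) : S ⊕ T → X.carrier × Y.carrier) := by
  change Submodule.span Rᵐᵒᵖ (Set.range (Sum.elim (fun i => (a i, 0)) (fun i => (0, b i)) :
    S ⊕ T → X.carrier × Y.carrier)) = (⊤ : Submodule Rᵐᵒᵖ (X.carrier × Y.carrier))
  rw [Set.Sum.elim_range, Submodule.span_union, eq_top_iff]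
  have h1 : Submodule.span Rᵐᵒᵖ (Set.range fun i => (a i, (0 : Y.carrier))) =
      Submodule.map (LinearMap.inl Rᵐᵒᵖ X.carrier Y.carrier) ⊤ := by
    rw [← show _ = ⊤ from ha, Submodule.map_span, ← Set.range_comp]
    rfl
  have h2 : Submodule.span Rᵐᵒᵖ (Set.range fun i => ((0 : X.carrier), b i)) =
      Submodule.map (LinearMap.inr Rᵐᵒᵖ X.carrier Y.carrier) ⊤ := by
    rw [← show _ = ⊤ from hb, Submodule.map_span, ← Set.range_comp]
    rfl
  rw [h1, h2]
  rintro ⟨x, y⟩ -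
  rw [show (x, y) = (x, 0) + (0, y) by simp]
  exact Submodule.add_mem_sup ⟨x, trivial, rfl⟩ ⟨y, trivial, rfl⟩

end

namespace AzumayaInv

variable {K : Type u} [CommRing K] {ι : K →+* K} {A : AzumayaInv ι} [Nontrivial K] [IsReduced K]
  [IsArtinianRing K] [InvBase ι]

/-- The space `X` has a generating family indexed by `T` whose inner products are, in the
coordinates of the splitting `G`, the matrices `g i j`. -/
def Presents (G : GoldmanAlg K (Pt ι) A.carrier) {n : ℕ} {ε : signGroup ι} (X : A.Herm n ε)
    {T : Type*} (g : T → T → (Fin n → G.I) → (Fin n → G.I) → Pt ι) : Prop :=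
  ∃ c : T → X.carrier, X.Generates c ∧
    ∀ i j f h, psiPow G.ψ (Fin n) (X.form (c i) (c j)) f h = g i j f h

variable {G : GoldmanAlg K (Pt ι) A.carrier} {m n : ℕ} {ε ε' : signGroup ι} {S T : Type*}

theorem presents_id (G : GoldmanAlg K (Pt ι) A.carrier) (X : A.Herm n ε) :
    Presents G X fun (x y : X.carrier) f h => psiPow G.ψ (Fin n) (X.form x y) f h :=
  ⟨id, X.generates_id, fun _ _ _ _ => rfl⟩

namespace Presents

theorem isometric {X Y : A.Herm n ε} {g : T → T → (Fin n → G.I) → (Fin n → G.I) → Pt ι}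
    (hX : Presents G X g) (hY : Presents G Y g) : HermSpace.Isometric X Y := by
  obtain ⟨a, ha, hg⟩ := hX
  obtain ⟨b, hb, hg'⟩ := hY
  refine HermSpace.isometric_of_gram (A.invPow_zero n) ha hb fun i j => ?_
  apply G.psiPow_injective (Pt.injective ι) n
  ext f h
  rw [hg', hg]

theorem congr {X : A.Herm n ε} {g g' : T → T → (Fin n → G.I) → (Fin n → G.I) → Pt ι}
    (hX : Presents G X g) (h : ∀ i j f h, g' i j f h = g i j f h) : Presents G X g' := by
  obtain ⟨a, ha, hg⟩ := hX
  exact ⟨a, ha, fun i j f k => (hg i j f k).trans (h i j f k).symm⟩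

theorem comp_surjective {X : A.Herm n ε} {g : T → T → (Fin n → G.I) → (Fin n → G.I) → Pt ι}
    (hX : Presents G X g) {σ : S → T} (hσ : Function.Surjective σ) :
    Presents G X fun i j => g (σ i) (σ j) := by
  obtain ⟨a, ha, hg⟩ := hX
  refine ⟨a ∘ σ, ?_, fun i j => hg _ _⟩
  rw [HermSpace.Generates, hσ.range_comp]
  exact ha

/-- A subfamily still generates if, up to the action of permutations of the tensor factors and
scalars, it has the same inner products as the whole family. -/
theorem restrict {X : A.Herm n ε} {g : T → T → (Fin n → G.I) → (Fin n → G.I) → Pt ι}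
    (hX : Presents G X g) {σ : S → T} (hσ : ∀ t, ∃ (t' : S) (π : Equiv.Perm (Fin n)) (k : ℤ),
      ∀ i f h, g i t f h = k * g i (σ t') f (h ∘ π)) : Presents G X fun i j => g (σ i) (σ j) := by
  obtain ⟨a, ha, hg⟩ := hX
  refine ⟨a ∘ σ, ha.of_forall fun t => ?_, fun i j => hg _ _⟩
  obtain ⟨t', π, k, h1⟩ := hσ t
  -- the vector `a t` is the multiple of `a (σ t')` by the Goldman permutation, which permutes columns
  have h2 : a t = MulOpposite.op (k • G.gamma (Pt.injective ι) n π.symm) • a (σ t') := by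
    refine X.eq_of_form_right (A.invPow_zero n) ha fun i => ?_
    rw [X.form_right]
    apply G.psiPow_injective (Pt.injective ι) n
    ext f h
    rw [hg, h1, map_mul, map_zsmul, GoldmanAlg.psiPow_gamma, Matrix.mul_apply,
      Finset.sum_eq_single (h ∘ π)]
    · rw [Matrix.smul_apply, tensorPermMatrix_apply, if_pos, hg, zsmul_eq_mul, mul_one, mul_comm]
      funext x
      simp
    · intro e _ he
      rw [Matrix.smul_apply, tensorPermMatrix_apply, if_neg, smul_zero, mul_zero]
      rintro rfl
      exact he (by funext x; simp)
    · intro h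
      exact absurd (Finset.mem_univ _) h
  rw [h2]
  exact Submodule.smul_mem _ _ (Submodule.subset_span ⟨t', rfl⟩)

/-- The tensor factors can be permuted. -/
theorem twist {X : A.Herm n ε}
    {g : T → T → (Fin n → A.goldman.I) → (Fin n → A.goldman.I) → Pt ι}
    (hX : Presents A.goldman.toGoldmanAlg X g) (π : Equiv.Perm (Fin n)) :
    Presents A.goldman.toGoldmanAlg X fun i j f h => g i j (f ∘ π) (h ∘ π) := by
  obtain ⟨a, ha, hg⟩ := hX
  let γ := A.goldman.toGoldmanAlg.gamma (Pt.injective ι) n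
  have hγ : ∀ π f h, psiPow A.goldman.ψ (Fin n) (γ π) f h = if h = f ∘ π then 1 else 0 := by
    intro π f h
    rw [← tensorPermMatrix_apply, ← GoldmanAlg.psiPow_gamma]
  refine ⟨fun i => MulOpposite.op (γ π.symm) • a i, ha.of_forall fun t => ?_, fun i j f h => ?_⟩
  · have h1 : a t = MulOpposite.op (γ π) • MulOpposite.op (γ π.symm) • a t := by
      rw [smul_smul, ← MulOpposite.op_mul, ← γ.map_mul,
        show π.symm * π = 1 from Equiv.ext fun x => π.symm_apply_apply x, γ.map_one,
        MulOpposite.op_one, one_smul]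
    rw [h1]
    exact Submodule.smul_mem _ _ (Submodule.subset_span ⟨t, rfl⟩)
  · rw [X.form_left, X.form_right]
    have h3 : ∀ e, psiPow A.goldman.ψ (Fin n) (A.invPow n (γ π.symm)) f e =
        if e = f ∘ π then 1 else 0 := by
      intro e
      refine ((A.goldmanPow n).ψ_inv (γ π.symm) f e).trans ?_
      refine (congrArg (Pt.swap ι) (hγ _ _ _)).trans ?_
      rw [apply_ite (Pt.swap ι), map_one, map_zero]
      refine if_congr ?_ rfl rfl
      constructor
      · rintro rfl
        funext x
        simp
      · rintro rfl
        funext x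
        simp
    refine (congrFun (congrFun (map_mul (psiPow A.goldman.ψ (Fin n)) _ _) f) h).trans ?_
    rw [Matrix.mul_apply, Finset.sum_eq_single (f ∘ π)]
    · rw [h3, if_pos rfl, one_mul]
      refine (congrFun (congrFun (map_mul (psiPow A.goldman.ψ (Fin n)) _ _) _) h).trans ?_
      rw [Matrix.mul_apply, Finset.sum_eq_single (h ∘ π)]
      · rw [hγ, if_pos, mul_one, hg]
        funext x
        simp
      · intro e _ he
        rw [hγ, if_neg, mul_zero]
        rintro rfl
        exact he (by funext x; simp)
      · intro h
        exact absurd (Finset.mem_univ _) h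
    · intro e _ he
      rw [h3, if_neg he, zero_mul]
    · intro h
      exact absurd (Finset.mem_univ _) h

theorem sum {X Y : A.Herm n ε} {g : S → S → (Fin n → G.I) → (Fin n → G.I) → Pt ι}
    {g' : T → T → (Fin n → G.I) → (Fin n → G.I) → Pt ι} (hX : Presents G X g)
    (hY : Presents G Y g') :
    Presents G (HermSpace.sum (A.invPow_add n) X Y) (sumGram g g') := by
  obtain ⟨a, ha, hg⟩ := hX
  obtain ⟨b, hb, hg'⟩ := hY
  refine ⟨_, ha.sum (A.invPow_add n) hb, ?_⟩
  rintro (i | i) (j | j) f h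
  · change psiPow G.ψ (Fin n) (X.form (a i) (a j) + Y.form 0 0) f h = _
    rw [map_zero, add_zero, hg]
    rfl
  · change psiPow G.ψ (Fin n) (X.form (a i) 0 + Y.form 0 (b j)) f h = _
    rw [map_zero, map_zero, LinearMap.zero_apply, add_zero, map_zero]
    rfl
  · change psiPow G.ψ (Fin n) (X.form 0 (a j) + Y.form (b i) 0) f h = _
    rw [map_zero, map_zero, LinearMap.zero_apply, add_zero, map_zero]
    rfl
  · change psiPow G.ψ (Fin n) (X.form 0 0 + Y.form (b i) (b j)) f h = _
    rw [map_zero, zero_add, hg']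
    rfl

theorem tensor {X : A.Herm m ε} {Y : A.Herm n ε'} {Z : A.Herm (m + n) (ε * ε')}
    {g : S → S → (Fin m → G.I) → (Fin m → G.I) → Pt ι}
    {g' : T → T → (Fin n → G.I) → (Fin n → G.I) → Pt ι} (hX : Presents G X g)
    (hY : Presents G Y g') (hZ : IsTensor X Y Z) :
    Presents G Z fun (i j : S × T) f h =>
      g i.1 j.1 (f ∘ Fin.castAdd n) (h ∘ Fin.castAdd n) *
        g' i.2 j.2 (f ∘ Fin.natAdd m) (h ∘ Fin.natAdd m) := by
  obtain ⟨a, ha, hg⟩ := hX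
  obtain ⟨b, hb, hg'⟩ := hY
  obtain ⟨c, hc, hf⟩ := hZ.generates ha hb
  refine ⟨c, hc, fun i j f h => ?_⟩
  rw [hf]
  refine (G.psiPow_mulEquiv _ _ f h).trans ?_
  rw [hg, hg']

theorem alt {d : ℕ} {X : A.Herm n ε} {Y : A.Herm (d * n) (ε ^ d)}
    {g : T → T → (Fin n → G.I) → (Fin n → G.I) → Pt ι} (hX : Presents G X g) (hY : IsAlt d X Y) :
    Presents G Y fun (x x' : Fin d → T) f h => (Matrix.of fun i j => g (x i) (x' j)
      (fun k => f (finProdFinEquiv (i, k))) (fun k => h (finProdFinEquiv (j, k)))).det := by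
  obtain ⟨a, ha, hg⟩ := hX
  obtain ⟨c, hc, hf⟩ := hY.generates ha
  refine ⟨c, hc, fun i j f h => ?_⟩
  rw [hf]
  simp only [hg]

end Presents

/-- The homogeneous components of the semiring of hermitian spaces. -/
abbrev SWFam (A : AzumayaInv ι) (g : GammaN ι) : Type (u + 1) := A.SW g.1 g.2.toMul

/-- The class of a hermitian space, together with its degree. -/
def gcls (X : A.Herm n ε) : GradedMonoid A.SWFam :=
  GradedMonoid.mk (n, Additive.ofMul ε) (cls X)

theorem gcls_eq_of_isometric {X Y : A.Herm n ε} (h : HermSpace.Isometric X Y) :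
    gcls X = gcls Y := congrArg (GradedMonoid.mk _) (Quotient.sound h)

theorem Presents.gcls_eq {n' : ℕ} {X : A.Herm n ε} {Y : A.Herm n' ε'}
    {g : T → T → (Fin n → G.I) → (Fin n → G.I) → Pt ι}
    {g' : T → T → (Fin n' → G.I) → (Fin n' → G.I) → Pt ι} (hX : Presents G X g)
    (hY : Presents G Y g') (hn : n' = n) (hε : ε' = ε)
    (h : ∀ i j f h, g i j f h = g' i j (f ∘ Fin.cast hn) (h ∘ Fin.cast hn)) : gcls X = gcls Y := by
  subst hn hε
  exact gcls_eq_of_isometric (hX.isometric (hY.congr h))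

end AzumayaInv

namespace HermMorita

variable {K : Type u} [CommRing K] {ι : K →+* K} {A B : AzumayaInv ι} (U : HermMorita B A)

/-- The action of `B`, as an isomorphism with the endomorphism algebra. -/
def endEquiv : B.carrier ≃ₐ[K] U.space.endAlg :=
  AlgEquiv.ofBijective
    { toFun := fun b =>
        { toFun := fun v => b • v
          map_add' := smul_add b
          map_smul' := fun a v => smul_comm b a v }
      map_one' := by ext v; exact one_smul _ v
      map_mul' := fun b b' => by ext v; exact mul_smul b b' v
      map_zero' := by ext v; exact zero_smul _ v
      map_add' := fun b b' => by ext v; exact add_smul b b' v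
      commutes' := fun c => by ext v; exact algebraMap_smul _ c v }
    ⟨(injective_iff_map_eq_zero _).mpr fun b hb => U.faithful b fun v => LinearMap.congr_fun hb v,
      fun f => by
        obtain ⟨b, hb⟩ := U.full f
        exact ⟨b, by ext v; exact (hb v).symm⟩⟩

variable [Nontrivial K] [IsReduced K] [IsArtinianRing K] [InvBase ι]

/-- The splitting of `B` that comes from coordinates on the bimodule. -/
abbrev goldman (C : U.space.Coord A.goldman) : GoldmanAlg K (Pt ι) B.carrier :=
  C.endGoldman.congr U.endEquiv

variable (C : U.space.Coord A.goldman)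

theorem χ_smul (b : B.carrier) (v : U.space.carrier) :
    C.χ (b • v) = (U.goldman C).ψ b * C.χ v := C.χ_apply (U.endEquiv b) v

theorem psiPow_formPow {n : ℕ} (u u' : Fin n → U.space.carrier) (b : B.pow n)
    (f h : Fin n → A.goldman.I) :
    psiPow A.goldman.ψ (Fin n) (U.space.formPow u
      (powAct B.carrier U.space.carrier n b (PiTensorProduct.tprod K u'))) f h =
        ∑ P : Fin n → C.J, ∑ Q : Fin n → C.J, (∏ i, C.η (u i) (f i) (P i)) *
          psiPow (U.goldman C).ψ (Fin n) b P Q * ∏ i, C.χ (u' i) (Q i) (h i) := by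
  rw [C.psiPow_formPow]
  refine Finset.sum_congr rfl fun P _ => ?_
  simp only [mul_assoc]
  rw [← Finset.mul_sum]
  congr 1
  have key : ∀ b : B.pow n, tensorCoord C.χ n (powAct B.carrier U.space.carrier n b
      (PiTensorProduct.tprod K u')) = psiPow (U.goldman C).ψ (Fin n) b *
        (Matrix.of fun Q h => ∏ i, C.χ (u' i) (Q i) (h i) : Matrix (Fin n → C.J) _ (Pt ι)) := by
    intro b
    induction b using PiTensorProduct.induction_on with
    | smul_tprod r b =>
      rw [map_smul, map_smul, LinearMap.smul_apply, map_smul, powAct_tprod, Matrix.smul_mul]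
      congr 1
      ext P h
      rw [tensorCoord_tprod, Matrix.mul_apply]
      simp only [psiPow_tprod, χ_smul, Matrix.mul_apply, Matrix.of_apply, ← Finset.prod_mul_distrib]
      exact Fintype.prod_sum_eq_sum_prod (T := Fin n) (I := C.J) fun i p =>
        (U.goldman C).ψ (b i) (P i) p * C.χ (u' i) p (h i)
    | add b b' hb hb' =>
      rw [map_add, map_add, LinearMap.add_apply, map_add, Matrix.add_mul, hb, hb']
  rw [key, Matrix.mul_apply]
  rfl

end HermMorita

theorem AzumayaInv.Presents.push {K : Type u} [CommRing K] {ι : K →+* K} {A B : AzumayaInv ι}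
    [Nontrivial K] [IsReduced K] [IsArtinianRing K] [InvBase ι] {U : HermMorita B A}
    {C : U.space.Coord A.goldman} {n : ℕ} {ε : signGroup ι} {X : B.Herm n ε}
    {Y : A.Herm n (U.sign ^ n * ε)} {T : Type*}
    {g : T → T → (Fin n → C.J) → (Fin n → C.J) → Pt ι} (hX : Presents (U.goldman C) X g)
    (hY : HermMorita.IsPush U X Y) :
    Presents A.goldman.toGoldmanAlg Y fun (i j : T × (Fin n → U.space.carrier)) f h =>
      ∑ P : Fin n → C.J, ∑ Q : Fin n → C.J, (∏ k, C.η (i.2 k) (f k) (P k)) *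
        g i.1 j.1 P Q * ∏ k, C.χ (j.2 k) (Q k) (h k) := by
  obtain ⟨a, ha, hg⟩ := hX
  obtain ⟨c, hc, hf⟩ := hY.generates ha (u := fun u : U.space.carrier => u) (by simp)
  refine ⟨c, hc, fun i j f h => ?_⟩
  rw [hf]
  refine (U.psiPow_formPow C i.2 j.2 _ f h).trans ?_
  refine Finset.sum_congr rfl fun P _ => Finset.sum_congr rfl fun Q _ => ?_
  congr 2
  exact hg _ _ _ _

/-! ### Associativity, commutativity and additivity of the tensor product -/

namespace AzumayaInv

variable {K : Type u} [CommRing K] {ι : K →+* K} {A : AzumayaInv ι} [Nontrivial K] [IsReduced K]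
  [IsArtinianRing K] [InvBase ι] {m n : ℕ} {ε ε' : signGroup ι} {S T : Type*}

theorem Presents.of_isometric {G : GoldmanAlg K (Pt ι) A.carrier} {X Y : A.Herm n ε}
    {g : T → T → (Fin n → G.I) → (Fin n → G.I) → Pt ι} (hX : Presents G X g)
    (h : HermSpace.Isometric X Y) : Presents G Y g := by
  obtain ⟨a, ha, hg⟩ := hX
  obtain ⟨e, h1, h2⟩ := h
  refine ⟨e ∘ a, ?_, fun i j f h => by rw [Function.comp, Function.comp, h2, hg]⟩
  let e' : X.carrier →ₗ[(A.pow n)ᵐᵒᵖ] Y.carrier :=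
    { toFun := e, map_add' := map_add e, map_smul' := fun r x => h1 r.unop x }
  have h3 := congrArg (Submodule.map e') ha
  rw [Submodule.map_span, Submodule.map_top, LinearMap.range_eq_top.mpr (show Function.Surjective e' from e.surjective),
    ← Set.range_comp] at h3
  exact h3

theorem presents_zero (G : GoldmanAlg K (Pt ι) A.carrier) (T : Type*) :
    Presents G (HermSpace.zero ι (A.pow n) (A.invPow n) (A.invPow_zero n) ε)
      fun (_ _ : T) _ _ => 0 := by
  refine ⟨fun _ => 0, ?_, fun i j f h => ?_⟩
  · rw [HermSpace.Generates, eq_top_iff]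
    intro x _
    rw [show x = 0 from rfl]
    exact zero_mem _
  · rw [map_zero, map_zero]
    rfl

theorem exists_unit (A : AzumayaInv ι) : ∃ X : A.Herm 0 1, ∀ G : GoldmanAlg K (Pt ι) A.carrier,
    Presents G X fun (_ _ : PUnit.{u + 1}) _ _ => 1 := by
  obtain ⟨X, c, hc, hf⟩ := HermSpace.exists_of_gram (A.goldmanPow 0) 1
    (T := PUnit.{u + 1}) (fun _ _ => 1) (fun _ _ => by rw [(A.goldmanPow 0).inv_one]; simp)
    (n := 1) (fun _ => PUnit.unit) (fun _ => ⟨fun _ => 1, fun _ => by simp⟩)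
  refine ⟨X, fun G => ⟨c, hc, fun i j f h => ?_⟩⟩
  rw [hf, map_one, Subsingleton.elim f h, Matrix.one_apply_eq]

/-- The unit form of rank one over `A^{⊗ 0}`. -/
def unit (A : AzumayaInv ι) : A.Herm 0 1 := A.exists_unit.choose

theorem presents_unit (G : GoldmanAlg K (Pt ι) A.carrier) :
    Presents G A.unit fun (_ _ : PUnit.{u + 1}) _ _ => 1 := A.exists_unit.choose_spec G

theorem IsTensor.isometric {X X' : A.Herm m ε} {Y Y' : A.Herm n ε'} {Z Z' : A.Herm (m + n) (ε * ε')}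
    (hX : HermSpace.Isometric X X') (hY : HermSpace.Isometric Y Y') (h : IsTensor X Y Z)
    (h' : IsTensor X' Y' Z') : HermSpace.Isometric Z Z' :=
  let G := A.goldman.toGoldmanAlg
  ((presents_id G X).tensor (presents_id G Y) h).isometric
    (((presents_id G X).of_isometric hX).tensor ((presents_id G Y).of_isometric hY) h')

theorem IsAlt.isometric {d : ℕ} {X X' : A.Herm n ε} {Y Y' : A.Herm (d * n) (ε ^ d)}
    (hX : HermSpace.Isometric X X') (h : IsAlt d X Y) (h' : IsAlt d X' Y') :
    HermSpace.Isometric Y Y' :=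
  let G := A.goldman.toGoldmanAlg
  ((presents_id G X).alt h).isometric (((presents_id G X).of_isometric hX).alt h')

theorem IsTensor.assoc {l : ℕ} {ε'' : signGroup ι} {X : A.Herm l ε} {Y : A.Herm m ε'}
    {Z : A.Herm n ε''} {XY : A.Herm (l + m) (ε * ε')} {YZ : A.Herm (m + n) (ε' * ε'')}
    {V : A.Herm (l + m + n) (ε * ε' * ε'')} {W : A.Herm (l + (m + n)) (ε * (ε' * ε''))}
    (h₁ : IsTensor X Y XY) (h₂ : IsTensor XY Z V) (h₃ : IsTensor Y Z YZ) (h₄ : IsTensor X YZ W) :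
    gcls V = gcls W := by
  have hX := presents_id A.goldman.toGoldmanAlg X
  have hY := presents_id A.goldman.toGoldmanAlg Y
  have hZ := presents_id A.goldman.toGoldmanAlg Z
  refine ((hX.tensor hY h₁).tensor hZ h₂).gcls_eq ((hX.tensor (hY.tensor hZ h₃) h₄).comp_surjective
    (σ := fun p : (X.carrier × Y.carrier) × Z.carrier => (p.1.1, p.1.2, p.2)) ?_)
    (Nat.add_assoc _ _ _).symm (mul_assoc _ _ _).symm fun i j f h => ?_
  · rintro ⟨x, y, z⟩
    exact ⟨((x, y), z), rfl⟩
  · have h1 : ∀ f : Fin (l + m + n) → A.goldman.I,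
        (f ∘ Fin.cast (Nat.add_assoc l m n).symm) ∘ Fin.natAdd l ∘ Fin.natAdd m =
          f ∘ Fin.natAdd (l + m) := fun f => by
      funext k
      exact congrArg f (Fin.ext (Nat.add_assoc l m k).symm)
    dsimp only
    rw [← h1 f, ← h1 h]
    exact mul_assoc _ _ _

theorem IsTensor.comm {X : A.Herm m ε} {Y : A.Herm n ε'} {Z : A.Herm (m + n) (ε * ε')}
    {Z' : A.Herm (n + m) (ε' * ε)} (h : IsTensor X Y Z) (h' : IsTensor Y X Z') :
    gcls Z = gcls Z' := by
  have hX := presents_id A.goldman.toGoldmanAlg X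
  have hY := presents_id A.goldman.toGoldmanAlg Y
  let π : Equiv.Perm (Fin (m + n)) := finAddFlip.trans (finCongr (Nat.add_comm n m))
  refine ((hX.tensor hY h).twist π).gcls_eq ((hY.tensor hX h').comp_surjective
    Prod.swap_surjective) (Nat.add_comm _ _) (mul_comm _ _) fun i j f k => ?_
  have h1 : ∀ f : Fin (m + n) → A.goldman.I, (f ∘ π) ∘ Fin.castAdd n =
      (f ∘ Fin.cast (Nat.add_comm n m)) ∘ Fin.natAdd n := fun f => by
    funext k
    simp [π]
  have h2 : ∀ f : Fin (m + n) → A.goldman.I, (f ∘ π) ∘ Fin.natAdd m =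
      (f ∘ Fin.cast (Nat.add_comm n m)) ∘ Fin.castAdd m := fun f => by
    funext k
    simp [π]
  rw [h1, h1, h2, h2]
  exact mul_comm _ _

theorem IsTensor.one_left {X : A.Herm n ε} {Z : A.Herm (0 + n) (1 * ε)}
    (h : IsTensor A.unit X Z) : gcls Z = gcls X := by
  have hX := presents_id A.goldman.toGoldmanAlg X
  refine ((presents_unit _).tensor hX h).gcls_eq (hX.comp_surjective
    (σ := fun p : PUnit.{u + 1} × X.carrier => p.2) fun x => ⟨(PUnit.unit, x), rfl⟩)
    (Nat.zero_add n).symm (one_mul ε).symm fun i j f h => ?_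
  have h1 : Fin.cast (Nat.zero_add n).symm = Fin.natAdd 0 := by
    funext k
    exact Fin.ext (Nat.zero_add k).symm
  rw [one_mul, h1]

theorem IsTensor.add_right {X : A.Herm m ε} {Y Y' : A.Herm n ε'}
    {Z Z' W : A.Herm (m + n) (ε * ε')} (h : IsTensor X Y Z) (h' : IsTensor X Y' Z')
    (hW : IsTensor X (HermSpace.sum (A.invPow_add n) Y Y') W) :
    HermSpace.Isometric W (HermSpace.sum (A.invPow_add (m + n)) Z Z') := by
  have hX := presents_id A.goldman.toGoldmanAlg X
  have hY := presents_id A.goldman.toGoldmanAlg Y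
  have hY' := presents_id A.goldman.toGoldmanAlg Y'
  refine (hX.tensor (hY.sum hY') hW).isometric ((((hX.tensor hY h).sum
    (hX.tensor hY' h')).comp_surjective (Equiv.prodSumDistrib _ _ _).surjective).congr ?_)
  rintro ⟨x, y | y⟩ ⟨x', z | z⟩ f k
  · rfl
  · exact mul_zero _
  · exact mul_zero _
  · rfl

theorem IsTensor.zero_right {X : A.Herm m ε} {W : A.Herm (m + n) (ε * ε')}
    (hW : IsTensor X (HermSpace.zero ι (A.pow n) (A.invPow n) (A.invPow_zero n) ε') W) :
    HermSpace.Isometric W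
      (HermSpace.zero ι (A.pow (m + n)) (A.invPow (m + n)) (A.invPow_zero (m + n)) (ε * ε')) :=
  (((presents_id A.goldman.toGoldmanAlg X).tensor (presents_zero _ PUnit.{1}) hW).congr
    fun _ _ _ _ => (mul_zero _).symm).isometric (presents_zero _ _)

theorem IsAlt.gcls_zero {X : A.Herm n ε} {Y : A.Herm (0 * n) (ε ^ 0)} (h : IsAlt 0 X Y) :
    gcls Y = gcls A.unit := by
  refine ((presents_id A.goldman.toGoldmanAlg X).alt h).gcls_eq ((presents_unit _).comp_surjective
    (σ := fun _ => PUnit.unit) (fun _ => ⟨finZeroElim, rfl⟩)) (Nat.zero_mul n).symm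
    (pow_zero ε).symm fun i j f h => ?_
  exact Matrix.det_isEmpty

theorem IsAlt.gcls_one {X : A.Herm n ε} {Y : A.Herm (1 * n) (ε ^ 1)} (h : IsAlt 1 X Y) :
    gcls Y = gcls X := by
  refine ((presents_id A.goldman.toGoldmanAlg X).alt h).gcls_eq ((presents_id _ X).comp_surjective
    (σ := fun x => x 0) (fun x => ⟨fun _ => x, rfl⟩)) (Nat.one_mul n).symm
    (pow_one ε).symm fun i j f h => ?_
  rw [Matrix.det_fin_one, Matrix.of_apply]
  have h1 : ∀ f : Fin (1 * n) → A.goldman.I, (fun k => f (finProdFinEquiv ((0 : Fin 1), k))) =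
      f ∘ Fin.cast (Nat.one_mul n).symm := fun f => by
    funext k
    refine congrArg f (Fin.ext ?_)
    simp [finProdFinEquiv]
  rw [h1, h1]

theorem Presents.cast {G : GoldmanAlg K (Pt ι) A.carrier} {n' : ℕ} {X : A.Herm n' ε'}
    {g : T → T → (Fin n' → G.I) → (Fin n' → G.I) → Pt ι} (hX : Presents G X g) (hn : n' = n)
    (hε : ε' = ε) : ∃ Y : A.Herm n ε, gcls Y = gcls X ∧
      Presents G Y fun i j f h => g i j (f ∘ Fin.cast hn) (h ∘ Fin.cast hn) := by
  subst hn hε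
  exact ⟨X, rfl, hX⟩

end AzumayaInv

/-! ### Alternating powers of orthogonal sums -/

namespace AzumayaInv

variable {K : Type u} [CommRing K] {ι : K →+* K}

instance : DecidableEq (GammaN ι) := Classical.decEq _

variable (A : AzumayaInv ι)

/-- The direct sum of the monoids of isometry classes over all degrees. -/
abbrev SWSum : Type (u + 1) := ⨁ g : GammaN ι, A.SWFam g

variable {A} {m n : ℕ} {ε ε' : signGroup ι}

/-- The class of a hermitian space as an element of the direct sum. -/
def elt (X : A.Herm n ε) : A.SWSum := DirectSum.of A.SWFam (n, Additive.ofMul ε) (cls X)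

theorem elt_eq {X : A.Herm n ε} {Y : A.Herm m ε'} (h : gcls X = gcls Y) : elt X = elt Y :=
  DirectSum.of_eq_of_gradedMonoid_eq h

theorem elt_sum (X Y : A.Herm n ε) :
    elt (HermSpace.sum (A.invPow_add n) X Y) = elt X + elt Y :=
  map_add (DirectSum.of A.SWFam (n, Additive.ofMul ε)) (cls X) (cls Y)

theorem elt_zero :
    elt (HermSpace.zero ι (A.pow n) (A.invPow n) (A.invPow_zero n) ε) = 0 :=
  map_zero (DirectSum.of A.SWFam (n, Additive.ofMul ε))

variable [Nontrivial K] [IsReduced K] [IsArtinianRing K] [InvBase ι]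
  {G : GoldmanAlg K (Pt ι) A.carrier}

/-- A space presented by a block diagonal Gram matrix is the sum of the spaces presented by the
blocks. -/
theorem Presents.elt_eq_sum {P : Type*} [Fintype P] [DecidableEq P] {T : P → Type*} {N : P → ℕ}
    {η : P → signGroup ι} {R : ∀ p, A.Herm (N p) (η p)}
    {g : ∀ p, T p → T p → (Fin (N p) → G.I) → (Fin (N p) → G.I) → Pt ι}
    (hR : ∀ p, Presents G (R p) (g p)) {Z : A.Herm n ε}
    {g₀ : (Σ p, T p) → (Σ p, T p) → (Fin n → G.I) → (Fin n → G.I) → Pt ι} (hZ : Presents G Z g₀)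
    (hn : ∀ p, N p = n) (hη : ∀ p, η p = ε)
    (hdiag : ∀ p i j f h, g₀ ⟨p, i⟩ ⟨p, j⟩ f h =
      g p i j (f ∘ Fin.cast (hn p)) (h ∘ Fin.cast (hn p)))
    (hoff : ∀ i j f h, i.1 ≠ j.1 → g₀ i j f h = 0) : elt Z = ∑ p, elt (R p) := by
  -- induction on the set of blocks that are kept, the other blocks being replaced by zero
  have key : ∀ s : Finset P, ∃ W : A.Herm n ε, elt W = ∑ p ∈ s, elt (R p) ∧
      Presents G W fun i j f h => if i.1 ∈ s then g₀ i j f h else 0 := by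
    intro s
    induction s using Finset.induction_on with
    | empty =>
      refine ⟨_, elt_zero, (presents_zero G _).congr fun i j f h => ?_⟩
      simp
    | insert p s hp ih =>
      obtain ⟨W, hW, hg⟩ := ih
      obtain ⟨R', hR', hg'⟩ := (hR p).cast (hn p) (hη p)
      refine ⟨HermSpace.sum (A.invPow_add n) R' W, ?_, ?_⟩
      · rw [elt_sum, hW, Finset.sum_insert hp, elt_eq hR']
      -- the family of the sum is restricted to the block `p` of the first summand and the other blocks
      -- of the second; the vectors left out vanish or occur otherwise
      let σ : (Σ q, T q) → T p ⊕ (Σ q, T q) := fun i =>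
        if h : i.1 = p then .inl (h ▸ i.2) else .inr i
      have hσp : ∀ i, σ ⟨p, i⟩ = .inl i := fun i => dif_pos rfl
      have hσq : ∀ i, i.1 ≠ p → σ i = .inr i := fun i hi => dif_neg hi
      refine ((hg'.sum hg).restrict (σ := σ) ?_).congr ?_
      · rintro (i | ⟨q, i⟩)
        · exact ⟨⟨p, i⟩, 1, 1, fun z f h => by rw [hσp]; simp⟩
        · by_cases hq : q = p
          · subst hq
            refine ⟨⟨q, i⟩, 1, 0, fun z f h => ?_⟩
            rw [Int.cast_zero, zero_mul]
            rcases z with z | z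
            · rfl
            · change (if z.1 ∈ s then g₀ z ⟨q, i⟩ f h else 0) = 0
              split_ifs with hz
              · exact hoff _ _ _ _ fun hzq => hp ((show z.1 = q from hzq) ▸ hz)
              · rfl
          · exact ⟨⟨q, i⟩, 1, 1, fun z f h => by rw [hσq _ hq]; simp⟩
      · rintro ⟨q, i⟩ ⟨r, j⟩ f h
        by_cases hq : q = p
        · subst hq
          rw [hσp, if_pos (Finset.mem_insert_self q s)]
          by_cases hr : r = q
          · subst hr
            rw [hσp]
            exact hdiag _ _ _ _ _
          · rw [hσq _ hr]
            exact hoff _ _ _ _ (Ne.symm hr)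
        · rw [hσq _ hq]
          by_cases hr : r = p
          · subst hr
            rw [hσp, hoff _ _ _ _ hq, ite_self]
            rfl
          · rw [hσq _ hr]
            simp only [Finset.mem_insert, hq, false_or]
            rfl
  obtain ⟨W, hW, hg⟩ := key Finset.univ
  rw [← hW]
  exact elt_eq (gcls_eq_of_isometric (hZ.isometric (hg.congr fun i j f h => by simp)))

end AzumayaInv

section

/-- The concatenation of two families. -/
def blockFamily {S T : Type*} {d : ℕ} {p : ℕ × ℕ} (hp : p ∈ Finset.HasAntidiagonal.antidiagonal d)
    (x : Fin p.1 → S) (y : Fin p.2 → T) : Fin d → S ⊕ T :=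
  Sum.map x y ∘ (finSumFinEquiv.trans (finCongr (Finset.HasAntidiagonal.mem_antidiagonal.mp hp))).symm

theorem exists_perm_blockFamily {S T : Type*} {d : ℕ} (t : Fin d → S ⊕ T) :
    ∃ (p : ℕ × ℕ) (hp : p ∈ Finset.HasAntidiagonal.antidiagonal d) (x : Fin p.1 → S) (y : Fin p.2 → T)
      (ρ : Equiv.Perm (Fin d)), t ∘ ρ = blockFamily hp x y := by
  classical
  let e := Equiv.sumCompl fun i => (t i).isLeft = true
  let eL := (Fintype.equivFin {i // (t i).isLeft = true}).symm
  let eR := (Fintype.equivFin {i // ¬ (t i).isLeft = true}).symm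
  have hp : (Fintype.card {i // (t i).isLeft = true}, Fintype.card {i // ¬ (t i).isLeft = true}) ∈
      Finset.HasAntidiagonal.antidiagonal d := by
    rw [Finset.HasAntidiagonal.mem_antidiagonal, ← Fintype.card_sum, Fintype.card_congr e, Fintype.card_fin]
  refine ⟨_, hp, fun k => (t (eL k)).getLeft (eL k).2, fun k => (t (eR k)).getRight
    (by simpa using (eR k).2), (finSumFinEquiv.trans (finCongr (Finset.HasAntidiagonal.mem_antidiagonal.mp
      hp))).symm.trans ((Equiv.sumCongr eL eR).trans e), ?_⟩
  funext i
  rw [blockFamily, Function.comp_apply, Function.comp_apply, Equiv.trans_apply]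
  generalize (finSumFinEquiv.trans (finCongr (Finset.HasAntidiagonal.mem_antidiagonal.mp hp))).symm i = k
  rcases k with k | k
  · simp [e]
  · simp [e]

theorem isLeft_blockFamily {S T : Type*} {d : ℕ} {p : ℕ × ℕ} (hp : p ∈ Finset.HasAntidiagonal.antidiagonal d)
    (x : Fin p.1 → S) (y : Fin p.2 → T) :
    (Finset.univ.filter fun i => (blockFamily hp x y i).isLeft = true).card = p.1 := by
  have h := Finset.card_equiv (s := Finset.univ.filter fun i => (blockFamily hp x y i).isLeft = true)
    (t := Finset.univ.filter fun i : Fin p.1 ⊕ Fin p.2 => i.isLeft = true)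
    (finSumFinEquiv.trans (finCongr (Finset.HasAntidiagonal.mem_antidiagonal.mp hp))).symm (fun i => by
      simp [blockFamily])
  rw [h]
  have h2 : (Finset.univ.filter fun i : Fin p.1 ⊕ Fin p.2 => i.isLeft = true) =
      Finset.univ.map ⟨Sum.inl, Sum.inl_injective⟩ := by
    ext (i | i) <;> simp
  rw [h2, Finset.card_map, Finset.card_univ, Fintype.card_fin]

end

namespace AzumayaInv

variable {K : Type u} [CommRing K] {ι : K →+* K} {A : AzumayaInv ι} [Nontrivial K] [IsReduced K]
  [IsArtinianRing K] [InvBase ι] {n : ℕ} {ε : signGroup ι}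

/-- Alternating powers of a sum. In the Gram matrix of minors, families of vectors from `X` and `Y`
can be sorted up to a sign and a permutation of the columns. Sorted families with different numbers of
vectors from `X` are orthogonal, and a minor for two families with the same number is a product of a
minor for `X` and one for `Y`. -/
theorem IsAlt.elt_sum {d : ℕ} {X Y : A.Herm n ε} {W : A.Herm (d * n) (ε ^ d)}
    (hW : IsAlt d (HermSpace.sum (A.invPow_add n) X Y) W) {P Q : ∀ p : ℕ, A.Herm (p * n) (ε ^ p)}
    (hP : ∀ p, IsAlt p X (P p)) (hQ : ∀ p, IsAlt p Y (Q p))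
    {R : ∀ p q : ℕ, A.Herm (p * n + q * n) (ε ^ p * ε ^ q)}
    (hR : ∀ p q, IsTensor (P p) (Q q) (R p q)) :
    elt W = ∑ p ∈ Finset.HasAntidiagonal.antidiagonal d, elt (R p.1 p.2) := by
  have hX := presents_id A.goldman.toGoldmanAlg X
  have hY := presents_id A.goldman.toGoldmanAlg Y
  let Γ : X.carrier ⊕ Y.carrier → X.carrier ⊕ Y.carrier → (Fin n → A.goldman.I) →
      (Fin n → A.goldman.I) → Pt ι :=
    sumGram (fun x y f h => psiPow A.goldman.ψ (Fin n) (X.form x y) f h)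
      fun x y f h => psiPow A.goldman.ψ (Fin n) (Y.form x y) f h
  have hn : ∀ p : Finset.HasAntidiagonal.antidiagonal d, p.1.1 * n + p.1.2 * n = d * n := fun p => by
    rw [← add_mul, Finset.HasAntidiagonal.mem_antidiagonal.mp p.2]
  have hη : ∀ p : Finset.HasAntidiagonal.antidiagonal d, ε ^ p.1.1 * ε ^ p.1.2 = ε ^ d := fun p => by
    rw [← pow_add, Finset.HasAntidiagonal.mem_antidiagonal.mp p.2]
  rw [← Finset.sum_coe_sort]
  let σ : (Σ p : Finset.HasAntidiagonal.antidiagonal d, (Fin p.1.1 → X.carrier) × (Fin p.1.2 → Y.carrier)) →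
      Fin d → X.carrier ⊕ Y.carrier := fun i => blockFamily i.1.2 i.2.1 i.2.2
  refine Presents.elt_eq_sum (fun p => (hX.alt (hP p.1.1)).tensor (hY.alt (hQ p.1.2)) (hR _ _))
    (((hX.sum hY).alt hW).restrict (σ := σ) fun t => ?_) hn hη (fun p i j f h => ?_)
    fun i j f h hij => ?_
  -- sorting a family multiplies the minors by the sign of the permutation
  · obtain ⟨p, hp, x, y, ρ, hρ⟩ := exists_perm_blockFamily t
    refine ⟨⟨⟨p, hp⟩, x, y⟩, finProdFinEquiv.permCongr (Equiv.prodCongr ρ (Equiv.refl _)),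
      ((Equiv.Perm.sign ρ : ℤˣ) : ℤ), fun z f h => ?_⟩
    change _ = _ * (Matrix.of fun i j => Γ (z i) (blockFamily hp x y j) _ _).det
    rw [← hρ]
    have h1 : ∀ M : Matrix (Fin d) (Fin d) (Pt ι), M.det =
        (((Equiv.Perm.sign ρ : ℤˣ) : ℤ) : Pt ι) * (M.submatrix id ρ).det := by
      intro M
      rw [Matrix.det_permute', ← mul_assoc, ← Int.cast_mul, ← Units.val_mul, Int.units_mul_self]
      simp
    rw [h1]
    congr 2
    ext i j
    simp only [Matrix.submatrix_apply, Matrix.of_apply, id_eq, Function.comp_apply]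
    refine congrArg (Γ (z i) (t (ρ j)) fun k => f (finProdFinEquiv (i, k))) (funext fun k => ?_)
    simp [Equiv.permCongr_apply]
  -- the matrix of inner products of two sorted families of the same type is block diagonal
  · obtain ⟨p, hp⟩ := p
    let e := finSumFinEquiv.trans (finCongr (Finset.HasAntidiagonal.mem_antidiagonal.mp hp))
    refine (Matrix.det_submatrix_equiv_self e _).symm.trans ?_
    have hinl : ∀ (a : Fin p.1) (k : Fin n), finProdFinEquiv (e (.inl a), k) =
        Fin.cast (hn ⟨p, hp⟩) (Fin.castAdd (p.2 * n) (finProdFinEquiv (a, k))) := fun a k => by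
      apply Fin.ext
      simp [e, finProdFinEquiv]
    have hinr : ∀ (a : Fin p.2) (k : Fin n), finProdFinEquiv (e (.inr a), k) =
        Fin.cast (hn ⟨p, hp⟩) (Fin.natAdd (p.1 * n) (finProdFinEquiv (a, k))) := fun a k => by
      apply Fin.ext
      simp [e, finProdFinEquiv]
      ring
    have hl : ∀ (x : Fin p.1 → X.carrier) (y : Fin p.2 → Y.carrier) a,
        blockFamily hp x y (e (.inl a)) = .inl (x a) := fun x y a => by
      simp [blockFamily, e]
    have hr : ∀ (x : Fin p.1 → X.carrier) (y : Fin p.2 → Y.carrier) a,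
        blockFamily hp x y (e (.inr a)) = .inr (y a) := fun x y a => by
      simp [blockFamily, e]
    refine Eq.trans (congrArg Matrix.det (Matrix.ext fun a b => ?_))
      (Matrix.det_fromBlocks_zero₂₁ _ 0 _)
    rcases a with a | a <;> rcases b with b | b
    · change Γ (blockFamily hp _ _ (e (.inl a))) (blockFamily hp _ _ (e (.inl b)))
        (fun k => f (finProdFinEquiv (e (.inl a), k))) (fun k => h (finProdFinEquiv (e (.inl b), k))) = _
      simp only [hl, hinl]
      rfl
    · change Γ (blockFamily hp _ _ (e (.inl a))) (blockFamily hp _ _ (e (.inr b))) _ _ = 0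
      rw [hl, hr]
      rfl
    · change Γ (blockFamily hp _ _ (e (.inr a))) (blockFamily hp _ _ (e (.inl b))) _ _ = 0
      rw [hl, hr]
      rfl
    · change Γ (blockFamily hp _ _ (e (.inr a))) (blockFamily hp _ _ (e (.inr b)))
        (fun k => f (finProdFinEquiv (e (.inr a), k))) (fun k => h (finProdFinEquiv (e (.inr b), k))) = _
      simp only [hr, hinr]
      rfl
  · -- a nonzero term of the determinant matches the summands of both families
    refine (Matrix.det_apply _).trans (Finset.sum_eq_zero fun π _ => ?_)
    by_contra hne
    have h1 : ∀ k, (σ i (π k)).isLeft = (σ j k).isLeft := by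
      intro k
      by_contra hk
      refine hne (smul_eq_zero_of_right _ (Finset.prod_eq_zero (Finset.mem_univ k) ?_))
      change Γ (σ i (π k)) (σ j k) _ _ = 0
      rcases hi : σ i (π k) with a | a <;> rcases hj : σ j k with b | b
      · rw [hi, hj] at hk; exact absurd rfl hk
      · rfl
      · rfl
      · rw [hi, hj] at hk; exact absurd rfl hk
    have h2 := Finset.card_equiv (s := Finset.univ.filter fun k => (σ j k).isLeft = true)
      (t := Finset.univ.filter fun k => (σ i k).isLeft = true) π (fun k => by simp [h1])
    rw [isLeft_blockFamily, isLeft_blockFamily] at h2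
    refine hij (Subtype.ext (Prod.ext h2.symm ?_))
    have h3 := Finset.HasAntidiagonal.mem_antidiagonal.mp i.1.2
    have h4 := Finset.HasAntidiagonal.mem_antidiagonal.mp j.1.2
    omega

end AzumayaInv

/-! ### Reduced dimensions -/

section CauchyBinet

variable {E J : Type*} [CommRing E] [Fintype J] [DecidableEq J] {d : ℕ}

/-- The elements of a subset with `d` elements, in some order. -/
def subsetEnum (s : {s : Finset J // s.card = d}) : Fin d ≃ s.1 :=
  (Finset.equivFinOfCardEq s.2).symm

/-- The Cauchy–Binet formula. -/
theorem Matrix.det_sum_eq_sum_subset (a : Fin d → J → E) (b : J → Fin d → E) :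
    (Matrix.of fun i j => ∑ p, a i p * b p j).det =
      ∑ s : {s : Finset J // s.card = d}, (Matrix.of fun i j => a i (subsetEnum s j)).det *
        (Matrix.of fun i j => b (subsetEnum s i) j).det := by
  rw [Matrix.det_sum_rows a fun _ p j => b p j]
  have h1 : ∀ (s : {s : Finset J // s.card = d}), (Matrix.of fun i j => a i (subsetEnum s j)).det *
        (Matrix.of fun i j => b (subsetEnum s i) j).det =
      ∑ π : Equiv.Perm (Fin d), (∏ i, a i (subsetEnum s (π i))) *
        (Matrix.of fun i j => b (subsetEnum s (π i)) j).det := by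
    intro s
    rw [← Matrix.det_transpose, Matrix.det_apply', Finset.sum_mul]
    refine Finset.sum_congr rfl fun π _ => ?_
    have h2 := Matrix.det_permute π (Matrix.of fun i j => b (subsetEnum s i) j)
    rw [mul_comm (_ : E) (∏ _, _), mul_assoc]
    congr 1
    exact h2.symm
  simp only [h1]
  rw [← Fintype.sum_prod_type']
  symm
  refine Finset.sum_of_injOn (fun q : {s : Finset J // s.card = d} × Equiv.Perm (Fin d) =>
    fun i => ((subsetEnum q.1 (q.2 i) : q.1.1) : J)) ?_ (fun _ _ => Finset.mem_coe.mpr (Finset.mem_univ _)) ?_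
    fun _ _ => rfl
  -- subsets with an ordering are injective families, and only these contribute
  · rintro ⟨s, π⟩ - ⟨s', π'⟩ - h
    have hs : s = s' := by
      apply Subtype.ext
      ext x
      have : ∀ (s : {s : Finset J // s.card = d}) (π : Equiv.Perm (Fin d)),
          x ∈ s.1 ↔ ∃ i, ((subsetEnum s (π i) : s.1) : J) = x := by
        intro s π
        constructor
        · intro hx
          exact ⟨π.symm ((subsetEnum s).symm ⟨x, hx⟩), by simp⟩
        · rintro ⟨i, rfl⟩
          exact (subsetEnum s (π i)).2
      rw [this s π, this s' π']
      have h' : ∀ i, ((subsetEnum s (π i) : s.1) : J) = (subsetEnum s' (π' i) : s'.1) := congrFun h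
      simp only [h']
    subst hs
    refine Prod.ext rfl (Equiv.ext fun i => (subsetEnum s).injective (Subtype.ext (congrFun h i)))
  · intro P _ hP
    have hinj : ¬ Function.Injective P := by
      intro hinj
      let s : {s : Finset J // s.card = d} := ⟨Finset.univ.image P, by
        rw [Finset.card_image_of_injective _ hinj, Finset.card_univ, Fintype.card_fin]⟩
      have hs : ∀ i, P i ∈ s.1 := fun i => Finset.mem_image_of_mem P (Finset.mem_univ i)
      refine hP ⟨⟨s, Equiv.ofBijective (fun i => (subsetEnum s).symm ⟨P i, hs i⟩) ?_⟩,
        Finset.mem_coe.mpr (Finset.mem_univ _), ?_⟩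
      · refine (Finite.injective_iff_bijective).mp fun i j hij => hinj ?_
        exact congrArg Subtype.val ((subsetEnum s).symm.injective hij)
      · funext i
        simp
    rw [Function.not_injective_iff] at hinj
    obtain ⟨i, j, hij, hne⟩ := hinj
    rw [Matrix.det_zero_of_row_eq hne (by funext k; simp [hij]), mul_zero]

/-- The minors of the matrices from a spanning set span the matrices indexed by subsets and
families of columns. -/
theorem Matrix.span_minors {I S : Type*} [Fintype I] [DecidableEq I] {v : S → Matrix J I E}
    (hv : Submodule.span E (Set.range v) = ⊤) :
    Submodule.span E (Set.range fun x : Fin d → S =>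
      (Matrix.of fun s F => (Matrix.of fun i j => v (x j) (subsetEnum s i) (F j)).det :
        Matrix {s : Finset J // s.card = d} (Fin d → I) E)) = ⊤ := by
  let D : MultilinearMap E (fun _ : Fin d => Matrix J I E)
      (Matrix {s : Finset J // s.card = d} (Fin d → I) E) :=
    MultilinearMap.pi fun s => MultilinearMap.pi fun F =>
      (Matrix.detRowAlternating (n := Fin d) (R := E)).toMultilinearMap.compLinearMap fun j =>
        LinearMap.pi fun i => Matrix.entryLinearMap E E (subsetEnum s i : J) (F j)
  have hD : ∀ M s F, D M s F = (Matrix.of fun i j => M j (subsetEnum s i) (F j)).det := by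
    intro M s F
    rw [← Matrix.det_transpose]
    rfl
  have h1 := PiTensorProduct.submodule_span_eq_top (R := E) fun _ : Fin d => hv
  have h2 := congrArg (Submodule.map (PiTensorProduct.lift D)) h1
  rw [Submodule.map_span, ← Set.range_comp] at h2
  have h3 : (fun x : Fin d → S => (Matrix.of fun s F =>
      (Matrix.of fun i j => v (x j) (subsetEnum s i) (F j)).det : Matrix _ _ E)) =
      PiTensorProduct.lift D ∘ fun x : Fin d → S => PiTensorProduct.tprod E fun i => v (x i) := by
    funext x
    rw [Function.comp_apply, PiTensorProduct.lift.tprod]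
    ext s F
    rw [hD]
    rfl
  rw [h3, h2, Submodule.map_top, LinearMap.range_eq_top]
  suffices h : ∀ s F, ∃ z, PiTensorProduct.lift D z = Matrix.single s F 1 by
    choose z hz using h
    intro M
    refine ⟨∑ s, ∑ F, M s F • z s F, ?_⟩
    rw [map_sum]
    conv_rhs => rw [Matrix.matrix_eq_sum_single M]
    refine Finset.sum_congr rfl fun s _ => ?_
    rw [map_sum]
    refine Finset.sum_congr rfl fun F _ => ?_
    rw [map_smul, hz, Matrix.smul_single, smul_eq_mul, mul_one]
  intro s F
  -- the minors of the matrix units with rows in `s` and columns `F` vanish except at `(s, F)`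
  refine ⟨PiTensorProduct.tprod E fun j => Matrix.single (subsetEnum s j : J) (F j) 1, ?_⟩
  rw [PiTensorProduct.lift.tprod]
  ext s' F'
  rw [hD]
  by_cases hF : F = F'
  · subst hF
    by_cases hs : s = s'
    · subst hs
      rw [Matrix.single_apply_same]
      refine Eq.trans (congrArg Matrix.det ?_) Matrix.det_one
      ext i j
      rw [Matrix.of_apply, Matrix.single_apply, Matrix.one_apply]
      refine if_congr ?_ rfl rfl
      simp [Subtype.ext_iff.symm, eq_comm]
    · have hex : ∃ x ∈ s'.1, x ∉ s.1 := by
        by_contra hall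
        push Not at hall
        exact hs (Subtype.ext (Finset.eq_of_subset_of_card_le hall (by rw [s.2, s'.2])).symm)
      obtain ⟨x, hx, hx'⟩ := hex
      rw [Matrix.single_apply_of_ne _ _ _ _ _ (fun h => hs h.1)]
      refine Matrix.det_eq_zero_of_row_eq_zero ((subsetEnum s').symm ⟨x, hx⟩) fun j => ?_
      rw [Matrix.of_apply, Matrix.single_apply, if_neg]
      rintro ⟨h, -⟩
      refine hx' ?_
      rw [Equiv.apply_symm_apply] at h
      rw [← show _ = x from h]
      exact (subsetEnum s j).2
  · rw [Matrix.single_apply_of_ne _ _ _ _ _ (fun h => hF h.2)]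
    obtain ⟨j, hj⟩ := Function.ne_iff.mp hF
    refine Matrix.det_eq_zero_of_column_eq_zero j fun i => ?_
    rw [Matrix.of_apply, Matrix.single_apply, if_neg]
    exact fun h => hj h.2

end CauchyBinet

namespace AzumayaInv

variable {K : Type u} [CommRing K] {ι : K →+* K} {A : AzumayaInv ι} [Nontrivial K] [IsReduced K]
  [IsArtinianRing K] [InvBase ι] {m n : ℕ} {ε ε' : signGroup ι}

theorem azumayaDegree_pow (A : AzumayaInv ι) (n : ℕ) :
    azumayaDegree K (A.pow n) = Fintype.card A.goldman.I ^ n := by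
  rw [azumayaDegree, (A.goldmanPow n).free_finrank.2, Nat.sqrt_eq]
  simp

theorem azumayaDegree_pos (A : AzumayaInv ι) (n : ℕ) : 0 < azumayaDegree K (A.pow n) := by
  rw [azumayaDegree_pow]
  exact pow_pos Fintype.card_pos n

/-- The reduced dimension. -/
def rdim (X : A.Herm n ε) : ℕ := Module.finrank K X.carrier / azumayaDegree K (A.pow n)

theorem rdim_eq {X : A.Herm n ε} {r : ℕ} (h : X.HasRdim r) : rdim X = r := by
  rw [rdim, ← h]
  exact Nat.mul_div_cancel_left r (azumayaDegree_pos A n)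

theorem rdim_eq_card {X : A.Herm n ε} (C : X.Coord (A.goldmanPow n)) :
    X.HasRdim (Fintype.card C.J) := by
  rw [HermSpace.HasRdim, C.free_finrank.2, azumayaDegree_pow, mul_comm]
  simp

theorem hasRdim (X : A.Herm n ε) : X.HasRdim (rdim X) := by
  obtain ⟨C⟩ := X.nonempty_coord (A.goldmanPow n)
  rw [rdim_eq (rdim_eq_card C)]
  exact rdim_eq_card C

theorem free_herm (X : A.Herm n ε) : Module.Free K X.carrier := by
  obtain ⟨C⟩ := X.nonempty_coord (A.goldmanPow n)
  exact C.free_finrank.1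

theorem rdim_eq_of_isometric {X Y : A.Herm n ε} (h : HermSpace.Isometric X Y) : rdim X = rdim Y := by
  obtain ⟨e, -⟩ := h
  rw [rdim, rdim, e.finrank_eq]

theorem rdim_zero :
    rdim (HermSpace.zero ι (A.pow n) (A.invPow n) (A.invPow_zero n) ε) = 0 := by
  have h : Module.finrank K PUnit.{u + 1} = 0 := Module.finrank_zero_of_subsingleton
  rw [rdim]
  exact (congrArg (· / _) h).trans (Nat.zero_div _)

theorem rdim_sum (X Y : A.Herm n ε) :
    rdim (HermSpace.sum (A.invPow_add n) X Y) = rdim X + rdim Y := by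
  have := free_herm X
  have := free_herm Y
  apply rdim_eq
  have h : Module.finrank K (X.carrier × Y.carrier) =
    Module.finrank K X.carrier + Module.finrank K Y.carrier := Module.finrank_prod
  refine Eq.trans ?_ h.symm
  rw [mul_add, hasRdim X, hasRdim Y]

theorem rdim_tensor {X : A.Herm m ε} {Y : A.Herm n ε'} {Z : A.Herm (m + n) (ε * ε')}
    (h : IsTensor X Y Z) : rdim Z = rdim X * rdim Y := by
  have := free_herm X
  have := free_herm Y
  obtain ⟨e, -⟩ := h
  apply rdim_eq
  rw [HermSpace.HasRdim, ← e.finrank_eq, Module.finrank_tensorProduct, ← hasRdim X, ← hasRdim Y,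
    azumayaDegree_pow, azumayaDegree_pow, azumayaDegree_pow, pow_add]
  ring

theorem rdim_unit : rdim A.unit = 1 := by
  obtain ⟨c, hc, hf⟩ := presents_unit A.goldman.toGoldmanAlg
  have hsingle : ∀ M : Matrix (A.goldmanPow 0).I (A.goldmanPow 0).I (Pt ι),
      Submodule.span (Pt ι) (Set.range fun p : A.pow 0 × PUnit.{u + 1} =>
        (A.goldmanPow 0).ψ p.1) = ⊤ := fun _ => by
    rw [← (A.goldmanPow 0).span_ψ]
    congr 1
    ext M
    constructor
    · rintro ⟨p, rfl⟩; exact ⟨p.1, rfl⟩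
    · rintro ⟨a, rfl⟩; exact ⟨(a, PUnit.unit), rfl⟩
  obtain ⟨C, hC⟩ := HermSpace.exists_coord (G := A.goldmanPow 0) hc (J := (A.goldmanPow 0).I)
    (fun _ => 1) (fun _ => 1) (fun i j => by
      ext f h
      rw [mul_one, Subsingleton.elim h f, Matrix.one_apply_eq]
      exact hf i j f f) (by simpa using hsingle 0) (by simpa using hsingle 0)
  rw [rdim_eq (rdim_eq_card C), Fintype.card_congr (Equiv.cast hC)]
  simp

/-- The reduced dimension of an alternating power: by the Cauchy–Binet formula, subsets with `d`
elements of the coordinates of `X` are coordinates of the alternating power. -/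
theorem rdim_alt {d : ℕ} {X : A.Herm n ε} {Y : A.Herm (d * n) (ε ^ d)} (h : IsAlt d X Y) :
    rdim Y = (rdim X).choose d := by
  obtain ⟨C⟩ := X.nonempty_coord (A.goldmanPow n)
  obtain ⟨c, hc, hf⟩ := h.generates X.generates_id
  let Q : (Fin d → X.carrier) → Matrix {s : Finset C.J // s.card = d} (Fin (d * n) → A.goldman.I)
      (Pt ι) := fun x => Matrix.of fun s F =>
    (Matrix.of fun i j => C.χ (x j) (subsetEnum s i) fun k => F (finProdFinEquiv (j, k))).det
  let P : (Fin d → X.carrier) → Matrix (Fin (d * n) → A.goldman.I) {s : Finset C.J // s.card = d}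
      (Pt ι) := fun x => Matrix.of fun F s =>
    (Matrix.of fun i j => C.η (x i) (fun k => F (finProdFinEquiv (i, k))) (subsetEnum s j)).det
  let e : (Fin (d * n) → A.goldman.I) ≃ (Fin d → Fin n → A.goldman.I) :=
    (finProdFinEquiv.arrowCongr (Equiv.refl _)).symm.trans (Equiv.curry _ _ _)
  have hspan : ∀ {S : Type u} (v : S → Matrix C.J (Fin n → A.goldman.I) (Pt ι)),
      Submodule.span (Pt ι) (Set.range v) = ⊤ →
      Submodule.span (Pt ι) (Set.range fun x : Fin d → S => (Matrix.of fun s F =>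
        (Matrix.of fun i j => v (x j) (subsetEnum s i) fun k => F (finProdFinEquiv (j, k))).det :
          Matrix {s : Finset C.J // s.card = d} (Fin (d * n) → A.goldman.I) (Pt ι))) = ⊤ := by
    intro S v hv
    have h1 := congrArg (Submodule.map (Matrix.reindexLinearEquiv (Pt ι) (Pt ι)
      (Equiv.refl {s : Finset C.J // s.card = d}) e.symm).toLinearMap) (Matrix.span_minors (d := d) hv)
    rw [Submodule.map_span, ← Set.range_comp, Submodule.map_top, LinearEquiv.range] at h1
    exact h1
  obtain ⟨C', hC'⟩ := HermSpace.exists_coord (G := A.goldmanPow (d * n)) hc P Q (fun x x' => by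
      ext F H
      refine (hf A.goldman.toGoldmanAlg x x' F H).trans ?_
      rw [Matrix.mul_apply]
      refine Eq.trans ?_ (Matrix.det_sum_eq_sum_subset
        (fun i p => C.η (x i) (fun k => F (finProdFinEquiv (i, k))) p)
        (fun p j => C.χ (x' j) p (fun k => H (finProdFinEquiv (j, k)))))
      congr 1
      ext i j
      rw [Matrix.of_apply, Matrix.of_apply, ← Matrix.mul_apply, ← C.form_eq]
      rfl)
    (by
      rw [eq_top_iff, ← Matrix.span_transpose (hspan _ (Matrix.span_transpose C.span_η))]
      refine Submodule.span_mono ?_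
      rintro _ ⟨x, rfl⟩
      refine ⟨(1, x), ?_⟩
      change (A.goldmanPow (d * n)).ψ 1 * P x = _
      rw [map_one, Matrix.one_mul]
      ext F s
      refine (Matrix.det_transpose _).symm.trans ?_
      rfl)
    (by
      rw [eq_top_iff, ← hspan _ C.span_χ]
      refine Submodule.span_mono ?_
      rintro _ ⟨x, rfl⟩
      refine ⟨(1, x), ?_⟩
      change Q x * (A.goldmanPow (d * n)).ψ 1 = _
      rw [map_one, Matrix.mul_one])
  rw [rdim_eq (rdim_eq_card C'), rdim_eq (rdim_eq_card C), Fintype.card_congr (Equiv.cast hC'),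
    Fintype.card_finset_len]

theorem cls_eq_zero {X : A.Herm n ε} (h : rdim X = 0) : cls X = 0 := by
  obtain ⟨C⟩ := X.nonempty_coord (A.goldmanPow n)
  rw [rdim_eq (rdim_eq_card C), Fintype.card_eq_zero_iff] at h
  have h2 : Subsingleton X.carrier := C.χ_injective.subsingleton
  refine Quotient.sound ⟨⟨⟨⟨fun _ => PUnit.unit, fun _ _ => rfl⟩, fun _ _ => rfl⟩, fun _ => 0,
    fun _ => Subsingleton.elim _ _, fun _ => rfl⟩, fun _ _ => rfl, fun x y => ?_⟩
  have h3 : X.form x y = 0 := by rw [Subsingleton.elim y 0, map_zero]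
  exact h3.symm

end AzumayaInv

/-! ### The `λ`-operations of the monoid ring -/

section MonoidRing

variable {M : Type v} [AddCommMonoid M]

/-- The series `∑ (n choose d) (d h) t^d`. -/
def monoidBinomialSeries (h : M) (n : ℤ) : PowerSeries (AddMonoidAlgebra ℤ M) :=
  PowerSeries.mk fun i => AddMonoidAlgebra.single (i • h) (Ring.choose n i)

theorem monoidBinomialSeries_zero (h : M) : monoidBinomialSeries h 0 = 1 := by
  ext1 d
  rw [monoidBinomialSeries, PowerSeries.coeff_mk, Ring.choose_zero_ite, PowerSeries.coeff_one]
  split_ifs with hd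
  · rw [hd, zero_smul]; rfl
  · exact AddMonoidAlgebra.single_zero _

theorem monoidBinomialSeries_add (h : M) (m n : ℤ) :
    monoidBinomialSeries h (m + n) = monoidBinomialSeries h m * monoidBinomialSeries h n := by
  ext1 d
  rw [PowerSeries.coeff_mul, monoidBinomialSeries, PowerSeries.coeff_mk,
    Ring.add_choose_eq d (Commute.all m n)]
  rw [show AddMonoidAlgebra.single (d • h) (∑ p ∈ Finset.HasAntidiagonal.antidiagonal d, Ring.choose m p.1 *
    Ring.choose n p.2) = ∑ p ∈ Finset.HasAntidiagonal.antidiagonal d, AddMonoidAlgebra.single (d • h)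
      (Ring.choose m p.1 * Ring.choose n p.2) from map_sum (AddMonoidAlgebra.singleAddHom (d • h)) _ _]
  refine Finset.sum_congr rfl fun p hp => ?_
  rw [monoidBinomialSeries, monoidBinomialSeries, PowerSeries.coeff_mk, PowerSeries.coeff_mk,
    AddMonoidAlgebra.single_mul_single, ← add_smul, Finset.HasAntidiagonal.mem_antidiagonal.mp hp]

/-- The series of the `λ`-operations of the monoid ring. -/
def monoidRingLamSeries (f : AddMonoidAlgebra ℤ M) : PowerSeries (AddMonoidAlgebra ℤ M) :=
  ∏ h ∈ f.coeff.support, monoidBinomialSeries h (f.coeff h)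

theorem coeff_monoidRingLamSeries (d : ℕ) (f : AddMonoidAlgebra ℤ M) :
    PowerSeries.coeff d (monoidRingLamSeries f) = monoidRingLam d f := rfl

theorem monoidRingLamSeries_eq_prod {f : AddMonoidAlgebra ℤ M} {s : Finset M}
    (hs : f.coeff.support ⊆ s) :
    monoidRingLamSeries f = ∏ h ∈ s, monoidBinomialSeries h (f.coeff h) := by
  refine Finset.prod_subset hs fun h _ hh => ?_
  rw [Finsupp.notMem_support_iff.mp hh, monoidBinomialSeries_zero]

theorem monoidRingLamSeries_add (f g : AddMonoidAlgebra ℤ M) :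
    monoidRingLamSeries (f + g) = monoidRingLamSeries f * monoidRingLamSeries g := by
  classical
  rw [monoidRingLamSeries_eq_prod (f := f + g) (Finsupp.support_add (g₁ := f.coeff) (g₂ := g.coeff)),
    monoidRingLamSeries_eq_prod (f := f) (Finset.subset_union_left (s₂ := g.coeff.support)),
    monoidRingLamSeries_eq_prod (f := g) (Finset.subset_union_right (s₁ := f.coeff.support)),
    ← Finset.prod_mul_distrib]
  exact Finset.prod_congr rfl fun h _ => monoidBinomialSeries_add h _ _

theorem monoidRingLamSeries_zero : monoidRingLamSeries (0 : AddMonoidAlgebra ℤ M) = 1 := rfl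

theorem monoidRingLamSeries_single (h : M) (n : ℤ) :
    monoidRingLamSeries (AddMonoidAlgebra.single h n) = monoidBinomialSeries h n := by
  rw [monoidRingLamSeries_eq_prod (f := AddMonoidAlgebra.single h n) (s := {h})
    Finsupp.support_single_subset, Finset.prod_singleton,
    AddMonoidAlgebra.coeff_single, Finsupp.single_eq_same]

end MonoidRing

/-! ### The semiring of hermitian spaces -/

namespace AzumayaInv

variable {K : Type u} [CommRing K] {ι : K →+* K} {A : AzumayaInv ι} [Nontrivial K] [IsReduced K]
  [IsArtinianRing K] [InvBase ι] {m n : ℕ} {ε ε' : signGroup ι}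

/-- The tensor product of isometry classes. -/
def swMul (a : A.SW m ε) (b : A.SW n ε') : A.SW (m + n) (ε * ε') :=
  Quotient.map₂ (fun X Y => (exists_isTensor X Y).choose) (fun X _ hX Y _ hY =>
    IsTensor.isometric hX hY (exists_isTensor X Y).choose_spec (exists_isTensor _ _).choose_spec) a b

theorem swMul_cls {X : A.Herm m ε} {Y : A.Herm n ε'} {Z : A.Herm (m + n) (ε * ε')}
    (h : IsTensor X Y Z) : swMul (cls X) (cls Y) = cls Z :=
  Quotient.sound (IsTensor.isometric (HermSpace.Isometric.refl X) (HermSpace.Isometric.refl Y)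
    (exists_isTensor X Y).choose_spec h)

/-- The alternating powers of isometry classes. -/
def swAlt (d : ℕ) (a : A.SW n ε) : A.SW (d * n) (ε ^ d) :=
  Quotient.map (fun X => (exists_isAlt d X).choose) (fun X _ hX =>
    IsAlt.isometric hX (exists_isAlt d X).choose_spec (exists_isAlt d _).choose_spec) a

theorem swAlt_cls {d : ℕ} {X : A.Herm n ε} {Y : A.Herm (d * n) (ε ^ d)}
    (h : IsAlt d X Y) : swAlt d (cls X) = cls Y :=
  Quotient.sound (IsAlt.isometric (HermSpace.Isometric.refl X) (exists_isAlt d X).choose_spec h)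

/-- The reduced dimension of isometry classes. -/
def swRdim : A.SW n ε →+ ℕ where
  toFun := Quotient.lift rdim fun _ _ h => rdim_eq_of_isometric h
  map_zero' := rdim_zero
  map_add' := by
    rintro ⟨X⟩ ⟨Y⟩
    exact rdim_sum X Y

theorem swMul_comm_mk (a : A.SW m ε) (b : A.SW n ε') :
    (GradedMonoid.mk (m + n, Additive.ofMul (ε * ε')) (swMul a b) : GradedMonoid A.SWFam) =
      GradedMonoid.mk (n + m, Additive.ofMul (ε' * ε)) (swMul b a) := by
  rcases a with ⟨X⟩
  rcases b with ⟨Y⟩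
  exact (exists_isTensor X Y).choose_spec.comm (exists_isTensor Y X).choose_spec

theorem swMul_add (a : A.SW m ε) (b c : A.SW n ε') : swMul a (b + c) = swMul a b + swMul a c := by
  rcases a with ⟨X⟩
  rcases b with ⟨Y⟩
  rcases c with ⟨Z⟩
  exact Quotient.sound (IsTensor.add_right (exists_isTensor X Y).choose_spec
    (exists_isTensor X Z).choose_spec (exists_isTensor X _).choose_spec)

theorem swMul_zero (a : A.SW m ε) : swMul a (0 : A.SW n ε') = 0 := by
  rcases a with ⟨X⟩
  exact Quotient.sound (exists_isTensor X _).choose_spec.zero_right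

theorem mk_right_injective {g : GammaN ι} {a b : A.SWFam g}
    (h : GradedMonoid.mk g a = GradedMonoid.mk g b) : a = b :=
  eq_of_heq (Sigma.mk.inj h).2

theorem exists_addMonoidHom_mk {g g' : GammaN ι} (hg : g = g') :
    ∃ φ : A.SWFam g →+ A.SWFam g', ∀ x, GradedMonoid.mk g' (φ x) = GradedMonoid.mk g x := by
  subst hg
  exact ⟨AddMonoidHom.id _, fun _ => rfl⟩

theorem add_swMul (a b : A.SW m ε) (c : A.SW n ε') : swMul (a + b) c = swMul a c + swMul b c := by
  obtain ⟨φ, hφ⟩ := exists_addMonoidHom_mk (A := A) (g := (n + m, Additive.ofMul (ε' * ε)))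
    (g' := (m + n, Additive.ofMul (ε * ε'))) (Prod.ext (add_comm _ _) (mul_comm ε' ε))
  have h : ∀ a : A.SW m ε, φ (swMul c a) = swMul a c := fun a =>
    mk_right_injective ((hφ _).trans (swMul_comm_mk c a))
  rw [← h, ← h, ← h, swMul_add, map_add]

theorem zero_swMul (c : A.SW n ε') : swMul (0 : A.SW m ε) c = 0 := by
  obtain ⟨φ, hφ⟩ := exists_addMonoidHom_mk (A := A) (g := (n + m, Additive.ofMul (ε' * ε)))
    (g' := (m + n, Additive.ofMul (ε * ε'))) (Prod.ext (add_comm _ _) (mul_comm ε' ε))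
  have h : ∀ a : A.SW m ε, φ (swMul c a) = swMul a c := fun a =>
    mk_right_injective ((hφ _).trans (swMul_comm_mk c a))
  rw [← h, swMul_zero, map_zero]

theorem unit_swMul_mk (a : A.SW n ε) :
    (GradedMonoid.mk (0 + n, Additive.ofMul (1 * ε)) (swMul (cls A.unit) a) : GradedMonoid A.SWFam) =
      GradedMonoid.mk (n, Additive.ofMul ε) a := by
  rcases a with ⟨X⟩
  exact (exists_isTensor A.unit X).choose_spec.one_left

instance : GradedMonoid.GMul A.SWFam where
  mul a b := swMul a b

instance : GradedMonoid.GOne A.SWFam where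
  one := cls A.unit

instance : GradedMonoid.GMonoid A.SWFam where
  one_mul a := unit_swMul_mk a.2
  mul_one a := (swMul_comm_mk a.2 (cls A.unit)).trans (unit_swMul_mk a.2)
  mul_assoc := by
    rintro ⟨g, ⟨X⟩⟩ ⟨g', ⟨Y⟩⟩ ⟨g'', ⟨Z⟩⟩
    have h1 := exists_isTensor X Y
    have h2 := exists_isTensor Y Z
    exact h1.choose_spec.assoc (exists_isTensor h1.choose Z).choose_spec h2.choose_spec
      (exists_isTensor X h2.choose).choose_spec

instance : DirectSum.GCommSemiring A.SWFam where
  __ := (inferInstance : GradedMonoid.GMonoid A.SWFam)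
  mul_zero a := swMul_zero a
  zero_mul b := zero_swMul b
  mul_add a b c := swMul_add a b c
  add_mul a b c := add_swMul a b c
  natCast k := k • (cls A.unit : A.SW 0 1)
  natCast_zero := zero_smul ℕ _
  natCast_succ k := succ_nsmul _ k
  mul_comm a b := swMul_comm_mk a.2 b.2

theorem elt_mul {X : A.Herm m ε} {Y : A.Herm n ε'} {Z : A.Herm (m + n) (ε * ε')}
    (h : IsTensor X Y Z) : elt X * elt Y = elt Z := by
  rw [elt, elt, DirectSum.of_mul_of]
  exact congrArg (DirectSum.of A.SWFam (m + n, Additive.ofMul (ε * ε'))) (swMul_cls h)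

theorem SWSum.induction {p : A.SWSum → Prop} (zero : p 0)
    (elt : ∀ (n : ℕ) (ε : signGroup ι) (X : A.Herm n ε), p (elt X))
    (add : ∀ x y, p x → p y → p (x + y)) (x : A.SWSum) : p x := by
  induction x using DirectSum.induction_on with
  | zero => exact zero
  | of g a =>
    rcases a with ⟨X⟩
    exact elt g.1 g.2.toMul X
  | add x y hx hy => exact add x y hx hy

theorem SWSum.addHom_ext {N : Type*} [AddCommMonoid N] {φ φ' : A.SWSum →+ N}
    (h : ∀ (n : ℕ) (ε : signGroup ι) (X : A.Herm n ε), φ (elt X) = φ' (elt X)) : φ = φ' := by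
  refine DFunLike.ext _ _ fun x => ?_
  induction x using SWSum.induction with
  | zero => rw [map_zero, map_zero]
  | elt n ε X => exact h n ε X
  | add x y hx hy => rw [map_add, map_add, hx, hy]

/-- The series of the alternating powers of an isometry class. -/
def swAltSeries (g : GammaN ι) (a : A.SWFam g) : PowerSeries A.SWSum :=
  PowerSeries.mk fun d =>
    DirectSum.of A.SWFam (d * g.1, Additive.ofMul (g.2.toMul ^ d)) (swAlt d a)

theorem coeff_swAltSeries (d : ℕ) (g : GammaN ι) (a : A.SWFam g) :
    PowerSeries.coeff d (swAltSeries g a) =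
      DirectSum.of A.SWFam (d * g.1, Additive.ofMul (g.2.toMul ^ d)) (swAlt d a) :=
  (PowerSeries.coeff_mk d _).trans (congrArg _ rfl)

theorem coeff_swAltSeries_cls {d : ℕ} {g : GammaN ι} {X : A.Herm g.1 g.2.toMul}
    {Y : A.Herm (d * g.1) (g.2.toMul ^ d)} (h : IsAlt d X Y) :
    PowerSeries.coeff d (swAltSeries g (cls X)) = elt Y :=
  (coeff_swAltSeries d g _).trans (congrArg
    (DirectSum.of A.SWFam (d * g.1, Additive.ofMul (g.2.toMul ^ d))) (swAlt_cls h))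

/-- The alternating powers as a series, which turns sums into products. -/
def lamSeries : A.SWSum →+ Additive (PowerSeries A.SWSum) :=
  DirectSum.toAddMonoid fun g =>
    { toFun := fun a => Additive.ofMul (swAltSeries g a)
      map_zero' := by
        refine congrArg Additive.ofMul (PowerSeries.ext fun d => ?_)
        have h := (exists_isAlt d (HermSpace.zero ι (A.pow g.1) (A.invPow g.1) (A.invPow_zero g.1)
          g.2.toMul))
        refine (coeff_swAltSeries_cls h.choose_spec).trans ((?_ : _ = _).trans
          (PowerSeries.coeff_one (R := A.SWSum) d).symm)
        split_ifs with hd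
        · subst hd
          exact elt_eq h.choose_spec.gcls_zero
        · have h1 := rdim_alt h.choose_spec
          rw [rdim_zero, Nat.choose_eq_zero_of_lt (Nat.pos_of_ne_zero hd)] at h1
          exact (congrArg _ (cls_eq_zero h1)).trans (map_zero _)
      map_add' := by
        rintro ⟨X⟩ ⟨Y⟩
        refine congrArg Additive.ofMul (PowerSeries.ext fun d => ?_)
        refine Eq.trans ?_ (PowerSeries.coeff_mul d _ _).symm
        have hP := fun p : ℕ => (exists_isAlt p X).choose_spec
        have hQ := fun p : ℕ => (exists_isAlt p Y).choose_spec
        refine (coeff_swAltSeries_cls (g := g) (exists_isAlt d _).choose_spec).trans ?_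
        refine ((exists_isAlt d _).choose_spec.elt_sum hP hQ fun p q =>
          (exists_isTensor _ _).choose_spec).trans ?_
        refine Finset.sum_congr rfl fun p _ => ?_
        exact (elt_mul (exists_isTensor _ _).choose_spec).symm.trans
          (congrArg₂ (fun x y : A.SWSum => x * y) (coeff_swAltSeries_cls (g := g) (hP p.1)).symm
            (coeff_swAltSeries_cls (g := g) (hQ p.2)).symm) }

theorem lamSeries_zero : (lamSeries (0 : A.SWSum)).toMul = (1 : PowerSeries A.SWSum) := by
  rw [map_zero]
  rfl

theorem lamSeries_add (x y : A.SWSum) :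
    (lamSeries (x + y)).toMul = (lamSeries x).toMul * (lamSeries y).toMul := by
  rw [map_add]
  rfl

theorem lamSeries_of (g : GammaN ι) (a : A.SWFam g) :
    lamSeries (DirectSum.of A.SWFam g a) = Additive.ofMul (swAltSeries g a) :=
  DirectSum.toAddMonoid_of _ _ _

/-- The `λ`-operations. -/
def lam (d : ℕ) (x : A.SWSum) : A.SWSum := PowerSeries.coeff d (lamSeries x).toMul

theorem lam_of (d : ℕ) (g : GammaN ι) (a : A.SWFam g) : lam d (DirectSum.of A.SWFam g a) =
    DirectSum.of A.SWFam (d * g.1, Additive.ofMul (g.2.toMul ^ d)) (swAlt d a) := by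
  rw [lam, lamSeries_of]
  exact coeff_swAltSeries d g a

theorem lam_elt {d : ℕ} {X : A.Herm n ε} {Y : A.Herm (d * n) (ε ^ d)}
    (h : IsAlt d X Y) : lam d (elt X) = elt Y := by
  rw [elt, lam_of]
  exact congrArg (DirectSum.of A.SWFam (d * n, Additive.ofMul (ε ^ d))) (swAlt_cls h)

theorem lam_add (d : ℕ) (x y : A.SWSum) : lam d (x + y) =
    ∑ p ∈ Finset.HasAntidiagonal.antidiagonal d, lam p.1 x * lam p.2 y := by
  rw [lam, map_add]
  exact PowerSeries.coeff_mul _ _ _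

theorem lam_zero_left (x : A.SWSum) : lam 0 x = 1 := by
  induction x using SWSum.induction with
  | zero =>  rw [lam, lamSeries_zero, PowerSeries.coeff_zero_one]
  | elt n ε X =>
    obtain ⟨Y, hY⟩ := exists_isAlt 0 X
    rw [lam_elt hY]
    exact elt_eq hY.gcls_zero
  | add x y hx hy => rw [lam_add]; simp [hx, hy]

theorem lam_one_left (x : A.SWSum) : lam 1 x = x := by
  induction x using SWSum.induction with
  | zero =>  rw [lam, lamSeries_zero, PowerSeries.coeff_one, if_neg one_ne_zero]
  | elt n ε X =>
    obtain ⟨Y, hY⟩ := exists_isAlt 1 X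
    rw [lam_elt hY]
    exact elt_eq hY.gcls_one
  | add x y hx hy =>
    rw [lam_add, Finset.Nat.antidiagonal_succ]
    simp [lam_zero_left, hx, hy, add_comm]

/-- The graded reduced dimension. -/
def aug : A.SWSum →+* AddMonoidAlgebra ℤ (GammaN ι) :=
  DirectSum.toSemiring
    (fun g => (AddMonoidAlgebra.singleAddHom g).comp ((Nat.castAddMonoidHom ℤ).comp swRdim))
    (by
      change AddMonoidAlgebra.single _ (((rdim A.unit : ℕ) : ℤ)) = _
      rw [rdim_unit]
      rfl)
    (by
      rintro g g' ⟨X⟩ ⟨Y⟩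
      change AddMonoidAlgebra.single _ (((rdim _ : ℕ) : ℤ)) = AddMonoidAlgebra.single _ ((rdim X : ℕ) : ℤ) *
        AddMonoidAlgebra.single _ ((rdim Y : ℕ) : ℤ)
      rw [AddMonoidAlgebra.single_mul_single, rdim_tensor (exists_isTensor X Y).choose_spec,
        Nat.cast_mul])

theorem aug_elt (X : A.Herm n ε) :
    aug (elt X) = AddMonoidAlgebra.single (n, Additive.ofMul ε) (rdim X : ℤ) :=
  DirectSum.toSemiring_of _ _ _ _ _

theorem aug_lam (d : ℕ) (x : A.SWSum) : aug (lam d x) = monoidRingLam d (aug x) := by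
  rw [← coeff_monoidRingLamSeries]
  suffices h : PowerSeries.map aug (lamSeries x).toMul = monoidRingLamSeries (aug x) by
    rw [← h, PowerSeries.coeff_map]
    rfl
  induction x using SWSum.induction with
  | zero =>  rw [lamSeries_zero, map_zero, monoidRingLamSeries_zero, map_one]
  | elt n ε X =>
    ext1 d
    obtain ⟨Y, hY⟩ := exists_isAlt d X
    rw [PowerSeries.coeff_map, aug_elt, monoidRingLamSeries_single, monoidBinomialSeries,
      PowerSeries.coeff_mk]
    refine (congrArg aug (lam_elt hY)).trans ?_
    rw [aug_elt, rdim_alt hY, Ring.choose_natCast]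
    rfl
  | add x y hx hy =>
    rw [lamSeries_add, map_mul, map_add, monoidRingLamSeries_add, ← hx, ← hy]

end AzumayaInv

/-! ### Witt cancellation -/

theorem Submodule.map_eq_bot_or_isAtom {S P Q : Type*} [Ring S] [AddCommGroup P] [AddCommGroup Q]
    [Module S P] [Module S Q] (f : P →ₗ[S] Q) {T : Submodule S P} (hT : IsAtom T) :
    T.map f = ⊥ ∨ IsAtom (T.map f) := by
  refine or_iff_not_imp_left.mpr fun h => ⟨h, fun N hN => ?_⟩
  have h1 : ∀ y ∈ N, ∃ x ∈ N.comap f ⊓ T, f x = y := fun y hy => by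
    obtain ⟨x, hx, rfl⟩ := hN.le hy
    exact ⟨x, ⟨hy, hx⟩, rfl⟩
  rcases hT.le_iff.mp (inf_le_right : N.comap f ⊓ T ≤ T) with h2 | h2
  · refine (Submodule.eq_bot_iff _).mpr fun y hy => ?_
    obtain ⟨x, hx, rfl⟩ := h1 y hy
    rw [h2, Submodule.mem_bot] at hx
    rw [hx, map_zero]
  · refine absurd hN.le (fun _ => hN.not_ge ?_)
    rintro _ ⟨x, hx, rfl⟩
    exact (h2.ge hx).1

/-- An algebra with a trace form of Goldman type is semisimple: the radical consists of elements
`x` for which all `x a` are nilpotent, so that the trace form vanishes on them. -/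
theorem GoldmanInv.isSemisimpleRing {K R : Type u} [CommRing K] [Nontrivial K] [IsReduced K]
    [IsArtinianRing K] {ι : K →+* K} [InvBase ι] [Ring R] [Algebra K R] {s : R → R}
    (G : GoldmanInv ι R s) : IsSemisimpleRing R := by
  have := G.finite
  have hred : IsReduced (Pt ι) := inferInstanceAs (IsReduced (Geom K × Geom K))
  have : IsArtinianRing R := IsArtinianRing.of_finite K R
  rw [IsArtinianRing.isSemisimpleRing_iff_jacobson, Submodule.eq_bot_iff]
  intro x hx
  obtain ⟨n, hn⟩ := IsSemiprimaryRing.isNilpotent (R := R)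
  have h : ∀ a, G.t (x * a) = 0 := fun a => by
    apply Pt.injective ι
    rw [← G.trace_ψ, map_zero]
    have h1 : (x * a) ^ n = 0 := by
      have : (x * a) ^ n ∈ Ring.jacobson R ^ n :=
        Ideal.pow_mem_pow (Ideal.mul_mem_right a _ hx) n
      rwa [hn] at this
    refine (Matrix.isNilpotent_trace_of_isNilpotent ⟨n, ?_⟩).eq_zero
    rw [← map_pow, h1, map_zero]
  rw [← G.frob x]
  exact Finset.sum_eq_zero fun k _ => by rw [h, zero_smul]

namespace HermSpace

variable {K : Type u} [CommRing K] {ι : K →+* K} {R : Type u} [Ring R]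
  [Algebra K R] {s : R → R} {ε : signGroup ι}

/-- The orthogonal complement of a submodule. -/
def perp (X : HermSpace ι R s ε) (M : Submodule Rᵐᵒᵖ X.carrier) : Submodule Rᵐᵒᵖ X.carrier where
  carrier := {v | ∀ m ∈ M, X.form m v = 0}
  add_mem' hx hy m hm := by rw [map_add, hx m hm, hy m hm, add_zero]
  zero_mem' m _ := map_zero _
  smul_mem' a x hx m hm := by
    have := X.form_right m x a.unop
    rw [hx m hm, zero_mul] at this
    exact this

/-- The map `c` exhibits `N` as the quotient of `M` by its radical. -/
structure IsReduction (X : HermSpace ι R s ε) (M : Submodule Rᵐᵒᵖ X.carrier)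
    (N : HermSpace ι R s ε) (c : M →ₗ[Rᵐᵒᵖ] N.carrier) : Prop where
  surjective : Function.Surjective c
  form_eq : ∀ x y, N.form (c x) (c y) = X.form x y

theorem generates_of_surjective {X : HermSpace ι R s ε} {T : Type*} {c : T → X.carrier}
    (h : Function.Surjective c) : X.Generates c := by
  rw [Generates, h.range_eq, Submodule.span_univ]

variable {X : HermSpace ι R s ε} {M : Submodule Rᵐᵒᵖ X.carrier} {N : HermSpace ι R s ε}
  {c : M →ₗ[Rᵐᵒᵖ] N.carrier}

theorem IsReduction.eq_zero (h : X.IsReduction M N c) (x : M) (hx : ∀ y ∈ M, X.form x y = 0) :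
    c x = 0 := by
  refine N.nondegenerate _ fun y => ?_
  obtain ⟨y, rfl⟩ := h.surjective y
  rw [h.form_eq, hx y y.2]

variable [Nontrivial K] [IsReduced K] [IsArtinianRing K] [InvBase ι] (G : GoldmanInv ι R s)
include G

/-- Every submodule has a nondegenerate quotient by its radical. -/
theorem exists_isReduction (X : HermSpace ι R s ε) (M : Submodule Rᵐᵒᵖ X.carrier) :
    ∃ (N : HermSpace ι R s ε) (c : M →ₗ[Rᵐᵒᵖ] N.carrier), X.IsReduction M N c := by
  have h0 : IsNoetherian K M := isNoetherian_of_injective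
    (M.subtype.restrictScalars K) Subtype.val_injective
  have h1 : Module.Finite Rᵐᵒᵖ M := Module.Finite.of_restrictScalars_finite K _ _
  -- the reduction is the space presented by the Gram matrix of all elements of `M`
  obtain ⟨n, f, hf⟩ := Module.Finite.exists_fin (R := Rᵐᵒᵖ) (M := M)
  obtain ⟨N, c, hc, hg⟩ := HermSpace.exists_of_gram G ε (T := M) (fun x y => X.form x y)
    (fun x y => X.form_symm x y) f (fun y => by
      obtain ⟨r, hr⟩ := (Submodule.mem_span_range_iff_exists_fun Rᵐᵒᵖ).mp
        (show y ∈ Submodule.span Rᵐᵒᵖ (Set.range f) by rw [hf]; trivial)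
      refine ⟨fun k => (r k).unop, fun i => ?_⟩
      rw [← hr, AddSubmonoidClass.coe_finsetSum, map_sum]
      exact Finset.sum_congr rfl fun k _ => X.form_right _ _ _)
  let c' : M →ₗ[Rᵐᵒᵖ] N.carrier :=
    { toFun := c
      map_add' := fun x y => N.eq_of_form_right G.inv_zero hc fun i => by
        rw [map_add, hg, hg, hg]
        exact map_add _ _ _
      map_smul' := fun a x => N.eq_of_form_right G.inv_zero hc fun i => by
        have h2 := N.form_right (c i) (c x) a.unop
        rw [MulOpposite.op_unop, hg] at h2
        rw [hg]
        exact (X.form_right _ _ _).trans h2.symm }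
  refine ⟨N, c', LinearMap.range_eq_top.mp (top_le_iff.mp ?_), hg⟩
  rw [← show Submodule.span Rᵐᵒᵖ (Set.range c) = ⊤ from hc, Submodule.span_le]
  rintro _ ⟨x, rfl⟩
  exact ⟨x, rfl⟩

/-- Orthogonal projection to a nondegenerate submodule. -/
theorem exists_sub_mem_perp (X : HermSpace ι R s ε) (M : Submodule Rᵐᵒᵖ X.carrier)
    (hM : ∀ x ∈ M, (∀ y ∈ M, X.form x y = 0) → x = 0) (v : X.carrier) :
    ∃ m ∈ M, v - m ∈ X.perp M := by
  obtain ⟨N, c, hc⟩ := exists_isReduction G X M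
  have hinj : Function.Injective c := by
    rw [injective_iff_map_eq_zero]
    intro x hx
    refine Subtype.ext (hM x x.2 fun y hy => ?_)
    rw [← hc.form_eq x ⟨y, hy⟩, hx, map_zero]
    rfl
  let e := LinearEquiv.ofBijective c ⟨hinj, hc.surjective⟩
  obtain ⟨n, hn⟩ := N.exists_form_eq G (G.t ∘ₗ X.form v ∘ₗ
    (M.subtype.restrictScalars K) ∘ₗ (e.symm.toLinearMap.restrictScalars K))
  obtain ⟨m, rfl⟩ := hc.surjective n
  have h1 : ∀ y : M, G.t (X.form m y) = G.t (X.form v y) := fun y => by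
    have := hn (c y)
    rw [hc.form_eq] at this
    refine this.trans ?_
    change G.t (X.form v (e.symm (e y) : M)) = _
    rw [e.symm_apply_apply]
  refine ⟨m, m.2, fun y hy => X.form_eq_zero_comm G.inv_zero ?_⟩
  rw [map_sub, LinearMap.sub_apply, ← G.frob (X.form v y - X.form m y)]
  refine Finset.sum_eq_zero fun k _ => ?_
  have := h1 ⟨MulOpposite.op (G.a k) • y, M.smul_mem _ hy⟩
  rw [sub_mul, map_sub]
  simp only [X.form_right] at this
  rw [this, sub_self, zero_smul]

/-- A nondegenerate submodule splits off. -/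
theorem isometric_sum_perp {N' : HermSpace ι R s ε} {c' : X.perp M →ₗ[Rᵐᵒᵖ] N'.carrier}
    (hM : ∀ x ∈ M, (∀ y ∈ M, X.form x y = 0) → x = 0)
    (hc : X.IsReduction M N c) (hc' : X.IsReduction (X.perp M) N' c') :
    Isometric X (sum G.inv_add N N') := by
  refine isometric_of_gram G.inv_zero (T := M × X.perp M) (a := fun p => (p.1 : X.carrier) + p.2)
    (b := fun p => ((c p.1, c' p.2) : N.carrier × N'.carrier))
    (generates_of_surjective fun v => ?_) (generates_of_surjective ?_) ?_
  · obtain ⟨m, hm, hv⟩ := exists_sub_mem_perp G X M hM v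
    exact ⟨(⟨m, hm⟩, ⟨v - m, hv⟩), add_sub_cancel _ _⟩
  · rintro ⟨x, y⟩
    obtain ⟨x, rfl⟩ := hc.surjective x
    obtain ⟨y, rfl⟩ := hc'.surjective y
    exact ⟨(x, y), rfl⟩
  · rintro ⟨x, y⟩ ⟨x', y'⟩
    change N.form (c x) (c x') + N'.form (c' y) (c' y') = X.form (x + y) (x' + y')
    rw [hc.form_eq, hc'.form_eq, map_add, map_add, LinearMap.add_apply, LinearMap.add_apply,
      y'.2 x x.2, X.form_eq_zero_comm G.inv_zero (y.2 x' x'.2), add_zero, zero_add]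

/-- Two simple isotropic submodules that pair nontrivially have isometric reductions. -/
theorem IsReduction.isometric_of_pairing {T₁ T₂ : Submodule Rᵐᵒᵖ X.carrier}
    {N₁ N₂ : HermSpace ι R s ε} {c₁ : X.perp T₁ →ₗ[Rᵐᵒᵖ] N₁.carrier}
    {c₂ : X.perp T₂ →ₗ[Rᵐᵒᵖ] N₂.carrier} (h₁ : X.IsReduction (X.perp T₁) N₁ c₁)
    (h₂ : X.IsReduction (X.perp T₂) N₂ c₂) (ha₁ : IsAtom T₁) (ha₂ : IsAtom T₂)
    (hi₁ : T₁ ≤ X.perp T₁) (hi₂ : T₂ ≤ X.perp T₂) (hp : ¬ T₁ ≤ X.perp T₂) :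
    Isometric N₁ N₂ := by
  have hs := G.inv_zero
  have hp' : ¬ T₂ ≤ X.perp T₁ := fun h => hp fun x hx y hy =>
    X.form_eq_zero_comm hs (h hy x hx)
  have e₁ : ∀ x ∈ T₁, x ∈ X.perp T₂ → x = 0 := fun x hx hx' => by
    have := ha₁.2 (T₁ ⊓ X.perp T₂) (inf_lt_left.mpr hp)
    exact (Submodule.eq_bot_iff _).mp this x ⟨hx, hx'⟩
  have e₂ : ∀ x ∈ T₂, x ∈ X.perp T₁ → x = 0 := fun x hx hx' => by
    have := ha₂.2 (T₂ ⊓ X.perp T₁) (inf_lt_left.mpr hp')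
    exact (Submodule.eq_bot_iff _).mp this x ⟨hx, hx'⟩
  have hproj := exists_sub_mem_perp G X (T₁ ⊔ T₂) fun x hx h => by
    obtain ⟨t, ht, t', ht', rfl⟩ := Submodule.mem_sup.mp hx
    have h1 : t = 0 := e₁ t ht fun y hy => by
      have := X.form_eq_zero_comm hs (h y (Submodule.mem_sup_right hy))
      rwa [map_add, hi₂ ht' y hy, add_zero] at this
    have h2 : t' = 0 := e₂ t' ht' fun y hy => by
      have := X.form_eq_zero_comm hs (h y (Submodule.mem_sup_left hy))
      rwa [map_add, hi₁ ht y hy, zero_add] at this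
    rw [h1, h2, add_zero]
  have hle₁ : X.perp (T₁ ⊔ T₂) ≤ X.perp T₁ := fun x hx y hy => hx y (Submodule.mem_sup_left hy)
  have hle₂ : X.perp (T₁ ⊔ T₂) ≤ X.perp T₂ := fun x hx y hy => hx y (Submodule.mem_sup_right hy)
  refine isometric_of_gram hs (T := X.perp (T₁ ⊔ T₂)) (a := fun v => c₁ ⟨v, hle₁ v.2⟩)
    (b := fun v => c₂ ⟨v, hle₂ v.2⟩) (generates_of_surjective fun w => ?_)
    (generates_of_surjective fun w => ?_) fun v w => ?_
  · obtain ⟨v, rfl⟩ := h₁.surjective w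
    obtain ⟨m, hm, hv⟩ := hproj v
    obtain ⟨t, ht, t', ht', rfl⟩ := Submodule.mem_sup.mp hm
    have h2 : t' = 0 := e₂ t' ht' fun y hy => by
      have := hle₁ hv y hy
      rwa [map_sub, v.2 y hy, map_add, hi₁ ht y hy, zero_add, zero_sub, neg_eq_zero] at this
    subst h2
    refine ⟨⟨_, hv⟩, ?_⟩
    rw [← sub_eq_zero, ← map_sub]
    refine h₁.eq_zero _ fun y hy => ?_
    change X.form ((v : X.carrier) - (t + 0) - v) y = 0
    rw [add_zero, sub_sub_cancel_left, map_neg, LinearMap.neg_apply, hy t ht, neg_zero]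
  · obtain ⟨v, rfl⟩ := h₂.surjective w
    obtain ⟨m, hm, hv⟩ := hproj v
    obtain ⟨t, ht, t', ht', rfl⟩ := Submodule.mem_sup.mp hm
    have h2 : t = 0 := e₁ t ht fun y hy => by
      have := hle₂ hv y hy
      rwa [map_sub, v.2 y hy, map_add, hi₂ ht' y hy, add_zero, zero_sub, neg_eq_zero] at this
    subst h2
    refine ⟨⟨_, hv⟩, ?_⟩
    rw [← sub_eq_zero, ← map_sub]
    refine h₂.eq_zero _ fun y hy => ?_
    change X.form ((v : X.carrier) - (0 + t') - v) y = 0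
    rw [zero_add, sub_sub_cancel_left, map_neg, LinearMap.neg_apply, hy t' ht', neg_zero]
  · rw [h₁.form_eq, h₂.form_eq]

variable {Y Z : HermSpace ι R s ε}

/-- The reduction of an orthogonal sum along a submodule of one summand. -/
theorem IsReduction.isometric_sum (e : X.carrier ≃ₗ[Rᵐᵒᵖ] (Y.carrier × Z.carrier))
    (he : ∀ x x', Y.form (e x).1 (e x').1 + Z.form (e x).2 (e x').2 = X.form x x')
    {S : Submodule Rᵐᵒᵖ Z.carrier} {Z' : HermSpace ι R s ε} {c : Z.perp S →ₗ[Rᵐᵒᵖ] Z'.carrier}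
    (hc : Z.IsReduction (Z.perp S) Z' c) {T : Submodule Rᵐᵒᵖ X.carrier}
    (hT : T = S.map (e.symm.toLinearMap ∘ₗ LinearMap.inr Rᵐᵒᵖ Y.carrier Z.carrier))
    {c' : X.perp T →ₗ[Rᵐᵒᵖ] N.carrier} (hc' : X.IsReduction (X.perp T) N c') :
    Isometric N (sum G.inv_add Y Z') := by
  have h1 : ∀ x, x ∈ X.perp T ↔ (e x).2 ∈ Z.perp S := fun x => by
    have h2 : ∀ z, X.form (e.symm (0, z)) x = Z.form z (e x).2 := fun z => by
      rw [← he, e.apply_symm_apply, map_zero, LinearMap.zero_apply, zero_add]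
    subst hT
    constructor
    · intro h z hz
      rw [← h2]
      exact h _ ⟨z, hz, rfl⟩
    · rintro h _ ⟨z, hz, rfl⟩
      exact (h2 z).trans (h z hz)
  refine isometric_of_gram G.inv_zero (T := X.perp T) (a := c')
    (b := fun x => (((e x).1, c ⟨(e x).2, (h1 x).mp x.2⟩) : Y.carrier × Z'.carrier))
    (generates_of_surjective hc'.surjective) (generates_of_surjective ?_) fun x x' => ?_
  · rintro ⟨y, z⟩
    obtain ⟨z, rfl⟩ := hc.surjective z
    refine ⟨⟨e.symm (y, z), (h1 _).mpr (by rw [e.apply_symm_apply]; exact z.2)⟩, ?_⟩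
    have h2 := e.apply_symm_apply (y, (z : Z.carrier))
    refine Prod.ext ?_ (congrArg c (Subtype.ext ?_))
    · change (e (e.symm (y, (z : Z.carrier)))).1 = y
      rw [h2]
    · exact congrArg Prod.snd h2
  · change Y.form (e x).1 (e x').1 + Z'.form (c _) (c _) = _
    rw [hc.form_eq, hc'.form_eq, he]

/-- Cancellation of a space on a simple module. The component `d : Z → Z` of the isometry is such that
`1 - d` or `-1 - d` is bijective, since both vanish only if `2 = 0`; this is the Cayley transform
argument for removing `Z`. -/
theorem cancel_of_isSimpleModule [IsSimpleModule Rᵐᵒᵖ Z.carrier]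
    (e : (X.carrier × Z.carrier) ≃ₗ[Rᵐᵒᵖ] (Y.carrier × Z.carrier))
    (he : ∀ p q, Y.form (e p).1 (e q).1 + Z.form (e p).2 (e q).2 =
      X.form p.1 q.1 + Z.form p.2 q.2) : Isometric X Y := by
  let d : Z.carrier →ₗ[Rᵐᵒᵖ] Z.carrier :=
    LinearMap.snd _ _ _ ∘ₗ e.toLinearMap ∘ₗ LinearMap.inr _ _ _
  let d' : Z.carrier →ₗ[Rᵐᵒᵖ] Z.carrier :=
    LinearMap.snd _ _ _ ∘ₗ e.symm.toLinearMap ∘ₗ LinearMap.inr _ _ _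
  -- the component of the inverse isometry is the adjoint of `d`
  have hadj : ∀ w z, Z.form (d' w) z = Z.form w (d z) := fun w z => by
    have h1 := he (e.symm (0, w)) (0, z)
    rw [e.apply_symm_apply, map_zero, map_zero, LinearMap.zero_apply, zero_add, zero_add] at h1
    exact h1.symm
  have hnt : Nontrivial Z.carrier := IsSimpleModule.nontrivial Rᵐᵒᵖ _
  obtain ⟨δ, hδ, hbij⟩ : ∃ δ : ℤ, δ * δ = 1 ∧
      Function.Bijective (δ • (LinearMap.id : Z.carrier →ₗ[Rᵐᵒᵖ] Z.carrier) - d) := by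
    by_contra! hcon
    have h1 := (LinearMap.bijective_or_eq_zero _).resolve_left (hcon 1 rfl)
    have h2 := (LinearMap.bijective_or_eq_zero _).resolve_left (hcon (-1) rfl)
    obtain ⟨z, hz⟩ := exists_ne (0 : Z.carrier)
    refine hz ?_
    have h3 := LinearMap.congr_fun (sub_eq_zero.mpr (h1.trans h2.symm)) z
    have h4 : (2 : K) • z = 0 := by
      rw [two_smul]
      simpa using h3
    exact (InvBase.two (ι := ι)).smul_eq_zero.mp h4
  have hinj' : Function.Injective (δ • (LinearMap.id : Z.carrier →ₗ[Rᵐᵒᵖ] Z.carrier) - d') := by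
    rw [injective_iff_map_eq_zero]
    intro w hw
    refine Z.nondegenerate w fun y => ?_
    obtain ⟨z, rfl⟩ := hbij.2 y
    have h1 : Z.form w ((δ • LinearMap.id - d : Z.carrier →ₗ[Rᵐᵒᵖ] Z.carrier) z) =
        Z.form ((δ • LinearMap.id - d' : Z.carrier →ₗ[Rᵐᵒᵖ] Z.carrier) w) z := by
      simp only [LinearMap.sub_apply, LinearMap.smul_apply, LinearMap.id_apply, map_sub, map_zsmul,
        hadj]
    rw [h1, hw, map_zero, LinearMap.zero_apply]
  have hbij' := (LinearMap.bijective_or_eq_zero (δ • LinearMap.id - d' :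
    Z.carrier →ₗ[Rᵐᵒᵖ] Z.carrier)).resolve_right fun h => by
      rw [h] at hinj'
      obtain ⟨z, hz⟩ := exists_ne (0 : Z.carrier)
      exact hz (hinj' rfl)
  -- the pairs `(x, y)` such that `e (x, z) = (y, δ z)` for some `z` form the graph of an isometry
  refine isometric_of_gram G.inv_zero (T := {p : X.carrier × Z.carrier // (e p).2 = δ • p.2})
    (a := fun p => p.1.1) (b := fun p => (e p.1).1) (generates_of_surjective fun x => ?_)
    (generates_of_surjective fun y => ?_) fun p q => ?_
  · obtain ⟨z, hz⟩ := hbij.2 (e (x, 0)).2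
    refine ⟨⟨(x, z), ?_⟩, rfl⟩
    have h1 : e (x, z) = e (x, 0) + e (0, z) := by rw [← map_add, Prod.mk_add_mk, add_zero, zero_add]
    rw [h1, Prod.snd_add, ← hz]
    exact sub_add_cancel _ _
  · obtain ⟨w, hw⟩ := hbij'.2 (e.symm (y, 0)).2
    have h1 : e.symm (y, w) = e.symm (y, 0) + e.symm (0, w) := by
      rw [← map_add, Prod.mk_add_mk, add_zero, zero_add]
    have h2 : (e.symm (y, w)).2 = δ • w := by
      rw [h1, Prod.snd_add, ← hw]
      exact sub_add_cancel _ _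
    refine ⟨⟨e.symm (y, w), ?_⟩, ?_⟩
    · rw [h2, e.apply_symm_apply, smul_smul, hδ, one_smul]
    · change (e (e.symm (y, w))).1 = y
      rw [e.apply_symm_apply]
  · have h1 := he p.1 q.1
    rw [p.2, q.2, map_zsmul, map_zsmul, LinearMap.smul_apply, smul_smul, hδ, one_smul] at h1
    exact add_right_cancel h1

theorem length_lt_of_isReduction {S : Submodule Rᵐᵒᵖ Z.carrier} (hS : S ≠ ⊥)
    {Z' : HermSpace ι R s ε} {c : Z.perp S →ₗ[Rᵐᵒᵖ] Z'.carrier}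
    (hc : Z.IsReduction (Z.perp S) Z' c) :
    Module.length Rᵐᵒᵖ Z'.carrier < Module.length Rᵐᵒᵖ Z.carrier := by
  have := G.finite
  have : Module.Finite K Rᵐᵒᵖ := Module.Finite.equiv (MulOpposite.opLinearEquiv K)
  have : IsArtinianRing Rᵐᵒᵖ := IsArtinianRing.of_finite K Rᵐᵒᵖ
  have : Module.Finite Rᵐᵒᵖ Z.carrier := Module.Finite.of_restrictScalars_finite K _ _
  refine (Module.length_le_of_surjective c hc.surjective).trans_lt (Submodule.length_lt ?_)
  intro h
  refine hS ((Submodule.eq_bot_iff _).mpr fun x hx => Z.nondegenerate x fun y => ?_)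
  exact (h.ge (Submodule.mem_top : y ∈ ⊤)) x hx

/-- Witt's cancellation theorem, by induction on the length of `Z`. If a simple submodule of `Z` is not
isotropic, it splits off and is cancelled. If all simple submodules are isotropic, `Z` is reduced along
one of them: the reductions of `X ⊥ Z ≅ Y ⊥ Z` along the two resulting isotropic submodules are
isometric, as both are isometric to the reduction along a third one that pairs with both. -/
theorem cancel {X Y : HermSpace ι R s ε} (Z : HermSpace ι R s ε)
    (h : Isometric (sum G.inv_add X Z) (sum G.inv_add Y Z)) : Isometric X Y := by
  generalize hl : Module.length Rᵐᵒᵖ Z.carrier = l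
  induction l using WellFoundedLT.induction generalizing X Y Z with
  | ind l ih =>
  subst hl
  have hss := G.isSemisimpleRing
  obtain ⟨e₀, he₀, hf⟩ := h
  let e : (X.carrier × Z.carrier) ≃ₗ[Rᵐᵒᵖ] (Y.carrier × Z.carrier) :=
    { e₀.toAddEquiv with map_smul' := fun a x => he₀ a.unop x }
  have he : ∀ p q, Y.form (e p).1 (e q).1 + Z.form (e p).2 (e q).2 =
      X.form p.1 q.1 + Z.form p.2 q.2 := hf
  rcases eq_bot_or_exists_atom_le (⊤ : Submodule Rᵐᵒᵖ Z.carrier) with hbot | ⟨S₀, hS₀, -⟩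
  · have hz : ∀ z : Z.carrier, z = 0 := fun z => (Submodule.eq_bot_iff _).mp hbot z trivial
    refine isometric_of_gram G.inv_zero (T := X.carrier × Z.carrier) (a := fun p => p.1)
      (b := fun p => (e p).1) (generates_of_surjective fun x => ⟨(x, 0), rfl⟩)
      (generates_of_surjective fun y => ⟨e.symm (y, 0), by simp⟩) fun p q => ?_
    have h1 := he p q
    rw [hz (e p).2, hz p.2, map_zero, LinearMap.zero_apply, LinearMap.zero_apply, add_zero,
      add_zero] at h1
    exact h1
  by_cases hiso : ∀ S : Submodule Rᵐᵒᵖ Z.carrier, IsAtom S → S ≤ Z.perp S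
  · have hiso' : ∀ (g : Z.carrier →ₗ[Rᵐᵒᵖ] Z.carrier) {S : Submodule Rᵐᵒᵖ Z.carrier}, IsAtom S →
        ∀ x ∈ S, ∀ y ∈ S, Z.form (g x) (g y) = 0 := fun g S hS x hx y hy => by
      rcases Submodule.map_eq_bot_or_isAtom g hS with h1 | h1
      · have h2 : g x ∈ S.map g := ⟨x, hx, rfl⟩
        rw [h1, Submodule.mem_bot] at h2
        rw [h2, map_zero, LinearMap.zero_apply]
      · exact hiso _ h1 ⟨y, hy, rfl⟩ _ ⟨x, hx, rfl⟩
    -- `Z` is the sum of its simple submodules, so that one of them pairs with `S₀`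
    obtain ⟨S', hS', hp⟩ : ∃ S' : Submodule Rᵐᵒᵖ Z.carrier, IsAtom S' ∧ ¬ S' ≤ Z.perp S₀ := by
      by_contra! hcon
      have h1 : (⊤ : Submodule Rᵐᵒᵖ Z.carrier) ≤ Z.perp S₀ := by
        rw [← sSup_atoms_eq_top]
        exact sSup_le hcon
      refine hS₀.1 ((Submodule.eq_bot_iff _).mpr fun x hx => Z.nondegenerate x fun y => ?_)
      exact h1 (Submodule.mem_top : y ∈ ⊤) x hx
    obtain ⟨x, hx, hxp⟩ := Set.not_subset.mp hp
    obtain ⟨y, hy, hxy⟩ : ∃ y ∈ S₀, Z.form y x ≠ 0 := by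
      by_contra! hcon
      exact hxp hcon
    let V := sum G.inv_add X Z
    let f₁ : Z.carrier →ₗ[Rᵐᵒᵖ] V.carrier := LinearMap.inr Rᵐᵒᵖ X.carrier Z.carrier
    let f₂ : Z.carrier →ₗ[Rᵐᵒᵖ] V.carrier :=
      e.symm.toLinearMap ∘ₗ LinearMap.inr Rᵐᵒᵖ Y.carrier Z.carrier
    let m : Z.carrier →ₗ[Rᵐᵒᵖ] Z.carrier := LinearMap.snd Rᵐᵒᵖ X.carrier Z.carrier ∘ₗ f₂
    have hf₁ : ∀ z z', V.form (f₁ z) (f₁ z') = Z.form z z' := fun z z' => by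
      change X.form 0 0 + Z.form z z' = _
      rw [map_zero, zero_add]
    have hf₂ : ∀ z z', V.form (f₂ z) (f₂ z') = Z.form z z' := fun z z' => by
      refine (he (e.symm (0, z)) (e.symm (0, z'))).symm.trans ?_
      rw [e.apply_symm_apply, e.apply_symm_apply, map_zero, zero_add]
    have hm : ∀ z z', V.form (f₁ z) (f₂ z') = Z.form z (m z') := fun z z' => by
      change X.form 0 _ + Z.form z (m z') = _
      rw [map_zero, LinearMap.zero_apply, zero_add]
    have hm' : ∀ z z', V.form (f₂ z) (f₁ z') = Z.form (m z) z' := fun z z' => by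
      change X.form _ 0 + Z.form (m z) z' = _
      rw [map_zero, zero_add]
    have hatom : ∀ (g : Z.carrier →ₗ[Rᵐᵒᵖ] V.carrier) {S : Submodule Rᵐᵒᵖ Z.carrier}, IsAtom S →
        (∃ z ∈ S, g z ≠ 0) → IsAtom (S.map g) := by
      rintro g S hS ⟨z, hz, hgz⟩
      refine (Submodule.map_eq_bot_or_isAtom g hS).resolve_left fun h => hgz ?_
      have h2 : g z ∈ S.map g := ⟨z, hz, rfl⟩
      rwa [h, Submodule.mem_bot] at h2
    -- a simple isotropic submodule that pairs with both copies of `S₀`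
    obtain ⟨g, hg, hp₁, hp₂⟩ : ∃ g : Z.carrier →ₗ[Rᵐᵒᵖ] V.carrier,
        (∀ z ∈ S', ∀ z' ∈ S', V.form (g z) (g z') = 0) ∧
        (∃ z ∈ S', ∃ y ∈ S₀, V.form (f₁ y) (g z) ≠ 0) ∧
        ∃ z ∈ S', ∃ y ∈ S₀, V.form (f₂ y) (g z) ≠ 0 := by
      by_cases h1 : ∃ z ∈ S', ∃ y ∈ S₀, V.form (f₂ y) (f₁ z) ≠ 0
      · exact ⟨f₁, fun z hz z' hz' => (hf₁ z z').trans (hiso' LinearMap.id hS' z hz z' hz'),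
          ⟨x, hx, y, hy, by rwa [hf₁]⟩, h1⟩
      by_cases h2 : ∃ z ∈ S', ∃ y ∈ S₀, V.form (f₁ y) (f₂ z) ≠ 0
      · exact ⟨f₂, fun z hz z' hz' => (hf₂ z z').trans (hiso' LinearMap.id hS' z hz z' hz'),
          h2, ⟨x, hx, y, hy, by rwa [hf₂]⟩⟩
      push Not at h1 h2
      refine ⟨f₁ + f₂, fun z hz z' hz' => ?_, ⟨x, hx, y, hy, ?_⟩, ⟨x, hx, y, hy, ?_⟩⟩
      · have h3 := hiso' (LinearMap.id + m) hS' z hz z' hz'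
        have h4 := hiso' m hS' z hz z' hz'
        have h5 := hiso' LinearMap.id hS' z hz z' hz'
        simp only [LinearMap.add_apply, map_add, LinearMap.id_apply, hf₁, hf₂, hm, hm'] at h3 h5 ⊢
        rw [h4, add_zero] at h3
        rw [← h3, h5]
        abel
      · rwa [LinearMap.add_apply, map_add, h2 x hx y hy, add_zero, hf₁]
      · rwa [LinearMap.add_apply, map_add, h1 x hx y hy, zero_add, hf₂]
    have hy0 : y ≠ 0 := fun h => hxy (by rw [h, map_zero, LinearMap.zero_apply])
    have ha₁ : IsAtom (S₀.map f₁) := hatom f₁ hS₀ ⟨y, hy, fun h => hy0 (congrArg Prod.snd h)⟩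
    have ha₂ : IsAtom (S₀.map f₂) := hatom f₂ hS₀ ⟨y, hy, fun h => hy0
      (congrArg Prod.snd (e.symm.map_eq_zero_iff.mp h))⟩
    have ha₃ : IsAtom (S'.map g) := hatom g hS' (by
      obtain ⟨z, hz, y, hy, h⟩ := hp₁
      exact ⟨z, hz, fun h' => h (by rw [h', map_zero])⟩)
    have hi : ∀ {f : Z.carrier →ₗ[Rᵐᵒᵖ] V.carrier} {S : Submodule Rᵐᵒᵖ Z.carrier},
        (∀ z ∈ S, ∀ z' ∈ S, V.form (f z) (f z') = 0) → S.map f ≤ V.perp (S.map f) := by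
      rintro f S h _ ⟨z, hz, rfl⟩ _ ⟨z', hz', rfl⟩
      exact h _ hz' _ hz
    have hi₁ := hi fun z hz z' hz' => (hf₁ z z').trans (hiso' LinearMap.id hS₀ z hz z' hz')
    have hi₂ := hi fun z hz z' hz' => (hf₂ z z').trans (hiso' LinearMap.id hS₀ z hz z' hz')
    have hi₃ := hi hg
    have hn : ∀ {f : Z.carrier →ₗ[Rᵐᵒᵖ] V.carrier},
        (∃ z ∈ S', ∃ y ∈ S₀, V.form (f y) (g z) ≠ 0) → ¬ S'.map g ≤ V.perp (S₀.map f) := by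
      rintro f ⟨z, hz, y, hy, h⟩ hle
      exact h (hle ⟨z, hz, rfl⟩ _ ⟨y, hy, rfl⟩)
    obtain ⟨N₁, c₁, hc₁⟩ := exists_isReduction G V (V.perp (S₀.map f₁))
    obtain ⟨N₂, c₂, hc₂⟩ := exists_isReduction G V (V.perp (S₀.map f₂))
    obtain ⟨N₃, c₃, hc₃⟩ := exists_isReduction G V (V.perp (S'.map g))
    obtain ⟨Z', c, hc⟩ := exists_isReduction G Z (Z.perp S₀)
    have r₁ : Isometric N₁ (sum G.inv_add X Z') := IsReduction.isometric_sum G (X := V)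
      (LinearEquiv.refl Rᵐᵒᵖ (X.carrier × Z.carrier)) (fun _ _ => rfl) hc rfl hc₁
    have r₂ : Isometric N₂ (sum G.inv_add Y Z') := IsReduction.isometric_sum G (X := V)
      e he hc rfl hc₂
    have r₃ := hc₃.isometric_of_pairing G hc₁ ha₃ ha₁ hi₃ hi₁ (hn hp₁)
    have r₄ := hc₃.isometric_of_pairing G hc₂ ha₃ ha₂ hi₃ hi₂ (hn hp₂)
    exact ih _ (length_lt_of_isReduction G hS₀.1 hc) Z'
      (r₁.symm.trans (r₃.symm.trans (r₄.trans r₂))) rfl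
  · push Not at hiso
    obtain ⟨S, hS, hne⟩ := hiso
    have hnd : ∀ x ∈ S, (∀ y ∈ S, Z.form x y = 0) → x = 0 := fun x hx h => by
      have h1 := hS.2 (S ⊓ Z.perp S) (inf_lt_left.mpr hne)
      exact (Submodule.eq_bot_iff _).mp h1 x
        ⟨hx, fun y hy => Z.form_eq_zero_comm G.inv_zero (h y hy)⟩
    obtain ⟨N, c, hc⟩ := exists_isReduction G Z S
    obtain ⟨Z', c', hc'⟩ := exists_isReduction G Z (Z.perp S)
    have hZ := isometric_sum_perp G hnd hc hc'
    have hsimple : IsSimpleModule Rᵐᵒᵖ N.carrier := by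
      have : IsSimpleModule Rᵐᵒᵖ S := isSimpleModule_iff_isAtom.mpr hS
      refine IsSimpleModule.congr (LinearEquiv.ofBijective c ⟨?_, hc.surjective⟩).symm
      rw [injective_iff_map_eq_zero]
      intro x hx
      refine Subtype.ext (hnd x x.2 fun y hy => ?_)
      rw [← hc.form_eq x ⟨y, hy⟩, hx, map_zero, LinearMap.zero_apply]
    have hX : ∀ X : HermSpace ι R s ε, Isometric (sum G.inv_add X Z)
        (sum G.inv_add (sum G.inv_add X Z') N) := fun X =>
      (HermSpace.isometric_sum G.inv_add (.refl X) (hZ.trans (sum_comm _ _ _))).trans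
        (sum_assoc _ _ _ _).symm
    obtain ⟨e', he', hf'⟩ := (hX X).symm.trans
      ((show Isometric (sum G.inv_add X Z) (sum G.inv_add Y Z) from ⟨e₀, he₀, hf⟩).trans (hX Y))
    have h2 : Isometric (sum G.inv_add X Z') (sum G.inv_add Y Z') :=
      cancel_of_isSimpleModule G (Z := N)
        { e'.toAddEquiv with map_smul' := fun a x => he' a.unop x } hf'
    exact ih _ (length_lt_of_isReduction G hS.1 hc') Z' h2 rfl

end HermSpace

/-! ### Tensor products with spaces of reduced dimension one -/

/-- In reduced dimension one, all endomorphisms are scalars. -/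
theorem HermSpace.Coord.op_form_smul {K : Type u} [CommRing K] [Nontrivial K] [IsReduced K]
    {ι : K →+* K} [InvBase ι] {R : Type u} [Ring R] [Algebra K R] {s : R → R} {ε : signGroup ι}
    {X : HermSpace ι R s ε} {G : GoldmanInv ι R s} (C : X.Coord G) [Nonempty G.I]
    (hC : Fintype.card C.J = 1) (v w x : X.carrier) :
    MulOpposite.op (X.form v x) • w = G.t (X.form v w) • x := by
  obtain ⟨j₀, hj⟩ := Fintype.card_eq_one_iff.mp hC
  have hs : Subsingleton C.J := ⟨fun i j => (hj i).trans (hj j).symm⟩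
  apply C.χ_injective
  have h1 : C.χ w * C.η v = (C.χ w * C.η v).trace • (1 : Matrix C.J C.J (Pt ι)) := by
    ext i j
    obtain rfl := Subsingleton.elim i j
    rw [Matrix.smul_apply, Matrix.one_apply_eq, Matrix.trace, Fintype.sum_subsingleton _ i,
      Matrix.diag_apply, smul_eq_mul, mul_one]
  rw [C.χ_smul, C.form_eq, ← Matrix.mul_assoc, h1, Matrix.trace_mul_comm, ← C.form_eq, G.trace_ψ,
    Matrix.smul_mul, Matrix.one_mul, map_smul, algebraMap_smul]

namespace AzumayaInv

variable {K : Type u} [CommRing K] {ι : K →+* K} {A : AzumayaInv ι} {m n : ℕ}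

theorem powMul_induction {p : A.pow (m + n) → Prop} (zero : p 0) (mul : ∀ a b, p (A.powMul a b))
    (add : ∀ x y, p x → p y → p (x + y)) (z : A.pow (m + n)) : p z := by
  obtain ⟨z, rfl⟩ := TensorPower.mulEquiv.surjective z
  induction z using TensorProduct.induction_on with
  | zero => rw [map_zero]; exact zero
  | tmul a b => exact mul a b
  | add x y hx hy => rw [map_add]; exact add _ _ hx hy

variable [Nontrivial K] [IsReduced K] [IsArtinianRing K] [InvBase ι] {ε ε' : signGroup ι}

theorem powMul_one_one : A.powMul (1 : A.pow m) (1 : A.pow n) = 1 := by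
  have h : ∀ z, A.powMul (1 : A.pow m) (1 : A.pow n) * z = z := fun z => by
    induction z using powMul_induction with
    | zero => rw [mul_zero]
    | mul a b => rw [← powMul_mul, one_mul, one_mul]
    | add x y hx hy => rw [mul_add, hx, hy]
  exact (mul_one _).symm.trans (h 1)

variable (A m n) in
/-- The map `(x, a ⊗ b) ↦ t(x a) b`, where `t` is the reduced trace. -/
def contract : A.pow m →ₗ[K] A.pow (m + n) →ₗ[K] A.pow n :=
  LinearMap.lcomp K _ (TensorPower.mulEquiv (R := K) (M := A.carrier) (n := m) (m := n)).symm.toLinearMap ∘ₗ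
    (LinearMap.rTensorHom (A.pow n) ∘ₗ (LinearMap.mul K (A.pow m)).compr₂ (A.goldmanPow m).t).compr₂
      (TensorProduct.lid K (A.pow n)).toLinearMap

theorem contract_powMul (x a : A.pow m) (b : A.pow n) :
    contract A m n x (A.powMul a b) = (A.goldmanPow m).t (x * a) • b := by
  change TensorProduct.lid K (A.pow n) (LinearMap.rTensor (A.pow n) _
    (TensorPower.mulEquiv.symm (TensorPower.mulEquiv (a ⊗ₜ[K] b)))) = _
  rw [LinearEquiv.symm_apply_apply]
  rfl

theorem inv_contract (x : A.pow m) (z : A.pow (m + n)) :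
    A.invPow n (contract A m n x z) = contract A m n (A.invPow m x) (A.invPow (m + n) z) := by
  induction z using powMul_induction with
  | zero =>
    rw [map_zero, (A.goldmanPow n).inv_zero, (A.goldmanPow (m + n)).inv_zero, map_zero]
  | mul a b =>
    rw [contract_powMul, (A.goldmanPow n).inv_smul, invPow_powMul, contract_powMul,
      ← (A.goldmanPow m).inv_mul, ← (A.goldmanPow m).t_inv,
      (A.goldmanPow m).inv_mul, (A.goldmanPow m).inv_mul,
      (A.goldmanPow m).t_comm (Pt.injective ι)]
  | add y z hy hz =>
    rw [map_add, (A.goldmanPow n).inv_add, hy, hz, (A.goldmanPow (m + n)).inv_add, map_add]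

/-- The Gram matrix over `A^{⊗ n}` of the space `Y` with `W ≅ L ⊗ Y`, for the family indexed by
`L × W` which contracts the factor `L`. -/
def lineGram (L : A.Herm m ε) {δ : signGroup ι} (W : A.Herm (m + n) δ) (p q : L.carrier × W.carrier) :
    A.pow n :=
  ((ε : Kˣ) : K) • contract A m n (L.form q.1 p.1) (W.form p.2 q.2)

variable {L : A.Herm m ε}

theorem op_form_smul_of_rdim (hL : rdim L = 1) (v w x : L.carrier) :
    MulOpposite.op (L.form v x) • w = (A.goldmanPow m).t (L.form v w) • x := by
  obtain ⟨C⟩ := L.nonempty_coord (A.goldmanPow m)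
  exact C.op_form_smul ((rdim_eq (rdim_eq_card C)).symm.trans hL) v w x

theorem exists_t_form_eq_one (hL : rdim L = 1) :
    ∃ v w : L.carrier, (A.goldmanPow m).t (L.form v w) = 1 := by
  have := free_herm L
  have h1 := hasRdim L
  rw [HermSpace.HasRdim, hL, mul_one] at h1
  let b := Module.finBasis K L.carrier
  obtain ⟨v, hv⟩ := L.exists_form_eq (A.goldmanPow m)
    (b.coord ⟨0, h1 ▸ azumayaDegree_pos A m⟩)
  exact ⟨v, b _, (hv _).trans (by rw [Module.Basis.coord_apply, b.repr_self, Finsupp.single_eq_same])⟩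

theorem form_mul_form (hL : rdim L = 1) (x v w y : L.carrier) (a : A.pow m) :
    L.form x v * a * L.form w y = (A.goldmanPow m).t (L.form w v * a) • L.form x y := by
  rw [← L.form_right, ← L.form_right, op_form_smul_of_rdim hL, map_smul, L.form_right]

/-- A tensor factor is recovered from the tensor product with a space of reduced dimension one. -/
theorem IsTensor.exists_lineGram (hL : rdim L = 1) {Y : A.Herm n ε'} {Z : A.Herm (m + n) (ε * ε')}
    (h : IsTensor L Y Z) : ∃ c : L.carrier × Z.carrier → Y.carrier, Y.Generates c ∧
      ∀ p q, Y.form (c p) (c q) = lineGram L Z p q := by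
  obtain ⟨e, -, h2⟩ := h
  let G := A.goldmanPow m
  let c : L.carrier → L.carrier ⊗[K] Y.carrier →ₗ[K] Y.carrier := fun v =>
    (TensorProduct.lid K Y.carrier).toLinearMap ∘ₗ LinearMap.rTensor Y.carrier (G.t ∘ₗ L.form v)
  have hc : ∀ v w y, c v (w ⊗ₜ y) = G.t (L.form v w) • y := fun v w y => rfl
  refine ⟨fun p => c p.1 (e.symm p.2), HermSpace.generates_of_surjective fun y => ?_, ?_⟩
  · obtain ⟨v, w, hvw⟩ := exists_t_form_eq_one hL
    refine ⟨(v, e (w ⊗ₜ y)), ?_⟩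
    change c v (e.symm (e (w ⊗ₜ y))) = y
    rw [e.symm_apply_apply, hc, hvw, one_smul]
  · rintro ⟨v, z⟩ ⟨v', z'⟩
    change Y.form (c v (e.symm z)) (c v' (e.symm z')) = ((ε : Kˣ) : K) • contract A m n _ (Z.form z z')
    obtain ⟨z, rfl⟩ := e.surjective z
    obtain ⟨z', rfl⟩ := e.surjective z'
    rw [e.symm_apply_apply, e.symm_apply_apply]
    induction z using TensorProduct.induction_on with
    | zero => simp only [map_zero, LinearMap.zero_apply, smul_zero]
    | add x y hx hy => simp only [map_add, LinearMap.add_apply, smul_add, hx, hy]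
    | tmul w y =>
      induction z' using TensorProduct.induction_on with
      | zero => simp only [map_zero, smul_zero]
      | add x y hx hy => simp only [map_add, smul_add, hx, hy]
      | tmul w' y' =>
        have h3 := form_mul_form hL v' v w w' 1
        rw [mul_one, mul_one] at h3
        rw [hc, hc, h2, contract_powMul, h3, map_smul, map_smulₛₗ, LinearMap.smul_apply,
          ← G.t_inv, L.form_symm, map_smul, map_smul]
        simp only [smul_smul, smul_eq_mul]
        congr 1
        ring

/-- Division by a space of reduced dimension one. -/
theorem exists_isTensor_of_rdim_eq_one (hL : rdim L = 1) (W : A.Herm (m + n) (ε * ε')) :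
    ∃ (Y : A.Herm n ε') (Z : A.Herm (m + n) (ε * ε')), IsTensor L Y Z ∧ HermSpace.Isometric Z W := by
  obtain ⟨p, l, hl⟩ := Module.Finite.exists_fin (R := K) (M := L.carrier)
  obtain ⟨q, w, hw⟩ := Module.Finite.exists_fin (R := K) (M := W.carrier)
  obtain ⟨Y, c, hc, hg⟩ := HermSpace.exists_of_gram (A.goldmanPow n) ε' (lineGram L W)
    (fun i j => by
      rw [lineGram, lineGram, (A.goldmanPow n).inv_smul, inv_contract, L.form_symm, W.form_symm]
      simp only [map_smul, LinearMap.smul_apply, smul_smul]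
      congr 1
      have h1 : ((ε : Kˣ) : K) * ι ((ε : Kˣ) : K) = 1 := ε.2
      rw [Subgroup.coe_mul, Units.val_mul]
      linear_combination (((ε : Kˣ) : K) * ((ε' : Kˣ) : K)) * h1)
    (fun k : Fin (p * q) => (l (finProdFinEquiv.symm k).1, w (finProdFinEquiv.symm k).2))
    (fun j => by
      obtain ⟨r, hr⟩ := (Submodule.mem_span_range_iff_exists_fun K).mp
        (show j.1 ∈ Submodule.span K (Set.range l) by rw [hl]; trivial)
      obtain ⟨r', hr'⟩ := (Submodule.mem_span_range_iff_exists_fun K).mp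
        (show j.2 ∈ Submodule.span K (Set.range w) by rw [hw]; trivial)
      refine ⟨fun k => algebraMap K _ (ι (r (finProdFinEquiv.symm k).1) *
        r' (finProdFinEquiv.symm k).2), fun i => ?_⟩
      rw [← finProdFinEquiv.sum_comp, Fintype.sum_prod_type]
      simp only [Equiv.symm_apply_apply, lineGram]
      conv_lhs => rw [← hr, ← hr']
      simp only [map_sum, map_smulₛₗ, LinearMap.sum_apply, LinearMap.smul_apply, Finset.smul_sum,
        RingHom.id_apply, ← Algebra.commutes, ← Algebra.smul_def, smul_smul]
      rw [Finset.sum_comm]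
      refine Finset.sum_congr rfl fun i _ => Finset.sum_congr rfl fun j _ => ?_
      congr 1
      ring)
  obtain ⟨Z, hZ⟩ := exists_isTensor L Y
  obtain ⟨d, hd, hdg⟩ := hZ.generates L.generates_id hc
  refine ⟨Y, Z, hZ, HermSpace.isometric_of_gram (A.goldmanPow (m + n)).inv_zero hd
    (b := fun i => MulOpposite.op (A.powMul (L.form i.2.1 i.1) (1 : A.pow n)) • i.2.2) ?_ ?_⟩
  · refine W.generates_id.of_forall fun y => ?_
    obtain ⟨v, x, hvx⟩ := exists_t_form_eq_one hL
    have h1 := (A.goldmanPow m).sandwich (Pt.injective ι) (L.form v x)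
    rw [hvx, map_one] at h1
    have h2 : ∀ k, (A.goldmanPow m).a k * L.form v x * (A.goldmanPow m).b k =
        L.form (MulOpposite.op (A.invPow m ((A.goldmanPow m).a k)) • v)
          (MulOpposite.op ((A.goldmanPow m).b k) • x) := fun k => by
      rw [L.form_right, L.form_left, (A.goldmanPow m).inv_inv]
    have h3 : y = ∑ k, MulOpposite.op (A.powMul
        (L.form (MulOpposite.op (A.invPow m ((A.goldmanPow m).a k)) • v)
          (MulOpposite.op ((A.goldmanPow m).b k) • x)) (1 : A.pow n)) • y := by
      rw [← Finset.sum_smul, ← Finset.op_sum]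
      conv_lhs => rw [← one_smul (A.pow (m + n))ᵐᵒᵖ y]
      congr 1
      rw [← MulOpposite.op_one]
      congr 1
      rw [← powMul_one_one, ← h1]
      simp only [powMul, TensorProduct.sum_tmul, map_sum, h2]
    rw [id, h3]
    exact Submodule.sum_mem _ fun k _ => Submodule.subset_span ⟨(_, (_, y)), rfl⟩
  · rintro ⟨x, v, y⟩ ⟨x', v', y'⟩
    rw [hdg, hg, W.form_right, W.form_left, invPow_powMul, (A.goldmanPow n).inv_one, L.form_symm]
    change _ = A.powMul (L.form x x') (((ε : Kˣ) : K) • contract A m n (L.form v' v) (W.form y y'))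
    generalize W.form y y' = z
    induction z using powMul_induction with
    | zero => simp [powMul]
    | mul a b =>
      rw [contract_powMul, ← powMul_mul, ← powMul_mul, one_mul, mul_one, smul_mul_assoc,
        smul_mul_assoc, form_mul_form hL, smul_smul, smul_smul]
      have h1 := A.powMul_smul (((ε : Kˣ) : K) * (A.goldmanPow m).t (L.form v' v * a)) 1
        (L.form x x') b
      have h2 := A.powMul_smul 1 (((ε : Kˣ) : K) * (A.goldmanPow m).t (L.form v' v * a))
        (L.form x x') b
      rw [one_smul, mul_one] at h1
      rw [one_smul, one_mul] at h2
      rw [h1, h2]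
    | add y z hy hz =>
      rw [mul_add, add_mul, hy, hz, map_add, smul_add, powMul, powMul, powMul, ← map_add,
        TensorProduct.tmul_add]

end AzumayaInv

/-! ### The structured semiring of an algebra with involution -/

namespace AzumayaInv

variable {K : Type u} [CommRing K] {ι : K →+* K} (A : AzumayaInv ι) [Nontrivial K] [IsReduced K]
  [IsArtinianRing K] [InvBase ι] {m n : ℕ} {ε ε' : signGroup ι}

/-- The homogeneous components. -/
def grade (g : GammaN ι) : AddSubmonoid A.SWSum := AddMonoidHom.mrange (DirectSum.of A.SWFam g)

variable {A}

theorem elt_mem_grade (X : A.Herm n ε) : elt X ∈ A.grade (n, Additive.ofMul ε) := ⟨cls X, rfl⟩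

theorem exists_eq_elt {g : GammaN ι} {x : A.SWSum} (h : x ∈ A.grade g) :
    ∃ X : A.Herm g.1 g.2.toMul, elt X = x := by
  obtain ⟨⟨X⟩, rfl⟩ := h
  exact ⟨X, rfl⟩

instance : SetLike.GradedMonoid A.grade where
  one_mem := ⟨GradedMonoid.GOne.one, rfl⟩
  mul_mem g h x y := by
    rintro ⟨a, rfl⟩ ⟨b, rfl⟩
    exact ⟨_, (DirectSum.of_mul_of a b).symm⟩

theorem isInternal_grade : DirectSum.IsInternal A.grade := by
  let φ : A.SWSum →+ ⨁ g, A.grade g := DirectSum.toAddMonoid fun g =>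
    (DirectSum.of (fun g => A.grade g) g).comp (DirectSum.of A.SWFam g).mrangeRestrict
  have h1 : φ.comp (DirectSum.coeAddMonoidHom A.grade) = AddMonoidHom.id _ := by
    refine DirectSum.addHom_ext fun g x => ?_
    obtain ⟨x, a, rfl⟩ := x
    rw [AddMonoidHom.comp_apply, DirectSum.coeAddMonoidHom_of]
    exact DirectSum.toAddMonoid_of _ _ _
  have h2 : (DirectSum.coeAddMonoidHom A.grade).comp φ = AddMonoidHom.id _ := by
    refine DirectSum.addHom_ext fun g a => ?_
    have h3 : φ (DirectSum.of A.SWFam g a) = DirectSum.of (fun g => A.grade g) g ⟨_, a, rfl⟩ :=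
      DirectSum.toAddMonoid_of _ _ _
    rw [AddMonoidHom.comp_apply, h3, DirectSum.coeAddMonoidHom_of]
    rfl
  exact Function.bijective_iff_has_inverse.mpr
    ⟨φ, DFunLike.congr_fun h1, DFunLike.congr_fun h2⟩

theorem elt_eq_iff {X Y : A.Herm n ε} : elt X = elt Y ↔ HermSpace.Isometric X Y :=
  ⟨fun h => Quotient.exact (DirectSum.of_injective (β := A.SWFam) _ h),
    fun h => congrArg (DirectSum.of A.SWFam (n, Additive.ofMul ε)) (Quotient.sound h)⟩

theorem elt_eq_zero_of_rdim {X : A.Herm n ε} (h : rdim X = 0) : elt X = 0 :=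
  (congrArg _ (cls_eq_zero h)).trans (map_zero _)

theorem rdim_eq_zero_of_elt {X : A.Herm n ε} (h : elt X = 0) : rdim X = 0 := by
  have h1 := aug_elt X
  rw [h, map_zero] at h1
  exact_mod_cast (AddMonoidAlgebra.single_eq_zero.mp h1.symm)

theorem add_left_cancel_sw {g : GammaN ι} {a b c : A.SWFam g} (h : a + b = a + c) : b = c := by
  rw [add_comm a, add_comm a] at h
  rcases a with ⟨X⟩
  rcases b with ⟨Y⟩
  rcases c with ⟨Z⟩
  exact Quotient.sound (HermSpace.cancel (A.goldmanPow g.1) X (Quotient.exact h))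

variable (A) in
/-- The graded pre-`λ`-semiring of hermitian spaces, augmented by the reduced dimension. -/
def augmentedSemiring : AugmentedPreLambdaSemiring.{u, u + 1} (GammaN ι) where
  carrier := A.SWSum
  grade := A.grade
  isInternal := isInternal_grade
  lam := lam
  lam_mem d g x := by
    rintro ⟨a, rfl⟩
    rw [lam_of]
    exact ⟨swAlt d a, rfl⟩
  lam_zero := lam_zero_left
  lam_one := lam_one_left
  lam_add := lam_add
  aug := aug
  aug_grade g x hx := by
    obtain ⟨X, rfl⟩ := exists_eq_elt hx
    exact ⟨_, aug_elt X⟩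
  aug_lam := aug_lam

/-- If the second alternating power of a nonzero space vanishes, then `r (r - 1) / 2 = 0` for its
reduced dimension `r`. -/
theorem rdim_eq_one_of_lamDim {X : A.Herm n ε} (h : A.augmentedSemiring.lamDim (elt X) = 1) :
    rdim X = 1 := by
  have h2 : lam 2 (elt X) = 0 := by
    by_contra hne
    have : ((2 : ℕ) : ℕ∞) ≤ A.augmentedSemiring.lamDim (elt X) :=
      le_iSup₂ (f := fun (n : ℕ) (_ : n ∈ {n : ℕ | A.augmentedSemiring.lam n (elt X) ≠ 0}) => (n : ℕ∞))
        2 hne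
    rw [h] at this
    exact absurd this (by decide)
  obtain ⟨Y, hY⟩ := exists_isAlt 2 X
  rw [lam_elt hY] at h2
  have h3 := rdim_alt hY
  rw [rdim_eq_zero_of_elt h2, eq_comm, Nat.choose_eq_zero_iff] at h3
  have h4 : rdim X ≠ 0 := fun h0 => by
    have h5 : A.augmentedSemiring.lamDim (elt X) ≤ 0 := by
      refine iSup₂_le fun d hd => ?_
      rcases Nat.eq_zero_or_pos d with rfl | hpos
      · exact le_rfl
      · refine absurd ?_ hd
        obtain ⟨Z, hZ⟩ := exists_isAlt d X
        refine (lam_elt hZ).trans (elt_eq_zero_of_rdim ?_)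
        rw [rdim_alt hZ, h0, Nat.choose_eq_zero_of_lt hpos]
    rw [h] at h5
    exact absurd h5 (by decide)
  omega

/-- Multiplication by a space of reduced dimension one is bijective, as the other tensor factor is
recovered by contraction. -/
theorem isGradedInvertibleIn_of_rdim {L : A.Herm m ε} (hL : rdim L = 1) :
    A.augmentedSemiring.IsGradedInvertibleIn ⊤ (elt L) := by
  refine ⟨trivial, (m, Additive.ofMul ε), elt_mem_grade L, fun g => ⟨?_, ?_, ?_⟩⟩
  · rintro y ⟨-, hy⟩
    refine ⟨trivial, ?_⟩
    rw [add_comm g]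
    exact SetLike.mul_mem_graded (elt_mem_grade L) hy
  · rintro y ⟨-, hy⟩ y' ⟨-, hy'⟩ h
    obtain ⟨Y, rfl⟩ := exists_eq_elt hy
    obtain ⟨Y', rfl⟩ := exists_eq_elt hy'
    obtain ⟨Z, hZ⟩ := exists_isTensor L Y
    obtain ⟨Z', hZ'⟩ := exists_isTensor L Y'
    have h1 : elt Z = elt Z' := (elt_mul hZ).symm.trans (Eq.trans h (elt_mul hZ'))
    obtain ⟨e, -, he⟩ := elt_eq_iff.mp h1
    obtain ⟨c, hc, hg⟩ := hZ.exists_lineGram hL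
    obtain ⟨c', hc', hg'⟩ := hZ'.exists_lineGram hL
    refine elt_eq_iff.mpr (HermSpace.isometric_of_gram (A.goldmanPow g.1).inv_zero hc
      (b := fun p => c' (p.1, e p.2)) (hc'.of_forall fun p => Submodule.subset_span
        ⟨(p.1, e.symm p.2), by simp⟩) fun p q => ?_)
    rw [hg, hg', lineGram, lineGram, he]
  · rintro w ⟨-, hw⟩
    rw [add_comm g] at hw
    obtain ⟨W, rfl⟩ := exists_eq_elt hw
    obtain ⟨Y, Z, hZ, hW⟩ := exists_isTensor_of_rdim_eq_one (ε' := g.2.toMul) (n := g.1) hL W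
    exact ⟨elt Y, ⟨trivial, elt_mem_grade Y⟩, (elt_mul hZ).trans (elt_eq_iff.mpr hW)⟩

theorem isRigid_augmentedSemiring : A.augmentedSemiring.IsRigid ⊤ where
  cancel x _ y _ z _ h := by
    change A.SWSum at x
    refine DFunLike.ext (F := A.SWSum) _ _ fun g => add_left_cancel_sw (a := x g) ?_
    exact congrArg (fun w : A.SWSum => w g) h
  eq_zero x _ hx h := by
    obtain ⟨g, hx⟩ := hx
    obtain ⟨X, rfl⟩ := exists_eq_elt hx
    refine elt_eq_zero_of_rdim ?_
    have h1 : A.augmentedSemiring.totalAug (elt X) = (rdim X : ℤ) := by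
      refine (congrArg (fun f : AddMonoidAlgebra ℤ (GammaN ι) => f.coeff.sum fun _ n => n)
        (aug_elt X)).trans ?_
      exact Finsupp.sum_single_index rfl
    exact_mod_cast h1.symm.trans h
  line x _ hx h := by
    obtain ⟨g, hx⟩ := hx
    obtain ⟨X, rfl⟩ := exists_eq_elt hx
    exact isGradedInvertibleIn_of_rdim (rdim_eq_one_of_lamDim h)

variable (A) in
/-- The structured semiring of hermitian spaces, which is its own positive structure. -/
def structuredSemiring : StructuredSemiring.{u, u + 1} (GammaN ι) where
  toAugmentedPreLambdaSemiring := A.augmentedSemiring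
  pos := ⊤
  pos_sub :=
    { homogeneous := fun x _ => by
        change A.SWSum at x
        induction x using SWSum.induction with
        | zero => exact zero_mem _
        | elt n ε X => exact AddSubmonoid.subset_closure ⟨trivial, _, elt_mem_grade X⟩
        | add x y hx hy => exact add_mem (hx trivial) (hy trivial)
      lam_mem := fun _ _ _ => trivial }
  pos_rigid := isRigid_augmentedSemiring
  pos_inv _ h := h
  pos_gen x hx := ⟨0, trivial, x, trivial, ⟨0, zero_mem _⟩, hx, add_zero x⟩

variable (A) in
/-- The homogeneous components are the monoids of isometry classes. -/
def gradeEquiv (n : ℕ) (ε : signGroup ι) :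
    A.SW n ε ≃+ A.structuredSemiring.grade (n, Additive.ofMul ε) :=
  AddEquiv.ofBijective (DirectSum.of A.SWFam (n, Additive.ofMul ε)).mrangeRestrict
    ⟨fun _ _ h => DirectSum.of_injective (β := A.SWFam) _ (congrArg Subtype.val h),
      AddMonoidHom.mrangeRestrict_surjective _⟩

end AzumayaInv

/-! ### Composition with a hermitian Morita equivalence -/

/-- A linear combination of products of entries vanishes if it vanishes on a spanning set. -/
theorem eq_zero_of_forall_sum_mul_prod {E I J S : Type*} [CommRing E] [Fintype J] [DecidableEq J]
    [DecidableEq I] [Nonempty I] {v : S → Matrix J I E}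
    (hv : Submodule.span E (Set.range v) = ⊤) {n : ℕ} {Z : (Fin n → J) → E}
    (h : ∀ (x : Fin n → S) (f : Fin n → I), ∑ Q, Z Q * ∏ k, v (x k) (Q k) (f k) = 0)
    (Q : Fin n → J) : Z Q = 0 := by
  obtain ⟨i⟩ := ‹Nonempty I›
  -- the combination is multilinear in the matrices, and is evaluated on matrix units
  let D : MultilinearMap E (fun _ : Fin n => Matrix J I E) E :=
    ∑ Q, Z Q • (MultilinearMap.mkPiAlgebra E (Fin n) E).compLinearMap fun k =>
      Matrix.entryLinearMap E E (Q k) i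
  have hD : ∀ M, D M = ∑ Q, Z Q * ∏ k, M k (Q k) i := fun M => by
    rw [_root_.sum_apply]
    rfl
  have h1 := PiTensorProduct.submodule_span_eq_top (R := E) fun _ : Fin n => hv
  have h2 : PiTensorProduct.lift D = 0 := by
    refine LinearMap.ext_on h1 ?_
    rintro _ ⟨x, rfl⟩
    rw [PiTensorProduct.lift.tprod, hD]
    exact h x fun _ => i
  have h3 := LinearMap.congr_fun h2 (PiTensorProduct.tprod E fun k => Matrix.single (Q k) i 1)
  rw [PiTensorProduct.lift.tprod, hD, Finset.sum_eq_single Q] at h3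
  · simpa using h3
  · intro P _ hP
    obtain ⟨k, hk⟩ := Function.ne_iff.mp hP
    rw [Finset.prod_eq_zero (Finset.mem_univ k), mul_zero]
    exact Matrix.single_apply_of_ne _ _ _ _ _ fun h => hk h.1.symm
  · exact fun h => absurd (Finset.mem_univ _) h

/-- Expansion of a determinant whose entries are double sums. -/
theorem Matrix.det_sum_rows_cols {E J : Type*} [CommRing E] [Fintype J] [DecidableEq J] {d : ℕ}
    (a b : Fin d → J → E) (M : Fin d → Fin d → J → J → E) :
    (Matrix.of fun i j => ∑ p, ∑ q, a i p * M i j p q * b j q).det =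
      ∑ P : Fin d → J, ∑ Q : Fin d → J, (∏ i, a i (P i)) *
        (Matrix.of fun i j => M i j (P i) (Q j)).det * ∏ j, b j (Q j) := by
  have h1 := Matrix.det_sum_rows a fun i p j => ∑ q, M i j p q * b j q
  simp only [Finset.mul_sum, ← mul_assoc] at h1
  rw [h1]
  refine Finset.sum_congr rfl fun P _ => ?_
  have h2 := Matrix.det_sum_rows b fun j q i => M i j (P i) q
  rw [← Matrix.det_transpose]
  rw [show (Matrix.of fun i j => ∑ q, M i j (P i) q * b j q).transpose =
    Matrix.of fun j i => ∑ q, b j q * M i j (P i) q by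
      ext j i
      exact Finset.sum_congr rfl fun q _ => mul_comm _ _, h2, Finset.mul_sum]
  refine Finset.sum_congr rfl fun Q _ => ?_
  rw [← Matrix.det_transpose, mul_assoc, mul_comm (∏ j, b j (Q j))]
  rfl

namespace HermMorita

open AzumayaInv

variable {K : Type u} [CommRing K] {ι : K →+* K} {A B : AzumayaInv ι} [Nontrivial K] [IsReduced K]
  [IsArtinianRing K] [InvBase ι] {U : HermMorita B A} {m n : ℕ} {ε ε' : signGroup ι}

variable (U) in
theorem nonempty_coord : Nonempty (U.space.Coord A.goldman) := U.space.nonempty_coord A.goldman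

theorem IsPush.isometric {X X' : B.Herm n ε} {Y Y' : A.Herm n (U.sign ^ n * ε)}
    (hX : HermSpace.Isometric X X') (h : IsPush U X Y) (h' : IsPush U X' Y') :
    HermSpace.Isometric Y Y' := by
  obtain ⟨C⟩ := U.nonempty_coord
  exact ((presents_id (U.goldman C) X).push h).isometric
    (((presents_id (U.goldman C) X).of_isometric hX).push h')

theorem IsPush.zero {Y : A.Herm n (U.sign ^ n * ε)}
    (h : IsPush U (HermSpace.zero ι (B.pow n) (B.invPow n) (B.invPow_zero n) ε) Y) :
    HermSpace.Isometric Y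
      (HermSpace.zero ι (A.pow n) (A.invPow n) (A.invPow_zero n) (U.sign ^ n * ε)) := by
  obtain ⟨C⟩ := U.nonempty_coord
  exact (((presents_zero (U.goldman C) PUnit.{1}).push h).congr fun _ _ _ _ => by simp).isometric
    (presents_zero _ _)

theorem IsPush.sum {X X' : B.Herm n ε} {Y Y' W : A.Herm n (U.sign ^ n * ε)}
    (h : IsPush U X Y) (h' : IsPush U X' Y')
    (hW : IsPush U (HermSpace.sum (B.invPow_add n) X X') W) :
    HermSpace.Isometric W (HermSpace.sum (A.invPow_add n) Y Y') := by
  obtain ⟨C⟩ := U.nonempty_coord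
  have hX := presents_id (U.goldman C) X
  have hX' := presents_id (U.goldman C) X'
  refine ((hX.sum hX').push hW).isometric ((((hX.push h).sum (hX'.push h')).comp_surjective
    (Equiv.sumProdDistrib _ _ _).surjective).congr ?_)
  rintro ⟨x | x, w⟩ ⟨y | y, w'⟩ f k
  · rfl
  · exact Finset.sum_eq_zero fun _ _ => Finset.sum_eq_zero fun _ _ => by
      change _ * (0 : Pt ι) * _ = 0
      rw [mul_zero, zero_mul]
  · exact Finset.sum_eq_zero fun _ _ => Finset.sum_eq_zero fun _ _ => by
      change _ * (0 : Pt ι) * _ = 0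
      rw [mul_zero, zero_mul]
  · rfl

theorem IsPush.unit {Y : A.Herm 0 (U.sign ^ 0 * 1)} (h : IsPush U B.unit Y) :
    gcls Y = gcls A.unit := by
  obtain ⟨C⟩ := U.nonempty_coord
  refine ((presents_unit (U.goldman C)).push h).gcls_eq ((presents_unit _).comp_surjective
    (σ := fun _ => PUnit.unit) fun _ => ⟨(PUnit.unit, finZeroElim), rfl⟩) rfl
    (by rw [pow_zero, one_mul]) fun i j f k => ?_
  simp

theorem IsPush.tensor {X : B.Herm m ε} {X' : B.Herm n ε'} {Z : B.Herm (m + n) (ε * ε')}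
    {Y : A.Herm m (U.sign ^ m * ε)} {Y' : A.Herm n (U.sign ^ n * ε')}
    {V : A.Herm (m + n) (U.sign ^ (m + n) * (ε * ε'))}
    {W : A.Herm (m + n) (U.sign ^ m * ε * (U.sign ^ n * ε'))} (hZ : IsTensor X X' Z)
    (h : IsPush U X Y) (h' : IsPush U X' Y') (hV : IsPush U Z V) (hW : IsTensor Y Y' W) :
    gcls V = gcls W := by
  obtain ⟨C⟩ := U.nonempty_coord
  have hX := presents_id (U.goldman C) X
  have hX' := presents_id (U.goldman C) X'
  refine (((hX.tensor hX' hZ).push hV).comp_surjective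
    (σ := fun p : (X.carrier × (Fin m → U.space.carrier)) × (X'.carrier × (Fin n → U.space.carrier)) =>
      ((p.1.1, p.2.1), Fin.append p.1.2 p.2.2)) ?_).gcls_eq ((hX.push h).tensor (hX'.push h') hW)
    rfl (by rw [pow_add]; exact mul_mul_mul_comm _ _ _ _) fun i j f k => ?_
  · rintro ⟨⟨x, y⟩, w⟩
    exact ⟨((x, w ∘ Fin.castAdd n), (y, w ∘ Fin.natAdd m)), by
      simp only [Function.comp_def, Fin.append_castAdd_natAdd]⟩
  · simp only [Fin.prod_univ_add, Fin.append_left, Fin.append_right]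
    let S : (Fin m → C.J) → (Fin m → C.J) → Pt ι := fun P Q =>
      (∏ l, C.η (i.1.2 l) (f (Fin.castAdd n l)) (P l)) *
        psiPow (U.goldman C).ψ (Fin m) (X.form i.1.1 j.1.1) P Q *
        ∏ l, C.χ (j.1.2 l) (Q l) (k (Fin.castAdd n l))
    let S' : (Fin n → C.J) → (Fin n → C.J) → Pt ι := fun P Q =>
      (∏ l, C.η (i.2.2 l) (f (Fin.natAdd m l)) (P l)) *
        psiPow (U.goldman C).ψ (Fin n) (X'.form i.2.1 j.2.1) P Q *
        ∏ l, C.χ (j.2.2 l) (Q l) (k (Fin.natAdd m l))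
    refine Eq.trans ?_ (Fin.sum_castAdd_mul_natAdd (fun P => ∑ Q, S P Q) fun P => ∑ Q, S' P Q)
    refine Finset.sum_congr rfl fun P _ => ?_
    refine Eq.trans ?_ (Fin.sum_castAdd_mul_natAdd _ _)
    refine Finset.sum_congr rfl fun Q _ => ?_
    simp only [S, S', Function.comp_apply]
    ring

theorem IsPush.alt {d : ℕ} {X : B.Herm n ε} {Z : B.Herm (d * n) (ε ^ d)}
    {Y : A.Herm n (U.sign ^ n * ε)} {V : A.Herm (d * n) (U.sign ^ (d * n) * ε ^ d)}
    {W : A.Herm (d * n) ((U.sign ^ n * ε) ^ d)} (hZ : IsAlt d X Z) (h : IsPush U X Y)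
    (hV : IsPush U Z V) (hW : IsAlt d Y W) : gcls V = gcls W := by
  obtain ⟨C⟩ := U.nonempty_coord
  have hX := presents_id (U.goldman C) X
  refine (((hX.alt hZ).push hV).comp_surjective
    (σ := fun p : Fin d → X.carrier × (Fin n → U.space.carrier) =>
      ((fun i => (p i).1), fun k => (p (finProdFinEquiv.symm k).1).2 (finProdFinEquiv.symm k).2))
    ?_).gcls_eq ((hX.push h).alt hW)
    rfl (by rw [mul_pow, ← pow_mul, mul_comm n d]) fun i j f k => ?_
  · rintro ⟨x, w⟩
    refine ⟨fun i => (x i, fun k => w (finProdFinEquiv (i, k))), Prod.ext rfl ?_⟩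
    funext k
    exact congrArg w (finProdFinEquiv.apply_symm_apply k)
  · let e : (Fin (d * n) → C.J) ≃ (Fin d → Fin n → C.J) :=
      (finProdFinEquiv.arrowCongr (Equiv.refl _)).symm.trans (Equiv.curry _ _ _)
    refine Eq.trans ?_ (Matrix.det_sum_rows_cols
      (fun t (p : Fin n → C.J) => ∏ l, C.η ((i t).2 l) (f (finProdFinEquiv (t, l))) (p l))
      (fun t (q : Fin n → C.J) => ∏ l, C.χ ((j t).2 l) (q l) (k (finProdFinEquiv (t, l))))
      fun t t' p q => psiPow (U.goldman C).ψ (Fin n) (X.form (i t).1 (j t').1) p q).symm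
    rw [← e.sum_comp]
    refine Finset.sum_congr rfl fun P _ => ?_
    rw [← e.sum_comp]
    refine Finset.sum_congr rfl fun Q _ => ?_
    rw [← finProdFinEquiv.prod_comp, ← finProdFinEquiv.prod_comp, Fintype.prod_prod_type,
      Fintype.prod_prod_type]
    simp only [Equiv.symm_apply_apply]
    rfl

/-- If `Y` vanishes, then all coordinates of the forms of `X` are annihilated by the products of
coordinates of the bimodule, which span. -/
theorem IsPush.rdim_eq_zero_iff {X : B.Herm n ε} {Y : A.Herm n (U.sign ^ n * ε)}
    (h : IsPush U X Y) : rdim Y = 0 ↔ rdim X = 0 := by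
  constructor
  · intro hY
    have hY0 : cls Y = 0 := cls_eq_zero hY
    obtain ⟨C⟩ := U.nonempty_coord
    obtain ⟨c, hc, hg⟩ := ((presents_id (U.goldman C) X).push h).of_isometric (Quotient.exact hY0)
    have h0 : ∀ x y : X.carrier, X.form x y = 0 := fun x y => by
      apply (U.goldman C).psiPow_injective (Pt.injective ι) n
      rw [map_zero]
      ext P Q
      refine eq_zero_of_forall_sum_mul_prod (v := C.χ) C.span_χ
        (Z := fun Q => psiPow (U.goldman C).ψ (Fin n) (X.form x y) P Q) (fun u' k => ?_) Q
      refine eq_zero_of_forall_sum_mul_prod (v := fun u => (C.η u).transpose)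
        (Matrix.span_transpose C.span_η) (Z := fun P => ∑ Q,
          psiPow (U.goldman C).ψ (Fin n) (X.form x y) P Q * ∏ l, C.χ (u' l) (Q l) (k l))
        (fun u f => ?_) P
      have h1 := hg (x, u) (y, u') f k
      refine Eq.trans ?_ (h1.symm.trans ?_)
      · refine Finset.sum_congr rfl fun P _ => ?_
        rw [Finset.sum_mul]
        refine Finset.sum_congr rfl fun Q _ => ?_
        simp only [Matrix.transpose_apply]
        ring
      · exact map_zero (psiPow A.goldman.ψ (Fin n)) ▸ rfl
    have h1 : HermSpace.Isometric X
        (HermSpace.zero ι (B.pow n) (B.invPow n) (B.invPow_zero n) ε) :=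
      HermSpace.isometric_of_gram (B.invPow_zero n) X.generates_id (b := fun _ => PUnit.unit)
        (HermSpace.generates_of_surjective fun _ => ⟨0, rfl⟩) fun x y => (h0 x y).symm
    rw [rdim_eq_of_isometric h1, rdim_zero]
  · intro hX
    have h1 : HermSpace.Isometric X
        (HermSpace.zero ι (B.pow n) (B.invPow n) (B.invPow_zero n) ε) :=
      Quotient.exact (cls_eq_zero hX)
    obtain ⟨Y', hY'⟩ := exists_isPush U
      (HermSpace.zero ι (B.pow n) (B.invPow n) (B.invPow_zero n) ε)
    rw [rdim_eq_of_isometric ((IsPush.isometric h1 h hY').trans hY'.zero), rdim_zero]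

/-- The reduced dimension is preserved, since it is determined by the vanishing of alternating
powers. -/
theorem IsPush.rdim_eq {X : B.Herm n ε} {Y : A.Herm n (U.sign ^ n * ε)}
    (h : IsPush U X Y) : rdim Y = rdim X := by
  have key : ∀ d, rdim Y < d ↔ rdim X < d := fun d => by
    obtain ⟨Z, hZ⟩ := exists_isAlt d X
    obtain ⟨W, hW⟩ := exists_isAlt d Y
    obtain ⟨V, hV⟩ := exists_isPush U Z
    have h1 : rdim V = 0 ↔ rdim W = 0 := by
      have h2 := elt_eq (IsPush.alt hZ h hV hW)
      exact ⟨fun h0 => rdim_eq_zero_of_elt (h2.symm.trans (elt_eq_zero_of_rdim h0)),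
        fun h0 => rdim_eq_zero_of_elt (h2.trans (elt_eq_zero_of_rdim h0))⟩
    rw [hV.rdim_eq_zero_iff, rdim_alt hZ, rdim_alt hW, Nat.choose_eq_zero_iff,
      Nat.choose_eq_zero_iff] at h1
    exact h1.symm
  exact le_antisymm (Nat.lt_succ_iff.mp ((key _).mpr (Nat.lt_succ_self _)))
    (Nat.lt_succ_iff.mp ((key _).mp (Nat.lt_succ_self _)))

variable (U) in
/-- The composition of isometry classes with a hermitian Morita equivalence. -/
def swPush (n : ℕ) (ε : signGroup ι) : B.SW n ε →+ A.SW n (U.sign ^ n * ε) where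
  toFun := Quotient.map (fun X => (exists_isPush U X).choose) fun X X' h =>
    IsPush.isometric h (exists_isPush U X).choose_spec (exists_isPush U X').choose_spec
  map_zero' := Quotient.sound (exists_isPush U _).choose_spec.zero
  map_add' := by
    rintro ⟨X⟩ ⟨Y⟩
    exact Quotient.sound ((exists_isPush U X).choose_spec.sum (exists_isPush U Y).choose_spec
      (exists_isPush U _).choose_spec)

variable (U) in
/-- The map of degrees `(n, ε') ↦ (n, ε ^ n ε')`, where `ε` is the sign. -/
def degHom : GammaN ι →+ GammaN ι where
  toFun g := (g.1, g.1 • Additive.ofMul U.sign + g.2)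
  map_zero' := Prod.ext rfl (by simp)
  map_add' g h := Prod.ext rfl (by
    change (g.1 + h.1) • Additive.ofMul U.sign + (g.2 + h.2) = _
    rw [add_smul]
    exact add_add_add_comm _ _ _ _)

variable (U) in
/-- The ring homomorphism given by composition with a hermitian Morita equivalence. -/
def pushHom : B.SWSum →+* A.SWSum :=
  DirectSum.toSemiring
    (fun g => (DirectSum.of A.SWFam (U.degHom g)).comp (U.swPush g.1 g.2.toMul))
    (elt_eq (exists_isPush U B.unit).choose_spec.unit)
    (by
      rintro g g' ⟨X⟩ ⟨Y⟩
      have h := exists_isPush U X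
      have h' := exists_isPush U Y
      have hZ := exists_isTensor X Y
      have hW := exists_isTensor h.choose h'.choose
      exact (elt_eq (IsPush.tensor hZ.choose_spec h.choose_spec h'.choose_spec
        (exists_isPush U _).choose_spec hW.choose_spec)).trans (elt_mul hW.choose_spec).symm)

theorem pushHom_of (g : GammaN ι) (a : B.SWFam g) : U.pushHom (DirectSum.of B.SWFam g a) =
    DirectSum.of A.SWFam (U.degHom g) (U.swPush g.1 g.2.toMul a) :=
  DirectSum.toSemiring_of _ _ _ _ _

theorem pushHom_elt {X : B.Herm n ε} {Y : A.Herm n (U.sign ^ n * ε)} (h : IsPush U X Y) :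
    U.pushHom (elt X) = elt Y :=
  (pushHom_of (n, Additive.ofMul ε) (cls X)).trans
    (congrArg (DirectSum.of A.SWFam (n, Additive.ofMul (U.sign ^ n * ε)))
      (Quotient.sound (IsPush.isometric (.refl X) (exists_isPush U X).choose_spec h)))

theorem pushHom_lam (d : ℕ) (x : B.SWSum) : U.pushHom (lam d x) = lam d (U.pushHom x) := by
  suffices h : PowerSeries.map U.pushHom (lamSeries x).toMul = (lamSeries (U.pushHom x)).toMul by
    rw [lam, lam, ← h, PowerSeries.coeff_map]
  induction x using SWSum.induction with
  | zero => rw [lamSeries_zero, map_one, map_zero U.pushHom, lamSeries_zero]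
  | elt n ε X =>
    ext1 d
    obtain ⟨Y, hY⟩ := exists_isPush U X
    obtain ⟨Z, hZ⟩ := exists_isAlt d X
    obtain ⟨W, hW⟩ := exists_isAlt d Y
    obtain ⟨V, hV⟩ := exists_isPush U Z
    rw [PowerSeries.coeff_map, pushHom_elt hY]
    refine (congrArg U.pushHom (lam_elt hZ)).trans ?_
    rw [pushHom_elt hV, elt_eq (IsPush.alt hZ hY hV hW)]
    exact (lam_elt hW).symm
  | add x y hx hy => rw [lamSeries_add, map_mul, map_add, lamSeries_add, hx, hy]

theorem aug_pushHom (x : B.SWSum) : aug (U.pushHom x) = (aug x).mapDomain U.degHom := by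
  induction x using SWSum.induction with
  | zero => rw [map_zero, map_zero, map_zero, AddMonoidAlgebra.mapDomain_zero]
  | elt n ε X =>
    obtain ⟨Y, hY⟩ := exists_isPush U X
    rw [pushHom_elt hY, aug_elt, aug_elt, hY.rdim_eq, AddMonoidAlgebra.mapDomain_single]
    rfl
  | add x y hx hy => rw [map_add, map_add, map_add, hx, hy, AddMonoidAlgebra.mapDomain_add]

variable (U) in
/-- The lax morphism given by composition with a hermitian Morita equivalence. -/
def laxHom : StructuredSemiring.LaxHom B.structuredSemiring A.structuredSemiring where
  deg := U.degHom
  hom := U.pushHom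
  map_grade g x hx := by
    obtain ⟨X, rfl⟩ := exists_eq_elt hx
    obtain ⟨Y, hY⟩ := exists_isPush U X
    change U.pushHom (elt X) ∈ A.grade _
    rw [pushHom_elt hY]
    exact elt_mem_grade Y
  map_lam := pushHom_lam
  map_aug := aug_pushHom
  map_pos _ _ := trivial

end HermMorita

/-! ### Functoriality -/

namespace HermMorita

open AzumayaInv

variable {K : Type u} [CommRing K] {ι : K →+* K} {A B C : AzumayaInv ι} [Nontrivial K]
  [IsReduced K] [IsArtinianRing K] [InvBase ι] {n : ℕ} {ε ε' : signGroup ι}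

theorem _root_.AzumayaInv.gcls_eq_of_gram {X : A.Herm n ε} {Y : A.Herm n ε'} (hε : ε' = ε)
    {T : Type*} {a : T → X.carrier} {b : T → Y.carrier} (ha : X.Generates a) (hb : Y.Generates b)
    (h : ∀ i j, Y.form (b i) (b j) = X.form (a i) (a j)) : gcls X = gcls Y := by
  subst hε
  exact gcls_eq_of_isometric (HermSpace.isometric_of_gram (A.invPow_zero n) ha hb h)

/-- The sign is determined by the form. -/
theorem sign_eq (U : HermMorita B A) {c : signGroup ι}
    (h : ∀ x y, A.inv (U.space.form x y) = ((c : Kˣ) : K) • U.space.form y x) : U.sign = c := by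
  refine Subtype.ext (Units.ext (sub_eq_zero.mp ?_))
  apply FaithfulSMul.algebraMap_injective K B.carrier
  rw [map_zero]
  refine U.faithful _ fun v => U.space.eq_zero_of_form_right A.goldman.inv_zero
    U.space.generates_id fun x => ?_
  rw [algebraMap_smul, map_smul, sub_smul, ← h, ← U.space.form_symm, sub_self]

theorem Iso.sign_eq {U V : HermMorita B A} (h : Iso U V) : U.sign = V.sign := by
  obtain ⟨e, -, -, he⟩ := h
  refine U.sign_eq fun x y => ?_
  rw [← he, ← he, V.space.form_symm]

theorem Iso.gcls_eq {U V : HermMorita B A} (h : Iso U V) {X : B.Herm n ε}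
    {Y : A.Herm n (U.sign ^ n * ε)} {Y' : A.Herm n (V.sign ^ n * ε)} (hY : IsPush U X Y)
    (hY' : IsPush V X Y') : gcls Y = gcls Y' := by
  have hs := h.sign_eq
  obtain ⟨e, h1, -, h2⟩ := h
  obtain ⟨a, ha, hg⟩ := hY.generates X.generates_id
    (u := fun u : U.space.carrier => u) (by simp)
  obtain ⟨b, hb, hg'⟩ := hY'.generates X.generates_id
    (u := fun u : U.space.carrier => e u) (by
      rw [show (Set.range fun u => e u) = Set.univ from e.surjective.range_eq, Submodule.span_univ])
  refine gcls_eq_of_gram (by rw [hs]) ha hb fun i j => ?_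
  rw [hg, hg']
  generalize X.form (id i.1) (id j.1) = z
  induction z using PiTensorProduct.induction_on with
  | smul_tprod r z =>
    simp only [map_smul, LinearMap.smul_apply, powAct_tprod, HermSpace.formPow_tprod, ← h1, h2]
  | add x y hx hy => simp only [map_add, LinearMap.add_apply, hx, hy]

theorem laxHom_eq {U : HermMorita B A} {W : StructuredSemiring.LaxHom B.structuredSemiring
    A.structuredSemiring} (hs : W.deg = U.degHom)
    (h : ∀ (n : ℕ) (ε : signGroup ι) (X : B.Herm n ε) (Y : A.Herm n (U.sign ^ n * ε)),
      IsPush U X Y → W.hom (elt X) = elt Y) : W = U.laxHom := by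
  refine StructuredSemiring.LaxHom.ext hs (RingHom.ext fun x => ?_)
  let φ : B.SWSum →+* A.SWSum := W.hom
  refine DFunLike.congr_fun (f := φ.toAddMonoidHom) (g := U.pushHom.toAddMonoidHom)
    (SWSum.addHom_ext fun n ε X => ?_) x
  obtain ⟨Y, hY⟩ := exists_isPush U X
  exact (h n ε X Y hY).trans (pushHom_elt hY).symm

theorem Iso.laxHom_eq {U V : HermMorita B A} (h : Iso U V) : U.laxHom = V.laxHom := by
  refine HermMorita.laxHom_eq (U := V) ?_ fun n ε X Y hY => ?_
  · refine AddMonoidHom.ext fun g => ?_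
    change ((g.1, g.1 • Additive.ofMul U.sign + g.2) : GammaN ι) = (g.1, g.1 • Additive.ofMul V.sign + g.2)
    rw [h.sign_eq]
  · obtain ⟨Y', hY'⟩ := exists_isPush U X
    exact (pushHom_elt hY').trans (elt_eq (h.gcls_eq hY' hY))

/-- Composition with the identity: the vectors `x a`, for pure tensors `a`, generate `X`. -/
theorem laxHom_refl (A : AzumayaInv ι) :
    (refl A).laxHom = StructuredSemiring.LaxHom.id A.structuredSemiring := by
  refine (laxHom_eq (U := refl A) ?_ fun n ε X Y hY => ?_).symm
  · refine AddMonoidHom.ext fun g => Prod.ext rfl ?_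
    change g.2 = g.1 • Additive.ofMul (1 : signGroup ι) + g.2
    rw [ofMul_one, smul_zero, zero_add]
  · change elt X = elt Y
    obtain ⟨b, hb, hg⟩ := hY.generates X.generates_id (u := fun u : (refl A).space.carrier => u)
      (by rw [Set.range_eq_univ.mpr fun u => ⟨u, rfl⟩, Submodule.span_univ])
    have key (u w : Fin n → (refl A).space.carrier) (z : Fin n → A.carrier) :
        (refl A).space.formPow u (powAct _ _ n (PiTensorProduct.tprod K z)
          (PiTensorProduct.tprod K w)) =
        PiTensorProduct.tprod K fun k => (refl A).space.form (u k) (z k • w k) := by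
      rw [powAct_tprod, HermSpace.formPow_tprod]
    refine elt_eq (gcls_eq_of_gram (by change (1 : signGroup ι) ^ n * ε = ε; rw [one_pow, one_mul])
      (a := fun i : X.carrier × (Fin n → A.carrier) =>
        MulOpposite.op (PiTensorProduct.tprod K i.2 : A.pow n) • i.1)
      (HermSpace.generates_of_surjective fun x => ⟨(x, 1), ?_⟩) hb fun i j => ?_)
    · rw [show (PiTensorProduct.tprod K (1 : Fin n → A.carrier) : A.pow n) = 1 from rfl,
        MulOpposite.op_one, one_smul]
    · refine (hg i j).trans ?_
      rw [X.form_left, X.form_right, invPow_tprod]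
      change _ = _ * (X.form (id i.1) (id j.1) * _)
      generalize X.form (id i.1) (id j.1) = z
      induction z using PiTensorProduct.induction_on with
      | smul_tprod r z =>
        rw [map_smul, LinearMap.smul_apply, map_smul, smul_mul_assoc, mul_smul_comm,
          PiTensorProduct.tprod_mul_tprod, PiTensorProduct.tprod_mul_tprod]
        exact congrArg (r • ·) (key i.2 j.2 z)
      | add x y hx hy =>
        rw [map_add, LinearMap.add_apply, map_add, hx, hy, add_mul, mul_add]

theorem IsComp.sign_eq {U : HermMorita C B} {V : HermMorita B A} {W : HermMorita C A}
    (h : IsComp U V W) : W.sign = U.sign * V.sign := by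
  obtain ⟨m, hm, -, -, -, hf⟩ := h
  refine W.sign_eq fun x y => ?_
  obtain ⟨x, rfl⟩ := hm x
  obtain ⟨y, rfl⟩ := hm y
  induction x using TensorProduct.induction_on with
  | zero => simp [A.goldman.inv_zero]
  | add x x' hx hx' =>
    rw [map_add, map_add, map_add, LinearMap.add_apply, A.inv_add, hx, hx', smul_add]
  | tmul u v =>
    induction y using TensorProduct.induction_on with
    | zero => simp [A.goldman.inv_zero]
    | add x x' hx hx' =>
      rw [map_add, map_add, map_add, LinearMap.add_apply, A.inv_add, hx, hx', smul_add]
    | tmul u' v' =>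
      rw [hf, hf, V.space.form_symm, V.adjoint, U.space.form_symm, smul_assoc, map_smul, smul_smul,
        mul_comm]
      rfl

/-- Both ways to compose with `U` and `V` have the same Gram matrix on the family indexed by `X` and
pure tensors of `U` and `V`. -/
theorem IsComp.gcls_eq {U : HermMorita C B} {V : HermMorita B A} {W : HermMorita C A}
    (h : IsComp U V W) {X : C.Herm n ε} {Y : B.Herm n (U.sign ^ n * ε)}
    {Z : A.Herm n (V.sign ^ n * (U.sign ^ n * ε))} {Z' : A.Herm n (W.sign ^ n * ε)}
    (hY : IsPush U X Y) (hZ : IsPush V Y Z) (hZ' : IsPush W X Z') : gcls Z = gcls Z' := by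
  have hs := h.sign_eq
  obtain ⟨m, hm, -, hC, -, hf⟩ := h
  have hsU : Submodule.span K (Set.range fun u : U.space.carrier => u) = ⊤ := by simp
  have hsV : Submodule.span K (Set.range fun v : V.space.carrier => v) = ⊤ := by simp
  obtain ⟨a, ha, hg⟩ := hY.generates X.generates_id hsU
  obtain ⟨b, hb, hg'⟩ := hZ.generates ha hsV
  have hsW := congrArg (Submodule.map m) (TensorProduct.span_tmul_eq_top_of_span hsU hsV)
  rw [Submodule.map_span, Submodule.map_top, LinearMap.range_eq_top.mpr hm, ← Set.range_comp] at hsW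
  obtain ⟨c, hc, hg''⟩ := hZ'.generates X.generates_id hsW
  refine gcls_eq_of_gram (by rw [hs, mul_pow, mul_comm (U.sign ^ n), mul_assoc]) hb
    (b := fun p : (X.carrier × (Fin n → U.space.carrier)) × (Fin n → V.space.carrier) =>
      c (p.1.1, fun k => (p.1.2 k, p.2 k))) (hc.of_forall fun p => Submodule.subset_span
        ⟨((p.1, fun k => (p.2 k).1), fun k => (p.2 k).2), rfl⟩) fun i j => ?_
  rw [hg', hg, hg'']
  dsimp only
  generalize X.form (id i.1.1) (id j.1.1) = z
  induction z using PiTensorProduct.induction_on with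
  | smul_tprod r z =>
    simp only [map_smul, LinearMap.smul_apply, powAct_tprod, HermSpace.formPow_tprod,
      Function.comp_apply, ← hC, hf]
  | add x y hx hy => simp only [map_add, LinearMap.add_apply, hx, hy]

theorem IsComp.laxHom_eq {U : HermMorita C B} {V : HermMorita B A} {W : HermMorita C A}
    (h : IsComp U V W) : W.laxHom = V.laxHom.comp U.laxHom := by
  refine (HermMorita.laxHom_eq (U := W) ?_ fun n ε X Y hY => ?_).symm
  · refine AddMonoidHom.ext fun g => Prod.ext rfl ?_
    change g.1 • Additive.ofMul V.sign + (g.1 • Additive.ofMul U.sign + g.2) =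
      g.1 • Additive.ofMul W.sign + g.2
    rw [h.sign_eq, ofMul_mul, nsmul_add, ← add_assoc, add_comm (g.1 • Additive.ofMul V.sign)]
  · obtain ⟨Y₁, hY₁⟩ := exists_isPush U X
    obtain ⟨Y₂, hY₂⟩ := exists_isPush V Y₁
    change V.pushHom (U.pushHom (elt X)) = _
    rw [pushHom_elt hY₁, pushHom_elt hY₂]
    exact elt_eq (h.gcls_eq hY₁ hY₂ hY)

/-- The lax morphism of an isomorphism class of hermitian Morita equivalences. -/
def Hom.laxHom (f : Hom B A) :
    StructuredSemiring.LaxHom B.structuredSemiring A.structuredSemiring :=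
  Quotient.lift HermMorita.laxHom (fun _ _ h => Iso.laxHom_eq h) f

end HermMorita

/-! ### The base ring -/

/-- A quadratic étale algebra, or its base field, has the properties required of the base. A
nondegenerate form is perfect by comparing dimensions over `k`, where functionals with values in `K`
are embedded in those with values in `k` by the trace `x ↦ x + ι x`. -/
theorem InvBase.of_etale {k : Type v} {K : Type u} [Field k] (h2 : (2 : k) ≠ 0) [CommRing K]
    [Nontrivial K] [IsReduced K] [Algebra k K] [Module.Finite k K] (ι : K →+* K)
    (hι : ∀ x, ι (ι x) = x) (hfix : ∀ x, ι x = x ↔ x ∈ Set.range (algebraMap k K)) :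
    InvBase ι where
  inv := hι
  fix x hx := by
    obtain ⟨c, rfl⟩ := (hfix x).mp hx
    rcases eq_or_ne c 0 with rfl | hc
    · exact Or.inl (map_zero _)
    · exact Or.inr ((IsUnit.mk0 c hc).map _)
  two := by
    have := (IsUnit.mk0 (2 : k) h2).map (algebraMap k K)
    rwa [map_ofNat] at this
  perfect V _ _ _ b hb f := by
    let : Module k V := Module.compHom V (algebraMap k K)
    have : IsScalarTower k K V := ⟨fun c x v => by
      rw [Algebra.smul_def, mul_smul]; rfl⟩
    have : Module.Finite k V := Module.Finite.trans K V
    have hc : ∀ c : k, ι (algebraMap k K c) = algebraMap k K c := fun c => (hfix _).mpr ⟨c, rfl⟩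
    let ι' : K →ₗ[k] K := { ι with
      map_smul' := fun c x => by
        change ι (c • x) = c • ι x
        rw [Algebra.smul_def, Algebra.smul_def, map_mul, hc] }
    let tr : K →ₗ[k] LinearMap.range (Algebra.linearMap k K) :=
      (LinearMap.id + ι').codRestrict _ fun x => (hfix _).mp (by
        change ι (x + ι x) = x + ι x
        rw [map_add, hι, add_comm])
    -- the trace form is nondegenerate: if `x` is in its radical then `2 x ^ 2 = 0`
    have htr : ∀ x, (∀ c, tr (c * x) = 0) → x = 0 := fun x h => by
      have h1 : ∀ c, c * x + ι (c * x) = 0 := fun c => congrArg Subtype.val (h c)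
      have h3 : (2 : K) * (x * x) = 0 := by
        have h4 := h1 1
        have h5 := h1 x
        rw [one_mul] at h4
        rw [map_mul, eq_neg_of_add_eq_zero_right h4] at h5
        linear_combination h5
      have h6 : IsUnit (2 : K) := by
        have := (IsUnit.mk0 (2 : k) h2).map (algebraMap k K)
        rwa [map_ofNat] at this
      exact IsReduced.eq_zero _ ⟨2, by rw [sq]; exact h6.mul_right_eq_zero.mp h3⟩
    let S : (V →ₗ[K] K) →ₗ[k] (V →ₗ[k] LinearMap.range (Algebra.linearMap k K)) :=
      { toFun := fun g => tr ∘ₗ g.restrictScalars k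
        map_add' := fun g g' => LinearMap.ext fun v => map_add tr _ _
        map_smul' := fun c g => LinearMap.ext fun v => map_smul tr _ _ }
    have hS : Function.Injective S := by
      rw [injective_iff_map_eq_zero]
      intro g hg
      refine LinearMap.ext fun v => htr _ fun c => ?_
      have := LinearMap.congr_fun hg (c • v)
      change tr (g (c • v)) = 0 at this
      rwa [map_smul] at this
    let T : V →ₗ[k] (V →ₗ[K] K) :=
      { toFun := fun x => b x
        map_add' := map_add b
        map_smul' := fun c x => by
          refine LinearMap.ext fun y => ?_
          have h1 : c • x = algebraMap k K c • x := rfl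
          rw [h1, map_smulₛₗ, hc]
          exact (Algebra.smul_def c (b x y)).symm }
    have hT : Function.Injective T := by
      rw [injective_iff_map_eq_zero]
      exact fun x hx => hb x fun y => LinearMap.congr_fun hx y
    have : Module.Finite k (V →ₗ[K] K) := Module.Finite.of_injective S hS
    have h1 : Module.finrank k (LinearMap.range (Algebra.linearMap k K)) = 1 := by
      rw [← (LinearEquiv.ofInjective (Algebra.linearMap k K)
        (FaithfulSMul.algebraMap_injective k K)).finrank_eq, Module.finrank_self]
    have h3 := LinearMap.finrank_le_finrank_of_injective hS
    have h4 := LinearMap.finrank_le_finrank_of_injective hT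
    rw [Module.finrank_linearMap k k, h1, mul_one] at h3
    obtain ⟨x, hx⟩ := (LinearMap.injective_iff_surjective_of_finrank_eq_finrank
      (le_antisymm h4 h3)).mp hT f
    exact ⟨x, hx⟩

end

theorem mainTheorem1 {k : Type v} {K : Type u} [Field k] (h2 : (2 : k) ≠ 0) [CommRing K]
    [Nontrivial K] [Algebra k K] [Module.Finite k K] [Algebra.Etale k K] (ι : K →+* K)
    (hι : ∀ x, ι (ι x) = x) (hfix : ∀ x, ι x = x ↔ x ∈ Set.range (algebraMap k K)) :
    -- tensor products, alternating powers, and compositions of hermitian spaces exist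
    (∀ (A : AzumayaInv ι) (m n : ℕ) (ε ε' : signGroup ι) (X : A.Herm m ε) (Y : A.Herm n ε'),
      ∃ Z, AzumayaInv.IsTensor X Y Z) ∧
    (∀ (A : AzumayaInv ι) (d n : ℕ) (ε : signGroup ι) (X : A.Herm n ε),
      ∃ Y, AzumayaInv.IsAlt d X Y) ∧
    (∀ (B A : AzumayaInv ι) (U : HermMorita B A) (n : ℕ) (ε : signGroup ι) (X : B.Herm n ε),
      ∃ Y, HermMorita.IsPush U X Y) ∧
    (∀ (C B A : AzumayaInv ι) (U : HermMorita C B) (V : HermMorita B A),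
      ∃ W, HermMorita.IsComp U V W) ∧
    -- the structured semirings `S A`, with homogeneous components identified with the monoids
    -- `SW^ε(A^{⊗ n}, σ^{⊗ n})`, and the action of morphisms of the hermitian Brauer 2-group
    ∃ (S : AzumayaInv ι → StructuredSemiring.{u, u + 1} (GammaN ι))
      (e : ∀ (A : AzumayaInv ι) (n : ℕ) (ε : signGroup ι),
        A.SW n ε ≃+ (S A).grade (n, Additive.ofMul ε))
      (F : ∀ B A : AzumayaInv ι, HermMorita.Hom B A → (S B ⟶ S A)),
      -- multiplication is the tensor product
      (∀ (A : AzumayaInv ι) (m n : ℕ) (ε ε' : signGroup ι) (X : A.Herm m ε) (Y : A.Herm n ε')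
        (Z : A.Herm (m + n) (ε * ε')), AzumayaInv.IsTensor X Y Z →
          (e A m ε (AzumayaInv.cls X) : (S A).carrier) * e A n ε' (AzumayaInv.cls Y) =
            e A (m + n) (ε * ε') (AzumayaInv.cls Z)) ∧
      -- the `λ`-operations are the alternating powers
      (∀ (A : AzumayaInv ι) (d n : ℕ) (ε : signGroup ι) (X : A.Herm n ε)
        (Y : A.Herm (d * n) (ε ^ d)), AzumayaInv.IsAlt d X Y →
          (S A).lam d (e A n ε (AzumayaInv.cls X)) = e A (d * n) (ε ^ d) (AzumayaInv.cls Y)) ∧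
      -- the augmentation is the graded reduced dimension
      (∀ (A : AzumayaInv ι) (n : ℕ) (ε : signGroup ι) (X : A.Herm n ε), ∃ r : ℕ, X.HasRdim r ∧
          (S A).aug (e A n ε (AzumayaInv.cls X)) =
            AddMonoidAlgebra.single (n, Additive.ofMul ε) (r : ℤ)) ∧
      -- `S A` is rigid, and it is its own positive structure
      (∀ A : AzumayaInv ι, (S A).IsRigid ⊤ ∧ (S A).pos = ⊤) ∧
      -- a morphism of sign `ε` is graded along `(n, ε') ↦ (n, ε ^ n * ε')`, and acts on hermitian
      -- spaces over `B^{⊗ n}` by composition with its `n`-th tensor power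
      (∀ (B A : AzumayaInv ι) (U : HermMorita B A) (n : ℕ) (ε : signGroup ι),
        StructuredSemiring.LaxHom.deg (F B A U.toHom) (n, Additive.ofMul ε) =
          (n, Additive.ofMul (U.sign ^ n * ε)) ∧
        ∀ (X : B.Herm n ε) (Y : A.Herm n (U.sign ^ n * ε)), HermMorita.IsPush U X Y →
          StructuredSemiring.LaxHom.hom (F B A U.toHom) (e B n ε (AzumayaInv.cls X)) =
            e A n (U.sign ^ n * ε) (AzumayaInv.cls Y)) ∧
      -- functoriality
      (∀ A : AzumayaInv ι, F A A (HermMorita.refl A).toHom = CategoryTheory.CategoryStruct.id (S A)) ∧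
      (∀ (C B A : AzumayaInv ι) (U : HermMorita C B) (V : HermMorita B A) (W : HermMorita C A),
        HermMorita.IsComp U V W →
          F C A W.toHom = CategoryTheory.CategoryStruct.comp (F C B U.toHom) (F B A V.toHom)) := by
  have : IsReduced K := Algebra.FormallyUnramified.isReduced_of_field k K
  have : IsArtinianRing K := IsArtinianRing.of_finite k K
  have : InvBase ι := InvBase.of_etale h2 ι hι hfix
  exact ⟨fun _ _ _ _ _ X Y => AzumayaInv.exists_isTensor X Y,
    fun _ d _ _ X => AzumayaInv.exists_isAlt d X,
    fun _ _ U _ _ X => HermMorita.exists_isPush U X,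
    fun _ _ _ U V => HermMorita.exists_isComp U V,
    fun A => A.structuredSemiring, fun A => A.gradeEquiv, fun _ _ f => f.laxHom,
    fun _ _ _ _ _ _ _ _ h => AzumayaInv.elt_mul h,
    fun _ _ _ _ _ _ h => AzumayaInv.lam_elt h,
    fun _ _ _ X => ⟨AzumayaInv.rdim X, AzumayaInv.hasRdim X, AzumayaInv.aug_elt X⟩,
    fun A => ⟨A.isRigid_augmentedSemiring, rfl⟩,
    fun _ _ _ _ _ => ⟨rfl, fun _ _ h => HermMorita.pushHom_elt h⟩,
    HermMorita.laxHom_refl, fun _ _ _ _ _ _ h => h.laxHom_eq⟩
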